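/- **Definitions.** A matrix $M$ over a finite alphabet $A$ has a nonempty finite linearly ordered set $R$ of $n$ rows and a nonempty finite linearly ordered set $C$ of $m$ columns. The span of a set of rows (or of columns) is the interval between its minimum and its maximum; two such sets are in conflict if their spans intersect; a partition is $k$-overlapping if every part is in conflict with at most $k$ other parts. A division is a pair of $0$-overlapping partitions $(\mathcal D^R,\mathcal D^C)$ of $R$ and $C$. It is $\ell$-rich if for every $R_a\in\mathcal D^R$ and every set $Y$ of at most $\ell$ parts of $\mathcal D^C$ the submatrix on $R_a$ and $C\setminus\bigcup Y$ has at least $\ell$ distinct rows, and symmetrically for every $C_b\in\mathcal D^C$ with at least $\ell$ distinct columns. A contraction sequence is a sequence $\mathcal P_1,\dots,\mathcal P_{n+m-1}$ of partitions of $R\uplus C$ starting with the partition into singletons, in which each $\mathcal P_{i+1}$ arises from $\mathcal P_i$ by merging two row parts or two column parts, and ending with $\{R,C\}$. It is a $(d,e)$-sequence if for all $i$ the induced partitions of $R$ and of $C$ are $d$-overlapping, and every row part forms a non-constant submatrix of $M$ with at most $e$ column parts, and vice versa. The twin-width $\mathrm{tww}(M)$ is the minimum of $d+e$ over all $(d,e)$-sequences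 of $M$. The matrix encoding of an ordered binary structure $G$ with nonempty finite domain $V$, linear order $<$ and further binary relations $E_1,\dots,E_p$ (and possibly unary relations) is the $V\times V$ matrix whose entry at $(x,y)$ is the vector $b\in\{-1,0,1,2\}^p$ with $b_i=1$ if only $E_i(x,y)$ holds, $b_i=-1$ if only $E_i(y,x)$ holds, $b_i=2$ if both hold and $b_i=0$ if neither holds; $\mathrm{tww}(G)$ is the twin-width of this matrix. Running times are counted on a random access machine with unit-cost addition, subtraction, comparison and memory access (letters of the alphabet are stored as numbers). **Theorem.** (1) There are an algorithm and an absolute constant $c$ such that, on every $n\times m$ matrix $M$ over a finite alphabet $A$ with $n,m\ge 1$ and every integer $k\ge 1$, the algorithm halts after at most $2^{2^{c k^2\lfloor\log_2 k\rfloor}}(n+m)^{c}$ steps and outputs - either a $2k(k+1)$-rich division of $M$, and then $\mathrm{tww}(M)>k$; - or an $\bigl(|A|^{c k^4},|A|^{c k^4}\bigr)$-sequence of $M$, and then $\mathrm{tww}(M)\le |A|^{c k^4}$. (2) Consequently, for every fixed signature of $p$ binary relations besides the order and $q$ unary relations, there are an algorithm and a constant $c$ such that, on every ordered binary structure $G$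 of that signature with $N\ge1$ elements, the algorithm, which is given $G$ but not $k:=\mathrm{tww}(G)$, halts after at most $2^{2^{c k^2\lfloor\log_2 k\rfloor}}(2N)^{c}$ steps (with $\log_2 0$ read as $0$) and outputs a $(d,e)$-sequence of the matrix encoding of $G$ with $d+e\le 2^{c k^4}$ in which all the partitions $\mathcal P_1,\mathcal P_3,\dots,\mathcal P_{2N-1}$ partition the rows and the columns in the same way (so that it can be read as contracting the elements of $G$). -/

import Mathlib

/-! ### Partitions of the rows and columns of a matrix

A matrix over the alphabet `α` is a function `M : R → C → α`, where the row set `R` and the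
column set `C` are finite linear orders. -/

namespace TwinWidth

section Matrices

variable {R C α : Type*} [Fintype R] [LinearOrder R] [Fintype C] [LinearOrder C] [DecidableEq α]

/-- The span of a set: everything between its minimum and its maximum. -/
def span {X : Type*} [Fintype X] [LinearOrder X] (S : Finset X) : Finset X :=
  Finset.univ.filter fun x => ∃ a ∈ S, ∃ b ∈ S, a ≤ x ∧ x ≤ b

/-- Two sets are in conflict if their spans intersect. -/
def Conflict {X : Type*} [Fintype X] [LinearOrder X] (S T : Finset X) : Prop :=
  (span S ∩ span T).Nonempty

instance {X : Type*} [Fintype X] [LinearOrder X] (S T : Finset X) : Decidable (Conflict S T) :=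
  inferInstanceAs (Decidable (Finset.Nonempty _))

/-- A partition is `k`-overlapping if every part is in conflict with at most `k` other parts. -/
def IsOverlapping {X : Type*} [Fintype X] [LinearOrder X] (k : ℕ)
    (P : Finpartition (Finset.univ : Finset X)) : Prop :=
  ∀ S ∈ P.parts, (P.parts.filter fun T => T ≠ S ∧ Conflict S T).card ≤ k

/-- `P'` is obtained from `P` by merging two parts. -/
def IsContraction {X : Type*} [Fintype X] [LinearOrder X]
    (P P' : Finpartition (Finset.univ : Finset X)) : Prop :=
  ∃ S ∈ P.parts, ∃ T ∈ P.parts, S ≠ T ∧ P'.parts = insert (S ∪ T) ((P.parts.erase S).erase T)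

/-- A partition of the disjoint union of the rows and the columns in which every part consists
only of rows or only of columns, given by the two partitions it induces. -/
structure MatPartition (R C : Type*) [Fintype R] [LinearOrder R] [Fintype C] [LinearOrder C] where
  rows : Finpartition (Finset.univ : Finset R)
  cols : Finpartition (Finset.univ : Finset C)

/-- One merge of two row parts or of two column parts. -/
def MatPartition.IsContraction (P P' : MatPartition R C) : Prop :=
  (TwinWidth.IsContraction P.rows P'.rows ∧ P'.cols = P.cols) ∨
  (TwinWidth.IsContraction P.cols P'.cols ∧ P'.rows = P.rows)

/-- The submatrix on the rows `X` and the columns `Y` is constant. -/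
def IsConstantOn (M : R → C → α) (X : Finset R) (Y : Finset C) : Prop :=
  ∀ r ∈ X, ∀ c ∈ Y, ∀ r' ∈ X, ∀ c' ∈ Y, M r c = M r' c'

instance (M : R → C → α) (X : Finset R) (Y : Finset C) : Decidable (IsConstantOn M X Y) := by
  unfold IsConstantOn; infer_instance

/-- Every row part and every column part of `P` has error value at most `e`. -/
def ErrorAtMost (M : R → C → α) (e : ℕ) (P : MatPartition R C) : Prop :=
  (∀ X ∈ P.rows.parts, (P.cols.parts.filter fun Y => ¬ IsConstantOn M X Y).card ≤ e) ∧
  (∀ Y ∈ P.cols.parts, (P.rows.parts.filter fun X => ¬ IsConstantOn M X Y).card ≤ e)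

/-- The index of the last partition of a contraction sequence: the `|R| + |C| - 1` partitions
are `P 0, …, P (|R| + |C| - 2)`; later values of `P` are irrelevant. -/
def lastIndex (R C : Type*) [Fintype R] [Fintype C] : ℕ := Fintype.card R + Fintype.card C - 2

/-- Contraction sequences, from the partition into singletons to the partition `{R, C}`. -/
structure IsContractionSequence (P : ℕ → MatPartition R C) : Prop where
  rows_start : ∀ X ∈ (P 0).rows.parts, X.card = 1
  cols_start : ∀ Y ∈ (P 0).cols.parts, Y.card = 1
  step : ∀ t < lastIndex R C, (P t).IsContraction (P (t + 1))
  rows_end : (P (lastIndex R C)).rows.parts = {Finset.univ}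
  cols_end : (P (lastIndex R C)).cols.parts = {Finset.univ}

/-- `(k, e)`-sequences of the matrix `M`. -/
structure IsSequence (M : R → C → α) (k e : ℕ) (P : ℕ → MatPartition R C) : Prop where
  contraction : IsContractionSequence P
  rows_overlap : ∀ t ≤ lastIndex R C, IsOverlapping k (P t).rows
  cols_overlap : ∀ t ≤ lastIndex R C, IsOverlapping k (P t).cols
  error : ∀ t ≤ lastIndex R C, ErrorAtMost M e (P t)

/-- The twin-width of a matrix: the minimum of `k + e` over its `(k, e)`-sequences. (Such a
sequence exists as soon as there is a row and a column.) -/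
noncomputable def tww (M : R → C → α) : ℕ :=
  sInf {d | ∃ k e : ℕ, k + e = d ∧ ∃ P : ℕ → MatPartition R C, IsSequence M k e P}

/-- A division: rows and columns are partitioned into intervals. -/
def IsDivision (D : MatPartition R C) : Prop :=
  IsOverlapping 0 D.rows ∧ IsOverlapping 0 D.cols

/-- The number of distinct row vectors of the submatrix on rows `X` and columns `Y`. -/
def numRows (M : R → C → α) (X : Finset R) (Y : Finset C) : ℕ :=
  (X.image fun r => fun c : {c // c ∈ Y} => M r c).card

/-- The number of distinct column vectors of the submatrix on rows `X` and columns `Y`. -/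
def numCols (M : R → C → α) (X : Finset R) (Y : Finset C) : ℕ :=
  (Y.image fun c => fun r : {r // r ∈ X} => M r c).card

/-- `k`-rich divisions. -/
def IsRich (M : R → C → α) (k : ℕ) (D : MatPartition R C) : Prop :=
  IsDivision D ∧
  (∀ X ∈ D.rows.parts, ∀ 𝒴 ⊆ D.cols.parts, 𝒴.card ≤ k →
    k ≤ numRows M X (Finset.univ \ 𝒴.biUnion id)) ∧
  (∀ Y ∈ D.cols.parts, ∀ 𝒳 ⊆ D.rows.parts, 𝒳.card ≤ k →
    k ≤ numCols M (Finset.univ \ 𝒳.biUnion id) Y)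

end Matrices

/-! ### Ordered binary structures -/

/-- An ordered structure on the domain `V`, whose linear order interprets `<`, with `p` further
binary and `q` unary relations. -/
structure OrderedBinaryStructure (p q : ℕ) (V : Type*) [LinearOrder V] where
  rel : Fin p → V → V → Bool
  un : Fin q → V → Bool

/-- The matrix encoding, over the alphabet `{-1, 0, 1, 2}^p`. -/
def OrderedBinaryStructure.encoding {p q : ℕ} {V : Type*} [LinearOrder V]
    (G : OrderedBinaryStructure p q V) (x y : V) : Fin p → ℤ := fun i =>
  match G.rel i x y, G.rel i y x with
  | true, false => 1
  | false, true => -1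
  | true, true => 2
  | false, false => 0

/-- The twin-width of an ordered binary structure is that of its matrix encoding. -/
noncomputable def OrderedBinaryStructure.tww {p q : ℕ} {V : Type*} [Fintype V] [LinearOrder V]
    (G : OrderedBinaryStructure p q V) : ℕ :=
  TwinWidth.tww G.encoding

/-! ### Random access machines

Programs act on scalar variables and on one-dimensional arrays, all holding natural numbers.
Every elementary operation (addition, truncated subtraction, comparison, array access,
assignment, branching) is one step. There is no multiplication, so that this unit-cost model is
polynomially equivalent to Turing machines. -/

/-- A memory configuration: the scalar variables and the arrays. -/
structure State where
  var : ℕ → ℕ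
  arr : ℕ → ℕ → ℕ

/-- Assign a value to a scalar variable. -/
def State.setVar (s : State) (x v : ℕ) : State :=
  { s with var := Function.update s.var x v }

/-- Assign a value to cell `i` of array `a`. -/
def State.setArr (s : State) (a i v : ℕ) : State :=
  { s with arr := Function.update s.arr a (Function.update (s.arr a) i v) }

/-- Expressions; `get a e` is the content of cell `e` of array `a`. -/
inductive Expr where
  | lit (v : ℕ)
  | var (x : ℕ)
  | get (a : ℕ) (e : Expr)
  | add (e₁ e₂ : Expr)
  | sub (e₁ e₂ : Expr)
  | lt (e₁ e₂ : Expr)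
  | eq (e₁ e₂ : Expr)

/-- The value of an expression; comparisons evaluate to `1` or `0`. -/
def Expr.eval (s : State) : Expr → ℕ
  | lit v => v
  | var x => s.var x
  | get a e => s.arr a (e.eval s)
  | add e₁ e₂ => e₁.eval s + e₂.eval s
  | sub e₁ e₂ => e₁.eval s - e₂.eval s
  | lt e₁ e₂ => if e₁.eval s < e₂.eval s then 1 else 0
  | eq e₁ e₂ => if e₁.eval s = e₂.eval s then 1 else 0

/-- The number of steps needed to evaluate an expression. -/
def Expr.cost : Expr → ℕ
  | lit _ => 1
  | var _ => 1
  | get _ e => e.cost + 1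
  | add e₁ e₂ => e₁.cost + e₂.cost + 1
  | sub e₁ e₂ => e₁.cost + e₂.cost + 1
  | lt e₁ e₂ => e₁.cost + e₂.cost + 1
  | eq e₁ e₂ => e₁.cost + e₂.cost + 1

/-- Programs; conditions count as true when they are nonzero. -/
inductive Program where
  | skip
  | assign (x : ℕ) (e : Expr)
  | store (a : ℕ) (i e : Expr)
  | seq (p₁ p₂ : Program)
  | branch (e : Expr) (p₁ p₂ : Program)
  | loop (e : Expr) (p : Program)

/-- `p.Runs s s' t`: started in `s`, the program `p` halts in `s'` after exactly `t` steps. -/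
inductive Program.Runs : Program → State → State → ℕ → Prop where
  | skip (s : State) : Runs .skip s s 1
  | assign (x : ℕ) (e : Expr) (s : State) :
      Runs (.assign x e) s (s.setVar x (e.eval s)) (e.cost + 1)
  | store (a : ℕ) (i e : Expr) (s : State) :
      Runs (.store a i e) s (s.setArr a (i.eval s) (e.eval s)) (i.cost + e.cost + 1)
  | seq {p₁ p₂ : Program} {s s₁ s₂ : State} {t₁ t₂ : ℕ} :
      Runs p₁ s s₁ t₁ → Runs p₂ s₁ s₂ t₂ → Runs (.seq p₁ p₂) s s₂ (t₁ + t₂)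
  | branch_true {e : Expr} {p₁ p₂ : Program} {s s' : State} {t : ℕ} :
      e.eval s ≠ 0 → Runs p₁ s s' t → Runs (.branch e p₁ p₂) s s' (e.cost + 1 + t)
  | branch_false {e : Expr} {p₁ p₂ : Program} {s s' : State} {t : ℕ} :
      e.eval s = 0 → Runs p₂ s s' t → Runs (.branch e p₁ p₂) s s' (e.cost + 1 + t)
  | loop_done {e : Expr} {p : Program} {s : State} :
      e.eval s = 0 → Runs (.loop e p) s s (e.cost + 1)
  | loop_step {e : Expr} {p : Program} {s s₁ s₂ : State} {t₁ t₂ : ℕ} :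
      e.eval s ≠ 0 → Runs p s s₁ t₁ → Runs (.loop e p) s₁ s₂ t₂ →
      Runs (.loop e p) s s₂ (e.cost + 1 + t₁ + t₂)

/-! ### Inputs and outputs -/

/-- An array that starts with the given values and continues with zeros. -/
def toArray {l : ℕ} (f : Fin l → ℕ) (x : ℕ) : ℕ :=
  if h : x < l then f ⟨x, h⟩ else 0

/-- The input `(M, k)`: the variables `0, 1, 2` hold `n, m, k`, and cell `i * m + j` of array `0`
holds the entry of `M` in row `i` and column `j`, the letters being numbered by `name`.
Everything else is `0`. -/
def matrixInput {A : Type*} [Fintype A] {n m : ℕ} (name : A ≃ Fin (Fintype.card A))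
    (M : Fin n → Fin m → A) (k : ℕ) : State where
  var x := match x with
    | 0 => n
    | 1 => m
    | 2 => k
    | _ => 0
  arr a := match a with
    | 0 => toArray fun x : Fin (n * m) =>
        (name (M (finProdFinEquiv.symm x).1 (finProdFinEquiv.symm x).2) : ℕ)
    | _ => fun _ => 0

/-- The input `G`: variable `0` holds the size `n` of the domain, cell `i * (n * n) + (x * n + y)`
of array `0` holds the truth value of the `i`-th binary relation at `(x, y)`, and cell `i * n + x`
of array `1` that of the `i`-th unary relation at `x`. Everything else is `0`. -/
def structureInput {p q n : ℕ} (G : OrderedBinaryStructure p q (Fin n)) : State where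
  var x := match x with
    | 0 => n
    | _ => 0
  arr a := match a with
    | 0 => toArray fun x : Fin (p * (n * n)) =>
        let i := (finProdFinEquiv.symm x).1
        let xy := finProdFinEquiv.symm (finProdFinEquiv.symm x).2
        (G.rel i xy.1 xy.2).toNat
    | 1 => toArray fun x : Fin (q * n) =>
        (G.un (finProdFinEquiv.symm x).1 (finProdFinEquiv.symm x).2).toNat
    | _ => fun _ => 0

/-- The cells `start, …, start + n + m - 1` of the array `a` hold labels of the `n` rows and then
of the `m` columns that describe the partition `P`: two rows (two columns) are in the same part
exactly if they have the same label. -/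
def Describes {n m : ℕ} (a : ℕ → ℕ) (start : ℕ) (P : MatPartition (Fin n) (Fin m)) : Prop :=
  (∀ i i' : Fin n, a (start + i) = a (start + i') ↔ P.rows.part i = P.rows.part i') ∧
  (∀ j j' : Fin m, a (start + n + j) = a (start + n + j') ↔ P.cols.part j = P.cols.part j')

/-- The array `2` of the final state describes the partition `D`. -/
def State.OutputsPartition {n m : ℕ} (s : State) (D : MatPartition (Fin n) (Fin m)) : Prop :=
  Describes (s.arr 2) 0 D

/-- The array `2` of the final state describes, one after the other, the partitions
`P 0, …, P (n + m - 2)`. -/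
def State.OutputsSequence {n m : ℕ} (s : State) (P : ℕ → MatPartition (Fin n) (Fin m)) : Prop :=
  ∀ t ≤ lastIndex (Fin n) (Fin m), Describes (s.arr 2) (t * (n + m)) (P t)

/-- Every other partition of the sequence (the first, the third, …, the last) partitions the rows
and the columns in the same way: after each merge of two row (column) parts the corresponding
column (row) parts are merged. Such a sequence contracts the elements of the domain. -/
def IsSymmetricSequence {V : Type*} [Fintype V] [LinearOrder V]
    (P : ℕ → MatPartition V V) : Prop :=
  ∀ t, 2 * t ≤ lastIndex V V → (P (2 * t)).rows = (P (2 * t)).cols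

end TwinWidth

/-! Put K = 2k(k+1) and L = 3K. The algorithm works on one square array of order N in which the
entry at (x, y) determines the entry at (y, x). An n × m matrix is placed, together with its
transpose, off the diagonal of a block matrix of order n + m with zero diagonal blocks; the boundary
h = n separates rows from columns. The encoding of a structure already has the required form, with h
= 0 and a single side. One division of the N elements then serves rows and columns alike.

Call a set of rows poor if deleting at most L column intervals leaves fewer than K distinct rows.
Starting from singletons, consecutive intervals are merged as long as their union is poor.

Suppose that this gets stuck while some side still has several intervals. Join consecutive intervals
in pairs, with a triple at the end of a side if necessary. Every new interval contains a union that
is not poor, and K new intervals consist of at most 3K = L old ones, so the new division is K-rich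
(`rich_pairLabel`). In the block matrix the other side also has several intervals, since otherwise
deleting its only interval would leave nothing but zeros (`IsDiv.exists_eligible_opposite`). A rich
division excludes small twin-width (`lt_tww_of_isRich`): in a (d, e)-sequence take the first
partition with a part whose span contains an interval X, say of rows. At most d + 1 row parts meet
X, they form non-constant zones with at most (d + 1)e column parts, and each of these meets at most
two column intervals. Deleting these intervals leaves at most d + 1 distinct rows in X.

Suppose that each side ends as a single interval. The contraction sequence comes from a partition
maintained along the way. Two rows of an interval are close if they differ on at most L column
intervals; components are those of closeness. The zone of two components is mixed if neither all its
rows nor all its columns are equal, and two rows of a component are twins if they agree on all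
columns outside its mixed zones. While all intervals are poor, the following holds. An interval has
fewer than K components (`card_components_le`). All rows of a component agree outside L + K²L column
intervals, because one close pair for every two classes of representatives accounts for all close
pairs (`exists_agree_components`); these intervals contain all mixed zones, hence all errors
(`card_errLabels_le`). A twin class is determined by its component, a representative and one entry
for each of at most KL components in the deleted intervals, which gives at most K²|A|^(KL) classes
in an interval (`card_twins_le`). Merging intervals only enlarges components and twin classes
(`Twins.mono`), so one twin partition is reached from the previous one by single merges, with at
most twice the above number of classes in an interval.

Poorness is tested by a bounded search. If Y' is a witness, Y ⊆ Y' is already deleted and at least K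
classes of rows remain, then two of the first K representatives agree outside Y', so the interval of
any column that separates them outside Y belongs to Y' (`exists_word`). Guessing the pair at most L
times gives (K²)^L branches.

The algorithm is written in a language with bounded loops, whose compiled programs run in time
polynomial in the loop bounds (`Cmd.compile_runs`, `Cmd.exists_time_le`). For structures the values
k = 1, 2, … are tried until a sequence appears. This happens at k = max(1, tww) at the latest,
because a rich division for that k would make the twin-width larger than itself. -/

namespace TwinWidth

/-- If equality of `g`-values forces equality of `f`-values, then `f` has at most as many values
as `g`. -/
theorem card_image_le_card_image {ι κ κ' : Type*} [DecidableEq κ] [DecidableEq κ'] (S : Finset ι)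
    (f : ι → κ) (g : ι → κ') (h : ∀ x ∈ S, ∀ y ∈ S, g x = g y → f x = f y) :
    (S.image f).card ≤ (S.image g).card := by
  classical
  have hch : ∀ v ∈ S.image f, ∃ x ∈ S, f x = v := fun v hv => Finset.mem_image.1 hv
  choose w hw hfw using hch
  rw [← Finset.card_attach]
  refine Finset.card_le_card_of_injOn (fun v => g (w v.1 v.2)) ?_ ?_
  · intro v _
    exact Finset.mem_image_of_mem _ (hw v.1 v.2)
  · intro v _ v' _ e
    refine Subtype.ext ?_
    rw [← hfw v.1 v.2, ← hfw v'.1 v'.2]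
    exact h _ (hw v.1 v.2) _ (hw v'.1 v'.2) e

/-! ### Divisions and partitions given by labels

A symmetric matrix is given as a function `M : ℕ → ℕ → ℕ`, of which only the entries with indices
below `N` matter, and a partition of `{0, …, N - 1}` by a labelling `ℕ → ℕ`. -/

open Classical in
/-- The elements with label `a`. -/
noncomputable def part (N : ℕ) (dl : ℕ → ℕ) (a : ℕ) : Finset ℕ :=
  (Finset.range N).filter fun x => dl x = a

theorem mem_part {N : ℕ} {dl : ℕ → ℕ} {a x : ℕ} : x ∈ part N dl a ↔ x < N ∧ dl x = a := by
  simp [part]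

/-- The rows `r` and `r'` agree on all columns outside the parts with labels in `Y`. -/
def Agree (N : ℕ) (M : ℕ → ℕ → ℕ) (dl : ℕ → ℕ) (Y : Finset ℕ) (r r' : ℕ) : Prop :=
  ∀ c < N, dl c ∉ Y → M r c = M r' c

theorem Agree.symm {N : ℕ} {M : ℕ → ℕ → ℕ} {dl : ℕ → ℕ} {Y : Finset ℕ} {r r' : ℕ}
    (h : Agree N M dl Y r r') : Agree N M dl Y r' r := fun c hc hY => (h c hc hY).symm

theorem Agree.trans {N : ℕ} {M : ℕ → ℕ → ℕ} {dl : ℕ → ℕ} {Y : Finset ℕ} {r r' r'' : ℕ}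
    (h : Agree N M dl Y r r') (h' : Agree N M dl Y r' r'') : Agree N M dl Y r r'' :=
  fun c hc hY => (h c hc hY).trans (h' c hc hY)

theorem Agree.mono {N : ℕ} {M : ℕ → ℕ → ℕ} {dl : ℕ → ℕ} {Y Y' : Finset ℕ} {r r' : ℕ}
    (h : Agree N M dl Y r r') (hY : Y ⊆ Y') : Agree N M dl Y' r r' :=
  fun c hc hc' => h c hc fun h => hc' (hY h)

open Classical in
/-- The first row of each class of rows of `S` that agree outside `Y`. -/
noncomputable def reps (N : ℕ) (M : ℕ → ℕ → ℕ) (dl : ℕ → ℕ) (Y S : Finset ℕ) : Finset ℕ :=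
  S.filter fun r => ∀ r' ∈ S, r' < r → ¬ Agree N M dl Y r r'

theorem mem_reps {N : ℕ} {M : ℕ → ℕ → ℕ} {dl : ℕ → ℕ} {Y S : Finset ℕ} {r : ℕ} :
    r ∈ reps N M dl Y S ↔ r ∈ S ∧ ∀ r' ∈ S, r' < r → ¬ Agree N M dl Y r r' := by
  simp only [reps, Finset.mem_filter]

theorem exists_rep {N : ℕ} {M : ℕ → ℕ → ℕ} {dl : ℕ → ℕ} {Y S : Finset ℕ} {r : ℕ} (hr : r ∈ S) :
    ∃ ρ ∈ reps N M dl Y S, Agree N M dl Y r ρ := by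
  induction r using Nat.strong_induction_on with
  | _ r ih =>
    by_cases h : ∀ r' ∈ S, r' < r → ¬ Agree N M dl Y r r'
    · exact ⟨r, mem_reps.2 ⟨hr, h⟩, fun _ _ _ => rfl⟩
    · push Not at h
      obtain ⟨r', hr', hlt, hag⟩ := h
      obtain ⟨ρ, hρ, hρ'⟩ := ih r' hlt hr'
      exact ⟨ρ, hρ, hag.trans hρ'⟩

theorem reps_subset {N : ℕ} {M : ℕ → ℕ → ℕ} {dl : ℕ → ℕ} {Y S : Finset ℕ} :
    reps N M dl Y S ⊆ S := fun _ h => (mem_reps.1 h).1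

theorem eq_of_mem_reps {N : ℕ} {M : ℕ → ℕ → ℕ} {dl : ℕ → ℕ} {Y S : Finset ℕ} {a b : ℕ}
    (ha : a ∈ reps N M dl Y S) (hb : b ∈ reps N M dl Y S) (h : Agree N M dl Y a b) : a = b := by
  rw [mem_reps] at ha hb
  rcases lt_trichotomy a b with hlt | heq | hlt
  · exact absurd h.symm (hb.2 a ha.1 hlt)
  · exact heq
  · exact absurd h (ha.2 b hb.1 hlt)

/-- There are at most as many representatives for a coarser agreement relation on a smaller set of
rows. -/
theorem card_reps_le {N : ℕ} {M M' : ℕ → ℕ → ℕ} {dl dl' : ℕ → ℕ} {Y Y' S S' : Finset ℕ}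
    (hS : S ⊆ S') (h : ∀ r ∈ S, ∀ r' ∈ S, Agree N M' dl' Y' r r' → Agree N M dl Y r r') :
    (reps N M dl Y S).card ≤ (reps N M' dl' Y' S').card := by
  have hch : ∀ r ∈ reps N M dl Y S, ∃ ρ ∈ reps N M' dl' Y' S', Agree N M' dl' Y' r ρ :=
    fun r hr => exists_rep (hS (reps_subset hr))
  choose! w hw hag using hch
  refine Finset.card_le_card_of_injOn w hw ?_
  intro r hr r' hr' e
  refine eq_of_mem_reps hr hr' (h _ (reps_subset hr) _ (reps_subset hr') ?_)
  have := hag r' hr'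
  rw [← e] at this
  exact (hag r hr).trans this.symm

/-- The rows in `S` become few after the deletion of few column parts. -/
def Poor (N : ℕ) (M : ℕ → ℕ → ℕ) (K L : ℕ) (dl : ℕ → ℕ) (S : Finset ℕ) : Prop :=
  ∃ Y : Finset ℕ, Y.card ≤ L ∧ (reps N M dl Y S).card < K

/-- Replace every deleted interval by the coarser interval that contains it. There are no more of
these, and rows that agree outside the old ones agree outside the new ones. -/
theorem Poor.mono {N : ℕ} {M : ℕ → ℕ → ℕ} {K L : ℕ} {dl dl' : ℕ → ℕ} {S S' : Finset ℕ}
    (h : Poor N M K L dl S) (g : ℕ → ℕ) (hg : ∀ c < N, dl' c = g (dl c)) (hS : S' ⊆ S) :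
    Poor N M K L dl' S' := by
  classical
  obtain ⟨Y, hY, hr⟩ := h
  refine ⟨Y.image g, Finset.card_image_le.trans hY, lt_of_le_of_lt (card_reps_le hS ?_) hr⟩
  intro r _ r' _ hag c hc hcY
  refine hag c hc fun hh => hcY ?_
  rw [hg c hc]
  exact Finset.mem_image_of_mem _ hh

/-- The labels of the column parts on which `r` and `r'` differ. -/
def diffLabels (N : ℕ) (M : ℕ → ℕ → ℕ) (dl : ℕ → ℕ) (r r' : ℕ) : Finset ℕ :=
  ((Finset.range N).filter fun c => M r c ≠ M r' c).image dl

theorem diffLabels_subset {N : ℕ} {M : ℕ → ℕ → ℕ} {dl : ℕ → ℕ} {Y : Finset ℕ} {r r' : ℕ} :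
    diffLabels N M dl r r' ⊆ Y ↔ Agree N M dl Y r r' := by
  simp only [diffLabels, Finset.subset_iff, Finset.mem_image, Finset.mem_filter, Finset.mem_range,
    Agree]
  constructor
  · intro h c hc hY
    by_contra hne
    exact hY (h ⟨c, ⟨hc, hne⟩, rfl⟩)
  · rintro h _ ⟨c, ⟨hc, hne⟩, rfl⟩
    by_contra hY
    exact hne (h c hc hY)

/-- Two rows in the same part are close if they differ on at most `L` column parts. -/
def Close (N : ℕ) (M : ℕ → ℕ → ℕ) (L : ℕ) (dl : ℕ → ℕ) (r r' : ℕ) : Prop :=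
  r < N ∧ r' < N ∧ dl r = dl r' ∧ (diffLabels N M dl r r').card ≤ L

/-- Each coarser interval on which the rows differ contains a finer one on which they differ. Hence
closeness survives merging, and components only grow. -/
theorem Close.mono {N : ℕ} {M : ℕ → ℕ → ℕ} {L : ℕ} {dl dl' : ℕ → ℕ} {r r' : ℕ}
    (h : Close N M L dl r r') (g : ℕ → ℕ) (hg : ∀ c < N, dl' c = g (dl c)) :
    Close N M L dl' r r' := by
  obtain ⟨h1, h2, h3, h4⟩ := h
  refine ⟨h1, h2, by rw [hg _ h1, hg _ h2, h3], le_trans ?_ h4⟩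
  refine card_image_le_card_image _ _ _ ?_
  intro x hx y hy e
  rw [hg x (by simpa using (Finset.mem_filter.1 hx).1),
    hg y (by simpa using (Finset.mem_filter.1 hy).1), e]

/-- `q` labels the connected components of the closeness relation. -/
def IsComponents (N : ℕ) (M : ℕ → ℕ → ℕ) (L : ℕ) (dl q : ℕ → ℕ) : Prop :=
  ∀ r < N, ∀ r' < N, q r = q r' ↔ Relation.EqvGen (Close N M L dl) r r'

theorem eqvGen_close_label {N : ℕ} {M : ℕ → ℕ → ℕ} {L : ℕ} {dl : ℕ → ℕ} {r r' : ℕ}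
    (h : Relation.EqvGen (Close N M L dl) r r') : dl r = dl r' := by
  induction h with
  | rel _ _ h => exact h.2.2.1
  | refl _ => rfl
  | symm _ _ _ ih => exact ih.symm
  | trans _ _ _ _ _ ih ih' => exact ih.trans ih'

theorem IsComponents.label {N : ℕ} {M : ℕ → ℕ → ℕ} {L : ℕ} {dl q : ℕ → ℕ}
    (hq : IsComponents N M L dl q) {r r' : ℕ} (hr : r < N) (hr' : r' < N) (h : q r = q r') :
    dl r = dl r' := eqvGen_close_label ((hq r hr r' hr').1 h)

/-- A part with a small set `Y` as in `Poor` has few components. -/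
theorem card_components_le {N : ℕ} {M : ℕ → ℕ → ℕ} {L : ℕ} {dl q : ℕ → ℕ}
    (hq : IsComponents N M L dl q) {a : ℕ} {Y : Finset ℕ} (hY : Y.card ≤ L) :
    ((part N dl a).image q).card ≤ (reps N M dl Y (part N dl a)).card := by
  refine le_trans (Finset.card_le_card ?_) (Finset.card_image_le (f := q))
  intro v hv
  obtain ⟨r, hr, rfl⟩ := Finset.mem_image.1 hv
  obtain ⟨ρ, hρ, hag⟩ := exists_rep (N := N) (M := M) (dl := dl) (Y := Y) hr
  refine Finset.mem_image.2 ⟨ρ, hρ, ?_⟩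
  have h1 := mem_part.1 hr
  have h2 := mem_part.1 (reps_subset hρ)
  refine ((hq r h1.1 ρ h2.1).2 (.rel _ _ ⟨h1.1, h2.1, h1.2.trans h2.2.symm, ?_⟩)).symm
  exact (Finset.card_le_card (diffLabels_subset.2 hag)).trans hY

/-- Outside a bounded number of column parts, the rows in a common component are equal. -/
theorem exists_agree_components {N : ℕ} {M : ℕ → ℕ → ℕ} {K L : ℕ} {dl q : ℕ → ℕ}
    (hq : IsComponents N M L dl q) {a : ℕ} (hp : Poor N M K L dl (part N dl a)) :
    ∃ Y : Finset ℕ, Y.card ≤ L + K * K * L ∧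
      ∀ r ∈ part N dl a, ∀ r' < N, q r = q r' → Agree N M dl Y r r' := by
  classical
  obtain ⟨Y, hY, hK⟩ := hp
  set R := reps N M dl Y (part N dl a) with hR
  have hch : ∀ r ∈ part N dl a, ∃ ρ ∈ R, Agree N M dl Y r ρ := fun r hr => exists_rep hr
  choose! ρ hρ hag using hch
  -- For every two representatives a single close pair between their classes is chosen. The other
  -- close pairs between these classes need no further deletions, because rows of a class already
  -- agree outside `Y`.
  let edge : ℕ × ℕ → ℕ × ℕ → Prop := fun u e =>
    e.1 ∈ part N dl a ∧ e.2 ∈ part N dl a ∧ ρ e.1 = u.1 ∧ ρ e.2 = u.2 ∧ Close N M L dl e.1 e.2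
  let D : ℕ × ℕ → Finset ℕ := fun u =>
    if h : ∃ e, edge u e then diffLabels N M dl h.choose.1 h.choose.2 else ∅
  have hD : ∀ u, (D u).card ≤ L := by
    intro u
    by_cases h : ∃ e, edge u e
    · simp only [D, dif_pos h]; exact h.choose_spec.2.2.2.2.2.2.2
    · simp only [D, dif_neg h]; simp
  refine ⟨Y ∪ (R ×ˢ R).biUnion D, ?_, ?_⟩
  · refine (Finset.card_union_le _ _).trans (Nat.add_le_add hY ?_)
    refine (Finset.card_biUnion_le_card_mul _ _ L fun u _ => hD u).trans ?_
    rw [Finset.card_product]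
    exact Nat.mul_le_mul_right _ (Nat.mul_le_mul hK.le hK.le)
  · set Y' := Y ∪ (R ×ˢ R).biUnion D with hY'
    have key : ∀ x y, Relation.EqvGen (Close N M L dl) x y →
        (x ∈ part N dl a ↔ y ∈ part N dl a) ∧ (x ∈ part N dl a → Agree N M dl Y' x y) := by
      intro x y h
      induction h with
      | rel x y h =>
        have hiff : x ∈ part N dl a ↔ y ∈ part N dl a := by
          simp only [mem_part, h.1, h.2.1, h.2.2.1]
        refine ⟨hiff, fun hx => ?_⟩
        have hy := hiff.1 hx
        have he : ∃ e, edge (ρ x, ρ y) e := ⟨(x, y), hx, hy, rfl, rfl, h⟩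
        obtain ⟨e1, e2, e3, e4, -⟩ := he.choose_spec
        have hsub : D (ρ x, ρ y) ⊆ Y' := by
          refine Finset.Subset.trans ?_ Finset.subset_union_right
          exact Finset.subset_biUnion_of_mem D (Finset.mk_mem_product (hρ x hx) (hρ y hy))
        have hmid : Agree N M dl Y' he.choose.1 he.choose.2 := by
          refine (diffLabels_subset.1 (Finset.Subset.trans ?_ hsub))
          simp only [D, dif_pos he]; exact Finset.Subset.refl _
        have hYY : Y ⊆ Y' := Finset.subset_union_left
        have a1 := (hag x hx).mono hYY
        have a2 := (hag _ e1).mono hYY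
        have a3 := (hag _ e2).mono hYY
        have a4 := (hag y hy).mono hYY
        rw [e3] at a2
        rw [e4] at a3
        -- The path goes from `x` to its representative, from there to the chosen pair and across
        -- it, and through the representative of `y` to `y`.
        exact a1.trans (a2.symm.trans (hmid.trans (a3.trans a4.symm)))
      | refl x => exact ⟨Iff.rfl, fun _ _ _ _ => rfl⟩
      | symm x y _ ih => exact ⟨ih.1.symm, fun hx => (ih.2 (ih.1.2 hx)).symm⟩
      | trans x y z _ _ ih ih' =>
        exact ⟨ih.1.trans ih'.1, fun hx => (ih.2 hx).trans (ih'.2 (ih.1.1 hx))⟩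
    intro r hr r' hr' e
    exact (key r r' ((hq r (mem_part.1 hr).1 r' hr').1 e)).2 hr

/-! ### Mixed zones -/

/-- The rows of the component of `r` are not all equal on the component of `c`. -/
def NonVertical (N : ℕ) (M : ℕ → ℕ → ℕ) (q : ℕ → ℕ) (r c : ℕ) : Prop :=
  ∃ r₁ < N, ∃ r₂ < N, ∃ c₁ < N, q r₁ = q r ∧ q r₂ = q r ∧ q c₁ = q c ∧ M r₁ c₁ ≠ M r₂ c₁

/-- The zone of the components of `r` and of `c` is mixed. -/
def Mixed (N : ℕ) (M : ℕ → ℕ → ℕ) (q : ℕ → ℕ) (r c : ℕ) : Prop :=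
  NonVertical N M q r c ∧ NonVertical N M q c r

theorem NonVertical.congr {N : ℕ} {M : ℕ → ℕ → ℕ} {q : ℕ → ℕ} {r r' c c' : ℕ}
    (h : NonVertical N M q r c) (hr : q r = q r') (hc : q c = q c') :
    NonVertical N M q r' c' := by
  unfold NonVertical at *; rwa [← hr, ← hc]

theorem Mixed.congr {N : ℕ} {M : ℕ → ℕ → ℕ} {q : ℕ → ℕ} {r r' c c' : ℕ}
    (h : Mixed N M q r c) (hr : q r = q r') (hc : q c = q c') : Mixed N M q r' c' :=
  ⟨h.1.congr hr hc, h.2.congr hc hr⟩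

theorem Mixed.symm {N : ℕ} {M : ℕ → ℕ → ℕ} {q : ℕ → ℕ} {r c : ℕ}
    (h : Mixed N M q r c) : Mixed N M q c r := ⟨h.2, h.1⟩

/-- Two rows are twins if they are in the same component and agree on all columns that do not
form a mixed zone with it. -/
def Twins (N : ℕ) (M : ℕ → ℕ → ℕ) (q : ℕ → ℕ) (r r' : ℕ) : Prop :=
  q r = q r' ∧ ∀ c < N, ¬ Mixed N M q r c → M r c = M r' c

theorem Twins.refl {N : ℕ} {M : ℕ → ℕ → ℕ} {q : ℕ → ℕ} (r : ℕ) : Twins N M q r r :=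
  ⟨rfl, fun _ _ _ => rfl⟩

theorem Twins.symm {N : ℕ} {M : ℕ → ℕ → ℕ} {q : ℕ → ℕ} {r r' : ℕ}
    (h : Twins N M q r r') : Twins N M q r' r :=
  ⟨h.1.symm, fun c hc hm => (h.2 c hc fun h' => hm (h'.congr h.1 rfl)).symm⟩

theorem Twins.trans {N : ℕ} {M : ℕ → ℕ → ℕ} {q : ℕ → ℕ} {r r' r'' : ℕ}
    (h : Twins N M q r r') (h' : Twins N M q r' r'') : Twins N M q r r'' :=
  ⟨h.1.trans h'.1, fun c hc hm =>
    (h.2 c hc hm).trans (h'.2 c hc fun h'' => hm (h''.congr h.1.symm rfl))⟩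

/-- Larger components make more zones mixed, so fewer columns have to be compared. This is why the
twin partitions along the algorithm get coarser and coarser. -/
theorem Twins.mono {N : ℕ} {M : ℕ → ℕ → ℕ} {q q' : ℕ → ℕ}
    (hq : ∀ x < N, ∀ y < N, q x = q y → q' x = q' y) {r r' : ℕ} (hr : r < N) (hr' : r' < N)
    (h : Twins N M q r r') : Twins N M q' r r' := by
  have hnv : ∀ x < N, ∀ c < N, NonVertical N M q x c → NonVertical N M q' x c := by
    rintro x hx c hc ⟨r₁, h1, r₂, h2, c₁, h3, e1, e2, e3, e4⟩
    exact ⟨r₁, h1, r₂, h2, c₁, h3, hq _ h1 _ hx e1, hq _ h2 _ hx e2, hq _ h3 _ hc e3, e4⟩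
  exact ⟨hq _ hr _ hr' h.1, fun c hc hm =>
    h.2 c hc fun h' => hm ⟨hnv r hr c hc h'.1, hnv c hc r hr h'.2⟩⟩

/-- `M` determines its transpose. -/
def TransposeInvariant (N : ℕ) (M : ℕ → ℕ → ℕ) : Prop :=
  ∀ x < N, ∀ y < N, ∀ u < N, ∀ v < N, M x y = M u v → M y x = M v u

/-- The number of twin classes in a part. -/
theorem card_twins_le {N : ℕ} {M : ℕ → ℕ → ℕ} (hM : TransposeInvariant N M) {K L : ℕ}
    {dl q : ℕ → ℕ} (hq : IsComponents N M L dl q) (hp : ∀ a, Poor N M K L dl (part N dl a))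
    {A : Finset ℕ} (hA : ∀ x < N, ∀ y < N, M x y ∈ A) {cur : ℕ → ℕ}
    (hcur : ∀ x < N, ∀ y < N, Twins N M q x y → cur x = cur y) (a : ℕ) :
    ((part N dl a).image cur).card ≤ K * K * A.card ^ (K * L) := by
  classical
  rcases (part N dl a).eq_empty_or_nonempty with h0 | ⟨x₀, hx₀⟩
  · simp [h0]
  have hA1 : 1 ≤ A.card :=
    Finset.card_pos.2 ⟨_, hA x₀ (mem_part.1 hx₀).1 x₀ (mem_part.1 hx₀).1⟩
  obtain ⟨Y, hY, hK⟩ := hp a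
  set R := reps N M dl Y (part N dl a) with hR
  have hch : ∀ r ∈ part N dl a, ∃ ρ ∈ R, Agree N M dl Y r ρ := fun r hr => exists_rep hr
  choose! ρ hρ hag using hch
  -- columns representing the components in the parts of `Y`
  let U : Finset ℕ := Y.biUnion fun b => part N dl b
  have hU : (U.image q).card ≤ K * L := by
    have : U.image q = Y.biUnion fun b => (part N dl b).image q := by
      exact Finset.biUnion_image
    rw [this]
    refine (Finset.card_biUnion_le_card_mul _ _ K fun b _ => ?_).trans ?_
    · obtain ⟨Y', hY', hK'⟩ := hp b
      exact (card_components_le hq hY').trans hK'.le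
    · rw [mul_comm]; exact Nat.mul_le_mul_left _ hY
  have hch2 : ∀ v ∈ U.image q, ∃ z ∈ U, q z = v := fun v hv => Finset.mem_image.1 hv
  choose! z hzU hzq using hch2
  have hUN : ∀ x ∈ U, x < N := by
    intro x hx
    obtain ⟨b, _, hb⟩ := Finset.mem_biUnion.1 hx
    exact (mem_part.1 hb).1
  -- These data determine the twin class: the component, the representative, and the entry in one
  -- column for each component inside the deleted intervals.
  let sig : ℕ → ℕ × ℕ × (↥(U.image q) → ℕ) := fun r => (q r, ρ r, fun v => M r (z v))
  refine (card_image_le_card_image (part N dl a) cur sig ?_).trans ?_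
  · intro x hx y hy e
    have hx' := mem_part.1 hx
    have hy' := mem_part.1 hy
    simp only [sig, Prod.mk.injEq] at e
    obtain ⟨e1, e2, e3⟩ := e
    refine hcur x hx'.1 y hy'.1 ⟨e1, fun c hc hm => ?_⟩
    by_cases hcY : dl c ∈ Y
    · have hcU : c ∈ U := Finset.mem_biUnion.2 ⟨dl c, hcY, mem_part.2 ⟨hc, rfl⟩⟩
      have hv : q c ∈ U.image q := Finset.mem_image_of_mem _ hcU
      have hz := hUN _ (hzU _ hv)
      have hzc := hzq _ hv
      have e3' := congrFun e3 ⟨q c, hv⟩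
      simp only at e3'
      -- In a zone that is not mixed either all columns are equal, so that the column chosen for the
      -- component decides, or all rows are equal.
      by_cases h1 : NonVertical N M q x c
      · have h2 : ¬ NonVertical N M q c x := fun h => hm ⟨h1, h⟩
        have hrow : ∀ w < N, q w = q x → M w c = M w (z (q c)) := by
          intro w hw hwq
          by_contra hne
          exact h2 ⟨c, hc, _, hz, w, hw, rfl, hzc, hwq, fun h => hne (hM c hc w hw _ hz w hw h)⟩
        rw [hrow x hx'.1 rfl, hrow y hy'.1 e1.symm, e3']
      · by_contra hne
        exact h1 ⟨x, hx'.1, y, hy'.1, c, hc, rfl, e1.symm, rfl, hne⟩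
    · have h1 := hag x hx c hc hcY
      have h2 := hag y hy c hc hcY
      rw [h1, h2, e2]
  · have hsub : (part N dl a).image sig ⊆
        ((part N dl a).image q) ×ˢ (R ×ˢ Fintype.piFinset fun _ => A) := by
      intro v hv
      obtain ⟨x, hx, rfl⟩ := Finset.mem_image.1 hv
      refine Finset.mk_mem_product (Finset.mem_image_of_mem _ hx)
        (Finset.mk_mem_product (hρ x hx) (Fintype.mem_piFinset.2 fun v => ?_))
      exact hA x (mem_part.1 hx).1 _ (hUN _ (hzU _ v.2))
    refine (Finset.card_le_card hsub).trans ?_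
    rw [Finset.card_product, Finset.card_product, Fintype.card_piFinset, Finset.prod_const,
      Finset.card_univ, Fintype.card_coe, ← mul_assoc]
    exact Nat.mul_le_mul (Nat.mul_le_mul ((card_components_le hq hY).trans hK.le) hK.le)
      (Nat.pow_le_pow_right hA1 hU)

open Classical in
/-- The labels of the column parts that contain a column whose class forms a non-constant zone
with the class of `r`. -/
noncomputable def errLabels (N : ℕ) (M : ℕ → ℕ → ℕ) (dl τ : ℕ → ℕ) (r : ℕ) : Finset ℕ :=
  ((Finset.range N).filter fun c => ∃ r' < N, ∃ c' < N, τ r' = τ r ∧ τ c' = τ c ∧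
    M r c ≠ M r' c').image dl

/-- Where the zone of two components is not mixed, twins can be exchanged first among the rows and
then among the columns without changing the entry. So a non-constant zone of `τ` lies in a mixed
zone, and mixed zones occur only on the intervals provided by `exists_agree_components`. -/
theorem card_errLabels_le {N : ℕ} {M : ℕ → ℕ → ℕ} (hM : TransposeInvariant N M) {K L : ℕ}
    {dl q : ℕ → ℕ} (hq : IsComponents N M L dl q) (hp : ∀ a, Poor N M K L dl (part N dl a))
    {τ : ℕ → ℕ} (hτ : ∀ x < N, ∀ y < N, τ x = τ y → Twins N M q x y) {r : ℕ} (hr : r < N) :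
    (errLabels N M dl τ r).card ≤ L + K * K * L := by
  obtain ⟨Y, hY, hag⟩ := exists_agree_components hq (hp (dl r))
  refine (Finset.card_le_card ?_).trans hY
  intro b hb
  simp only [errLabels, Finset.mem_image, Finset.mem_filter, Finset.mem_range] at hb
  obtain ⟨c, ⟨hc, r', hr', c', hc', e1, e2, hne⟩, rfl⟩ := hb
  have t1 := hτ _ hr' _ hr e1
  have t2 := hτ _ hc' _ hc e2
  have hm : Mixed N M q r c := by
    by_contra hm
    apply hne
    have h1 : M r' c = M r c := t1.2 c hc fun h => hm (h.congr t1.1 rfl)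
    -- The exchange of columns is an exchange of rows in the transpose; `hM` carries the equality
    -- back.
    have h2 : M c' r' = M c r' := t2.2 r' hr' fun h => hm ((h.congr t2.1 t1.1).symm)
    rw [← h1]
    exact (hM c' hc' r' hr' c hc r' hr' h2).symm
  obtain ⟨r₁, h1, r₂, h2, c₁, h3, f1, f2, f3, f4⟩ := hm.1
  by_contra hbY
  apply f4
  have hl : dl c₁ ∉ Y := by rwa [hq.label h3 hc f3]
  have hr1 : r ∈ part N dl (dl r) := mem_part.2 ⟨hr, rfl⟩
  exact (hag r hr1 r₁ h1 f1.symm c₁ h3 hl).symm.trans (hag r hr1 r₂ h2 f2.symm c₁ h3 hl)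

/-- A partition `τ` that refines the division `dl` with bounded errors, and a refinement `ρ` of it
with boundedly many classes in every part of `dl`. -/
structure Good (N : ℕ) (M : ℕ → ℕ → ℕ) (F E : ℕ) (dl ρ τ : ℕ → ℕ) : Prop where
  mono : ∀ x y, x ≤ y → y < N → dl x ≤ dl y
  coarse : ∀ x < N, ∀ y < N, τ x = τ y → dl x = dl y
  refine : ∀ x < N, ∀ y < N, ρ x = ρ y → τ x = τ y
  count : ∀ a, ((part N dl a).image ρ).card ≤ F
  err : ∀ r < N, (errLabels N M dl τ r).card ≤ E

/-! ### Divisions -/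

/-- `dl` labels every element of an interval of a division by the minimum of that interval, and no
interval contains both `h` and a smaller element. -/
structure IsDiv (N h : ℕ) (dl : ℕ → ℕ) : Prop where
  mono : ∀ x y, x ≤ y → y < N → dl x ≤ dl y
  le : ∀ x < N, dl x ≤ x
  idem : ∀ x < N, dl (dl x) = dl x
  side : ∀ x < N, h ≤ x → h ≤ dl x

/-- The first element of an interval that can be merged with the preceding one. -/
def Eligible (N h : ℕ) (dl : ℕ → ℕ) (x : ℕ) : Prop := x < N ∧ dl x = x ∧ x ≠ 0 ∧ x ≠ h

/-- Merge the interval starting in `x` with the preceding one. -/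
def mergeAt (dl : ℕ → ℕ) (x y : ℕ) : ℕ := if dl y = x then dl (x - 1) else dl y

theorem IsDiv.mergeAt {N h : ℕ} {dl : ℕ → ℕ} (hd : IsDiv N h dl) {x : ℕ}
    (hx : Eligible N h dl x) : IsDiv N h (mergeAt dl x) := by
  obtain ⟨h1, h2, h3, h4⟩ := hx
  have hl : dl (x - 1) ≤ x - 1 := hd.le _ (by omega)
  refine ⟨?_, ?_, ?_, ?_⟩
  · intro y y' hy hy'
    have hm := hd.mono y y' hy hy'
    unfold TwinWidth.mergeAt
    split_ifs with e e'
    · exact le_rfl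
    · omega
    · have : dl y < x := by omega
      have hyx : y < x := by
        by_contra hge
        have := hd.mono x y (by omega) (by omega)
        omega
      exact hd.mono y (x - 1) (by omega) (by omega)
    · exact hm
  · intro y hy
    have := hd.le y hy
    unfold TwinWidth.mergeAt
    split_ifs <;> omega
  · intro y hy
    have hi := hd.idem y hy
    have hi' := hd.idem (x - 1) (by omega)
    unfold TwinWidth.mergeAt
    by_cases e : dl y = x
    · simp only [e, if_true]
      rw [if_neg (by omega), hi']
    · simp only [e, if_false, hi]
  · intro y hy hhy
    have := hd.side y hy hhy
    unfold TwinWidth.mergeAt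
    split_ifs with e
    · exact hd.side (x - 1) (by omega) (by omega)
    · exact this

open Classical in
/-- The union of the interval starting in `x` and the preceding one. -/
noncomputable def mergedPart (N : ℕ) (dl : ℕ → ℕ) (x : ℕ) : Finset ℕ :=
  (Finset.range N).filter fun y => dl y = dl (x - 1) ∨ dl y = x

/-- Only the new interval needs the second hypothesis; the other intervals stay poor because
coarsening the columns preserves poorness. -/
theorem Poor.mergeAt {N : ℕ} {M : ℕ → ℕ → ℕ} {K L : ℕ} {dl : ℕ → ℕ} {x : ℕ}
    (hp : ∀ a, Poor N M K L dl (part N dl a)) (hx : Poor N M K L dl (mergedPart N dl x)) (a : ℕ) :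
    Poor N M K L (mergeAt dl x) (part N (mergeAt dl x) a) := by
  let g : ℕ → ℕ := fun v => if v = x then dl (x - 1) else v
  have hg : ∀ c < N, TwinWidth.mergeAt dl x c = g (dl c) := fun c _ => rfl
  by_cases ha : a = dl (x - 1)
  · refine hx.mono g hg ?_
    intro y hy
    have := mem_part.1 hy
    simp only [mergedPart, Finset.mem_filter, Finset.mem_range]
    refine ⟨this.1, ?_⟩
    have h2 := this.2
    unfold TwinWidth.mergeAt at h2
    split_ifs at h2 with e
    · exact .inr e
    · exact .inl (h2.trans ha)
  · refine (hp a).mono g hg ?_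
    intro y hy
    have := mem_part.1 hy
    refine mem_part.2 ⟨this.1, ?_⟩
    have h2 := this.2
    unfold TwinWidth.mergeAt at h2
    split_ifs at h2 with e
    · exact absurd h2.symm ha
    · exact h2

/-- If nothing can be merged, every interval starts at `0` or at `h`, so each side is a single
interval. -/
theorem IsDiv.complete {N h : ℕ} {dl : ℕ → ℕ} (hd : IsDiv N h dl)
    (hc : ∀ x, ¬ Eligible N h dl x) {x y : ℕ} (hx : x < N) (hy : y < N)
    (hs : x < h ↔ y < h) : dl x = dl y := by
  have key : ∀ z < N, dl z = if z < h then 0 else h := by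
    intro z hz
    have h1 := hd.le z hz
    have h2 := hd.side z hz
    have h3 := hd.idem z hz
    have h4 := hc (dl z)
    simp only [Eligible, not_and, not_not] at h4
    have h5 := h4 (by omega) h3
    split_ifs <;> omega
  rw [key x hx, key y hy]
  simp only [hs]

/-- Merging two of the classes of a labelling. -/
def mergeLabels (f : ℕ → ℕ) (r r' y : ℕ) : ℕ := if f y = f r then f r' else f y

theorem mergeLabels_eq_iff {f : ℕ → ℕ} {r r' x y : ℕ} :
    mergeLabels f r r' x = mergeLabels f r r' y ↔
      f x = f y ∨ (f x = f r ∨ f x = f r') ∧ (f y = f r ∨ f y = f r') := by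
  unfold mergeLabels; split_ifs <;> grind

/-- Choosing two representatives that have to be identified. -/
theorem exists_pair_of_card_reps {N : ℕ} {M : ℕ → ℕ → ℕ} {dl : ℕ → ℕ} {K : ℕ} {Y Y' S : Finset ℕ}
    (h' : (reps N M dl Y' S).card < K) (h : K ≤ (reps N M dl Y S).card) :
    ∃ a ∈ reps N M dl Y S, ∃ b ∈ reps N M dl Y S,
      ((reps N M dl Y S).filter (· < a)).card < K ∧ ((reps N M dl Y S).filter (· < b)).card < K ∧
      ¬ Agree N M dl Y a b ∧ Agree N M dl Y' a b := by
  classical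
  set R := reps N M dl Y S with hR
  -- The first `K` representatives. Outside `Y'` there are fewer than `K` classes, so two of them
  -- agree there.
  let T := R.filter fun a => (R.filter (· < a)).card < K
  have hT : K ≤ T.card := by
    obtain ⟨U, hUR, hU⟩ : ∃ U : Finset (Fin R.card), U.card = K ∧ ∀ i ∈ U, (i : ℕ) < K := by
      refine ⟨Finset.univ.filter fun i => (i : ℕ) < K, ?_, by simp⟩
      rw [Fin.card_filter_val_lt]
      omega
    rw [← hUR]
    refine Finset.card_le_card_of_injOn (fun i => R.orderEmbOfFin rfl i) ?_ ?_
    · intro i hi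
      have hmem := R.orderEmbOfFin_mem rfl i
      refine Finset.mem_coe.2 (Finset.mem_filter.2 ⟨hmem, lt_of_le_of_lt ?_ (hU i hi)⟩)
      have : (R.filter (· < R.orderEmbOfFin rfl i)) ⊆
          (Finset.univ.filter fun j : Fin R.card => j < i).image (R.orderEmbOfFin rfl) := by
        intro y hy
        obtain ⟨hyR, hlt⟩ := Finset.mem_filter.1 hy
        have : y ∈ Set.range (R.orderEmbOfFin rfl) := by
          rw [Finset.range_orderEmbOfFin]; exact hyR
        obtain ⟨j, rfl⟩ := this
        refine Finset.mem_image_of_mem _ (Finset.mem_filter.2 ⟨Finset.mem_univ _, ?_⟩)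
        simpa using hlt
      refine (Finset.card_le_card this).trans (Finset.card_image_le.trans ?_)
      have hc : (Finset.univ.filter fun j : Fin R.card => j < i) = Finset.Iio i := by ext; simp
      rw [hc, Fin.card_Iio]
    · intro i _ j _ e
      exact (R.orderEmbOfFin rfl).injective e
  have hch : ∀ r ∈ T, ∃ ρ ∈ reps N M dl Y' S, Agree N M dl Y' r ρ :=
    fun r hr => exists_rep (reps_subset (Finset.filter_subset _ _ hr))
  choose! w hw hag using hch
  obtain ⟨a, ha, b, hb, hne, e⟩ := Finset.exists_ne_map_eq_of_card_lt_of_maps_to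
    (lt_of_lt_of_le h' hT) hw
  obtain ⟨ha1, ha2⟩ := Finset.mem_filter.1 ha
  obtain ⟨hb1, hb2⟩ := Finset.mem_filter.1 hb
  refine ⟨a, ha1, b, hb1, ha2, hb2, fun h => hne (eq_of_mem_reps ha1 hb1 h), ?_⟩
  have h1 := hag a ha
  rw [e] at h1
  exact h1.trans (hag b hb).symm

end TwinWidth

namespace TwinWidth

/-! ### Partitions of a finite linear order given by labels -/

section Labels

set_option linter.unusedSectionVars false

variable {X : Type*} [Fintype X] [LinearOrder X]

/-- The elements with the same label as `x`. -/
def labelClass (f : X → ℕ) (x : X) : Finset X := Finset.univ.filter fun y => f y = f x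

/-- The partition into the classes of elements with a common label. -/
def ofLabel (f : X → ℕ) : Finpartition (Finset.univ : Finset X) :=
  haveI : DecidableRel (Setoid.ker f).r := fun x y => inferInstanceAs (Decidable (f x = f y))
  Finpartition.ofSetoid (Setoid.ker f)

theorem mem_labelClass {f : X → ℕ} {x y : X} : y ∈ labelClass f x ↔ f y = f x := by
  simp [labelClass]

theorem part_ofLabel (f : X → ℕ) (x : X) : (ofLabel f).part x = labelClass f x := by
  ext y
  let : DecidableRel (Setoid.ker f).r := fun x y => inferInstanceAs (Decidable (f x = f y))
  rw [mem_labelClass]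
  exact (Finpartition.mem_part_ofSetoid_iff_rel (s := Setoid.ker f)).trans eq_comm

theorem mem_parts_ofLabel {f : X → ℕ} {S : Finset X} :
    S ∈ (ofLabel f).parts ↔ ∃ x, S = labelClass f x := by
  constructor
  · intro h
    obtain ⟨x, hx⟩ := Finpartition.nonempty_of_mem_parts _ h
    exact ⟨x, by rw [← part_ofLabel]; exact (Finpartition.part_eq_of_mem _ h hx).symm⟩
  · rintro ⟨x, rfl⟩
    rw [← part_ofLabel]
    exact (Finpartition.part_mem _).2 (Finset.mem_univ x)

theorem labelClass_eq_iff {f : X → ℕ} {x y : X} : labelClass f x = labelClass f y ↔ f x = f y := by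
  constructor
  · intro h
    have : x ∈ labelClass f x := mem_labelClass.2 rfl
    rw [h] at this
    exact mem_labelClass.1 this
  · intro h; ext z; rw [mem_labelClass, mem_labelClass, h]

theorem ofLabel_congr {f g : X → ℕ} (h : ∀ x y, f x = f y ↔ g x = g y) : ofLabel f = ofLabel g := by
  apply Finpartition.ext
  ext S
  have : ∀ x, labelClass f x = labelClass g x := fun x => by
    ext y; rw [mem_labelClass, mem_labelClass, h]
  simp only [mem_parts_ofLabel, this]

/-- Only the kernel of a labelling matters for its partition. The hypothesis therefore describes
which labels coincide and leaves the values free. -/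
theorem isContraction_ofLabel {f g : X → ℕ} {x y : X} (hne : f x ≠ f y)
    (hg : ∀ a b, g a = g b ↔ f a = f b ∨ (f a = f x ∨ f a = f y) ∧ (f b = f x ∨ f b = f y)) :
    IsContraction (ofLabel f) (ofLabel g) := by
  have hcls : ∀ z, labelClass g z =
      if f z = f x ∨ f z = f y then labelClass f x ∪ labelClass f y else labelClass f z := by
    intro z
    split_ifs with h
    · ext w
      rw [Finset.mem_union, mem_labelClass, mem_labelClass, mem_labelClass, hg]
      constructor
      · rintro (h' | ⟨h', -⟩)
        · rwa [h']
        · exact h'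
      · exact fun h' => .inr ⟨h', h⟩
    · ext w
      rw [mem_labelClass, mem_labelClass, hg]
      exact ⟨fun h' => h'.resolve_right fun h'' => h h''.2, .inl⟩
  refine ⟨labelClass f x, mem_parts_ofLabel.2 ⟨x, rfl⟩, labelClass f y,
    mem_parts_ofLabel.2 ⟨y, rfl⟩, fun h => hne (labelClass_eq_iff.1 h), ?_⟩
  ext S
  rw [Finset.mem_insert, Finset.mem_erase, Finset.mem_erase, mem_parts_ofLabel, mem_parts_ofLabel]
  constructor
  · rintro ⟨z, rfl⟩
    rw [hcls]
    split_ifs with h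
    · exact .inl rfl
    · refine .inr ⟨fun h' => h (.inr ?_), fun h' => h (.inl ?_), z, rfl⟩ <;>
        exact labelClass_eq_iff.1 h'
  · rintro (rfl | ⟨h1, h2, z, rfl⟩)
    · exact ⟨x, by rw [hcls, if_pos (.inl rfl)]⟩
    · refine ⟨z, ?_⟩
      rw [hcls, if_neg]
      rintro (h | h)
      · exact h2 (labelClass_eq_iff.2 h)
      · exact h1 (labelClass_eq_iff.2 h)

theorem mem_span {S : Finset X} {x : X} : x ∈ span S ↔ ∃ a ∈ S, ∃ b ∈ S, a ≤ x ∧ x ≤ b := by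
  simp [span]

theorem subset_span {S : Finset X} {x : X} (h : x ∈ S) : x ∈ span S :=
  mem_span.2 ⟨x, h, x, h, le_rfl, le_rfl⟩

/-- The span of a class stays inside one interval of `d`, so a class can only be in conflict with
classes of the same interval. The class itself does not count, whence `F + 1`. -/
theorem isOverlapping_ofLabel {f d : X → ℕ} (hd : Monotone d) (hf : ∀ x y, f x = f y → d x = d y)
    {F : ℕ} (hF : ∀ x, ((Finset.univ.filter fun y => d y = d x).image f).card ≤ F + 1) :
    IsOverlapping F (ofLabel f) := by
  intro S hS
  obtain ⟨x, rfl⟩ := mem_parts_ofLabel.1 hS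
  have hspan : ∀ y, ∀ z ∈ span (labelClass f y), d z = d y := by
    intro y z hz
    obtain ⟨a, ha, b, hb, h1, h2⟩ := mem_span.1 hz
    have e1 := hf _ _ (mem_labelClass.1 ha)
    have e2 := hf _ _ (mem_labelClass.1 hb)
    exact le_antisymm ((hd h2).trans e2.le) (e1.ge.trans (hd h1))
  let B := (Finset.univ.filter fun y => d y = d x).image (labelClass f)
  have hB : B.card ≤ F + 1 :=
    (card_image_le_card_image _ _ f fun a _ b _ e => labelClass_eq_iff.2 e).trans (hF x)
  have hx : labelClass f x ∈ B := Finset.mem_image_of_mem _ (by simp)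
  have hsub : (ofLabel f).parts.filter (fun T => T ≠ labelClass f x ∧
      Conflict (labelClass f x) T) ⊆ B.erase (labelClass f x) := by
    intro T hT
    obtain ⟨hT, hne, z, hz⟩ := Finset.mem_filter.1 hT
    obtain ⟨y, rfl⟩ := mem_parts_ofLabel.1 hT
    obtain ⟨hz1, hz2⟩ := Finset.mem_inter.1 hz
    refine Finset.mem_erase.2 ⟨hne, Finset.mem_image_of_mem _ (Finset.mem_filter.2 ⟨Finset.mem_univ _, ?_⟩)⟩
    rw [← hspan y z hz2, hspan x z hz1]
  refine (Finset.card_le_card hsub).trans ?_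
  rw [Finset.card_erase_of_mem hx]
  omega

theorem card_parts_ofLabel_le (f : X → ℕ) : (ofLabel f).parts.card ≤ Fintype.card X := by
  have : (ofLabel f).parts ⊆ Finset.univ.image (labelClass f) := by
    intro S hS
    obtain ⟨x, rfl⟩ := mem_parts_ofLabel.1 hS
    exact Finset.mem_image_of_mem _ (Finset.mem_univ x)
  exact (Finset.card_le_card this).trans Finset.card_image_le

end Labels

/-! ### Rich divisions have large twin-width -/

section Rich

variable {R C α : Type*} [Fintype R] [LinearOrder R] [Fintype C] [LinearOrder C] [DecidableEq α]

theorem not_conflict_of_isOverlapping_zero {X : Type*} [Fintype X] [LinearOrder X]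
    {P : Finpartition (Finset.univ : Finset X)} (h : IsOverlapping 0 P) {S T : Finset X}
    (hS : S ∈ P.parts) (hT : T ∈ P.parts) (hne : T ≠ S) : ¬ Conflict S T := by
  intro hc
  have := h S hS
  rw [Nat.le_zero, Finset.card_eq_zero] at this
  exact Finset.notMem_empty T (this ▸ Finset.mem_filter.2 ⟨hT, hne, hc⟩)

/-- A set whose span contains no interval of a division meets at most two of the intervals. -/
theorem card_meet_le_two {X : Type*} [Fintype X] [LinearOrder X]
    {P : Finpartition (Finset.univ : Finset X)} (h : IsOverlapping 0 P) {Z : Finset X}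
    (hZ : ∀ W ∈ P.parts, ¬ W ⊆ span Z) :
    (P.parts.filter fun W => (W ∩ Z).Nonempty).card ≤ 2 := by
  by_contra hlt
  obtain ⟨U, hU, V, hV, W, hW, hUV, hUW, hVW⟩ := Finset.two_lt_card.1 (not_le.1 hlt)
  -- Of three intervals met by `Z`, the middle one lies between two elements of `Z`, hence in its
  -- span.
  have key : ∀ U ∈ P.parts, ∀ V ∈ P.parts, ∀ W ∈ P.parts, U ≠ V → V ≠ W →
      ∀ u ∈ U ∩ Z, ∀ v ∈ V ∩ Z, ∀ w ∈ W ∩ Z, u ≤ v → v ≤ w → False := by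
    intro U hU V hV W hW hUV hVW u hu v hv w hw huv hvw
    rw [Finset.mem_inter] at hu hv hw
    refine hZ V hV fun y hy => mem_span.2 ⟨u, hu.2, w, hw.2, ?_, ?_⟩
    · by_contra hlt
      refine not_conflict_of_isOverlapping_zero h hV hU hUV
        ⟨u, Finset.mem_inter.2 ⟨mem_span.2 ⟨y, hy, v, hv.1, (not_le.1 hlt).le, huv⟩,
          subset_span hu.1⟩⟩
    · by_contra hlt
      refine not_conflict_of_isOverlapping_zero h hV hW hVW.symm
        ⟨w, Finset.mem_inter.2 ⟨mem_span.2 ⟨v, hv.1, y, hy, hvw, (not_le.1 hlt).le⟩,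
          subset_span hw.1⟩⟩
  obtain ⟨hU, u, hu⟩ := Finset.mem_filter.1 hU
  obtain ⟨hV, v, hv⟩ := Finset.mem_filter.1 hV
  obtain ⟨hW, w, hw⟩ := Finset.mem_filter.1 hW
  rcases le_total u v with h1 | h1 <;> rcases le_total v w with h2 | h2 <;>
    rcases le_total u w with h3 | h3
  · exact key U hU V hV W hW hUV hVW u hu v hv w hw h1 h2
  · exact key U hU V hV W hW hUV hVW u hu v hv w hw h1 h2
  · exact key U hU W hW V hV hUW hVW.symm u hu w hw v hv h3 h2
  · exact key W hW U hU V hV hUW.symm hUV w hw u hu v hv h3 h1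
  · exact key V hV U hU W hW hUV.symm hUW v hv u hu w hw h1 h3
  · exact key V hV W hW U hU hVW hUW.symm v hv w hw u hu h2 h3
  · exact key W hW V hV U hU hVW.symm hUV.symm w hw v hv u hu h2 h1
  · exact key W hW V hV U hU hVW.symm hUV.symm w hw v hv u hu h2 h1

/-- Every row part that meets `X` is `S` or in conflict with `S`, so there are at most `d + 1` of
them. They form non-constant zones with at most `(d + 1) * e` column parts, each of which meets at
most two intervals. Outside these intervals rows of `X` in the same part are equal, so at most `d +
1` distinct rows are left. -/
theorem not_rich_of_subset_span {M : R → C → α} {k d e : ℕ} (hk : 1 ≤ k) (hde : d + e ≤ k)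
    {D P : MatPartition R C} (hD : IsOverlapping 0 D.cols)
    (hrich : ∀ X ∈ D.rows.parts, ∀ 𝒴 ⊆ D.cols.parts, 𝒴.card ≤ 2 * k * (k + 1) →
      2 * k * (k + 1) ≤ numRows M X (Finset.univ \ 𝒴.biUnion id))
    (hov : IsOverlapping d P.rows)
    (herr : ∀ X ∈ P.rows.parts, (P.cols.parts.filter fun Y => ¬ IsConstantOn M X Y).card ≤ e)
    (hcols : ∀ Z ∈ P.cols.parts, ∀ W ∈ D.cols.parts, ¬ W ⊆ span Z)
    {S X : Finset R} (hS : S ∈ P.rows.parts) (hX : X ∈ D.rows.parts) (hXS : X ⊆ span S) :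
    False := by
  classical
  let 𝒮 := P.rows.parts.filter fun T => (T ∩ X).Nonempty
  have h𝒮 : 𝒮.card ≤ d + 1 := by
    have : 𝒮 ⊆ insert S (P.rows.parts.filter fun T => T ≠ S ∧ Conflict S T) := by
      intro T hT
      obtain ⟨hT, x, hx⟩ := Finset.mem_filter.1 hT
      rw [Finset.mem_inter] at hx
      by_cases hTS : T = S
      · exact Finset.mem_insert.2 (.inl hTS)
      · exact Finset.mem_insert_of_mem (Finset.mem_filter.2 ⟨hT, hTS, x,
          Finset.mem_inter.2 ⟨hXS hx.2, subset_span hx.1⟩⟩)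
    refine (Finset.card_le_card this).trans ((Finset.card_insert_le _ _).trans ?_)
    exact Nat.succ_le_succ (hov S hS)
  let ℬ := 𝒮.biUnion fun T => P.cols.parts.filter fun Y => ¬ IsConstantOn M T Y
  have hℬ : ℬ.card ≤ (d + 1) * e :=
    (Finset.card_biUnion_le_card_mul _ _ e fun T hT => herr T (Finset.mem_filter.1 hT).1).trans
      (Nat.mul_le_mul_right _ h𝒮)
  let 𝒴 := ℬ.biUnion fun Z => D.cols.parts.filter fun W => (W ∩ Z).Nonempty
  have h𝒴 : 𝒴.card ≤ 2 * k * (k + 1) := by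
    refine (Finset.card_biUnion_le_card_mul _ _ 2 fun Z hZ => ?_).trans ?_
    · obtain ⟨T, _, hZ⟩ := Finset.mem_biUnion.1 hZ
      exact card_meet_le_two hD (hcols Z (Finset.mem_filter.1 hZ).1)
    · have h1 : (d + 1) * e ≤ (k + 1) * k := Nat.mul_le_mul (by omega) (by omega)
      nlinarith
  have hsub : 𝒴 ⊆ D.cols.parts := by
    intro W hW
    obtain ⟨Z, _, hW⟩ := Finset.mem_biUnion.1 hW
    exact (Finset.mem_filter.1 hW).1
  have h1 := hrich X hX 𝒴 hsub h𝒴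
  have h2 : numRows M X (Finset.univ \ 𝒴.biUnion id) ≤ (X.image P.rows.part).card := by
    refine card_image_le_card_image _ _ _ ?_
    intro r hr r' hr' he
    funext ⟨c, hc⟩
    have hc' := (Finset.mem_sdiff.1 hc).2
    have hT : P.rows.part r ∈ P.rows.parts := (Finpartition.part_mem _).2 (Finset.mem_univ r)
    have hZ : P.cols.part c ∈ P.cols.parts := (Finpartition.part_mem _).2 (Finset.mem_univ c)
    have hrT : r ∈ P.rows.part r := Finpartition.mem_part _ (Finset.mem_univ r)
    have hrT' : r' ∈ P.rows.part r := by
      rw [he]; exact Finpartition.mem_part _ (Finset.mem_univ r')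
    have hcZ : c ∈ P.cols.part c := Finpartition.mem_part _ (Finset.mem_univ c)
    have hcon : IsConstantOn M (P.rows.part r) (P.cols.part c) := by
      by_contra hcon
      apply hc'
      have hW : D.cols.part c ∈ D.cols.parts := (Finpartition.part_mem _).2 (Finset.mem_univ c)
      have hcW : c ∈ D.cols.part c := Finpartition.mem_part _ (Finset.mem_univ c)
      refine Finset.mem_biUnion.2 ⟨D.cols.part c, Finset.mem_biUnion.2 ⟨P.cols.part c,
        Finset.mem_biUnion.2 ⟨P.rows.part r, ?_, Finset.mem_filter.2 ⟨hZ, hcon⟩⟩,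
        Finset.mem_filter.2 ⟨hW, c, Finset.mem_inter.2 ⟨hcW, hcZ⟩⟩⟩, hcW⟩
      exact Finset.mem_filter.2 ⟨hT, r, Finset.mem_inter.2 ⟨hrT, hr⟩⟩
    exact hcon r hrT c hcZ r' hrT' c hcZ
  have h3 : (X.image P.rows.part).card ≤ 𝒮.card := by
    refine Finset.card_le_card ?_
    intro T hT
    obtain ⟨r, hr, rfl⟩ := Finset.mem_image.1 hT
    exact Finset.mem_filter.2 ⟨(Finpartition.part_mem _).2 (Finset.mem_univ r), r,
      Finset.mem_inter.2 ⟨Finpartition.mem_part _ (Finset.mem_univ r), hr⟩⟩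
  -- At least `2 * k * (k + 1)` rows by richness, at most one for each row part that meets `X`:
  -- impossible for `k ≥ 1`.
  have h4 : 2 * k * (k + 1) ≤ k + 1 := by omega
  nlinarith

/-- A singleton is its own span, and a single row cannot provide two distinct vectors. -/
theorem not_singleton_rich {M : R → C → α} {K : ℕ} (hK : 2 ≤ K) {D : MatPartition R C}
    (hrich : ∀ X ∈ D.rows.parts, ∀ 𝒴 ⊆ D.cols.parts, 𝒴.card ≤ K →
      K ≤ numRows M X (Finset.univ \ 𝒴.biUnion id))
    {S X : Finset R} (hS : S.card = 1) (hX : X ∈ D.rows.parts) (hXS : X ⊆ span S) :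
    False := by
  obtain ⟨x, rfl⟩ := Finset.card_eq_one.1 hS
  have h1 := hrich X hX ∅ (Finset.empty_subset _) (by simp)
  have h2 : X.card ≤ 1 := by
    rw [← Finset.card_singleton x]
    refine Finset.card_le_card fun y hy => ?_
    obtain ⟨a, ha, b, hb, h1, h2⟩ := mem_span.1 (hXS hy)
    rw [Finset.mem_singleton] at ha hb ⊢
    subst ha hb
    exact le_antisymm h2 h1
  have h3 : numRows M X (Finset.univ \ (∅ : Finset (Finset C)).biUnion id) ≤ X.card :=
    Finset.card_image_le
  omega

/-- Look at the first partition with a part whose span contains an interval of the division. The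
step leading to it changed only rows or only columns, so on the other side no span contains an
interval yet, and `not_rich_of_subset_span` applies. That some sequence exists is needed because the
infimum of the empty set is `0`. -/
theorem lt_tww_of_isRich [Nonempty R] [Nonempty C] {M : R → C → α} {k : ℕ} (hk : 1 ≤ k)
    (hex : ∃ d e, ∃ P : ℕ → MatPartition R C, IsSequence M d e P)
    {D : MatPartition R C} (hD : IsRich M (2 * k * (k + 1)) D) : k < tww M := by
  classical
  by_contra hlt
  have hmem : tww M ∈ {d | ∃ k e : ℕ, k + e = d ∧ ∃ P : ℕ → MatPartition R C,
      IsSequence M k e P} := by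
    obtain ⟨d, e, P, hP⟩ := hex
    exact Nat.sInf_mem ⟨d + e, d, e, rfl, P, hP⟩
  obtain ⟨d, e, hde, P, hP⟩ := hmem
  obtain ⟨⟨hDr, hDc⟩, hrows, hcols⟩ := hD
  have hK : 2 ≤ 2 * k * (k + 1) := by nlinarith
  let BadR : ℕ → Prop := fun t => ∃ S ∈ (P t).rows.parts, ∃ X ∈ D.rows.parts, X ⊆ span S
  let BadC : ℕ → Prop := fun t => ∃ S ∈ (P t).cols.parts, ∃ X ∈ D.cols.parts, X ⊆ span S
  have hex : ∃ t, t ≤ lastIndex R C ∧ (BadR t ∨ BadC t) := by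
    refine ⟨_, le_rfl, .inl ⟨Finset.univ, by rw [hP.contraction.rows_end]; simp, ?_⟩⟩
    obtain ⟨x⟩ := ‹Nonempty R›
    exact ⟨D.rows.part x, (Finpartition.part_mem _).2 (Finset.mem_univ x),
      fun y _ => subset_span (Finset.mem_univ y)⟩
  obtain ⟨hle, hbad⟩ := Nat.find_spec hex
  have hmin := fun t (h : t < Nat.find hex) => Nat.find_min hex h
  generalize Nat.find hex = t at hle hbad hmin
  -- The error bound for columns, stated for the transpose, so that the lemma about rows also covers
  -- columns.
  have hrowsC : ∀ P' : MatPartition R C, ErrorAtMost M e P' →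
      ∀ X ∈ P'.cols.parts,
        (P'.rows.parts.filter fun Y => ¬ IsConstantOn (fun c r => M r c) X Y).card ≤ e := by
    intro P' h X hX
    refine le_trans (Finset.card_le_card ?_) (h.2 X hX)
    intro Y hY
    obtain ⟨hY, hc⟩ := Finset.mem_filter.1 hY
    exact Finset.mem_filter.2 ⟨hY, fun h => hc fun r hr c hc r' hr' c' hc' =>
      h c hc r hr c' hc' r' hr'⟩
  rcases Nat.eq_zero_or_pos t with rfl | hpos
  · rcases hbad with ⟨S, hS, X, hX, hXS⟩ | ⟨S, hS, X, hX, hXS⟩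
    · exact not_singleton_rich hK hrows (hP.contraction.rows_start S hS) hX hXS
    · exact not_singleton_rich (M := fun c r => M r c) (D := ⟨D.cols, D.rows⟩) hK
        hcols (hP.contraction.cols_start S hS) hX hXS
  · obtain ⟨t, rfl⟩ : ∃ t', t = t' + 1 := ⟨t - 1, by omega⟩
    have hm := hmin t (Nat.lt_succ_self t)
    simp only [not_and, not_or] at hm
    obtain ⟨hmR, hmC⟩ := hm (by omega)
    rcases hbad with ⟨S, hS, X, hX, hXS⟩ | ⟨S, hS, X, hX, hXS⟩
    · rcases hP.contraction.step t (by omega) with ⟨_, h⟩ | ⟨_, h⟩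
      · refine not_rich_of_subset_span hk (by omega) hDc hrows (hP.rows_overlap _ hle)
          (hP.error _ hle).1 ?_ hS hX hXS
        intro Z hZ W hW hsub
        rw [h] at hZ
        exact hmC ⟨Z, hZ, W, hW, hsub⟩
      · rw [h] at hS
        exact hmR ⟨S, hS, X, hX, hXS⟩
    · rcases hP.contraction.step t (by omega) with ⟨_, h⟩ | ⟨_, h⟩
      · rw [h] at hS
        exact hmC ⟨S, hS, X, hX, hXS⟩
      · refine not_rich_of_subset_span (M := fun c r => M r c) (D := ⟨D.cols, D.rows⟩)
          (P := ⟨(P (t + 1)).cols, (P (t + 1)).rows⟩) hk (d := d) (e := e) (by omega) hDr hcols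
          (hP.cols_overlap _ hle) (hrowsC _ (hP.error _ hle)) ?_ hS hX hXS
        intro Z hZ W hW hsub
        simp only [h] at hZ
        exact hmR ⟨Z, hZ, W, hW, hsub⟩

end Rich

/-! ### The existence of contraction sequences -/

theorem ofLabel_parts_eq_univ {X : Type*} [Fintype X] [LinearOrder X] [Nonempty X] {f : X → ℕ}
    (h : ∀ x y, f x = f y) : (ofLabel f).parts = {Finset.univ} := by
  ext S
  rw [mem_parts_ofLabel, Finset.mem_singleton]
  have : ∀ x, labelClass f x = Finset.univ := fun x => by
    ext y; simp [mem_labelClass, h y x]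
  simp [this]

theorem card_of_mem_ofLabel {X : Type*} [Fintype X] [LinearOrder X] {f : X → ℕ}
    (h : Function.Injective f) {S : Finset X} (hS : S ∈ (ofLabel f).parts) : S.card = 1 := by
  obtain ⟨x, rfl⟩ := mem_parts_ofLabel.1 hS
  refine Finset.card_eq_one.2 ⟨x, ?_⟩
  ext y
  simp [mem_labelClass, h.eq_iff]

/-- Merge all rows one by one, then all columns; the number of parts bounds every quantity
trivially. The infimum in the definition of `tww` is therefore attained. -/
theorem exists_isSequence {α : Type*} [DecidableEq α] {n m : ℕ} (hn : 1 ≤ n) (hm : 1 ≤ m)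
    (M : Fin n → Fin m → α) : ∃ d e, ∃ P : ℕ → MatPartition (Fin n) (Fin m), IsSequence M d e P := by
  have : Nonempty (Fin n) := ⟨⟨0, hn⟩⟩
  have : Nonempty (Fin m) := ⟨⟨0, hm⟩⟩
  have hlast : lastIndex (Fin n) (Fin m) = n + m - 2 := by simp [lastIndex]
  have hstep : ∀ {l : ℕ} (t : ℕ) (ht : t + 1 < l),
      IsContraction (ofLabel fun i : Fin l => max (i : ℕ) t)
        (ofLabel fun i : Fin l => max (i : ℕ) (t + 1)) := by
    intro l t ht
    refine isContraction_ofLabel (x := ⟨t, by omega⟩) (y := ⟨t + 1, ht⟩) (by simp) ?_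
    intro a b
    simp only
    omega
  -- After `t` steps the rows up to `t` form one part; the columns begin to merge once the `n - 1`
  -- merges of rows are done.
  let P : ℕ → MatPartition (Fin n) (Fin m) := fun t =>
    ⟨ofLabel fun i : Fin n => max (i : ℕ) (min t (n - 1)),
      ofLabel fun j : Fin m => max (j : ℕ) (t - (n - 1))⟩
  refine ⟨n + m, n + m, P, ⟨?_, ?_, ?_, ?_, ?_⟩, ?_, ?_, ?_⟩
  · intro X hX
    refine card_of_mem_ofLabel ?_ hX
    intro i j h
    simp at h
    exact Fin.ext h
  · intro X hX
    refine card_of_mem_ofLabel ?_ hX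
    intro i j h
    simp at h
    exact Fin.ext h
  · intro t ht
    rw [hlast] at ht
    by_cases h : t < n - 1
    · refine .inl ⟨?_, ?_⟩
      · simp only [P]
        rw [min_eq_left (by omega), min_eq_left (by omega)]
        exact hstep t (by omega)
      · simp only [P]
        rw [Nat.sub_eq_zero_of_le (by omega), Nat.sub_eq_zero_of_le (by omega)]
    · refine .inr ⟨?_, ?_⟩
      · simp only [P]
        rw [show t + 1 - (n - 1) = t - (n - 1) + 1 by omega]
        exact hstep _ (by omega)
      · simp only [P]
        rw [min_eq_right (by omega), min_eq_right (by omega)]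
  · refine ofLabel_parts_eq_univ fun x y => ?_
    have := x.2
    have := y.2
    rw [hlast]
    omega
  · refine ofLabel_parts_eq_univ fun x y => ?_
    have := x.2
    have := y.2
    rw [hlast]
    omega
  · intro t _ S _
    refine (Finset.card_filter_le _ _).trans ((card_parts_ofLabel_le _).trans ?_)
    simp
  · intro t _ S _
    refine (Finset.card_filter_le _ _).trans ((card_parts_ofLabel_le _).trans ?_)
    simp
  · intro t _
    constructor
    · intro S _
      refine (Finset.card_filter_le _ _).trans ((card_parts_ofLabel_le _).trans ?_)
      simp
    · intro S _
      refine (Finset.card_filter_le _ _).trans ((card_parts_ofLabel_le _).trans ?_)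
      simp

end TwinWidth

namespace TwinWidth

/-! ### Matrices inside a symmetric matrix -/

/-- The matrix `A` is the submatrix of `M` on the rows `o₁, …, o₁ + n - 1` and the columns
`o₂, …, o₂ + m - 1` up to the names of the letters, and these rows agree on all other columns. -/
structure Embeds {n m : ℕ} {α : Type*} (N : ℕ) (M : ℕ → ℕ → ℕ) (A : Fin n → Fin m → α)
    (o₁ o₂ : ℕ) : Prop where
  rows_le : o₁ + n ≤ N
  cols_le : o₂ + m ≤ N
  eq_iff : ∀ i j i' j', A i j = A i' j' ↔ M (o₁ + i) (o₂ + j) = M (o₁ + i') (o₂ + j')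
  outside : ∀ i k : Fin n, ∀ c < N, (c < o₂ ∨ o₂ + m ≤ c) → M (o₁ + i) c = M (o₁ + k) c

/-- The partition of `n` elements starting at `o`. -/
def shiftLabel (n o : ℕ) (f : ℕ → ℕ) : Finpartition (Finset.univ : Finset (Fin n)) :=
  ofLabel fun i : Fin n => f (o + i)

theorem isOverlapping_shiftLabel {N n o : ℕ} (ho : o + n ≤ N) {dl ρ : ℕ → ℕ} {F : ℕ}
    (hmono : ∀ x y, o ≤ x → x ≤ y → y < o + n → dl x ≤ dl y)
    (hρ : ∀ x < N, ∀ y < N, ρ x = ρ y → dl x = dl y)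
    (hF : ∀ a, ((part N dl a).image ρ).card ≤ F + 1) : IsOverlapping F (shiftLabel n o ρ) := by
  refine isOverlapping_ofLabel (d := fun i : Fin n => dl (o + i)) ?_ ?_ ?_
  · intro i j hij
    exact hmono _ _ (by omega) (Nat.add_le_add_left hij _) (by omega)
  · intro i j h
    exact hρ _ (by omega) _ (by omega) h
  · intro i
    refine le_trans (Finset.card_le_card ?_) (hF (dl (o + i)))
    intro v hv
    obtain ⟨j, hj, rfl⟩ := Finset.mem_image.1 hv
    exact Finset.mem_image.2 ⟨o + j, mem_part.2 ⟨by omega, (Finset.mem_filter.1 hj).2⟩, rfl⟩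

/-- Both partitions refine `τ`, so a non-constant zone puts the interval of its columns into
`errLabels`, and such an interval contains at most `F` column parts. Rows and columns may use
different refinements `ρ` and `γ`, as happens halfway through a symmetric step. -/
theorem card_not_isConstantOn_le {n m : ℕ} {α : Type*} [DecidableEq α] {N : ℕ} {M : ℕ → ℕ → ℕ}
    {A : Fin n → Fin m → α} {o₁ o₂ : ℕ} (hA : Embeds N M A o₁ o₂) {F E : ℕ} {dl τ ρ γ : ℕ → ℕ}
    (herr : ∀ r < N, (errLabels N M dl τ r).card ≤ E)
    (hρ : ∀ x < N, ∀ y < N, ρ x = ρ y → τ x = τ y)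
    (hγ : ∀ x < N, ∀ y < N, γ x = γ y → τ x = τ y)
    (hF : ∀ a, ((part N dl a).image γ).card ≤ F) {X : Finset (Fin n)}
    (hX : X ∈ (shiftLabel n o₁ ρ).parts) :
    ((shiftLabel m o₂ γ).parts.filter fun Y => ¬ IsConstantOn A X Y).card ≤ E * F := by
  classical
  obtain ⟨i, rfl⟩ := mem_parts_ofLabel.1 hX
  have hn := hA.rows_le
  have hm := hA.cols_le
  have hi : o₁ + i < N := by omega
  let J : Finset (Fin m) := Finset.univ.filter fun j => dl (o₂ + j) ∈ errLabels N M dl τ (o₁ + i)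
  have hsub : (shiftLabel m o₂ γ).parts.filter
      (fun Y => ¬ IsConstantOn A (labelClass (fun i : Fin n => ρ (o₁ + i)) i) Y) ⊆
      J.image (labelClass fun j : Fin m => γ (o₂ + j)) := by
    intro Y hY
    obtain ⟨hY, hne⟩ := Finset.mem_filter.1 hY
    obtain ⟨j, rfl⟩ := mem_parts_ofLabel.1 hY
    refine Finset.mem_image_of_mem _ (Finset.mem_filter.2 ⟨Finset.mem_univ _, ?_⟩)
    have hj : o₂ + j < N := by omega
    have hex : ∃ (i' : Fin n) (j' : Fin m), ρ (o₁ + i') = ρ (o₁ + i) ∧ γ (o₂ + j') = γ (o₂ + j) ∧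
        A i j ≠ A i' j' := by
      by_contra hcon
      push Not at hcon
      refine hne fun r hr c hc r' hr' c' hc' => ?_
      have hL : ∀ {l : ℕ} {f : Fin l → ℕ} {x y : Fin l}, y ∈ labelClass f x → f y = f x :=
        mem_labelClass.1
      rw [← hcon r c (hL hr) (hL hc), ← hcon r' c' (hL hr') (hL hc')]
    obtain ⟨i', j', h1, h2, h3⟩ := hex
    simp only [errLabels, Finset.mem_image, Finset.mem_filter, Finset.mem_range]
    have hi' : o₁ + i' < N := by omega
    have hj' : o₂ + j' < N := by omega
    exact ⟨o₂ + j, ⟨hj, o₁ + i', hi', o₂ + j', hj', hρ _ hi' _ hi h1, hγ _ hj' _ hj h2,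
      fun h => h3 ((hA.eq_iff _ _ _ _).2 h)⟩, rfl⟩
  refine (Finset.card_le_card hsub).trans ?_
  refine (card_image_le_card_image _ _ (fun j : Fin m => γ (o₂ + j)) fun a _ b _ e =>
    (labelClass_eq_iff (f := fun j : Fin m => γ (o₂ + j))).2 e).trans ?_
  have hsub2 : J.image (fun j : Fin m => γ (o₂ + j)) ⊆
      (errLabels N M dl τ (o₁ + i)).biUnion fun b => (part N dl b).image γ := by
    intro v hv
    obtain ⟨j, hj, rfl⟩ := Finset.mem_image.1 hv
    refine Finset.mem_biUnion.2 ⟨_, (Finset.mem_filter.1 hj).2, Finset.mem_image.2 ⟨o₂ + j, ?_, rfl⟩⟩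
    exact mem_part.2 ⟨by omega, rfl⟩
  refine (Finset.card_le_card hsub2).trans ?_
  exact (Finset.card_biUnion_le_card_mul _ _ F fun b _ => hF b).trans
    (Nat.mul_le_mul_right _ (herr _ hi))

theorem errorAtMost_shiftLabel {n m : ℕ} {α : Type*} [DecidableEq α] {N : ℕ} {M : ℕ → ℕ → ℕ}
    {A : Fin n → Fin m → α} {o₁ o₂ : ℕ} (hA : Embeds N M A o₁ o₂)
    (hA' : Embeds N M (fun j i => A i j) o₂ o₁) {F E : ℕ} {dl τ ρ γ : ℕ → ℕ}
    (herr : ∀ r < N, (errLabels N M dl τ r).card ≤ E)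
    (hρ : ∀ x < N, ∀ y < N, ρ x = ρ y → τ x = τ y)
    (hγ : ∀ x < N, ∀ y < N, γ x = γ y → τ x = τ y)
    (hF : ∀ a, ((part N dl a).image ρ).card ≤ F) (hF' : ∀ a, ((part N dl a).image γ).card ≤ F) :
    ErrorAtMost A (E * F) ⟨shiftLabel n o₁ ρ, shiftLabel m o₂ γ⟩ := by
  refine ⟨fun X hX => card_not_isConstantOn_le hA herr hρ hγ hF' hX, fun Y hY => ?_⟩
  refine le_trans (Finset.card_le_card ?_) (card_not_isConstantOn_le hA' herr hγ hρ hF hY)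
  intro X hX
  obtain ⟨hX, hc⟩ := Finset.mem_filter.1 hX
  exact Finset.mem_filter.2 ⟨hX, fun h => hc fun r hr c hc r' hr' c' hc' =>
    h c hc r hr c' hc' r' hr'⟩

/-! ### Pairing the intervals of a division -/

/-- The first elements of the intervals on the same side of `h` as `x`. -/
def leaders (N h : ℕ) (dl : ℕ → ℕ) (x : ℕ) : Finset ℕ :=
  (Finset.range N).filter fun y => dl y = y ∧ (y < h ↔ x < h)

/-- The number of intervals before the one of `x` on the same side of `h`. -/
def rank (N h : ℕ) (dl : ℕ → ℕ) (x : ℕ) : ℕ :=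
  ((Finset.range N).filter fun y => (dl y = y ∧ (y < h ↔ x < h)) ∧ y ≤ x).card - 1

/-- The labelling that joins the intervals on each side of `h` in pairs (and a triple). -/
def pairLabel (N h : ℕ) (dl : ℕ → ℕ) (x : ℕ) : ℕ :=
  min (rank N h dl x / 2) ((leaders N h dl x).card / 2 - 1)

theorem rank_eq (N h : ℕ) (dl : ℕ → ℕ) (x : ℕ) :
    rank N h dl x = ((leaders N h dl x).filter (· ≤ x)).card - 1 := by
  rw [rank, leaders, Finset.filter_filter]

theorem mem_leaders {N h : ℕ} {dl : ℕ → ℕ} {x y : ℕ} :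
    y ∈ leaders N h dl x ↔ y < N ∧ dl y = y ∧ (y < h ↔ x < h) := by
  simp [leaders]

theorem leaders_congr {N h : ℕ} {dl : ℕ → ℕ} {x y : ℕ} (hs : x < h ↔ y < h) :
    leaders N h dl x = leaders N h dl y := by
  ext z; simp only [mem_leaders, hs]

theorem exists_card_filter_lt_eq (R : Finset ℕ) {i : ℕ} (hi : i < R.card) :
    ∃ a ∈ R, (R.filter (· < a)).card = i := by
  refine ⟨R.orderEmbOfFin rfl ⟨i, hi⟩, R.orderEmbOfFin_mem rfl _, ?_⟩
  have : (R.filter (· < R.orderEmbOfFin rfl ⟨i, hi⟩)) =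
      (Finset.Iio (⟨i, hi⟩ : Fin R.card)).image (R.orderEmbOfFin rfl) := by
    ext y
    rw [Finset.mem_filter, Finset.mem_image]
    constructor
    · rintro ⟨hy, hlt⟩
      have : y ∈ Set.range (R.orderEmbOfFin rfl) := by
        rw [Finset.range_orderEmbOfFin]; exact hy
      obtain ⟨j, rfl⟩ := this
      exact ⟨j, Finset.mem_Iio.2 (by simpa using hlt), rfl⟩
    · rintro ⟨j, hj, rfl⟩
      exact ⟨R.orderEmbOfFin_mem rfl _, by simpa using hj⟩
  rw [this, Finset.card_image_of_injective _ (R.orderEmbOfFin rfl).injective, Fin.card_Iio]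

theorem IsDiv.same_side {N h : ℕ} {dl : ℕ → ℕ} (hd : IsDiv N h dl) {x : ℕ} (hx : x < N) :
    dl x < h ↔ x < h := by
  have := hd.le x hx
  have := hd.side x hx
  omega

theorem IsDiv.dl_mem_leaders {N h : ℕ} {dl : ℕ → ℕ} (hd : IsDiv N h dl) {x : ℕ} (hx : x < N) :
    dl x ∈ leaders N h dl x := by
  have := hd.le x hx
  exact mem_leaders.2 ⟨by omega, hd.idem x hx, hd.same_side hx⟩

theorem IsDiv.rank_lt {N h : ℕ} {dl : ℕ → ℕ} (hd : IsDiv N h dl) {x : ℕ} (hx : x < N) :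
    rank N h dl x < (leaders N h dl x).card := by
  have h1 : 0 < (leaders N h dl x).card := Finset.card_pos.2 ⟨_, hd.dl_mem_leaders hx⟩
  have h2 : ((leaders N h dl x).filter (· ≤ x)).card ≤ (leaders N h dl x).card :=
    Finset.card_filter_le _ _
  rw [rank_eq]
  omega

theorem IsDiv.rank_mono {N h : ℕ} {dl : ℕ → ℕ} {x y : ℕ} (hs : x < h ↔ y < h) (hxy : x ≤ y) :
    rank N h dl x ≤ rank N h dl y := by
  rw [rank_eq, rank_eq, leaders_congr hs]
  refine Nat.sub_le_sub_right (Finset.card_le_card ?_) 1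
  intro z hz
  rw [Finset.mem_filter] at hz ⊢
  exact ⟨hz.1, hz.2.trans hxy⟩

/-- Elements on the same side with the same rank are in the same interval. -/
theorem IsDiv.eq_of_rank_eq {N h : ℕ} {dl : ℕ → ℕ} (hd : IsDiv N h dl) {x y : ℕ} (hx : x < N)
    (hy : y < N) (hs : x < h ↔ y < h) (hr : rank N h dl x = rank N h dl y) : dl x = dl y := by
  wlog hxy : x ≤ y generalizing x y
  · exact (this hy hx hs.symm hr.symm (by omega)).symm
  by_contra hne
  have hlt : dl x < dl y := lt_of_le_of_ne (hd.mono x y hxy hy) hne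
  have hxy' : x < dl y := by
    by_contra hge
    have := hd.mono (dl y) x (by omega) hx
    rw [hd.idem y hy] at this
    omega
  rw [rank_eq, rank_eq, leaders_congr hs] at hr
  have hxm : dl x ∈ (leaders N h dl y).filter (· ≤ x) := by
    rw [← leaders_congr hs]
    exact Finset.mem_filter.2 ⟨hd.dl_mem_leaders hx, hd.le x hx⟩
  have hpos : 0 < ((leaders N h dl y).filter (· ≤ x)).card := Finset.card_pos.2 ⟨_, hxm⟩
  have hss : ((leaders N h dl y).filter (· ≤ x)).card < ((leaders N h dl y).filter (· ≤ y)).card := by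
    refine Finset.card_lt_card ⟨?_, ?_⟩
    · intro z hz
      have hz' := Finset.mem_filter.1 hz
      exact Finset.mem_filter.2 ⟨hz'.1, by omega⟩
    · intro hsub
      have := hsub (Finset.mem_filter.2 ⟨hd.dl_mem_leaders hy, hd.le y hy⟩)
      have := (Finset.mem_filter.1 this).2
      omega
  omega

theorem IsDiv.rank_eq_of_eq {N h : ℕ} {dl : ℕ → ℕ} (hd : IsDiv N h dl) {x y : ℕ} (hx : x < N)
    (hy : y < N) (he : dl x = dl y) : rank N h dl x = rank N h dl y := by
  have hs : x < h ↔ y < h := by rw [← hd.same_side hx, ← hd.same_side hy, he]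
  have key : ∀ z < N, ∀ w ∈ leaders N h dl z, w ≤ z ↔ w ≤ dl z := by
    intro z hz w hw
    obtain ⟨h1, h2, _⟩ := mem_leaders.1 hw
    constructor
    · intro h
      have := hd.mono w z h hz
      omega
    · intro h
      have := hd.le z hz
      omega
  rw [rank_eq, rank_eq, Finset.filter_congr (key x hx), Finset.filter_congr (key y hy),
    leaders_congr hs, he]

theorem IsDiv.pairLabel_eq_of_eq {N h : ℕ} {dl : ℕ → ℕ} (hd : IsDiv N h dl) {x y : ℕ} (hx : x < N)
    (hy : y < N) (he : dl x = dl y) : pairLabel N h dl x = pairLabel N h dl y := by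
  have hs : x < h ↔ y < h := by rw [← hd.same_side hx, ← hd.same_side hy, he]
  rw [pairLabel, pairLabel, hd.rank_eq_of_eq hx hy he, leaders_congr hs]

/-- Every class of `pairLabel` contains two consecutive intervals. -/
theorem IsDiv.exists_eligible {N h : ℕ} {dl : ℕ → ℕ} (hd : IsDiv N h dl) {x : ℕ} (hx : x < N)
    (ht : 2 ≤ (leaders N h dl x).card) : ∃ y, Eligible N h dl y ∧ (y < h ↔ x < h) ∧
      (y - 1 < h ↔ x < h) ∧
      pairLabel N h dl (y - 1) = pairLabel N h dl x ∧ pairLabel N h dl y = pairLabel N h dl x := by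
  have hrx := hd.rank_lt hx
  set T := (leaders N h dl x).card with hT
  set g := pairLabel N h dl x with hg
  have hgT : g ≤ T / 2 - 1 := by rw [hg, pairLabel]; exact min_le_right _ _
  -- The interval of rank `2 * g + 1`. It is preceded by the one of rank `2 * g`, and both get the
  -- label `g`.
  obtain ⟨y, hy, hcard⟩ := exists_card_filter_lt_eq (leaders N h dl x) (i := 2 * g + 1) (by omega)
  obtain ⟨hyN, hyl, hys⟩ := mem_leaders.1 hy
  have hle : (leaders N h dl x).filter (· ≤ y) =
      insert y ((leaders N h dl x).filter (· < y)) := by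
    ext z
    rw [Finset.mem_insert, Finset.mem_filter, Finset.mem_filter, le_iff_lt_or_eq]
    constructor
    · rintro ⟨h1, h2 | h2⟩
      · exact .inr ⟨h1, h2⟩
      · exact .inl h2
    · rintro (rfl | ⟨h1, h2⟩)
      · exact ⟨hy, .inr rfl⟩
      · exact ⟨h1, .inl h2⟩
  have hry : rank N h dl y = 2 * g + 1 := by
    rw [rank_eq, leaders_congr hys, hle, Finset.card_insert_of_notMem (by simp), hcard]
    omega
  obtain ⟨z, hz⟩ := Finset.card_pos.1 (show 0 < ((leaders N h dl x).filter (· < y)).card by omega)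
  obtain ⟨hz1, hzy⟩ := Finset.mem_filter.1 hz
  obtain ⟨hzN, hzl, hzs⟩ := mem_leaders.1 hz1
  have hys' : y - 1 < h ↔ x < h := by omega
  have hry' : rank N h dl (y - 1) = 2 * g := by
    rw [rank_eq, leaders_congr hys']
    have : (leaders N h dl x).filter (· ≤ y - 1) = (leaders N h dl x).filter (· < y) := by
      refine Finset.filter_congr fun w _ => ?_
      omega
    rw [this, hcard]
    omega
  refine ⟨y, ⟨hyN, hyl, by omega, by omega⟩, hys, hys', ?_, ?_⟩
  · rw [pairLabel, hry', leaders_congr hys', ← hT]; omega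
  · rw [pairLabel, hry, leaders_congr hys, ← hT]; omega

/-- The elements `o, …, o + n - 1` form one of the sides of `h`. -/
structure IsSide (N h o n : ℕ) : Prop where
  pos : 1 ≤ n
  le : o + n ≤ N
  iff : ∀ y < N, (o ≤ y ∧ y < o + n) ↔ (y < h ↔ o < h)

theorem IsSide.same {N h o n : ℕ} (hs : IsSide N h o n) {x y : ℕ} (hx : o ≤ x ∧ x < o + n)
    (hy : o ≤ y ∧ y < o + n) : x < h ↔ y < h := by
  have h1 := (hs.iff x (by have := hs.le; omega)).1 hx
  have h2 := (hs.iff y (by have := hs.le; omega)).1 hy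
  rw [h1, h2]

theorem isOverlapping_pairLabel {N h o n : ℕ} {dl : ℕ → ℕ} (hs : IsSide N h o n) :
    IsOverlapping 0 (shiftLabel n o (pairLabel N h dl)) := by
  refine isOverlapping_shiftLabel (N := N) hs.le (dl := pairLabel N h dl) ?_ (fun _ _ _ _ h => h) ?_
  · intro x y hx hxy hy
    have hside : x < h ↔ y < h := hs.same (by omega) (by omega)
    rw [pairLabel, pairLabel, leaders_congr hside]
    exact min_le_min_right _ (Nat.div_le_div_right (IsDiv.rank_mono hside hxy))
  · intro a
    refine (Finset.card_le_card (t := {a}) ?_).trans (by simp)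
    intro v hv
    obtain ⟨x, hx, rfl⟩ := Finset.mem_image.1 hv
    exact Finset.mem_singleton.2 (mem_part.1 hx).2

/-- Every class of the paired division contains two consecutive intervals whose union is not poor.
Since `K` classes of columns consist of at most `3 * K` intervals, the union keeps `K` rows that are
pairwise separated outside them. By `Embeds.outside` the separating columns belong to the matrix
`A`. -/
theorem rich_pairLabel {n m : ℕ} {α : Type*} [DecidableEq α] {N h : ℕ} {M : ℕ → ℕ → ℕ}
    {A : Fin n → Fin m → α} {o₁ o₂ : ℕ} (hA : Embeds N M A o₁ o₂) {dl : ℕ → ℕ}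
    (hd : IsDiv N h dl) (hs₁ : IsSide N h o₁ n) (hs₂ : IsSide N h o₂ m) {K : ℕ}
    (hstuck : ∀ x, Eligible N h dl x → ¬ Poor N M K (3 * K) dl (mergedPart N dl x))
    (ht : 2 ≤ (leaders N h dl o₁).card) :
    ∀ X ∈ (shiftLabel n o₁ (pairLabel N h dl)).parts,
      ∀ 𝒴 ⊆ (shiftLabel m o₂ (pairLabel N h dl)).parts, 𝒴.card ≤ K →
      K ≤ numRows A X (Finset.univ \ 𝒴.biUnion id) := by
  classical
  intro X hX 𝒴 h𝒴 hcard
  obtain ⟨i, rfl⟩ := mem_parts_ofLabel.1 hX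
  have hn := hA.rows_le
  have hm := hA.cols_le
  have hside : ∀ j : Fin n, (o₁ + j < h ↔ o₁ < h) := fun j =>
    hs₁.same ⟨by omega, by omega⟩ ⟨le_rfl, by have := hs₁.pos; omega⟩
  obtain ⟨y, hy, hys, hys', hp1, hp2⟩ := hd.exists_eligible (x := o₁ + i) (by omega)
    (by rw [leaders_congr (hside i)]; exact ht)
  let Y : Finset ℕ := 𝒴.biUnion fun T => T.image fun j : Fin m => dl (o₂ + j)
  have hY : Y.card ≤ 3 * K := by
    refine (Finset.card_biUnion_le_card_mul _ _ 3 fun T hT => ?_).trans (by omega)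
    obtain ⟨j, rfl⟩ := mem_parts_ofLabel.1 (h𝒴 hT)
    let g := pairLabel N h dl (o₂ + j)
    refine (card_image_le_card_image _ _ (fun j : Fin m => rank N h dl (o₂ + j)) ?_).trans ?_
    · intro a _ b _ e
      exact hd.eq_of_rank_eq (by omega) (by omega)
        (hs₂.same ⟨by omega, by omega⟩ ⟨by omega, by omega⟩) e
    -- The third rank occurs in the last class of a side with an odd number of intervals.
    · refine (Finset.card_le_card (t := {2 * g, 2 * g + 1, 2 * g + 2}) ?_).trans
        Finset.card_le_three
      intro v hv
      obtain ⟨a, ha, rfl⟩ := Finset.mem_image.1 hv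
      have ha' : pairLabel N h dl (o₂ + a) = g :=
        (mem_labelClass (f := fun i : Fin m => pairLabel N h dl (o₂ + i))).1 ha
      have hr := hd.rank_lt (x := o₂ + a) (by omega)
      rw [pairLabel] at ha'
      simp only [Finset.mem_insert, Finset.mem_singleton]
      omega
  have hK : K ≤ (reps N M dl Y (mergedPart N dl y)).card := by
    by_contra hlt
    exact hstuck y hy ⟨Y, hY, not_le.1 hlt⟩
  refine hK.trans ?_
  have hmem : ∀ r ∈ mergedPart N dl y, ∃ i' : Fin n, r = o₁ + i' ∧
      i' ∈ labelClass (fun i : Fin n => pairLabel N h dl (o₁ + i)) i := by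
    intro r hr
    simp only [mergedPart, Finset.mem_filter, Finset.mem_range] at hr
    obtain ⟨hrN, hr⟩ := hr
    have hyN := hy.1
    have hy1N : y - 1 < N := by omega
    have hry : (r < h ↔ o₁ + i < h) ∧ pairLabel N h dl r = pairLabel N h dl (o₁ + i) := by
      rcases hr with hr | hr
      · refine ⟨?_, by rw [← hp1]; exact hd.pairLabel_eq_of_eq hrN hy1N hr⟩
        rw [← hd.same_side hrN, hr, hd.same_side hy1N, hys']
      · rw [← hy.2.1] at hr
        refine ⟨?_, by rw [← hp2]; exact hd.pairLabel_eq_of_eq hrN hyN hr⟩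
        rw [← hd.same_side hrN, hr, hd.same_side hyN, hys]
    have hr' := (hs₁.iff r hrN).2 (by rw [hry.1, hside])
    refine ⟨⟨r - o₁, by omega⟩, by simp; omega, mem_labelClass.2 ?_⟩
    simp only
    rw [show o₁ + (r - o₁) = r by omega]
    exact hry.2
  have : Nonempty (Fin n) := ⟨i⟩
  choose! w hw hwX using hmem
  refine Finset.card_le_card_of_injOn (fun r =>
    (fun c : {c // c ∈ Finset.univ \ 𝒴.biUnion id} => A (w r) c)) ?_ ?_
  · intro r hr
    exact Finset.mem_coe.2 (Finset.mem_image_of_mem _ (hwX r (reps_subset hr)))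
  · intro r hr r' hr' e
    refine eq_of_mem_reps hr hr' fun c hc hcY => ?_
    rw [hw r (reps_subset hr), hw r' (reps_subset hr')]
    by_cases hcr : c < o₂ ∨ o₂ + m ≤ c
    · exact hA.outside _ _ c hc hcr
    · have hj : c = o₂ + (⟨c - o₂, by omega⟩ : Fin m) := by simp; omega
      rw [hj]
      refine (hA.eq_iff _ _ _ _).1 (congrFun e ⟨⟨c - o₂, by omega⟩, ?_⟩)
      refine Finset.mem_sdiff.2 ⟨Finset.mem_univ _, fun hmem => hcY ?_⟩
      obtain ⟨T, hT, hjT⟩ := Finset.mem_biUnion.1 hmem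
      refine Finset.mem_biUnion.2 ⟨T, hT, Finset.mem_image.2 ⟨_, hjT, ?_⟩⟩
      rw [← hj]

theorem isRich_pairLabel {n m : ℕ} {α : Type*} [DecidableEq α] {N h : ℕ} {M : ℕ → ℕ → ℕ}
    {A : Fin n → Fin m → α} {o₁ o₂ : ℕ} (hA : Embeds N M A o₁ o₂)
    (hA' : Embeds N M (fun j i => A i j) o₂ o₁) {dl : ℕ → ℕ}
    (hd : IsDiv N h dl) (hs₁ : IsSide N h o₁ n) (hs₂ : IsSide N h o₂ m) {K : ℕ}
    (hstuck : ∀ x, Eligible N h dl x → ¬ Poor N M K (3 * K) dl (mergedPart N dl x))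
    (ht₁ : 2 ≤ (leaders N h dl o₁).card) (ht₂ : 2 ≤ (leaders N h dl o₂).card) :
    IsRich A K ⟨shiftLabel n o₁ (pairLabel N h dl), shiftLabel m o₂ (pairLabel N h dl)⟩ :=
  ⟨⟨isOverlapping_pairLabel hs₁, isOverlapping_pairLabel hs₂⟩,
    rich_pairLabel hA hd hs₁ hs₂ hstuck ht₁, rich_pairLabel hA' hd hs₂ hs₁ hstuck ht₂⟩

/-- The preceding interval starts on the same side, because a mergeable position is not the boundary
`h`. -/
theorem IsDiv.two_le_card_leaders {N h : ℕ} {dl : ℕ → ℕ} (hd : IsDiv N h dl) {x : ℕ}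
    (hx : Eligible N h dl x) : 2 ≤ (leaders N h dl x).card := by
  obtain ⟨h1, h2, h3, h4⟩ := hx
  have hle := hd.le (x - 1) (by omega)
  have hs := hd.same_side (x := x - 1) (by omega)
  have hsub : {dl (x - 1), x} ⊆ leaders N h dl x := by
    intro y hy
    rw [Finset.mem_insert, Finset.mem_singleton] at hy
    rcases hy with rfl | rfl
    · exact mem_leaders.2 ⟨by omega, hd.idem _ (by omega), by omega⟩
    · exact mem_leaders.2 ⟨h1, h2, Iff.rfl⟩
  refine le_trans ?_ (Finset.card_le_card hsub)
  rw [Finset.card_pair (by omega)]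

/-- If the entries with both indices on one side are constant, a division that cannot be coarsened
has at least two intervals on both sides. -/
theorem IsDiv.exists_eligible_opposite {N h : ℕ} {M : ℕ → ℕ → ℕ} {dl : ℕ → ℕ} (hd : IsDiv N h dl)
    {K L : ℕ} (hK : 2 ≤ K) (hL : 1 ≤ L)
    (hblock : ∀ r < N, ∀ r' < N, ∀ c < N, (r < h ↔ c < h) → (r' < h ↔ c < h) → M r c = M r' c)
    (hstuck : ∀ x, Eligible N h dl x → ¬ Poor N M K L dl (mergedPart N dl x))
    {x : ℕ} (hx : Eligible N h dl x) : ∃ y, Eligible N h dl y ∧ ¬ (y < h ↔ x < h) := by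
  by_contra hcon
  push Not at hcon
  -- The label of the only interval on the opposite side. The remaining columns are on the side of
  -- the rows, where all rows agree, so just one class of rows is left.
  refine hstuck x hx ⟨{if x < h then h else 0}, by simpa using hL, lt_of_lt_of_le ?_ hK⟩
  obtain ⟨h1, h2, h3, h4⟩ := hx
  rw [Nat.lt_succ_iff, Finset.card_le_one]
  intro r hr r' hr'
  refine eq_of_mem_reps hr hr' fun c hc hcY => ?_
  have hside : ∀ r ∈ mergedPart N dl x, r < N ∧ (r < h ↔ x < h) := by
    intro r hr
    simp only [mergedPart, Finset.mem_filter, Finset.mem_range] at hr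
    have hs := hd.same_side hr.1
    have hs' := hd.same_side (x := x - 1) (by omega)
    refine ⟨hr.1, ?_⟩
    rcases hr.2 with h | h <;> rw [h] at hs <;> omega
  obtain ⟨hr1, hr2⟩ := hside r (reps_subset hr)
  obtain ⟨hr1', hr2'⟩ := hside r' (reps_subset hr')
  have hcs : c < h ↔ x < h := by
    by_contra hne
    apply hcY
    rw [Finset.mem_singleton]
    have hle := hd.le c hc
    have hs := hd.same_side hc
    by_cases he : Eligible N h dl (dl c)
    · have := hcon _ he
      omega
    · simp only [Eligible, not_and, not_not] at he
      have := he (by omega) (hd.idem c hc)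
      split_ifs <;> omega
  exact hblock r hr1 r' hr1' c hc (by omega) (by omega)

end TwinWidth

namespace TwinWidth

/-! ### From sequences of labellings to contraction sequences -/

/-- Between `ρ` and `τ` there is room: a coarser labelling has no more classes, and the errors are
measured on `τ` alone. -/
theorem Good.coarser {N : ℕ} {M : ℕ → ℕ → ℕ} {F E : ℕ} {dl ρ ρ' τ : ℕ → ℕ}
    (hg : Good N M F E dl ρ τ) (h₁ : ∀ x < N, ∀ y < N, ρ x = ρ y → ρ' x = ρ' y)
    (h₂ : ∀ x < N, ∀ y < N, ρ' x = ρ' y → τ x = τ y) : Good N M F E dl ρ' τ where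
  mono := hg.mono
  coarse := hg.coarse
  refine := h₂
  err := hg.err
  count a := (card_image_le_card_image _ _ ρ fun x hx y hy e =>
    h₁ x (mem_part.1 hx).1 y (mem_part.1 hy).1 e).trans (hg.count a)

theorem good_of_injective {N : ℕ} {M : ℕ → ℕ → ℕ} {F E : ℕ} {ρ : ℕ → ℕ} (hF : 1 ≤ F)
    (h : ∀ x < N, ∀ y < N, ρ x = ρ y → x = y) : Good N M F E id ρ id where
  mono _ _ h _ := h
  coarse _ _ _ _ h := h
  refine := h
  count a := by
    refine le_trans (Finset.card_image_le.trans ?_) hF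
    rw [Finset.card_le_one]
    intro x hx y hy
    exact (mem_part.1 hx).2.trans (mem_part.1 hy).2.symm
  err r hr := by
    have : errLabels N M id id r = ∅ := by
      rw [errLabels, Finset.image_eq_empty, Finset.filter_eq_empty_iff]
      rintro c _ ⟨r', _, c', _, h1, h2, h3⟩
      simp only [id] at h1 h2
      exact h3 (by rw [h1, h2])
    simp [this]

/-- A sequence of labellings in which two classes are merged in each step. -/
structure IsChain (N h : ℕ) (M : ℕ → ℕ → ℕ) (F E T : ℕ) (Q : ℕ → ℕ → ℕ) : Prop where
  start : ∀ x < N, ∀ y < N, Q 0 x = Q 0 y → x = y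
  step : ∀ t < T, ∃ r < N, ∃ r' < N, Q t r ≠ Q t r' ∧
    (∀ y < N, Q (t + 1) y = mergeLabels (Q t) r r' y) ∧
    ∃ dl, Good N M F E dl (Q t) (Q (t + 1)) ∧ IsDiv N h dl

/-- After the first step every labelling refines a division that respects `h`, so no class contains
elements of both sides. -/
theorem IsChain.side {N h : ℕ} {M : ℕ → ℕ → ℕ} {F E T : ℕ} {Q : ℕ → ℕ → ℕ}
    (hQ : IsChain N h M F E T Q) {t : ℕ} (ht : t ≤ T) {x y : ℕ} (hx : x < N) (hy : y < N)
    (he : Q t x = Q t y) : x < h ↔ y < h := by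
  rcases Nat.eq_zero_or_pos t with rfl | hpos
  · rw [hQ.start x hx y hy he]
  · obtain ⟨s, rfl⟩ : ∃ s, t = s + 1 := ⟨t - 1, by omega⟩
    obtain ⟨_, _, _, _, _, _, dl, hg, hd⟩ := hQ.step s (by omega)
    rw [← hd.same_side hx, ← hd.same_side hy, hg.coarse x hx y hy he]

/-- Each merge removes exactly one label. This fixes the length of a chain by the number of its
final classes. -/
theorem IsChain.card_image {N h : ℕ} {M : ℕ → ℕ → ℕ} {F E T : ℕ} {Q : ℕ → ℕ → ℕ}
    (hQ : IsChain N h M F E T Q) : ∀ t ≤ T, ((Finset.range N).image (Q t)).card + t = N := by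
  intro t
  induction t with
  | zero =>
    intro _
    rw [Finset.card_image_of_injOn, Finset.card_range, add_zero]
    intro x hx y hy e
    exact hQ.start x (by simpa using hx) y (by simpa using hy) e
  | succ t ih =>
    intro ht
    obtain ⟨r, hr, r', hr', hne, hm, _⟩ := hQ.step t (by omega)
    have : (Finset.range N).image (Q (t + 1)) = ((Finset.range N).image (Q t)).erase (Q t r) := by
      ext v
      simp only [Finset.mem_image, Finset.mem_range, Finset.mem_erase]
      constructor
      · rintro ⟨x, hx, rfl⟩
        rw [hm x hx]
        unfold mergeLabels
        split_ifs with e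
        · exact ⟨hne.symm, r', hr', rfl⟩
        · exact ⟨e, x, hx, rfl⟩
      · rintro ⟨hv, x, hx, rfl⟩
        refine ⟨x, hx, ?_⟩
        rw [hm x hx, mergeLabels, if_neg hv]
    rw [this, Finset.card_erase_of_mem (Finset.mem_image_of_mem _ (Finset.mem_range.2 hr))]
    have hpos : 0 < ((Finset.range N).image (Q t)).card :=
      Finset.card_pos.2 ⟨_, Finset.mem_image_of_mem _ (Finset.mem_range.2 hr)⟩
    have := ih (by omega)
    omega

theorem IsChain.exists_good {N h : ℕ} {M : ℕ → ℕ → ℕ} {F E T : ℕ} {Q : ℕ → ℕ → ℕ} (hF : 1 ≤ F)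
    (hQ : IsChain N h M F E T Q) {t : ℕ} (ht : t ≤ T) : ∃ dl τ, Good N M F E dl (Q t) τ := by
  rcases Nat.eq_zero_or_pos t with rfl | hpos
  · exact ⟨_, _, good_of_injective hF hQ.start⟩
  · obtain ⟨s, rfl⟩ : ∃ s, t = s + 1 := ⟨t - 1, by omega⟩
    obtain ⟨_, _, _, _, _, _, dl, hg, _⟩ := hQ.step s (by omega)
    exact ⟨dl, Q (s + 1), hg.coarser hg.refine fun _ _ _ _ h => h⟩

section

variable {n m : ℕ} {α : Type*} [DecidableEq α] {N : ℕ} {M : ℕ → ℕ → ℕ} {A : Fin n → Fin m → α}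
  {o₁ o₂ : ℕ}

/-- The bounds of `(F - 1, E * F)`-sequences for one partition. -/
theorem bounds_of_good (hA : Embeds N M A o₁ o₂) (hA' : Embeds N M (fun j i => A i j) o₂ o₁)
    {F E : ℕ} (hF : 1 ≤ F) {dl τ ρ γ : ℕ → ℕ} (hρ : Good N M F E dl ρ τ)
    (hγ : Good N M F E dl γ τ) :
    IsOverlapping (F - 1) (shiftLabel n o₁ ρ) ∧ IsOverlapping (F - 1) (shiftLabel m o₂ γ) ∧
    ErrorAtMost A (E * F) ⟨shiftLabel n o₁ ρ, shiftLabel m o₂ γ⟩ := by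
  refine ⟨?_, ?_, ?_⟩
  · exact isOverlapping_shiftLabel hA.rows_le
      (fun x y _ hxy hy => hρ.mono x y hxy (by have := hA.rows_le; omega))
      (fun x hx y hy e => hρ.coarse x hx y hy (hρ.refine x hx y hy e))
      (fun a => (hρ.count a).trans (by omega))
  · exact isOverlapping_shiftLabel hA.cols_le
      (fun x y _ hxy hy => hρ.mono x y hxy (by have := hA.cols_le; omega))
      (fun x hx y hy e => hγ.coarse x hx y hy (hγ.refine x hx y hy e))
      (fun a => (hγ.count a).trans (by omega))
  · exact errorAtMost_shiftLabel hA hA' hρ.err hρ.refine hγ.refine hρ.count hγ.count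

theorem isContraction_shiftLabel {f g : ℕ → ℕ} {n o r r' : ℕ}
    (hr : o ≤ r ∧ r < o + n) (hr' : o ≤ r' ∧ r' < o + n) (hne : f r ≠ f r')
    (hg : ∀ y, o ≤ y → y < o + n → g y = mergeLabels f r r' y) :
    IsContraction (shiftLabel n o f) (shiftLabel n o g) := by
  have e1 : o + (r - o) = r := by omega
  have e2 : o + (r' - o) = r' := by omega
  refine isContraction_ofLabel (x := ⟨r - o, by omega⟩) (y := ⟨r' - o, by omega⟩) ?_ ?_
  · simp only [e1, e2]; exact hne
  · intro a b
    simp only [e1, e2]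
    rw [hg _ (by omega) (by omega), hg _ (by omega) (by omega), mergeLabels_eq_iff]

theorem shiftLabel_congr {f g : ℕ → ℕ} {n o : ℕ} (h : ∀ x, o ≤ x → x < o + n → f x = g x) :
    shiftLabel n o f = shiftLabel n o g := by
  refine ofLabel_congr fun x y => ?_
  rw [h _ (by omega) (by omega), h _ (by omega) (by omega)]

end

/-- Labellings of rows and columns together give a contraction sequence. -/
theorem IsChain.isSequence_disjoint {n m : ℕ} {α : Type*} [DecidableEq α] {M : ℕ → ℕ → ℕ}
    {A : Fin n → Fin m → α} (hn : 1 ≤ n) (hm : 1 ≤ m) (hA : Embeds (n + m) M A 0 n)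
    (hA' : Embeds (n + m) M (fun j i => A i j) n 0) {F E T : ℕ} (hF : 1 ≤ F) {Q : ℕ → ℕ → ℕ}
    (hQ : IsChain (n + m) n M F E T Q)
    (hend : ∀ x < n + m, ∀ y < n + m, (x < n ↔ y < n) → Q T x = Q T y) :
    T = lastIndex (Fin n) (Fin m) ∧
    IsSequence A (F - 1) (E * F) fun t => ⟨shiftLabel n 0 (Q t), shiftLabel m n (Q t)⟩ := by
  have hT : T = n + m - 2 := by
    have h1 := hQ.card_image T le_rfl
    have : (Finset.range (n + m)).image (Q T) = {Q T 0, Q T n} := by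
      ext v
      simp only [Finset.mem_image, Finset.mem_range, Finset.mem_insert, Finset.mem_singleton]
      constructor
      · rintro ⟨x, hx, rfl⟩
        by_cases h : x < n
        · exact .inl (hend _ hx _ (by omega) (by omega))
        · exact .inr (hend _ hx _ (by omega) (by omega))
      · rintro (rfl | rfl)
        · exact ⟨0, by omega, rfl⟩
        · exact ⟨n, by omega, rfl⟩
    rw [this, Finset.card_pair] at h1
    · omega
    · intro he
      have := hQ.side le_rfl (x := 0) (y := n) (by omega) (by omega) he
      omega
  have hlast : T = lastIndex (Fin n) (Fin m) := by simp [lastIndex, hT]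
  have hb : ∀ t ≤ T, IsOverlapping (F - 1) (shiftLabel n 0 (Q t)) ∧
      IsOverlapping (F - 1) (shiftLabel m n (Q t)) ∧
      ErrorAtMost A (E * F) ⟨shiftLabel n 0 (Q t), shiftLabel m n (Q t)⟩ := fun t ht => by
    obtain ⟨dl, τ, hg⟩ := hQ.exists_good hF ht
    exact bounds_of_good hA hA' hF hg hg
  have : Nonempty (Fin n) := ⟨⟨0, hn⟩⟩
  have : Nonempty (Fin m) := ⟨⟨0, hm⟩⟩
  refine ⟨hlast, ⟨?_, ?_, ?_, ?_, ?_⟩, fun t ht => ?_, fun t ht => ?_, fun t ht => ?_⟩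
  · intro X hX
    refine card_of_mem_ofLabel ?_ hX
    intro i j e
    have := hQ.start _ (by omega) _ (by omega) e
    exact Fin.ext (by omega)
  · intro X hX
    refine card_of_mem_ofLabel ?_ hX
    intro i j e
    have := hQ.start _ (by omega) _ (by omega) e
    exact Fin.ext (by omega)
  · intro t ht
    obtain ⟨r, hr, r', hr', hne, hm', dl, hg, hd⟩ := hQ.step t (by omega)
    have hs : r < n ↔ r' < n := by
      refine hQ.side (t := t + 1) (by omega) hr hr' ?_
      rw [hm' r hr, hm' r' hr', mergeLabels_eq_iff]
      exact .inr ⟨.inl rfl, .inr rfl⟩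
    by_cases h : r < n
    · refine .inl ⟨isContraction_shiftLabel (r := r) (r' := r') (by omega) (by omega) hne
        fun y _ _ => hm' y (by omega), ?_⟩
      refine shiftLabel_congr fun x hx hx' => ?_
      rw [hm' x (by omega), mergeLabels, if_neg]
      intro he
      have := hQ.side (t := t) (by omega) (by omega) hr he
      omega
    · refine .inr ⟨isContraction_shiftLabel (r := r) (r' := r') (by omega) (by omega) hne
        fun y _ _ => hm' y (by omega), ?_⟩
      refine shiftLabel_congr fun x hx hx' => ?_
      rw [hm' x (by omega), mergeLabels, if_neg]
      intro he
      have := hQ.side (t := t) (by omega) (by omega) hr he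
      omega
  · refine ofLabel_parts_eq_univ fun x y => ?_
    rw [← hlast]
    exact hend _ (by omega) _ (by omega) (by omega)
  · refine ofLabel_parts_eq_univ fun x y => ?_
    rw [← hlast]
    exact hend _ (by omega) _ (by omega) (by omega)
  · exact (hb t (by omega)).1
  · exact (hb t (by omega)).2.1
  · exact (hb t (by omega)).2.2

/-- Labellings of the elements of a symmetric matrix give a symmetric contraction sequence. -/
theorem IsChain.isSequence_symmetric {n : ℕ} {α : Type*} [DecidableEq α] {M : ℕ → ℕ → ℕ}
    {A : Fin n → Fin n → α} (hn : 1 ≤ n) (hA : Embeds n M A 0 0)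
    (hA' : Embeds n M (fun j i => A i j) 0 0) {F E T : ℕ} (hF : 1 ≤ F) {Q : ℕ → ℕ → ℕ}
    (hQ : IsChain n 0 M F E T Q) (hend : ∀ x < n, ∀ y < n, Q T x = Q T y) :
    2 * T = lastIndex (Fin n) (Fin n) ∧
    IsSequence A (F - 1) (E * F)
      (fun t => ⟨shiftLabel n 0 (Q ((t + 1) / 2)), shiftLabel n 0 (Q (t / 2))⟩) ∧
    IsSymmetricSequence (V := Fin n)
      (fun t => ⟨shiftLabel n 0 (Q ((t + 1) / 2)), shiftLabel n 0 (Q (t / 2))⟩) := by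
  have hT : T = n - 1 := by
    have h1 := hQ.card_image T le_rfl
    have : (Finset.range n).image (Q T) = {Q T 0} := by
      ext v
      simp only [Finset.mem_image, Finset.mem_range, Finset.mem_singleton]
      constructor
      · rintro ⟨x, hx, rfl⟩
        exact hend _ hx _ (by omega)
      · rintro rfl
        exact ⟨0, by omega, rfl⟩
    rw [this, Finset.card_singleton] at h1
    omega
  have hlast : 2 * T = lastIndex (Fin n) (Fin n) := by simp [lastIndex, hT]; omega
  have hb : ∀ t ≤ 2 * T, IsOverlapping (F - 1) (shiftLabel n 0 (Q ((t + 1) / 2))) ∧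
      IsOverlapping (F - 1) (shiftLabel n 0 (Q (t / 2))) ∧
      ErrorAtMost A (E * F) ⟨shiftLabel n 0 (Q ((t + 1) / 2)), shiftLabel n 0 (Q (t / 2))⟩ := by
    intro t ht
    rcases Nat.even_or_odd' t with ⟨s, rfl | rfl⟩
    · have e : (2 * s + 1) / 2 = 2 * s / 2 := by omega
      rw [e]
      obtain ⟨dl, τ, hg⟩ := hQ.exists_good hF (t := 2 * s / 2) (by omega)
      exact bounds_of_good hA hA' hF hg hg
    -- Halfway through a step the rows carry `Q (s + 1)` and the columns still `Q s`. Both refine `Q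
    -- (s + 1)`, for which the errors are bounded.
    · have e : (2 * s + 1 + 1) / 2 = s + 1 := by omega
      have e' : (2 * s + 1) / 2 = s := by omega
      rw [e, e']
      obtain ⟨_, _, _, _, _, _, dl, hg, _⟩ := hQ.step s (by omega)
      exact bounds_of_good hA hA' hF (hg.coarser hg.refine fun _ _ _ _ h => h) hg
  have : Nonempty (Fin n) := ⟨⟨0, hn⟩⟩
  have hinj : ∀ X ∈ (shiftLabel n 0 (Q 0)).parts, X.card = 1 := by
    intro X hX
    refine card_of_mem_ofLabel ?_ hX
    intro i j e
    have := hQ.start _ (by omega) _ (by omega) e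
    exact Fin.ext (by omega)
  have hone : (shiftLabel n 0 (Q T)).parts = {Finset.univ} :=
    ofLabel_parts_eq_univ fun x y => hend _ (by omega) _ (by omega)
  have hstep : ∀ s < T, IsContraction (shiftLabel n 0 (Q s)) (shiftLabel n 0 (Q (s + 1))) := by
    intro s hs
    obtain ⟨r, hr, r', hr', hne, hm', _⟩ := hQ.step s hs
    exact isContraction_shiftLabel (r := r) (r' := r') (by omega) (by omega) hne
        fun y _ _ => hm' y (by omega)
  refine ⟨hlast, ⟨⟨hinj, hinj, ?_, ?_, ?_⟩, fun t ht => ?_, fun t ht => ?_, fun t ht => ?_⟩, ?_⟩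
  · intro t ht
    rcases Nat.even_or_odd' t with ⟨s, rfl | rfl⟩
    · refine .inl ⟨?_, ?_⟩
      · have e1 : (2 * s + 1) / 2 = s := by omega
        have e2 : (2 * s + 1 + 1) / 2 = s + 1 := by omega
        simp only [e1, e2]
        exact hstep s (by omega)
      · have e1 : (2 * s + 1) / 2 = 2 * s / 2 := by omega
        simp only [e1]
    · refine .inr ⟨?_, ?_⟩
      · have e1 : (2 * s + 1) / 2 = s := by omega
        have e2 : (2 * s + 1 + 1) / 2 = s + 1 := by omega
        simp only [e1, e2]
        exact hstep s (by omega)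
      · have e1 : (2 * s + 1 + 1 + 1) / 2 = (2 * s + 1 + 1) / 2 := by omega
        simp only [e1]
  · rw [← hlast]
    have e1 : (2 * T + 1) / 2 = T := by omega
    simp only [e1]
    exact hone
  · rw [← hlast]
    have e1 : 2 * T / 2 = T := by omega
    simp only [e1]
    exact hone
  · exact (hb t (by omega)).1
  · exact (hb t (by omega)).2.1
  · exact (hb t (by omega)).2.2
  · intro t _
    have e1 : (2 * t + 1) / 2 = 2 * t / 2 := by omega
    simp only [e1]

end TwinWidth

namespace TwinWidth

/-! ### A language with bounded loops

Terms extend the expressions of the machine by case distinction and by bounded sums, commands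
have only loops whose number of iterations is fixed at their start. Both have a functional
semantics, and a command runs in time polynomial in the bounds of its loops. -/

/-- Terms; `sum x v t` is the sum of `t` over all values of `x` below the variable `v`. -/
inductive Term where
  | lit (v : ℕ)
  | var (x : ℕ)
  | get (a : ℕ) (t : Term)
  | add (t₁ t₂ : Term)
  | sub (t₁ t₂ : Term)
  | lt (t₁ t₂ : Term)
  | eq (t₁ t₂ : Term)
  | ite (t t₁ t₂ : Term)
  | sum (x v : ℕ) (t : Term)

namespace Term

/-- The value of a term. -/
def eval : Term → State → ℕ
  | lit v, _ => v
  | var x, s => s.var x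
  | get a t, s => s.arr a (t.eval s)
  | add t₁ t₂, s => t₁.eval s + t₂.eval s
  | sub t₁ t₂, s => t₁.eval s - t₂.eval s
  | lt t₁ t₂, s => if t₁.eval s < t₂.eval s then 1 else 0
  | eq t₁ t₂, s => if t₁.eval s = t₂.eval s then 1 else 0
  | ite t t₁ t₂, s => if t.eval s ≠ 0 then t₁.eval s else t₂.eval s
  | sum x v t, s => ∑ i ∈ Finset.range (s.var v), t.eval (s.setVar x i)

/-- All variables are below `d`. -/
def varsBelow (d : ℕ) : Term → Bool
  | lit _ => true
  | var x => decide (x < d)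
  | get _ t => t.varsBelow d
  | add t₁ t₂ => t₁.varsBelow d && t₂.varsBelow d
  | sub t₁ t₂ => t₁.varsBelow d && t₂.varsBelow d
  | lt t₁ t₂ => t₁.varsBelow d && t₂.varsBelow d
  | eq t₁ t₂ => t₁.varsBelow d && t₂.varsBelow d
  | ite t t₁ t₂ => t.varsBelow d && (t₁.varsBelow d && t₂.varsBelow d)
  | sum x v t => decide (x < d) && (decide (v < d) && t.varsBelow d)

/-- All sums are bounded by a variable in the list `V`, and none of these variables is bound. -/
def static (V : List ℕ) : Term → Bool
  | lit _ => true
  | var _ => true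
  | get _ t => t.static V
  | add t₁ t₂ => t₁.static V && t₂.static V
  | sub t₁ t₂ => t₁.static V && t₂.static V
  | lt t₁ t₂ => t₁.static V && t₂.static V
  | eq t₁ t₂ => t₁.static V && t₂.static V
  | ite t t₁ t₂ => t.static V && (t₁.static V && t₂.static V)
  | sum x v t => V.contains v && (!(V.contains x) && t.static V)

/-- A bound on the number of steps, if all sums have at most `B` summands. -/
def time (B : ℕ) : Term → ℕ
  | lit _ => 2
  | var _ => 2
  | get _ t => t.time B + 3
  | add t₁ t₂ => t₁.time B + t₂.time B + 4
  | sub t₁ t₂ => t₁.time B + t₂.time B + 4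
  | lt t₁ t₂ => t₁.time B + t₂.time B + 4
  | eq t₁ t₂ => t₁.time B + t₂.time B + 4
  | ite t t₁ t₂ => t.time B + t₁.time B + t₂.time B + 2
  | sum _ _ t => B * (t.time B + 12) + 14

/-- The program that writes the value of a term into the variable `d` and uses only the
variables from `d` on. -/
def compile : Term → ℕ → Program
  | lit v, d => .assign d (.lit v)
  | var x, d => .assign d (.var x)
  | get a t, d => .seq (t.compile d) (.assign d (.get a (.var d)))
  | add t₁ t₂, d => .seq (t₁.compile d) (.seq (t₂.compile (d + 1))
      (.assign d (.add (.var d) (.var (d + 1)))))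
  | sub t₁ t₂, d => .seq (t₁.compile d) (.seq (t₂.compile (d + 1))
      (.assign d (.sub (.var d) (.var (d + 1)))))
  | lt t₁ t₂, d => .seq (t₁.compile d) (.seq (t₂.compile (d + 1))
      (.assign d (.lt (.var d) (.var (d + 1)))))
  | eq t₁ t₂, d => .seq (t₁.compile d) (.seq (t₂.compile (d + 1))
      (.assign d (.eq (.var d) (.var (d + 1)))))
  | ite t t₁ t₂, d => .seq (t.compile d) (.branch (.var d) (t₁.compile d) (t₂.compile d))
  | sum x v t, d =>
      .seq (.assign (d + 1) (.var x)) (.seq (.assign (d + 2) (.var v)) (.seq (.assign x (.lit 0))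
        (.seq (.assign d (.lit 0)) (.seq
          (.loop (.lt (.var x) (.var (d + 2))) (.seq (t.compile (d + 3))
            (.seq (.assign d (.add (.var d) (.var (d + 3)))) (.assign x (.add (.var x) (.lit 1))))))
          (.assign x (.var (d + 1)))))))

end Term

/-- Two states agree on all variables below `d` and on all arrays. -/
def AgreeBelow (d : ℕ) (s s' : State) : Prop := (∀ y < d, s.var y = s'.var y) ∧ s.arr = s'.arr

theorem AgreeBelow.refl (d : ℕ) (s : State) : AgreeBelow d s s := ⟨fun _ _ => rfl, rfl⟩

theorem AgreeBelow.trans {d : ℕ} {s s' s'' : State} (h : AgreeBelow d s s')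
    (h' : AgreeBelow d s' s'') : AgreeBelow d s s'' :=
  ⟨fun y hy => (h.1 y hy).trans (h'.1 y hy), h.2.trans h'.2⟩

theorem AgreeBelow.mono {d d' : ℕ} {s s' : State} (h : AgreeBelow d s s') (hd : d' ≤ d) :
    AgreeBelow d' s s' := ⟨fun y hy => h.1 y (by omega), h.2⟩

@[simp] theorem setVar_var_self (s : State) (x v : ℕ) : (s.setVar x v).var x = v := by
  simp [State.setVar]

theorem setVar_var_ne {x y : ℕ} (s : State) (v : ℕ) (h : y ≠ x) :
    (s.setVar x v).var y = s.var y := by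
  simp [State.setVar, h]

theorem setVar_var (s : State) (x v y : ℕ) :
    (s.setVar x v).var y = if y = x then v else s.var y := by
  simp [State.setVar, Function.update_apply]

@[simp] theorem setVar_arr (s : State) (x v : ℕ) : (s.setVar x v).arr = s.arr := rfl

@[simp] theorem setArr_var (s : State) (a i v : ℕ) : (s.setArr a i v).var = s.var := rfl

theorem setArr_arr (s : State) (a i v a' j : ℕ) :
    (s.setArr a i v).arr a' j = if a' = a ∧ j = i then v else s.arr a' j := by
  simp only [State.setArr, Function.update_apply]
  by_cases h : a' = a
  · subst h
    by_cases h' : j = i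
    · simp [h']
    · simp [h']
  · simp [h]

theorem AgreeBelow.setVar {d : ℕ} {s s' : State} (h : AgreeBelow d s s') (x v : ℕ) :
    AgreeBelow d (s.setVar x v) (s'.setVar x v) := by
  refine ⟨fun y hy => ?_, h.2⟩
  rw [setVar_var, setVar_var, h.1 y hy]

theorem AgreeBelow.setVar_left {d : ℕ} {s s' : State} (h : AgreeBelow d s s') {x : ℕ} (hx : d ≤ x)
    (v : ℕ) : AgreeBelow d (s.setVar x v) s' := by
  refine ⟨fun y hy => ?_, h.2⟩
  rw [setVar_var, if_neg (by omega), h.1 y hy]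

namespace Term

/-- Compiled code keeps its intermediate values in variables from `d` on; a term whose variables are
below `d` does not notice them. -/
theorem eval_congr {d : ℕ} {t : Term} (ht : t.varsBelow d = true) {s s' : State}
    (h : AgreeBelow d s s') : t.eval s = t.eval s' := by
  induction t generalizing s s' with
  | lit v => rfl
  | var x => exact h.1 x (by simpa [varsBelow] using ht)
  | get a t ih => simp only [eval, ih ht h, h.2]
  | add t₁ t₂ ih₁ ih₂ | sub t₁ t₂ ih₁ ih₂ | lt t₁ t₂ ih₁ ih₂ | eq t₁ t₂ ih₁ ih₂ =>
    simp only [varsBelow, Bool.and_eq_true] at ht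
    simp only [eval, ih₁ ht.1 h, ih₂ ht.2 h]
  | ite t t₁ t₂ ih ih₁ ih₂ =>
    simp only [varsBelow, Bool.and_eq_true] at ht
    simp only [eval, ih ht.1 h, ih₁ ht.2.1 h, ih₂ ht.2.2 h]
  | sum x v t ih =>
    simp only [varsBelow, Bool.and_eq_true, decide_eq_true_eq] at ht
    simp only [eval, h.1 v ht.2.1]
    exact Finset.sum_congr rfl fun i _ => ih ht.2.2 (h.setVar x i)

theorem varsBelow_mono {d d' : ℕ} (hd : d ≤ d') {t : Term} (ht : t.varsBelow d = true) :
    t.varsBelow d' = true := by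
  induction t with
  | lit v => rfl
  | var x => simp only [varsBelow, decide_eq_true_eq] at *; omega
  | get a t ih => exact ih ht
  | add t₁ t₂ ih₁ ih₂ | sub t₁ t₂ ih₁ ih₂ | lt t₁ t₂ ih₁ ih₂ | eq t₁ t₂ ih₁ ih₂ =>
    simp only [varsBelow, Bool.and_eq_true] at *
    exact ⟨ih₁ ht.1, ih₂ ht.2⟩
  | ite t t₁ t₂ ih ih₁ ih₂ =>
    simp only [varsBelow, Bool.and_eq_true] at *
    exact ⟨ih ht.1, ih₁ ht.2.1, ih₂ ht.2.2⟩
  | sum x v t ih =>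
    simp only [varsBelow, Bool.and_eq_true, decide_eq_true_eq] at *
    exact ⟨by omega, by omega, ih ht.2.2⟩

/-- The second operand only uses variables from `d + 1` on, so the value of the first one survives
in `d`. The final assignment costs the `4` additional steps. -/
theorem compile_runs_binary {d T₁ T₂ v₁ v₂ : ℕ} {p₁ p₂ : Program} {s : State} {f : ℕ → ℕ → ℕ}
    {e : Expr} (he : e.cost = 3) (hf : ∀ s : State, e.eval s = f (s.var d) (s.var (d + 1)))
    (h₁ : ∃ s' k, p₁.Runs s s' k ∧ k ≤ T₁ ∧ s'.var d = v₁ ∧ AgreeBelow d s' s)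
    (h₂ : ∀ s₁, AgreeBelow d s₁ s →
      ∃ s' k, p₂.Runs s₁ s' k ∧ k ≤ T₂ ∧ s'.var (d + 1) = v₂ ∧ AgreeBelow (d + 1) s' s₁) :
    ∃ s' k, (Program.seq p₁ (.seq p₂ (.assign d e))).Runs s s' k ∧ k ≤ T₁ + T₂ + 4 ∧
      s'.var d = f v₁ v₂ ∧ AgreeBelow d s' s := by
  obtain ⟨s₁, k₁, r₁, t₁, e₁, a₁⟩ := h₁
  obtain ⟨s₂, k₂, r₂, t₂, e₂, a₂⟩ := h₂ s₁ a₁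
  refine ⟨_, _, .seq r₁ (.seq r₂ (.assign d e s₂)), by omega, ?_, ?_⟩
  · rw [setVar_var_self, hf, e₂, a₂.1 d (by omega), e₁]
  · exact ((a₂.mono (by omega)).trans a₁).setVar_left le_rfl _

/-- The invariant: `d` holds the partial sum, `d + 1` the saved value of `x`, `d + 2` the bound, and
`x` itself is the counter. The induction is over the number of remaining rounds. -/
theorem compile_sum_loop {d x T b v : ℕ} {t : Term} {s : State} (hx : x < d)
    (ht : t.varsBelow d = true)
    (ih : ∀ i < b, ∀ s₁, AgreeBelow d s₁ (s.setVar x i) → ∃ s' k,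
      (t.compile (d + 3)).Runs s₁ s' k ∧ k ≤ T ∧ s'.var (d + 3) = t.eval s₁ ∧
        AgreeBelow (d + 3) s' s₁) (rem : ℕ) :
    ∀ i acc s₁, i + rem = b → s₁.var d = acc → s₁.var (d + 1) = v → s₁.var (d + 2) = b →
      AgreeBelow d s₁ (s.setVar x i) → ∃ s' k,
      (Program.loop (.lt (.var x) (.var (d + 2))) (.seq (t.compile (d + 3))
        (.seq (.assign d (.add (.var d) (.var (d + 3))))
          (.assign x (.add (.var x) (.lit 1)))))).Runs s₁ s' k ∧
      k ≤ rem * (T + 12) + 4 ∧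
      s'.var d = acc + ∑ j ∈ Finset.Ico i b, t.eval (s.setVar x j) ∧ s'.var (d + 1) = v ∧
      AgreeBelow d s' (s.setVar x b) := by
  induction rem with
  | zero =>
    intro i acc s₁ hi h0 h1 h2 ha
    have hxi : s₁.var x = i := by rw [ha.1 x hx, setVar_var_self]
    refine ⟨s₁, _, .loop_done ?_, by simp [Expr.cost], ?_, h1, ?_⟩
    · simp only [Expr.eval, hxi, h2]; rw [if_neg (by omega)]
    · rw [h0, Finset.Ico_eq_empty (by omega)]; simp
    · rw [show b = i by omega]; exact ha
  | succ rem ihr =>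
    intro i acc s₁ hi h0 h1 h2 ha
    have hxi : s₁.var x = i := by rw [ha.1 x hx, setVar_var_self]
    obtain ⟨s₂, k₂, r₂, t₂, e₂, a₂⟩ := ih i (by omega) s₁ ha
    let s₃ := s₂.setVar d (Expr.eval s₂ (.add (.var d) (.var (d + 3))))
    let s₄ := s₃.setVar x (Expr.eval s₃ (.add (.var x) (.lit 1)))
    have hx₄ : Expr.eval s₃ (.add (.var x) (.lit 1)) = i + 1 := by
      simp only [Expr.eval, s₃]
      rw [setVar_var_ne _ _ (by omega), a₂.1 x (by omega), hxi]
    have hd₃ : Expr.eval s₂ (.add (.var d) (.var (d + 3))) = acc + t.eval (s.setVar x i) := by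
      simp only [Expr.eval]
      rw [a₂.1 d (by omega), h0, e₂, eval_congr ht ha]
    obtain ⟨s', k', r', t', e', f', a'⟩ := ihr (i + 1) (acc + t.eval (s.setVar x i)) s₄ (by omega)
      (by simp only [s₄, s₃]; rw [setVar_var_ne _ _ (by omega), setVar_var_self, hd₃])
      (by simp only [s₄, s₃]; rw [setVar_var_ne _ _ (by omega), setVar_var_ne _ _ (by omega),
            a₂.1 _ (by omega), h1])
      (by simp only [s₄, s₃]; rw [setVar_var_ne _ _ (by omega), setVar_var_ne _ _ (by omega),
            a₂.1 _ (by omega), h2])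
      (by
        refine ⟨fun y hy => ?_, ?_⟩
        · simp only [s₄, hx₄, setVar_var]
          split_ifs with hyx
          · rfl
          · simp only [s₃]
            rw [setVar_var_ne _ _ (by omega), a₂.1 _ (by omega), ha.1 y hy, setVar_var_ne _ _ hyx]
        · simp only [s₄, s₃, setVar_arr]
          rw [a₂.2, ha.2, setVar_arr])
    refine ⟨s', _, .loop_step ?_ (.seq r₂ (.seq (.assign _ _ _) (.assign _ _ _))) r', ?_, ?_, f', a'⟩
    · simp only [Expr.eval, hxi, h2]; rw [if_pos (by omega)]; exact one_ne_zero
    · simp only [Expr.cost]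
      have : (rem + 1) * (T + 12) = rem * (T + 12) + (T + 12) := by ring
      omega
    · rw [e', Finset.sum_eq_sum_Ico_succ_bot (by omega : i < b), add_assoc]

/-- The compiled program computes the value of the term. -/
theorem compile_runs {V : List ℕ} {B : ℕ} (t : Term) :
    ∀ (d : ℕ) (s : State), t.varsBelow d = true → t.static V = true →
      (∀ v ∈ V, v < d ∧ s.var v ≤ B) →
      ∃ s' k, (t.compile d).Runs s s' k ∧ k ≤ t.time B ∧ s'.var d = t.eval s ∧
        AgreeBelow d s' s := by
  have tr : ∀ {d d' : ℕ} {s s' : State}, (∀ v ∈ V, v < d ∧ s.var v ≤ B) → AgreeBelow d s' s →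
      d ≤ d' → ∀ v ∈ V, v < d' ∧ s'.var v ≤ B := by
    intro d d' s s' h ha hd v hv
    rw [ha.1 v (h v hv).1]
    exact ⟨by have := (h v hv).1; omega, (h v hv).2⟩
  induction t with
  | lit v =>
    intro d s _ _ _
    exact ⟨_, _, .assign _ _ _, le_rfl, by simp [eval, Expr.eval],
      (AgreeBelow.refl d s).setVar_left le_rfl _⟩
  | var x =>
    intro d s _ _ _
    exact ⟨_, _, .assign _ _ _, le_rfl, by simp [eval, Expr.eval],
      (AgreeBelow.refl d s).setVar_left le_rfl _⟩
  | get a t ih =>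
    intro d s hb hs hB
    obtain ⟨s₁, k₁, r₁, t₁, e₁, a₁⟩ := ih d s hb hs hB
    refine ⟨_, _, .seq r₁ (.assign _ _ _), by simp only [Expr.cost, time]; omega, ?_,
      a₁.setVar_left le_rfl _⟩
    simp only [setVar_var_self, Expr.eval, eval, e₁, a₁.2]
  | add t₁ t₂ ih₁ ih₂ | sub t₁ t₂ ih₁ ih₂ | lt t₁ t₂ ih₁ ih₂ | eq t₁ t₂ ih₁ ih₂ =>
    intro d s hb hs hB
    simp only [varsBelow, Bool.and_eq_true] at hb
    simp only [static, Bool.and_eq_true] at hs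
    have h₁ := ih₁ d s hb.1 hs.1 hB
    have h₂ : ∀ s₁, AgreeBelow d s₁ s → ∃ s' k, (t₂.compile (d + 1)).Runs s₁ s' k ∧
        k ≤ t₂.time B ∧ s'.var (d + 1) = t₂.eval s ∧ AgreeBelow (d + 1) s' s₁ := by
      intro s₁ ha
      rw [← eval_congr hb.2 ha]
      exact ih₂ (d + 1) s₁ (varsBelow_mono (by omega) hb.2) hs.2 (tr hB ha (by omega))
    first
      | exact compile_runs_binary (f := fun a b => a + b) rfl (fun _ => rfl) h₁ h₂
      | exact compile_runs_binary (f := fun a b => a - b) rfl (fun _ => rfl) h₁ h₂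
      | exact compile_runs_binary (f := fun a b => if a < b then 1 else 0) rfl (fun _ => rfl) h₁ h₂
      | exact compile_runs_binary (f := fun a b => if a = b then 1 else 0) rfl (fun _ => rfl) h₁ h₂
  | ite t t₁ t₂ ih ih₁ ih₂ =>
    intro d s hb hs hB
    simp only [varsBelow, Bool.and_eq_true] at hb
    simp only [static, Bool.and_eq_true] at hs
    obtain ⟨s₁, k₁, r₁, l₁, e₁, a₁⟩ := ih d s hb.1 hs.1 hB
    by_cases h : t.eval s = 0
    · obtain ⟨s₂, k₂, r₂, l₂, e₂, a₂⟩ := ih₂ d s₁ hb.2.2 hs.2.2 (tr hB a₁ le_rfl)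
      refine ⟨s₂, _, .seq r₁ (.branch_false (by simp [Expr.eval, e₁, h]) r₂),
        by simp only [Expr.cost, time]; omega, ?_, a₂.trans a₁⟩
      rw [e₂, eval_congr hb.2.2 a₁, eval, if_neg (by simp [h])]
    · obtain ⟨s₂, k₂, r₂, l₂, e₂, a₂⟩ := ih₁ d s₁ hb.2.1 hs.2.1 (tr hB a₁ le_rfl)
      refine ⟨s₂, _, .seq r₁ (.branch_true (by simp [Expr.eval, e₁, h]) r₂),
        by simp only [Expr.cost, time]; omega, ?_, a₂.trans a₁⟩
      rw [e₂, eval_congr hb.2.1 a₁, eval, if_pos h]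
  | sum x v t ih =>
    intro d s hb hs hB
    simp only [varsBelow, Bool.and_eq_true, decide_eq_true_eq] at hb
    simp only [static, Bool.and_eq_true, Bool.not_eq_true', List.contains_iff_mem] at hs
    obtain ⟨hx, hv, hb⟩ := hb
    obtain ⟨hvV, hxV, hs⟩ := hs
    have hxV : x ∉ V := by simpa using hxV
    have hloop := compile_sum_loop (d := d) (x := x) (T := t.time B) (b := s.var v)
      (v := s.var x) (t := t) (s := s) hx hb (fun i _ s₁ ha => by
        refine ih (d + 3) s₁ (varsBelow_mono (by omega) hb) hs fun w hw => ?_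
        have hwd := (hB w hw).1
        refine ⟨by omega, ?_⟩
        have hwx : w ≠ x := fun h => hxV (h ▸ hw)
        rw [ha.1 w hwd, setVar_var_ne _ _ hwx]
        exact (hB w hw).2) (s.var v) 0 0
    let s₁ := s.setVar (d + 1) (Expr.eval s (.var x))
    let s₂ := s₁.setVar (d + 2) (Expr.eval s₁ (.var v))
    let s₃ := s₂.setVar x (Expr.eval s₂ (.lit 0))
    let s₄ := s₃.setVar d (Expr.eval s₃ (.lit 0))
    obtain ⟨s₅, k, r, l, e, f, a⟩ := hloop s₄ (by omega) (by simp [s₄, Expr.eval])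
      (by simp only [s₄, s₃, s₂, s₁]
          rw [setVar_var_ne _ _ (by omega), setVar_var_ne _ _ (by omega),
            setVar_var_ne _ _ (by omega), setVar_var_self, Expr.eval])
      (by simp only [s₄, s₃, s₂, s₁]
          rw [setVar_var_ne _ _ (by omega), setVar_var_ne _ _ (by omega), setVar_var_self,
            Expr.eval, setVar_var_ne _ _ (by omega)])
      (by
        refine ⟨fun y hy => ?_, rfl⟩
        simp only [s₄, s₃, s₂, s₁]
        rw [setVar_var_ne _ _ (by omega), setVar_var, setVar_var _ x 0]
        split_ifs
        · rfl
        · rw [setVar_var_ne _ _ (by omega), setVar_var_ne _ _ (by omega)])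
    refine ⟨_, _, .seq (.assign _ _ _) (.seq (.assign _ _ _) (.seq (.assign _ _ _)
      (.seq (.assign _ _ _) (.seq r (.assign _ _ _))))), ?_, ?_, ?_⟩
    · simp only [Expr.cost, time]
      have := Nat.mul_le_mul_right (t.time B + 12) (hB v hvV).2
      omega
    · rw [setVar_var_ne _ _ (by omega), e, eval, ← Finset.range_eq_Ico, zero_add]
    · refine ⟨fun y hy => ?_, ?_⟩
      · simp only [Expr.eval, f, setVar_var]
        split_ifs with h
        · rw [h]
        · rw [a.1 y hy, setVar_var_ne _ _ h]
      · simp only [setVar_arr]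
        rw [a.2, setVar_arr]

/-- The same number serves as coefficient and as exponent, which keeps the induction uniform. A
bounded sum multiplies the time by its bound and thus raises the degree by one. -/
theorem exists_time_le (t : Term) : ∃ κ, ∀ B, t.time B ≤ κ * (B + 1) ^ κ := by
  have one : ∀ {a B : ℕ}, 1 ≤ (B + 1) ^ a := Nat.one_le_pow _ _ (by omega)
  induction t with
  | lit v => exact ⟨2, fun B => by have := one (a := 2) (B := B); simp only [time]; omega⟩
  | var v => exact ⟨2, fun B => by have := one (a := 2) (B := B); simp only [time]; omega⟩
  | get a t ih =>
    obtain ⟨κ, h⟩ := ih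
    refine ⟨κ + 3, fun B => ?_⟩
    have h1 := one (a := κ + 3) (B := B)
    have h2 := (h B).trans (Nat.mul_le_mul_left κ (Nat.pow_le_pow_right (Nat.succ_pos B)
      (by omega : κ ≤ κ + 3)))
    simp only [time, Nat.succ_eq_add_one] at *
    nlinarith
  | add t₁ t₂ ih₁ ih₂ | sub t₁ t₂ ih₁ ih₂ | lt t₁ t₂ ih₁ ih₂ | eq t₁ t₂ ih₁ ih₂ =>
    obtain ⟨κ₁, h₁⟩ := ih₁
    obtain ⟨κ₂, h₂⟩ := ih₂
    refine ⟨κ₁ + κ₂ + 4, fun B => ?_⟩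
    have h0 := one (a := κ₁ + κ₂ + 4) (B := B)
    have h1 := (h₁ B).trans (Nat.mul_le_mul_left κ₁ (Nat.pow_le_pow_right (Nat.succ_pos B)
      (by omega : κ₁ ≤ κ₁ + κ₂ + 4)))
    have h2 := (h₂ B).trans (Nat.mul_le_mul_left κ₂ (Nat.pow_le_pow_right (Nat.succ_pos B)
      (by omega : κ₂ ≤ κ₁ + κ₂ + 4)))
    simp only [time, Nat.succ_eq_add_one] at *
    nlinarith
  | ite t t₁ t₂ ih ih₁ ih₂ =>
    obtain ⟨κ, h⟩ := ih
    obtain ⟨κ₁, h₁⟩ := ih₁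
    obtain ⟨κ₂, h₂⟩ := ih₂
    refine ⟨κ + κ₁ + κ₂ + 2, fun B => ?_⟩
    have h0 := one (a := κ + κ₁ + κ₂ + 2) (B := B)
    have h' := (h B).trans (Nat.mul_le_mul_left κ (Nat.pow_le_pow_right (Nat.succ_pos B)
      (by omega : κ ≤ κ + κ₁ + κ₂ + 2)))
    have h1 := (h₁ B).trans (Nat.mul_le_mul_left κ₁ (Nat.pow_le_pow_right (Nat.succ_pos B)
      (by omega : κ₁ ≤ κ + κ₁ + κ₂ + 2)))
    have h2 := (h₂ B).trans (Nat.mul_le_mul_left κ₂ (Nat.pow_le_pow_right (Nat.succ_pos B)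
      (by omega : κ₂ ≤ κ + κ₁ + κ₂ + 2)))
    simp only [time, Nat.succ_eq_add_one] at *
    nlinarith
  | sum x v t ih =>
    obtain ⟨κ, h⟩ := ih
    -- `26 = 12 + 14` pays for the overhead of a round and of the whole sum; one further factor `B +
    -- 1` pays for the number of rounds.
    refine ⟨κ + 26, fun B => ?_⟩
    have h1 := (h B).trans (Nat.mul_le_mul_left κ (Nat.pow_le_pow_right (Nat.succ_pos B)
      (by omega : κ ≤ κ + 25)))
    have h0 := one (a := κ + 25) (B := B)
    simp only [time, Nat.succ_eq_add_one] at *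
    have h2 : B * (t.time B + 12) ≤ B * (κ * (B + 1) ^ (κ + 25) + 12 * (B + 1) ^ (κ + 25)) :=
      Nat.mul_le_mul_left _ (by omega)
    have h3 : (B + 1) ^ (κ + 26) = (B + 1) ^ (κ + 25) * (B + 1) := pow_succ _ _
    rw [h3]
    nlinarith

end Term

/-- Commands; `loop x v c` executes `c` for all values of `x` below the value that the variable `v`
has at the start. -/
inductive Cmd where
  | skip
  | assign (x : ℕ) (t : Term)
  | store (a : ℕ) (i t : Term)
  | seq (c₁ c₂ : Cmd)
  | ite (t : Term) (c₁ c₂ : Cmd)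
  | loop (x v : ℕ) (c : Cmd)

namespace Cmd

/-- Iterating a state transformation for all values of the variable `x` below `b`. -/
def iter (x : ℕ) (f : State → State) (s : State) : ℕ → State
  | 0 => s
  | i + 1 => f ((iter x f s i).setVar x i)

/-- The final state. -/
def exec : Cmd → State → State
  | skip, s => s
  | assign x t, s => s.setVar x (t.eval s)
  | store a i t, s => s.setArr a (i.eval s) (t.eval s)
  | seq c₁ c₂, s => c₂.exec (c₁.exec s)
  | ite t c₁ c₂, s => if t.eval s ≠ 0 then c₁.exec s else c₂.exec s
  | loop x v c, s => iter x c.exec s (s.var v)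

/-- All variables are below `d`. -/
def varsBelow (d : ℕ) : Cmd → Bool
  | skip => true
  | assign x t => decide (x < d) && t.varsBelow d
  | store _ i t => i.varsBelow d && t.varsBelow d
  | seq c₁ c₂ => c₁.varsBelow d && c₂.varsBelow d
  | ite t c₁ c₂ => t.varsBelow d && (c₁.varsBelow d && c₂.varsBelow d)
  | loop x v c => decide (x < d) && (decide (v < d) && c.varsBelow d)

/-- All loops and sums are bounded by a variable in the list `V`, and none of these variables is
changed. -/
def static (V : List ℕ) : Cmd → Bool
  | skip => true
  | assign x t => !(V.contains x) && t.static V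
  | store _ i t => i.static V && t.static V
  | seq c₁ c₂ => c₁.static V && c₂.static V
  | ite t c₁ c₂ => t.static V && (c₁.static V && c₂.static V)
  | loop x v c => V.contains v && (!(V.contains x) && c.static V)

/-- The variable `x` is never assigned. -/
def keepsVar (x : ℕ) : Cmd → Bool
  | skip => true
  | assign y _ => x != y
  | store _ _ _ => true
  | seq c₁ c₂ => c₁.keepsVar x && c₂.keepsVar x
  | ite _ c₁ c₂ => c₁.keepsVar x && c₂.keepsVar x
  | loop y _ c => x != y && c.keepsVar x

/-- The array `a` is never changed. -/
def keepsArr (a : ℕ) : Cmd → Bool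
  | skip => true
  | assign _ _ => true
  | store b _ _ => a != b
  | seq c₁ c₂ => c₁.keepsArr a && c₂.keepsArr a
  | ite _ c₁ c₂ => c₁.keepsArr a && c₂.keepsArr a
  | loop _ _ c => c.keepsArr a

/-- A bound on the number of steps, if all loops and sums have at most `B` rounds. -/
def time (B : ℕ) : Cmd → ℕ
  | skip => 1
  | assign _ t => t.time B + 2
  | store _ i t => i.time B + t.time B + 3
  | seq c₁ c₂ => c₁.time B + c₂.time B
  | ite t c₁ c₂ => t.time B + c₁.time B + c₂.time B + 2
  | loop _ _ c => B * (c.time B + 10) + 8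

/-- The program for a command, with auxiliary variables from `d` on. -/
def compile : Cmd → ℕ → Program
  | skip, _ => .skip
  | assign x t, d => .seq (t.compile d) (.assign x (.var d))
  | store a i t, d => .seq (i.compile d) (.seq (t.compile (d + 1))
      (.store a (.var d) (.var (d + 1))))
  | seq c₁ c₂, d => .seq (c₁.compile d) (c₂.compile d)
  | ite t c₁ c₂, d => .seq (t.compile d) (.branch (.var d) (c₁.compile d) (c₂.compile d))
  | loop x v c, d => .seq (.assign d (.var v)) (.seq (.assign (d + 1) (.lit 0))
      (.loop (.lt (.var (d + 1)) (.var d)) (.seq (.assign x (.var (d + 1)))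
        (.seq (c.compile (d + 2)) (.assign (d + 1) (.add (.var (d + 1)) (.lit 1)))))))

/-- Induction over the rounds of a loop. -/
theorem exec_loop_induction {x v : ℕ} {c : Cmd} {s : State} (P : ℕ → State → Prop) (h0 : P 0 s)
    (hs : ∀ i < s.var v, ∀ s', P i s' → P (i + 1) (c.exec (s'.setVar x i))) :
    P (s.var v) ((loop x v c).exec s) := by
  have : ∀ i ≤ s.var v, P i (iter x c.exec s i) := by
    intro i
    induction i with
    | zero => exact fun _ => h0
    | succ i ih => exact fun hi => hs i (by omega) _ (ih (by omega))
  exact this _ le_rfl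

theorem exec_var {x : ℕ} {c : Cmd} (hc : c.keepsVar x = true) (s : State) :
    (c.exec s).var x = s.var x := by
  induction c generalizing s with
  | skip => rfl
  | assign y t => exact setVar_var_ne _ _ (by simpa [keepsVar] using hc)
  | store a i t => rfl
  | seq c₁ c₂ ih₁ ih₂ =>
    simp only [keepsVar, Bool.and_eq_true] at hc
    simp only [exec, ih₁ hc.1, ih₂ hc.2]
  | ite t c₁ c₂ ih₁ ih₂ =>
    simp only [keepsVar, Bool.and_eq_true] at hc
    simp only [exec]
    split_ifs
    · exact ih₁ hc.1 s
    · exact ih₂ hc.2 s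
  | loop y v c ih =>
    simp only [keepsVar, Bool.and_eq_true, bne_iff_ne] at hc
    refine exec_loop_induction (fun _ s' => s'.var x = s.var x) rfl fun i _ s' h => ?_
    rw [ih hc.2, setVar_var_ne _ _ hc.1, h]

theorem exec_arr {a : ℕ} {c : Cmd} (hc : c.keepsArr a = true) (s : State) :
    (c.exec s).arr a = s.arr a := by
  induction c generalizing s with
  | skip => rfl
  | assign y t => rfl
  | store b i t =>
    funext j
    have : a ≠ b := by simpa [keepsArr] using hc
    simp [exec, setArr_arr, this]
  | seq c₁ c₂ ih₁ ih₂ =>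
    simp only [keepsArr, Bool.and_eq_true] at hc
    simp only [exec, ih₁ hc.1, ih₂ hc.2]
  | ite t c₁ c₂ ih₁ ih₂ =>
    simp only [keepsArr, Bool.and_eq_true] at hc
    simp only [exec]
    split_ifs
    · exact ih₁ hc.1 s
    · exact ih₂ hc.2 s
  | loop y v c ih =>
    refine exec_loop_induction (fun _ s' => s'.arr a = s.arr a) rfl fun i _ s' h => ?_
    rw [ih hc, setVar_arr, h]

/-- The variables that bound loops are never written, so a bound on their initial values holds
throughout the execution. -/
theorem static_keepsVar {V : List ℕ} {v : ℕ} (hv : v ∈ V) {c : Cmd} (hc : c.static V = true) :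
    c.keepsVar v = true := by
  induction c with
  | skip => rfl
  | assign y t =>
    simp only [static, Bool.and_eq_true, Bool.not_eq_true'] at hc
    have : y ∉ V := by simpa using hc.1
    simp only [keepsVar, bne_iff_ne]
    exact fun h => this (h ▸ hv)
  | store a i t => rfl
  | seq c₁ c₂ ih₁ ih₂ =>
    simp only [static, Bool.and_eq_true] at hc
    simp only [keepsVar, ih₁ hc.1, ih₂ hc.2, Bool.and_self]
  | ite t c₁ c₂ ih₁ ih₂ =>
    simp only [static, Bool.and_eq_true] at hc
    simp only [keepsVar, ih₁ hc.2.1, ih₂ hc.2.2, Bool.and_self]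
  | loop y w c ih =>
    simp only [static, Bool.and_eq_true, Bool.not_eq_true'] at hc
    have : y ∉ V := by simpa using hc.2.1
    simp only [keepsVar, Bool.and_eq_true, bne_iff_ne]
    exact ⟨fun h => this (h ▸ hv), ih hc.2.2⟩

theorem varsBelow_mono {d d' : ℕ} (hd : d ≤ d') {c : Cmd} (hc : c.varsBelow d = true) :
    c.varsBelow d' = true := by
  induction c with
  | skip => rfl
  | assign y t =>
    simp only [varsBelow, Bool.and_eq_true, decide_eq_true_eq] at *
    exact ⟨by omega, Term.varsBelow_mono hd hc.2⟩
  | store a i t =>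
    simp only [varsBelow, Bool.and_eq_true] at *
    exact ⟨Term.varsBelow_mono hd hc.1, Term.varsBelow_mono hd hc.2⟩
  | seq c₁ c₂ ih₁ ih₂ =>
    simp only [varsBelow, Bool.and_eq_true] at *
    exact ⟨ih₁ hc.1, ih₂ hc.2⟩
  | ite t c₁ c₂ ih₁ ih₂ =>
    simp only [varsBelow, Bool.and_eq_true] at *
    exact ⟨Term.varsBelow_mono hd hc.1, ih₁ hc.2.1, ih₂ hc.2.2⟩
  | loop x v c ih =>
    simp only [varsBelow, Bool.and_eq_true, decide_eq_true_eq] at *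
    exact ⟨by omega, by omega, ih hc.2.2⟩

theorem keepsVar_of_varsBelow {d y : ℕ} {c : Cmd} (hc : c.varsBelow d = true) (hy : d ≤ y) :
    c.keepsVar y = true := by
  induction c with
  | skip => rfl
  | assign z t =>
    simp only [varsBelow, Bool.and_eq_true, decide_eq_true_eq] at hc
    simp only [keepsVar, bne_iff_ne]; omega
  | store a i t => rfl
  | seq c₁ c₂ ih₁ ih₂ =>
    simp only [varsBelow, Bool.and_eq_true] at hc
    simp only [keepsVar, ih₁ hc.1, ih₂ hc.2, Bool.and_self]
  | ite t c₁ c₂ ih₁ ih₂ =>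
    simp only [varsBelow, Bool.and_eq_true] at hc
    simp only [keepsVar, ih₁ hc.2.1, ih₂ hc.2.2, Bool.and_self]
  | loop z w c ih =>
    simp only [varsBelow, Bool.and_eq_true, decide_eq_true_eq] at hc
    simp only [keepsVar, Bool.and_eq_true, bne_iff_ne]
    exact ⟨by omega, ih hc.2.2⟩

theorem exec_congr {d : ℕ} {c : Cmd} (hc : c.varsBelow d = true) {s s' : State}
    (h : AgreeBelow d s s') : AgreeBelow d (c.exec s) (c.exec s') := by
  induction c generalizing s s' with
  | skip => exact h
  | assign x t =>
    simp only [varsBelow, Bool.and_eq_true] at hc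
    simp only [exec, Term.eval_congr hc.2 h]
    exact h.setVar _ _
  | store a i t =>
    simp only [varsBelow, Bool.and_eq_true] at hc
    simp only [exec, Term.eval_congr hc.1 h, Term.eval_congr hc.2 h]
    exact ⟨h.1, by simp only [State.setArr, h.2]⟩
  | seq c₁ c₂ ih₁ ih₂ =>
    simp only [varsBelow, Bool.and_eq_true] at hc
    exact ih₂ hc.2 (ih₁ hc.1 h)
  | ite t c₁ c₂ ih₁ ih₂ =>
    simp only [varsBelow, Bool.and_eq_true] at hc
    simp only [exec, Term.eval_congr hc.1 h]
    split_ifs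
    · exact ih₁ hc.2.1 h
    · exact ih₂ hc.2.2 h
  | loop x v c ih =>
    simp only [varsBelow, Bool.and_eq_true, decide_eq_true_eq] at hc
    simp only [exec, h.1 v hc.2.1]
    induction s'.var v with
    | zero => exact h
    | succ i ih' => exact ih hc.2.2 (ih'.setVar x i)

/-- The compiled program executes the command. -/
theorem compile_runs {V : List ℕ} {B : ℕ} (c : Cmd) :
    ∀ (d : ℕ) (s σ : State), c.varsBelow d = true → c.static V = true →
      (∀ v ∈ V, v < d ∧ σ.var v ≤ B) → AgreeBelow d s σ →
      ∃ s' k, (c.compile d).Runs s s' k ∧ k ≤ c.time B ∧ AgreeBelow d s' (c.exec σ) := by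
  have tr : ∀ {d d' : ℕ} {s s' : State}, (∀ v ∈ V, v < d ∧ s.var v ≤ B) → AgreeBelow d s' s →
      d ≤ d' → ∀ v ∈ V, v < d' ∧ s'.var v ≤ B := by
    intro d d' s s' h ha hd v hv
    rw [ha.1 v (h v hv).1]
    exact ⟨by have := (h v hv).1; omega, (h v hv).2⟩
  have tr' : ∀ {d : ℕ} {σ : State} {c : Cmd}, (∀ v ∈ V, v < d ∧ σ.var v ≤ B) →
      c.static V = true → ∀ v ∈ V, v < d ∧ (c.exec σ).var v ≤ B := by
    intro d σ c h hc v hv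
    rw [exec_var (static_keepsVar hv hc)]
    exact h v hv
  induction c with
  | skip =>
    intro d s σ _ _ _ ha
    exact ⟨s, 1, .skip s, le_rfl, ha⟩
  | assign x t =>
    intro d s σ hb hs hB ha
    simp only [varsBelow, Bool.and_eq_true, decide_eq_true_eq] at hb
    simp only [static, Bool.and_eq_true] at hs
    obtain ⟨s₁, k₁, r₁, t₁, e₁, a₁⟩ := Term.compile_runs t d s hb.2 hs.2 (tr hB ha le_rfl)
    refine ⟨_, _, .seq r₁ (.assign _ _ _), by simp only [Expr.cost, time]; omega, ?_⟩
    simp only [exec, Expr.eval, e₁, Term.eval_congr hb.2 ha]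
    exact (a₁.trans ha).setVar _ _
  | store a i t =>
    intro d s σ hb hs hB ha
    simp only [varsBelow, Bool.and_eq_true] at hb
    simp only [static, Bool.and_eq_true] at hs
    obtain ⟨s₁, k₁, r₁, t₁, e₁, a₁⟩ := Term.compile_runs i d s hb.1 hs.1 (tr hB ha le_rfl)
    obtain ⟨s₂, k₂, r₂, t₂, e₂, a₂⟩ := Term.compile_runs t (d + 1) s₁
      (Term.varsBelow_mono (by omega) hb.2) hs.2 (tr hB (a₁.trans ha) (by omega))
    refine ⟨_, _, .seq r₁ (.seq r₂ (.store _ _ _ _)), by simp only [Expr.cost, time]; omega, ?_⟩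
    simp only [exec, Expr.eval, e₂, a₂.1 d (by omega), e₁, Term.eval_congr hb.1 ha,
      Term.eval_congr hb.2 (a₁.trans ha)]
    have := (a₂.mono (d' := d) (by omega)).trans (a₁.trans ha)
    refine ⟨this.1, ?_⟩
    simp only [State.setArr, this.2]
  | seq c₁ c₂ ih₁ ih₂ =>
    intro d s σ hb hs hB ha
    simp only [varsBelow, Bool.and_eq_true] at hb
    simp only [static, Bool.and_eq_true] at hs
    obtain ⟨s₁, k₁, r₁, t₁, a₁⟩ := ih₁ d s σ hb.1 hs.1 hB ha
    obtain ⟨s₂, k₂, r₂, t₂, a₂⟩ := ih₂ d s₁ _ hb.2 hs.2 (tr' hB hs.1) a₁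
    exact ⟨s₂, _, .seq r₁ r₂, by simp only [time]; omega, a₂⟩
  | ite t c₁ c₂ ih₁ ih₂ =>
    intro d s σ hb hs hB ha
    simp only [varsBelow, Bool.and_eq_true] at hb
    simp only [static, Bool.and_eq_true] at hs
    obtain ⟨s₁, k₁, r₁, t₁, e₁, a₁⟩ := Term.compile_runs t d s hb.1 hs.1 (tr hB ha le_rfl)
    rw [Term.eval_congr hb.1 ha] at e₁
    by_cases h : t.eval σ = 0
    · obtain ⟨s₂, k₂, r₂, t₂, a₂⟩ := ih₂ d s₁ σ hb.2.2 hs.2.2 hB (a₁.trans ha)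
      refine ⟨s₂, _, .seq r₁ (.branch_false (by simp [Expr.eval, e₁, h]) r₂),
        by simp only [Expr.cost, time]; omega, ?_⟩
      rwa [exec, if_neg (by simp [h])]
    · obtain ⟨s₂, k₂, r₂, t₂, a₂⟩ := ih₁ d s₁ σ hb.2.1 hs.2.1 hB (a₁.trans ha)
      refine ⟨s₂, _, .seq r₁ (.branch_true (by simp [Expr.eval, e₁, h]) r₂),
        by simp only [Expr.cost, time]; omega, ?_⟩
      rwa [exec, if_pos h]
  | loop x v c ih =>
    intro d s σ hb hs hB ha
    simp only [varsBelow, Bool.and_eq_true, decide_eq_true_eq] at hb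
    obtain ⟨hx, hv, hb⟩ := hb
    have hs0 := hs
    simp only [static, Bool.and_eq_true, Bool.not_eq_true', List.contains_iff_mem] at hs
    obtain ⟨hvV, hxV, hs⟩ := hs
    have hxV : x ∉ V := by simpa using hxV
    -- The rounds are counted in `d + 1` and copied to `x` each time, because the body may overwrite
    -- `x`.
    have key : ∀ rem i s₁, i + rem = σ.var v → s₁.var d = σ.var v → s₁.var (d + 1) = i →
        AgreeBelow d s₁ (iter x c.exec σ i) →
        ∃ s' k, (Program.loop (.lt (.var (d + 1)) (.var d)) (.seq (.assign x (.var (d + 1)))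
          (.seq (c.compile (d + 2))
            (.assign (d + 1) (.add (.var (d + 1)) (.lit 1)))))).Runs s₁ s' k ∧
          k ≤ rem * (c.time B + 10) + 4 ∧ AgreeBelow d s' (iter x c.exec σ (σ.var v)) := by
      intro rem
      induction rem with
      | zero =>
        intro i s₁ hi h0 h1 ha
        refine ⟨s₁, _, .loop_done ?_, by simp [Expr.cost], ?_⟩
        · simp only [Expr.eval, h0, h1]; rw [if_neg (by omega)]
        · rw [← hi]; exact ha
      | succ rem ihr =>
        intro i s₁ hi h0 h1 ha
        let s₂ := s₁.setVar x (Expr.eval s₁ (.var (d + 1)))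
        have h2 : Expr.eval s₁ (.var (d + 1)) = i := h1
        have ha₂ : AgreeBelow d s₂ ((iter x c.exec σ i).setVar x i) := by
          simp only [s₂, h2]; exact ha.setVar x i
        have hbound : ∀ w ∈ V, w < d + 2 ∧ s₂.var w ≤ B := by
          intro w hw
          have hwd := (hB w hw).1
          have hwx : w ≠ x := fun h => hxV (h ▸ hw)
          refine ⟨by omega, ?_⟩
          rw [ha₂.1 w hwd, setVar_var_ne _ _ hwx]
          have : ∀ i, (iter x c.exec σ i).var w = σ.var w := by
            intro i
            induction i with
            | zero => rfl
            | succ i ih' =>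
              rw [iter, exec_var (static_keepsVar hw hs), setVar_var_ne _ _ hwx, ih']
          rw [this]
          exact (hB w hw).2
        obtain ⟨s₃, k₃, r₃, t₃, a₃⟩ := ih (d + 2) s₂ s₂ (varsBelow_mono (by omega) hb) hs hbound
          (AgreeBelow.refl _ _)
        have hk : ∀ {y}, d ≤ y → c.keepsVar y = true := keepsVar_of_varsBelow hb
        have hd1 : s₃.var (d + 1) = i := by
          rw [a₃.1 _ (by omega), exec_var (hk (by omega)), setVar_var_ne _ _ (by omega), h1]
        have hd0 : s₃.var d = σ.var v := by
          rw [a₃.1 _ (by omega), exec_var (hk (by omega)), setVar_var_ne _ _ (by omega), h0]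
        have hcong : AgreeBelow d (c.exec s₂) (c.exec ((iter x c.exec σ i).setVar x i)) :=
          exec_congr hb ha₂
        obtain ⟨s', k', r', t', a'⟩ := ihr (i + 1)
          (s₃.setVar (d + 1) (Expr.eval s₃ (.add (.var (d + 1)) (.lit 1)))) (by omega)
          (by rw [setVar_var_ne _ _ (by omega), hd0])
          (by rw [setVar_var_self]; simp [Expr.eval, hd1])
          (((a₃.mono (by omega)).trans hcong).setVar_left (by omega) _)
        refine ⟨s', _, .loop_step ?_ (.seq (.assign _ _ _) (.seq r₃ (.assign _ _ _))) r', ?_, a'⟩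
        · simp only [Expr.eval, h0, h1]; rw [if_pos (by omega)]; exact one_ne_zero
        · simp only [Expr.cost]
          have : (rem + 1) * (c.time B + 10) = rem * (c.time B + 10) + (c.time B + 10) := by ring
          omega
    let s₁ := s.setVar d (Expr.eval s (.var v))
    obtain ⟨s', k', r', t', a'⟩ := key (σ.var v) 0
      (s₁.setVar (d + 1) (Expr.eval s₁ (.lit 0))) (by omega)
      (by rw [setVar_var_ne _ _ (by omega), setVar_var_self]; exact ha.1 v hv)
      (by rw [setVar_var_self]; rfl)
      ((ha.setVar_left le_rfl _).setVar_left (by omega) _)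
    refine ⟨s', _, .seq (.assign _ _ _) (.seq (.assign _ _ _) r'), ?_, a'⟩
    simp only [Expr.cost, time]
    have := Nat.mul_le_mul_right (c.time B + 10) (hB v hvV).2
    omega

theorem exists_time_le (c : Cmd) : ∃ κ, ∀ B, c.time B ≤ κ * (B + 1) ^ κ := by
  have one : ∀ {a B : ℕ}, 1 ≤ (B + 1) ^ a := Nat.one_le_pow _ _ (by omega)
  have up : ∀ {T : ℕ → ℕ} {a b B : ℕ}, (∀ B, T B ≤ a * (B + 1) ^ a) → a ≤ b →
      T B ≤ a * (B + 1) ^ b := fun h hab =>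
    (h _).trans (Nat.mul_le_mul_left _ (Nat.pow_le_pow_right (Nat.succ_pos _) hab))
  induction c with
  | skip => exact ⟨1, fun B => by have := one (a := 1) (B := B); simp only [time]; omega⟩
  | assign x t =>
    obtain ⟨κ, h⟩ := t.exists_time_le
    refine ⟨κ + 2, fun B => ?_⟩
    have h0 := one (a := κ + 2) (B := B)
    have h1 := up (B := B) h (by omega : κ ≤ κ + 2)
    simp only [time]
    nlinarith
  | store a i t =>
    obtain ⟨κ₁, h₁⟩ := i.exists_time_le
    obtain ⟨κ₂, h₂⟩ := t.exists_time_le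
    refine ⟨κ₁ + κ₂ + 3, fun B => ?_⟩
    have h0 := one (a := κ₁ + κ₂ + 3) (B := B)
    have h1 := up (B := B) h₁ (by omega : κ₁ ≤ κ₁ + κ₂ + 3)
    have h2 := up (B := B) h₂ (by omega : κ₂ ≤ κ₁ + κ₂ + 3)
    simp only [time]
    nlinarith
  | seq c₁ c₂ ih₁ ih₂ =>
    obtain ⟨κ₁, h₁⟩ := ih₁
    obtain ⟨κ₂, h₂⟩ := ih₂
    refine ⟨κ₁ + κ₂, fun B => ?_⟩
    have h1 := up (B := B) h₁ (by omega : κ₁ ≤ κ₁ + κ₂)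
    have h2 := up (B := B) h₂ (by omega : κ₂ ≤ κ₁ + κ₂)
    simp only [time]
    nlinarith
  | ite t c₁ c₂ ih₁ ih₂ =>
    obtain ⟨κ, h⟩ := t.exists_time_le
    obtain ⟨κ₁, h₁⟩ := ih₁
    obtain ⟨κ₂, h₂⟩ := ih₂
    refine ⟨κ + κ₁ + κ₂ + 2, fun B => ?_⟩
    have h0 := one (a := κ + κ₁ + κ₂ + 2) (B := B)
    have h' := up (B := B) h (by omega : κ ≤ κ + κ₁ + κ₂ + 2)
    have h1 := up (B := B) h₁ (by omega : κ₁ ≤ κ + κ₁ + κ₂ + 2)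
    have h2 := up (B := B) h₂ (by omega : κ₂ ≤ κ + κ₁ + κ₂ + 2)
    simp only [time]
    nlinarith
  | loop x v c ih =>
    obtain ⟨κ, h⟩ := ih
    refine ⟨κ + 26, fun B => ?_⟩
    have h1 := up (B := B) h (by omega : κ ≤ κ + 25)
    have h0 := one (a := κ + 25) (B := B)
    simp only [time] at *
    have h2 : B * (c.time B + 10) ≤ B * (κ * (B + 1) ^ (κ + 25) + 10 * (B + 1) ^ (κ + 25)) :=
      Nat.mul_le_mul_left _ (by omega)
    have h3 : (B + 1) ^ (κ + 26) = (B + 1) ^ (κ + 25) * (B + 1) := pow_succ _ _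
    rw [h3]
    nlinarith

end Cmd
end TwinWidth

/-! ### Derived terms: logic, counting, least solutions, products and quotients. -/

namespace TwinWidth

namespace Term

/-- Negation. -/
def not (t : Term) : Term := .eq t (.lit 0)

/-- Conjunction. -/
def and (t₁ t₂ : Term) : Term := .ite t₁ t₂ (.lit 0)

/-- Disjunction. -/
def or (t₁ t₂ : Term) : Term := .ite t₁ (.lit 1) t₂

/-- Bounded existential quantification. -/
def ex (x v : ℕ) (t : Term) : Term := .sum x v t

/-- Bounded universal quantification. -/
def all (x v : ℕ) (t : Term) : Term := not (ex x v (not t))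

/-- The number of values of `x` below `v` with a property. -/
def count (x v : ℕ) (t : Term) : Term := .sum x v (.ite t (.lit 1) (.lit 0))

/-- The first value of `x` below `v` with a property; `y` is an auxiliary variable. -/
def first (x y v : ℕ) (t : Term) : Term :=
  count y v (all x v (or (.lt (.var y) (.var x)) (not t)))

/-- The product of the variable `v` and a term. -/
def mulVar (v : ℕ) (t : Term) : Term := .sum 40 v t

/-- The quotient of a term by the variable `v`, if it is at most the value of the variable `b`. -/
def divVar (b v : ℕ) (t : Term) : Term :=
  count 39 b (not (.lt t (mulVar v (.add (.var 39) (.lit 1)))))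

variable {s : State}

@[simp] theorem eval_lit {v : ℕ} : (lit v).eval s = v := rfl

@[simp] theorem eval_var {x : ℕ} : (var x).eval s = s.var x := rfl

@[simp] theorem eval_get {a : ℕ} {t : Term} : (get a t).eval s = s.arr a (t.eval s) := rfl

@[simp] theorem eval_add {t₁ t₂ : Term} : (add t₁ t₂).eval s = t₁.eval s + t₂.eval s := rfl

@[simp] theorem eval_sub {t₁ t₂ : Term} : (sub t₁ t₂).eval s = t₁.eval s - t₂.eval s := rfl

theorem not_iff {t : Term} : (not t).eval s ≠ 0 ↔ ¬ t.eval s ≠ 0 := by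
  simp only [not, eval]; split_ifs <;> simp_all

theorem and_iff {t₁ t₂ : Term} : (and t₁ t₂).eval s ≠ 0 ↔ t₁.eval s ≠ 0 ∧ t₂.eval s ≠ 0 := by
  simp only [and, eval]; split_ifs <;> simp_all

theorem or_iff {t₁ t₂ : Term} : (or t₁ t₂).eval s ≠ 0 ↔ t₁.eval s ≠ 0 ∨ t₂.eval s ≠ 0 := by
  simp only [or, eval]; split_ifs <;> simp_all

theorem lt_iff {t₁ t₂ : Term} : (lt t₁ t₂).eval s ≠ 0 ↔ t₁.eval s < t₂.eval s := by
  simp [eval]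

theorem eq_iff {t₁ t₂ : Term} : (eq t₁ t₂).eval s ≠ 0 ↔ t₁.eval s = t₂.eval s := by
  simp [eval]

theorem ex_iff {x v : ℕ} {t : Term} :
    (ex x v t).eval s ≠ 0 ↔ ∃ i < s.var v, t.eval (s.setVar x i) ≠ 0 := by
  simp [ex, eval]

theorem all_iff {x v : ℕ} {t : Term} :
    (all x v t).eval s ≠ 0 ↔ ∀ i < s.var v, t.eval (s.setVar x i) ≠ 0 := by
  rw [all, not_iff, ex_iff]
  push Not
  refine forall₂_congr fun i _ => ?_
  have := not_iff (s := s.setVar x i) (t := t)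
  tauto

theorem eval_count {x v : ℕ} {t : Term} :
    (count x v t).eval s =
      ((Finset.range (s.var v)).filter fun i => t.eval (s.setVar x i) ≠ 0).card := by
  simp only [count, eval, Finset.card_filter]

theorem eval_mulVar {v w : ℕ} {t : Term} (h : ∀ i, t.eval (s.setVar 40 i) = w) :
    (mulVar v t).eval s = s.var v * w := by
  simp [mulVar, eval, h]

/-- The counted values of `y` are those below every solution, so their number is the least solution.
The property of `x` must not depend on `y`, which changes during the count. -/
theorem first_spec {x y v : ℕ} (hxy : x ≠ y) {t : Term} {p : ℕ → Prop}
    (ht : ∀ i < s.var v, ∀ j, t.eval ((s.setVar y j).setVar x i) ≠ 0 ↔ p i) (hv : v ≠ y)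
    (hp : ∃ i < s.var v, p i) :
    (first x y v t).eval s < s.var v ∧ p ((first x y v t).eval s) ∧
      ∀ i < (first x y v t).eval s, ¬ p i := by
  classical
  have hfind : (first x y v t).eval s = Nat.find hp := by
    rw [first, eval_count]
    have : ((Finset.range (s.var v)).filter fun j =>
        (all x v (or (.lt (.var y) (.var x)) (not t))).eval (s.setVar y j) ≠ 0) =
        Finset.range (Nat.find hp) := by
      ext j
      simp only [Finset.mem_filter, Finset.mem_range, all_iff, or_iff, lt_iff, not_iff, eval_var,
        setVar_var_self, setVar_var_ne _ _ hxy.symm, setVar_var_ne _ _ hv]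
      constructor
      · rintro ⟨_, h⟩
        obtain ⟨h1, h2⟩ := Nat.find_spec hp
        rcases h _ h1 with h | h
        · exact h
        · exact absurd ((ht _ h1 _).2 h2) h
      · intro h
        obtain ⟨h1, h2⟩ := Nat.find_spec hp
        refine ⟨by omega, fun i hi => ?_⟩
        by_cases hji : j < i
        · exact .inl hji
        · exact .inr fun hpi =>
            Nat.find_min hp (by omega : i < Nat.find hp) ⟨hi, (ht i hi _).1 hpi⟩
    rw [this, Finset.card_range]
  rw [hfind]
  refine ⟨(Nat.find_spec hp).1, (Nat.find_spec hp).2, fun i hi hpi => ?_⟩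
  have := (Nat.find_spec hp).1
  exact Nat.find_min hp hi ⟨by omega, hpi⟩

/-- The quotient is the number of `i` such that `i + 1` copies of the divisor fit into `w`. Only `i`
below the variable `b` are tried, hence the bound on the quotient. -/
theorem eval_divVar {b v w : ℕ} {t : Term} (h39 : v ≠ 39)
    (ht : ∀ i, t.eval (s.setVar 39 i) = w) (hv : 0 < s.var v)
    (hb : w / s.var v ≤ s.var b) : (divVar b v t).eval s = w / s.var v := by
  rw [divVar, eval_count]
  have : ((Finset.range (s.var b)).filter fun i =>
      (not (.lt t (mulVar v (.add (.var 39) (.lit 1))))).eval (s.setVar 39 i) ≠ 0) =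
      Finset.range (w / s.var v) := by
    ext i
    have hm : (mulVar v (.add (.var 39) (.lit 1))).eval (s.setVar 39 i) = s.var v * (i + 1) := by
      rw [eval_mulVar (w := i + 1), setVar_var_ne _ _ h39]
      intro j
      simp [eval, setVar_var]
    rw [Finset.mem_filter, Finset.mem_range, Finset.mem_range, not_iff, lt_iff, ht, hm, not_lt]
    constructor
    · rintro ⟨_, h⟩
      have := (Nat.le_div_iff_mul_le hv).2 (by rwa [mul_comm] at h : (i + 1) * s.var v ≤ w)
      omega
    · intro h
      refine ⟨by omega, ?_⟩
      rw [mul_comm]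
      exact (Nat.le_div_iff_mul_le hv).1 h
  rw [this, Finset.card_range]

end Term

/-- The command `for y < v: a[y] := t`. -/
def Cmd.fill (a y v : ℕ) (t : Term) : Cmd := .loop y v (.store a (.var y) t)

/-- The array after filling it with a term that does not read the part already filled. -/
theorem Cmd.exec_fill {a y v : ℕ} {t : Term} {s : State} {g : ℕ → ℕ}
    (ht : ∀ i < s.var v, ∀ s' : State, s'.var = (s.setVar y i).var →
      (∀ b ≠ a, s'.arr b = s.arr b) → (∀ j, i ≤ j → s'.arr a j = s.arr a j) → t.eval s' = g i) :
    ∀ i, ((fill a y v t).exec s).arr a i = if i < s.var v then g i else s.arr a i := by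
  have key : (∀ i, ((fill a y v t).exec s).arr a i = if i < s.var v then g i else s.arr a i) ∧
      (∀ b ≠ a, ((fill a y v t).exec s).arr b = s.arr b) ∧
      (∀ z ≠ y, ((fill a y v t).exec s).var z = s.var z) := by
    refine Cmd.exec_loop_induction (P := fun i s' => (∀ j, s'.arr a j = if j < i then g j else
      s.arr a j) ∧ (∀ b ≠ a, s'.arr b = s.arr b) ∧ (∀ z ≠ y, s'.var z = s.var z))
      ⟨by simp, fun _ _ => rfl, fun _ _ => rfl⟩ ?_
    rintro i hi s' ⟨h1, h2, h3⟩
    have hval : t.eval (s'.setVar y i) = g i := by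
      refine ht i hi _ ?_ h2 fun j hj => ?_
      · funext z
        rw [setVar_var, setVar_var]
        split_ifs with hz
        · rfl
        · exact h3 z hz
      · rw [setVar_arr, h1, if_neg (by omega)]
    refine ⟨fun j => ?_, fun b hb => ?_, fun z hz => ?_⟩
    · simp only [Cmd.exec, Term.eval, setVar_var_self, setArr_arr, hval, true_and, setVar_arr]
      by_cases hj : j = i
      · simp [hj]
      · rw [if_neg hj, h1]
        by_cases hj' : j < i
        · rw [if_pos hj', if_pos (by omega)]
        · rw [if_neg hj', if_neg (by omega)]
    · funext j
      simp only [Cmd.exec, setArr_arr, hb, false_and, if_false, setVar_arr]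
      rw [h2 b hb]
    · simp only [Cmd.exec, setArr_var]
      rw [setVar_var_ne _ _ hz, h3 z hz]
  exact key.1

end TwinWidth

namespace TwinWidth

/-! ### Variables and arrays

The parameters are the number `v_N` of elements, the boundary `v_h`, the parameter `v_k`, the
bounds `v_K` and `v_L` of `Poor`, and the number `v_W` of branches of the test for it. -/

notation "v_N" => 10
notation "v_h" => 11
notation "v_k" => 12
notation "v_K" => 13
notation "v_L" => 14
notation "v_W" => 15
notation "v_flag" => 16
notation "v_pos" => 17
notation "v_found" => 18
notation "v_ok" => 19
notation "v_rest" => 20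
notation "v_i" => 21
notation "v_j" => 22
notation "v_a" => 23
notation "v_b" => 24
notation "v_c" => 25
notation "v_u" => 26
notation "v_w" => 27
notation "v_round" => 30
notation "v_x" => 31
notation "v_word" => 32
notation "v_step" => 33
notation "v_y" => 34
notation "v_r" => 35
notation "v_s" => 36
notation "v_z" => 37
notation "a_mat" => 3
notation "a_out" => 4
notation "a_div" => 5
notation "a_comp" => 6
notation "a_cur" => 7
notation "a_mark" => 8

/-- The matrix stored row by row in an array. -/
def matOf (N : ℕ) (f : ℕ → ℕ) (r c : ℕ) : ℕ := f (N * r + c)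

/-- The matrix in a state. -/
def State.mat (s : State) : ℕ → ℕ → ℕ := matOf (s.var v_N) (s.arr a_mat)

open Classical in
/-- The marked labels in a state. -/
noncomputable def State.marked (s : State) : Finset ℕ :=
  (Finset.range (s.var v_N)).filter fun l => s.arr a_mark l ≠ 0

/-- The representatives of the rows in the two intervals that meet at `v_x`. -/
noncomputable def State.reps (s : State) : Finset ℕ :=
  TwinWidth.reps (s.var v_N) s.mat (s.arr a_div) s.marked
    (mergedPart (s.var v_N) (s.arr a_div) (s.var v_x))

theorem setVar_mat {s : State} {x v : ℕ} (hx : x ≠ v_N) : (s.setVar x v).mat = s.mat := by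
  simp [State.mat, setVar_var_ne _ _ hx.symm]

theorem setVar_reps {s : State} {x v : ℕ} (hx : x ≠ v_N) (hx' : x ≠ v_x) :
    (s.setVar x v).reps = s.reps := by
  simp [State.reps, State.marked, setVar_mat hx, setVar_var_ne _ _ hx.symm,
    setVar_var_ne _ _ hx'.symm]

namespace Term

/-- The entry of the matrix in row `a` and column `b`. -/
def entry (a b : ℕ) : Term := .get a_mat (.add (mulVar v_N (.var a)) (.var b))

theorem eval_entry {a b : ℕ} {s : State} (ha : a ≠ 40) :
    (entry a b).eval s = s.mat (s.var a) (s.var b) := by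
  rw [entry, eval_get, eval_add, eval_mulVar (w := s.var a)]
  · rfl
  · intro i; exact setVar_var_ne _ _ ha

/-- The rows `a` and `b` differ in the column `c`, which is not marked. -/
def differ (a b c : ℕ) : Term :=
  and (not (.get a_mark (.get a_div (.var c)))) (not (.eq (entry a c) (entry b c)))

/-- The rows `a` and `b` differ in some column that is not marked. -/
def separated (a b : ℕ) : Term := ex 41 v_N (differ a b 41)

/-- The element `a` belongs to one of the two intervals that meet at `v_x`. -/
def inMerged (a : ℕ) : Term :=
  or (.eq (.get a_div (.var a)) (.get a_div (.sub (.var v_x) (.lit 1))))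
    (.eq (.get a_div (.var a)) (.var v_x))

/-- The element `a` is a representative. -/
def isRep (a : ℕ) : Term :=
  and (inMerged a) (not (ex 42 v_N (and (.lt (.var 42) (.var a))
    (and (inMerged 42) (not (separated a 42))))))

/-- The number of representatives. -/
def numReps : Term := count 43 v_N (isRep 43)

/-- The representative whose number is the variable `i`. -/
def nthRep (i : ℕ) : Term :=
  first 44 45 v_N (and (isRep 44) (.eq (count 46 v_N (and (.lt (.var 46) (.var 44)) (isRep 46)))
    (.var i)))

variable {s : State}

theorem differ_iff {a b c : ℕ} (ha : a ≠ 40) (hb : b ≠ 40)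
    (hdl : ∀ c < s.var v_N, s.arr a_div c < s.var v_N) (hc : s.var c < s.var v_N) :
    (differ a b c).eval s ≠ 0 ↔
      s.arr a_div (s.var c) ∉ s.marked ∧ s.mat (s.var a) (s.var c) ≠ s.mat (s.var b) (s.var c) := by
  rw [differ, and_iff, not_iff, not_iff, eq_iff, eval_entry ha, eval_entry hb]
  simp only [eval_get, eval_var, State.marked, Finset.mem_filter, Finset.mem_range, hdl _ hc,
    true_and]

theorem separated_iff {a b : ℕ} (ha : a ≠ 40) (hb : b ≠ 40) (ha' : a ≠ 41) (hb' : b ≠ 41)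
    (hdl : ∀ c < s.var v_N, s.arr a_div c < s.var v_N) :
    (separated a b).eval s ≠ 0 ↔
      ¬ Agree (s.var v_N) s.mat (s.arr a_div) s.marked (s.var a) (s.var b) := by
  rw [separated, ex_iff, Agree]
  push Not
  refine exists_congr fun c => and_congr_right fun hc => ?_
  rw [differ_iff ha hb (by simpa [setVar_var] using hdl) (by simpa [setVar_var] using hc)]
  simp only [setVar_arr, setVar_var_self, setVar_mat (show (41 : ℕ) ≠ v_N by decide),
    setVar_var_ne _ _ ha', setVar_var_ne _ _ hb']
  rfl

theorem inMerged_iff {a : ℕ} (ha : s.var a < s.var v_N) : (inMerged a).eval s ≠ 0 ↔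
    s.var a ∈ mergedPart (s.var v_N) (s.arr a_div) (s.var v_x) := by
  rw [inMerged, or_iff, eq_iff, eq_iff]
  simp [mergedPart, ha]

theorem isRep_iff {a : ℕ} (ha : a ≠ 40) (ha' : a ≠ 41) (ha'' : a ≠ 42)
    (hdl : ∀ c < s.var v_N, s.arr a_div c < s.var v_N) (hlt : s.var a < s.var v_N) :
    (isRep a).eval s ≠ 0 ↔ s.var a ∈ s.reps := by
  rw [isRep, and_iff, not_iff, ex_iff, inMerged_iff hlt, State.reps, mem_reps]
  refine and_congr_right fun _ => ?_
  push Not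
  have key : ∀ i < s.var v_N, (and (.lt (.var 42) (.var a))
      (and (inMerged 42) (not (separated a 42)))).eval (s.setVar 42 i) ≠ 0 ↔
      i < s.var a ∧ i ∈ mergedPart (s.var v_N) (s.arr a_div) (s.var v_x) ∧
        Agree (s.var v_N) s.mat (s.arr a_div) s.marked (s.var a) i := by
    intro i hi
    rw [and_iff, and_iff, lt_iff, not_iff, inMerged_iff (by simpa [setVar_var] using hi),
      separated_iff ha (by decide) ha' (by decide) (by simpa [setVar_var] using hdl)]
    simp only [eval_var, setVar_arr, setVar_var_self, setVar_mat (show (42 : ℕ) ≠ v_N by decide),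
      setVar_var_ne _ _ ha'', not_not]
    simp only [setVar_var, State.marked, setVar_arr]
    simp
  constructor
  · intro h r' hr' hlt' hag
    have hr'N : r' < s.var v_N := by omega
    exact absurd (h r' hr'N) ((key r' hr'N).2 ⟨hlt', hr', hag⟩)
  · intro h i hi
    by_contra hne
    obtain ⟨h1, h2, h3⟩ := (key i hi).1 hne
    exact h i h2 h1 h3

theorem eval_numReps (hdl : ∀ c < s.var v_N, s.arr a_div c < s.var v_N) :
    numReps.eval s = s.reps.card := by
  rw [numReps, eval_count]
  congr 1
  ext i
  rw [Finset.mem_filter, Finset.mem_range]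
  constructor
  · rintro ⟨hi, h⟩
    rw [isRep_iff (by decide) (by decide) (by decide) (by simpa [setVar_var] using hdl)
      (by simpa [setVar_var] using hi), setVar_reps (by decide) (by decide), setVar_var_self] at h
    exact h
  · intro h
    have hi : i < s.var v_N := by
      have := reps_subset h
      simp only [mergedPart, Finset.mem_filter, Finset.mem_range] at this
      exact this.1
    refine ⟨hi, ?_⟩
    rw [isRep_iff (by decide) (by decide) (by decide) (by simpa [setVar_var] using hdl)
      (by simpa [setVar_var] using hi), setVar_reps (by decide) (by decide), setVar_var_self]
    exact h

theorem mem_reps_lt {r : ℕ} (h : r ∈ s.reps) : r < s.var v_N := by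
  have := reps_subset h
  simp only [mergedPart, Finset.mem_filter, Finset.mem_range] at this
  exact this.1

/-- A representative is determined by the number of smaller ones, since this number increases
strictly along the representatives. -/
theorem eval_nthRep {i : ℕ} (hi : i < 40)
    (hdl : ∀ c < s.var v_N, s.arr a_div c < s.var v_N) {a : ℕ}
    (ha : a ∈ s.reps) (hr : (s.reps.filter (· < a)).card = s.var i) : (nthRep i).eval s = a := by
  have hcount : ∀ p j, p < s.var v_N →
      (count 46 v_N (and (.lt (.var 46) (.var 44)) (isRep 46))).eval
        ((s.setVar 45 j).setVar 44 p) = (s.reps.filter (· < p)).card := by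
    intro p j hp
    rw [eval_count]
    congr 1
    ext r
    rw [Finset.mem_filter, Finset.mem_filter, Finset.mem_range, and_iff, lt_iff]
    have hN : ((s.setVar 45 j).setVar 44 p).var v_N = s.var v_N := by simp [setVar_var]
    rw [hN]
    have hrep : r < s.var v_N → ((isRep 46).eval (((s.setVar 45 j).setVar 44 p).setVar 46 r) ≠ 0 ↔
        r ∈ s.reps) := by
      intro hr
      rw [isRep_iff (by decide) (by decide) (by decide) (by simpa [setVar_var] using hdl)
        (by simpa [setVar_var] using hr), setVar_reps (by decide) (by decide),
        setVar_reps (by decide) (by decide), setVar_reps (by decide) (by decide), setVar_var_self]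
    constructor
    · rintro ⟨h1, h2, h3⟩
      exact ⟨(hrep h1).1 h3, by simpa [setVar_var] using h2⟩
    · rintro ⟨h1, h2⟩
      have hlt := mem_reps_lt h1
      exact ⟨hlt, by simpa [setVar_var] using h2, (hrep hlt).2 h1⟩
  have hrep : ∀ r j, r < s.var v_N → ((isRep 44).eval ((s.setVar 45 j).setVar 44 r) ≠ 0 ↔
      r ∈ s.reps) := by
    intro r j hr
    rw [isRep_iff (by decide) (by decide) (by decide) (by simpa [setVar_var] using hdl)
      (by simpa [setVar_var] using hr), setVar_reps (by decide) (by decide),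
      setVar_reps (by decide) (by decide), setVar_var_self]
  obtain ⟨-, ⟨h1, h2⟩, -⟩ := first_spec (s := s) (x := 44) (y := 45) (v := v_N) (by decide)
    (t := and (isRep 44) (.eq (count 46 v_N (and (.lt (.var 46) (.var 44)) (isRep 46))) (.var i)))
    (p := fun r => r ∈ s.reps ∧ (s.reps.filter (· < r)).card = s.var i)
    (fun r hr j => by
      rw [and_iff, eq_iff, hrep r j hr, hcount r j hr, eval_var, setVar_var_ne _ _ (by omega),
        setVar_var_ne _ _ (by omega)]) (by decide) ⟨a, mem_reps_lt ha, ha, hr⟩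
  have hinj : ∀ x ∈ s.reps, ∀ y ∈ s.reps, x < y →
      (s.reps.filter (· < x)).card < (s.reps.filter (· < y)).card := by
    intro x hx y hy hxy
    refine Finset.card_lt_card (Finset.ssubset_iff_of_subset (fun z hz => ?_) |>.2 ⟨x, ?_, ?_⟩)
    · simp only [Finset.mem_filter] at hz ⊢
      exact ⟨hz.1, by omega⟩
    · simp [hx, hxy]
    · simp
  rw [← hr] at h2
  rcases lt_trichotomy ((nthRep i).eval s) a with h | h | h
  · exact absurd (hinj _ h1 _ ha h) h2.not_lt
  · exact h
  · exact absurd (hinj _ ha _ h1 h) h2.symm.not_lt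

end Term
end TwinWidth

/-! ### The poorness test as a bounded search. -/

namespace TwinWidth

/-- The first column that separates two rows outside the columns with labels in `Y`. -/
noncomputable def firstSep (N : ℕ) (M : ℕ → ℕ → ℕ) (dl : ℕ → ℕ) (Y : Finset ℕ) (a b : ℕ) : ℕ :=
  sInf {c | c < N ∧ dl c ∉ Y ∧ M a c ≠ M b c}

theorem firstSep_spec {N : ℕ} {M : ℕ → ℕ → ℕ} {dl : ℕ → ℕ} {Y : Finset ℕ} {a b : ℕ}
    (h : ¬ Agree N M dl Y a b) :
    firstSep N M dl Y a b < N ∧ dl (firstSep N M dl Y a b) ∉ Y ∧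
      M a (firstSep N M dl Y a b) ≠ M b (firstSep N M dl Y a b) := by
  rw [Agree] at h
  push Not at h
  obtain ⟨c, h1, h2, h3⟩ := h
  exact Nat.sInf_mem (s := {c | c < N ∧ dl c ∉ Y ∧ M a c ≠ M b c}) ⟨c, h1, h2, h3⟩

/-- If `S` is poor, witnessed by `Y'`, then the choices that lead from a subset of `Y'` to `Y'` by
repeatedly separating two of the first `K` representatives can be encoded by numbers. -/
theorem exists_word {N : ℕ} {M : ℕ → ℕ → ℕ} {dl : ℕ → ℕ} {K : ℕ} {S Y' : Finset ℕ}
    (h' : (reps N M dl Y' S).card < K) :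
    ∃ word : ℕ → Finset ℕ → ℕ, (∀ j Y, word j Y < (K * K) ^ j) ∧
      ∀ j Y, K ≤ (reps N M dl Y S).card →
        ∃ a ∈ reps N M dl Y S, ∃ b ∈ reps N M dl Y S, ∃ i < K, ∃ i' < K,
          ((reps N M dl Y S).filter (· < a)).card = i ∧
          ((reps N M dl Y S).filter (· < b)).card = i' ∧
          ¬ Agree N M dl Y a b ∧ dl (firstSep N M dl Y a b) ∈ Y' ∧
          word (j + 1) Y = i + K * (i' + K * word j (insert (dl (firstSep N M dl Y a b)) Y)) := by
  classical
  have hK : 0 < K := by omega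
  have hpair := fun (Y : Finset ℕ) (h : K ≤ (reps N M dl Y S).card) =>
    exists_pair_of_card_reps h' h
  choose! a ha b hb ra rb hne hag using hpair
  -- The reduction modulo `K` makes the words bounded for every `Y`. Where a pair must be separated
  -- the positions are below `K` anyway.
  let dig : Finset ℕ → ℕ → ℕ := fun Y x => ((reps N M dl Y S).filter (· < x)).card % K
  let word : ℕ → Finset ℕ → ℕ := fun j => Nat.rec (motive := fun _ => Finset ℕ → ℕ) (fun _ => 0)
    (fun _ w Y => dig Y (a Y) + K * (dig Y (b Y) +
      K * w (insert (dl (firstSep N M dl Y (a Y) (b Y))) Y))) j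
  refine ⟨word, fun j => ?_, fun j Y hY => ⟨a Y, ha Y hY, b Y, hb Y hY, _, ra Y hY, _, rb Y hY,
    rfl, rfl, hne Y hY, ?_, ?_⟩⟩
  · induction j with
    | zero => intro Y; simp [word]
    | succ j ih =>
      intro Y
      have h1 : dig Y (a Y) < K := Nat.mod_lt _ hK
      have h2 : dig Y (b Y) < K := Nat.mod_lt _ hK
      have h3 := ih (insert (dl (firstSep N M dl Y (a Y) (b Y))) Y)
      change dig Y (a Y) + K * (dig Y (b Y) +
        K * word j (insert (dl (firstSep N M dl Y (a Y) (b Y))) Y)) < (K * K) ^ (j + 1)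
      generalize word j (insert (dl (firstSep N M dl Y (a Y) (b Y))) Y) = w at h3 ⊢
      generalize dig Y (a Y) = d at h1 ⊢
      generalize dig Y (b Y) = d' at h2 ⊢
      have h4 : d' + K * w < K * (K * K) ^ j := by
        have : K * (w + 1) ≤ K * (K * K) ^ j := Nat.mul_le_mul_left K h3
        rw [mul_add] at this
        omega
      have h5 : K * (d' + K * w + 1) ≤ K * (K * (K * K) ^ j) := Nat.mul_le_mul_left K h4
      rw [mul_add] at h5
      calc d + K * (d' + K * w) < K * (K * (K * K) ^ j) := by omega
        _ = (K * K) ^ (j + 1) := by ring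
  -- The two rows agree outside `Y'`, so a column on which they differ has its label in `Y'`.
  · obtain ⟨h1, h2, h3⟩ := firstSep_spec (hne Y hY)
    by_contra h
    exact h3 (hag Y hY _ h1 h)
  · have h1 : dig Y (a Y) = _ := Nat.mod_eq_of_lt (ra Y hY)
    have h2 : dig Y (b Y) = _ := Nat.mod_eq_of_lt (rb Y hY)
    rw [← h1, ← h2]

namespace Cmd

/-- Split off the last digit of `v_rest` in base `v_K` and write it into the variable `i`. -/
def digit (i : ℕ) : Cmd :=
  .seq (.assign v_u (Term.divVar v_W v_K (.var v_rest)))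
    (.seq (.assign i (.sub (.var v_rest) (Term.mulVar v_K (.var v_u)))) (.assign v_rest (.var v_u)))

/-- The quotient is searched below `v_W`, which is why the remaining word must not exceed the number
of branches. -/
theorem exec_digit {i d w : ℕ} {s : State} (hi : i ≠ v_rest) (hi' : i ≠ v_u) (hd : d < s.var v_K)
    (hw : s.var v_rest = d + s.var v_K * w) (hb : s.var v_rest ≤ s.var v_W) :
    ((digit i).exec s).var i = d ∧ ((digit i).exec s).var v_rest = w := by
  have hK : 0 < s.var v_K := by omega
  have hdiv : s.var v_rest / s.var v_K = w := by
    rw [hw, Nat.add_mul_div_left _ _ hK, Nat.div_eq_of_lt hd, zero_add]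
  have h1 : (Term.divVar v_W v_K (.var v_rest)).eval s = w := by
    rw [Term.eval_divVar (w := s.var v_rest) (by decide) _ hK _, hdiv]
    · intro j; exact setVar_var_ne _ _ (by decide)
    · exact (Nat.div_le_self _ _).trans hb
  have h2 : (Term.sub (.var v_rest) (Term.mulVar v_K (.var v_u))).eval (s.setVar v_u w) = d := by
    rw [Term.eval_sub, Term.eval_mulVar (w := w)]
    · simp only [Term.eval_var, setVar_var]
      simp [hw]
    · intro j; simp [setVar_var]
  simp only [digit, exec, h1, h2]
  simp [setVar_var, hi, hi'.symm]

/-- Mark the label of a column that separates the two representatives given by two digits. -/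
def mark : Cmd :=
  .seq (digit v_i) (.seq (digit v_j) (.seq (.assign v_a (Term.nthRep v_i))
    (.seq (.assign v_b (Term.nthRep v_j)) (.seq
      (.assign v_c (Term.first 47 48 v_N (Term.differ v_a v_b 47)))
      (.store a_mark (.get a_div (.var v_c)) (.lit 1))))))

/-- The parameters of the poorness test agree in the states `s` and `s'`. -/
structure SameTest (s s' : State) : Prop where
  N : s'.var v_N = s.var v_N
  K : s'.var v_K = s.var v_K
  L : s'.var v_L = s.var v_L
  W : s'.var v_W = s.var v_W
  x : s'.var v_x = s.var v_x
  mat : s'.arr a_mat = s.arr a_mat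
  div : s'.arr a_div = s.arr a_div

theorem SameTest.trans {s s' s'' : State} (h : SameTest s s') (h' : SameTest s' s'') :
    SameTest s s'' :=
  ⟨h'.N.trans h.N, h'.K.trans h.K, h'.L.trans h.L, h'.W.trans h.W, h'.x.trans h.x,
    h'.mat.trans h.mat, h'.div.trans h.div⟩

theorem SameTest.setVar {s : State} {x v : ℕ} (h1 : x ∉ [v_N, v_K, v_L, v_W, v_x]) :
    SameTest s (s.setVar x v) := by
  simp only [List.mem_cons, List.not_mem_nil, or_false, not_or] at h1
  constructor <;> first | rfl | exact setVar_var_ne _ _ (by tauto)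

theorem SameTest.exec {s : State} (c : Cmd)
    (hv : ([v_N, v_K, v_L, v_W, v_x].all fun x => c.keepsVar x) = true)
    (ha : (c.keepsArr a_mat && c.keepsArr a_div) = true) : SameTest s (c.exec s) := by
  simp only [List.all_cons, List.all_nil, Bool.and_true, Bool.and_eq_true] at hv ha
  exact ⟨exec_var hv.1 s, exec_var hv.2.1 s, exec_var hv.2.2.1 s, exec_var hv.2.2.2.1 s,
    exec_var hv.2.2.2.2 s, exec_arr ha.1 s, exec_arr ha.2 s⟩

theorem SameTest.eq_mat {s s' : State} (h : SameTest s s') : s'.mat = s.mat := by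
  rw [State.mat, State.mat, h.N, h.mat]

theorem SameTest.eq_reps {s s' : State} (h : SameTest s s') (hm : s'.marked = s.marked) :
    s'.reps = s.reps := by
  rw [State.reps, State.reps, h.N, h.eq_mat, h.div, hm, h.x]

theorem SameTest.eq_marked {s s' : State} (h : SameTest s s') (hm : s'.arr a_mark = s.arr a_mark) :
    s'.marked = s.marked := by
  rw [State.marked, State.marked, h.N, hm]

theorem marked_setArr {s : State} {l : ℕ} (hl : l < s.var v_N) :
    (s.setArr a_mark l 1).marked = insert l s.marked := by
  ext j
  simp only [State.marked, Finset.mem_filter, Finset.mem_range, Finset.mem_insert, setArr_var,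
    setArr_arr, true_and]
  by_cases h : j = l
  · simp [h, hl]
  · simp [h]

theorem marked_setArr_card {s : State} {l : ℕ} :
    (s.setArr a_mark l 1).marked.card ≤ s.marked.card + 1 := by
  by_cases hl : l < s.var v_N
  · rw [marked_setArr hl]
    exact Finset.card_insert_le _ _
  · have : (s.setArr a_mark l 1).marked = s.marked := by
      ext j
      simp only [State.marked, Finset.mem_filter, Finset.mem_range, setArr_var, setArr_arr, true_and]
      refine and_congr_right fun hj => ?_
      rw [if_neg (by omega)]
    rw [this]
    omega

/-- Needed for arbitrary states: a branch whose digits describe no pair of representatives must not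
mark too many labels either. -/
theorem card_marked_mark (s : State) : (mark.exec s).marked.card ≤ s.marked.card + 1 := by
  simp only [mark, exec]
  refine marked_setArr_card.trans ?_
  apply le_of_eq
  congr 2

/-- For a correct guess, the digits are the positions of `a` and `b`, and the new mark is the label
of the first column that separates them, exactly the choice encoded in `exists_word`. -/
theorem exec_mark {s : State} (hdl : ∀ c < s.var v_N, s.arr a_div c < s.var v_N) {a b i j w : ℕ}
    (ha : a ∈ s.reps) (hb : b ∈ s.reps) (hai : (s.reps.filter (· < a)).card = i)
    (hbj : (s.reps.filter (· < b)).card = j) (hi : i < s.var v_K) (hj : j < s.var v_K)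
    (hne : ¬ Agree (s.var v_N) s.mat (s.arr a_div) s.marked a b)
    (hw : s.var v_rest = i + s.var v_K * (j + s.var v_K * w)) (hW : s.var v_rest ≤ s.var v_W) :
    (mark.exec s).var v_rest = w ∧ (mark.exec s).marked =
      insert (s.arr a_div (firstSep (s.var v_N) s.mat (s.arr a_div) s.marked a b)) s.marked := by
  obtain ⟨hi1, hr1⟩ := exec_digit (i := v_i) (s := s) (by decide) (by decide) hi hw hW
  set s1 := (digit v_i).exec s with hs1
  have t1 : SameTest s s1 := SameTest.exec _ (by decide) (by decide)
  have m1 : s1.marked = s.marked := t1.eq_marked (exec_arr (by decide) _)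
  have hle : s1.var v_rest ≤ s.var v_rest := by
    rw [hr1, hw]
    have := Nat.le_mul_of_pos_left (j + s.var v_K * w) (show 0 < s.var v_K by omega)
    omega
  obtain ⟨hi2, hr2⟩ := exec_digit (i := v_j) (s := s1) (w := w) (by decide) (by decide)
    (by rw [t1.K]; exact hj) (by rw [t1.K]; exact hr1) (by rw [t1.W]; omega)
  set s2 := (digit v_j).exec s1 with hs2
  have t2 : SameTest s s2 := t1.trans (SameTest.exec _ (by decide) (by decide))
  have m2 : s2.marked = s.marked := by
    rw [← m1]
    exact (SameTest.exec _ (by decide) (by decide)).eq_marked (exec_arr (by decide) _)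
  have hi2' : s2.var v_i = i := by rw [hs2, exec_var (by decide)]; exact hi1
  have r2 : s2.reps = s.reps := t2.eq_reps m2
  have e3 : (Term.nthRep v_i).eval s2 = a :=
    Term.eval_nthRep (by decide) (by rw [t2.N, t2.div]; exact hdl) (by rw [r2]; exact ha)
      (by rw [r2, hi2']; exact hai)
  have e4 : (Term.nthRep v_j).eval (s2.setVar v_a a) = b := by
    have r3 : (s2.setVar v_a a).reps = s.reps := by rw [setVar_reps (by decide) (by decide), r2]
    refine Term.eval_nthRep (by decide) (by simpa [setVar_var, t2.N, t2.div] using hdl)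
      (by rw [r3]; exact hb) ?_
    rw [r3, setVar_var_ne _ _ (by decide), hi2, hbj]
  set s4 := (s2.setVar v_a a).setVar v_b b with hs4
  have t4 : SameTest s s4 :=
    (t2.trans (SameTest.setVar (by decide))).trans (SameTest.setVar (by decide))
  have m4 : s4.marked = s.marked := by
    rw [← m2]
    exact ((SameTest.setVar (by decide)).trans (SameTest.setVar (by decide))).eq_marked rfl
  have a4 : s4.var v_a = a := by simp [hs4, setVar_var]
  have b4 : s4.var v_b = b := by simp [hs4]
  have hsep := firstSep_spec hne
  set c := firstSep (s.var v_N) s.mat (s.arr a_div) s.marked a b with hc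
  have e5 : (Term.first 47 48 v_N (Term.differ v_a v_b 47)).eval s4 = c := by
    obtain ⟨h1, h2, h3⟩ := Term.first_spec (s := s4) (x := 47) (y := 48) (v := v_N) (by decide)
      (t := Term.differ v_a v_b 47)
      (p := fun c => s.arr a_div c ∉ s.marked ∧ s.mat a c ≠ s.mat b c) (fun z hz l => by
        have t5 : SameTest s ((s4.setVar 48 l).setVar 47 z) :=
          (t4.trans (SameTest.setVar (by decide))).trans (SameTest.setVar (by decide))
        rw [Term.differ_iff (by decide) (by decide) (by rw [t5.N, t5.div]; exact hdl)
          (by simpa [setVar_var] using hz), t5.div, t5.eq_mat]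
        have m5 : ((s4.setVar 48 l).setVar 47 z).marked = s.marked := by
          rw [← m4]
          exact ((SameTest.setVar (by decide)).trans (SameTest.setVar (by decide))).eq_marked rfl
        rw [m5]
        simp [setVar_var, a4, b4])
      (by decide) ⟨c, by rw [t4.N]; exact hsep.1, hsep.2⟩
    rw [t4.N] at h1
    refine le_antisymm ?_ ?_
    · by_contra h
      exact h3 c (by omega) hsep.2
    · exact Nat.sInf_le ⟨h1, h2⟩
  have hexec : mark.exec s = (s4.setVar v_c c).setArr a_mark (s.arr a_div c) 1 := by
    simp only [mark, exec]
    rw [← hs1, ← hs2, e3, e4, ← hs4, e5, Term.eval_lit, Term.eval_get, Term.eval_var,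
      setVar_var_self, setVar_arr, t4.div]
  rw [hexec]
  constructor
  · rw [setArr_var, setVar_var_ne _ _ (by decide), hs4]
    simp only [setVar_var]
    simp [hr2]
  · rw [marked_setArr]
    · rw [← m4]
      rfl
    · rw [setVar_var_ne _ _ (by decide), t4.N]
      exact hdl c hsep.1

/-- Set `v_ok` if there are few representatives. -/
def checkReps : Cmd := .ite (.lt Term.numReps (.var v_K)) (.assign v_ok (.lit 1)) .skip

/-- Set `v_ok` if there are few representatives, and mark another label otherwise. -/
def markStep : Cmd := .ite (.lt Term.numReps (.var v_K)) (.assign v_ok (.lit 1)) mark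

/-- One branch of the poorness test. -/
def testBranch : Cmd :=
  .seq (fill a_mark v_y v_N (.lit 0)) (.seq (.assign v_rest (.var v_word))
    (.seq (.loop v_step v_L markStep) checkReps))

/-- The poorness test for the interval that arises by merging at `v_x`; the result is `v_ok`. -/
def testPoor : Cmd := .seq (.assign v_ok (.lit 0)) (.loop v_word v_W testBranch)

theorem lt_numReps_iff {s : State} (hdl : ∀ c < s.var v_N, s.arr a_div c < s.var v_N) :
    (Term.lt Term.numReps (.var v_K)).eval s ≠ 0 ↔ s.reps.card < s.var v_K := by
  rw [Term.lt_iff, Term.eval_numReps hdl, Term.eval_var]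

theorem marked_fill (s : State) : ((fill a_mark v_y v_N (.lit 0)).exec s).marked = ∅ := by
  have h := exec_fill (a := a_mark) (y := v_y) (v := v_N) (t := .lit 0) (s := s) (g := fun _ => 0)
    (fun _ _ _ _ _ _ => rfl)
  ext l
  simp only [State.marked, Finset.mem_filter, Finset.mem_range, h, Finset.notMem_empty, iff_false]
  rw [exec_var (by decide)]
  rintro ⟨h1, h2⟩
  rw [if_pos h1] at h2
  exact h2 rfl

/-- The set whose poorness is tested is poor. -/
def IsPoorAt (s : State) : Prop :=
  Poor (s.var v_N) s.mat (s.var v_K) (s.var v_L) (s.arr a_div)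
    (mergedPart (s.var v_N) (s.arr a_div) (s.var v_x))

theorem SameTest.isPoorAt {s s' : State} (h : SameTest s s') : IsPoorAt s' ↔ IsPoorAt s := by
  rw [IsPoorAt, IsPoorAt, h.N, h.eq_mat, h.K, h.L, h.div, h.x]

/-- A branch marks at most one label in each of its `L` steps. Whenever it finds few
representatives, the marked labels are a witness of poorness. -/
theorem testBranch_sound {s : State} (hdl : ∀ c < s.var v_N, s.arr a_div c < s.var v_N)
    (h : (testBranch.exec s).var v_ok ≠ 0) : s.var v_ok ≠ 0 ∨ IsPoorAt s := by
  set s1 := (fill a_mark v_y v_N (.lit 0)).exec s with hs1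
  set s2 := s1.setVar v_rest (s1.var v_word) with hs2
  set s3 := (loop v_step v_L markStep).exec s2 with hs3
  have t2 : SameTest s s2 := (SameTest.exec (fill a_mark v_y v_N (.lit 0)) (by decide)
    (by decide)).trans (SameTest.setVar (by decide))
  have ok2 : s2.var v_ok = s.var v_ok := by
    rw [hs2, setVar_var_ne _ _ (by decide), hs1, exec_var (by decide)]
  have m2 : s2.marked = ∅ := marked_fill s
  have hpoor : ∀ s', SameTest s s' → s'.marked.card ≤ s.var v_L → s'.reps.card < s'.var v_K →
      IsPoorAt s := fun s' ht hm hr => by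
    rw [← ht.isPoorAt]
    exact ⟨s'.marked, by rw [ht.L]; exact hm, hr⟩
  have key : SameTest s s3 ∧ s3.marked.card ≤ s2.var v_L ∧
      (s3.var v_ok ≠ 0 → s.var v_ok ≠ 0 ∨ IsPoorAt s) := by
    refine exec_loop_induction (P := fun i s' => SameTest s s' ∧ s'.marked.card ≤ i ∧
      (s'.var v_ok ≠ 0 → s.var v_ok ≠ 0 ∨ IsPoorAt s)) ⟨t2, by simp [m2], fun h => ?_⟩ ?_
    · rw [ok2] at h; exact .inl h
    · rintro i hi s' ⟨h1, h2, h3⟩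
      have h1' : SameTest s (s'.setVar v_step i) := h1.trans (SameTest.setVar (by decide))
      have h2' : (s'.setVar v_step i).marked = s'.marked :=
        (SameTest.setVar (s := s') (by decide)).eq_marked rfl
      have hok : (s'.setVar v_step i).var v_ok = s'.var v_ok := setVar_var_ne _ _ (by decide)
      generalize s'.setVar v_step i = s'' at h1' h2' hok
      rw [t2.L] at hi
      simp only [markStep, exec]
      split_ifs with hc
      · rw [lt_numReps_iff (by rw [h1'.N, h1'.div]; exact hdl)] at hc
        refine ⟨h1'.trans (SameTest.setVar (by decide)), ?_, fun _ => .inr ?_⟩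
        · have : (s''.setVar v_ok 1).marked = s''.marked := rfl
          rw [Term.eval_lit, this, h2']
          omega
        · exact hpoor _ h1' (by rw [h2']; omega) hc
      · refine ⟨h1'.trans (SameTest.exec _ (by decide) (by decide)), ?_, fun h => h3 ?_⟩
        · have := card_marked_mark s''
          rw [h2'] at this
          omega
        · rw [exec_var (by decide), hok] at h
          exact h
  obtain ⟨t3, m3, k3⟩ := key
  have hex : testBranch.exec s = checkReps.exec s3 := rfl
  rw [hex] at h
  simp only [checkReps, exec] at h
  split_ifs at h with hc
  · rw [lt_numReps_iff (by rw [t3.N, t3.div]; exact hdl)] at hc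
    exact .inr (hpoor s3 t3 (by rw [t2.L] at m3; exact m3) hc)
  · exact k3 h

theorem testBranch_mono {s : State} (h : s.var v_ok ≠ 0) : (testBranch.exec s).var v_ok ≠ 0 := by
  set s2 := ((fill a_mark v_y v_N (.lit 0)).exec s).setVar v_rest
    (((fill a_mark v_y v_N (.lit 0)).exec s).var v_word) with hs2
  have ok2 : s2.var v_ok = s.var v_ok := by
    rw [hs2, setVar_var_ne _ _ (by decide), exec_var (by decide)]
  have h3 : ((loop v_step v_L markStep).exec s2).var v_ok ≠ 0 := by
    refine exec_loop_induction (P := fun _ s' => s'.var v_ok ≠ 0) (by rwa [ok2]) ?_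
    intro i _ s' h'
    simp only [markStep, exec]
    split_ifs
    · simp
    · rw [exec_var (by decide), setVar_var_ne _ _ (by decide)]
      exact h'
  have hex : testBranch.exec s = checkReps.exec ((loop v_step v_L markStep).exec s2) := rfl
  rw [hex]
  simp only [checkReps, exec]
  split_ifs
  · simp
  · exact h3

/-- The branch belonging to the word for a witness `Y` either succeeds early or marks a new label of
`Y` in every step. After `L` steps all of `Y` is marked, and the final check succeeds. The word
depends only on the parameters of the test, so it can be chosen before the state in which the branch
starts. -/
theorem exists_testBranch_complete {s : State} (hdl : ∀ c < s.var v_N, s.arr a_div c < s.var v_N)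
    (hW : s.var v_W = (s.var v_K * s.var v_K) ^ s.var v_L) (hp : IsPoorAt s) :
    ∃ w < s.var v_W, ∀ s', SameTest s s' → s'.var v_word = w →
      (testBranch.exec s').var v_ok ≠ 0 := by
  obtain ⟨Y, hYL, hYK⟩ := hp
  have hK : 0 < s.var v_K := by omega
  obtain ⟨word, hlt, hword⟩ := exists_word hYK
  refine ⟨word (s.var v_L) ∅, by rw [hW]; exact hlt _ _, fun s' ht hw => ?_⟩
  set s2 := ((fill a_mark v_y v_N (.lit 0)).exec s').setVar v_rest
    (((fill a_mark v_y v_N (.lit 0)).exec s').var v_word) with hs2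
  have t2 : SameTest s s2 := (ht.trans (SameTest.exec (fill a_mark v_y v_N (.lit 0)) (by decide)
    (by decide))).trans (SameTest.setVar (by decide))
  have m2 : s2.marked = ∅ := marked_fill s'
  have r2 : s2.var v_rest = word (s.var v_L) ∅ := by
    rw [hs2, setVar_var_self, exec_var (by decide), hw]
  have reps_eq : ∀ s'', SameTest s s'' → s''.reps = reps (s.var v_N) s.mat (s.arr a_div) s''.marked
      (mergedPart (s.var v_N) (s.arr a_div) (s.var v_x)) := fun s'' h => by
    rw [State.reps, h.N, h.eq_mat, h.div, h.x]
  have key : SameTest s ((loop v_step v_L markStep).exec s2) ∧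
      (((loop v_step v_L markStep).exec s2).var v_ok ≠ 0 ∨
        (((loop v_step v_L markStep).exec s2).marked ⊆ Y ∧
          ((loop v_step v_L markStep).exec s2).marked.card = s2.var v_L ∧
          ((loop v_step v_L markStep).exec s2).var v_rest =
            word (s.var v_L - s2.var v_L) ((loop v_step v_L markStep).exec s2).marked)) := by
    refine exec_loop_induction (P := fun i s' => SameTest s s' ∧ (s'.var v_ok ≠ 0 ∨
      (s'.marked ⊆ Y ∧ s'.marked.card = i ∧ s'.var v_rest = word (s.var v_L - i) s'.marked)))
      ⟨t2, .inr ⟨by simp [m2], by simp [m2], by rw [r2, m2, Nat.sub_zero]⟩⟩ ?_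
    rintro i hi s1 ⟨h1, h2⟩
    have h1' : SameTest s (s1.setVar v_step i) := h1.trans (SameTest.setVar (by decide))
    have h2' : (s1.setVar v_step i).marked = s1.marked :=
      (SameTest.setVar (s := s1) (by decide)).eq_marked rfl
    have hok : (s1.setVar v_step i).var v_ok = s1.var v_ok := setVar_var_ne _ _ (by decide)
    have hrest : (s1.setVar v_step i).var v_rest = s1.var v_rest := setVar_var_ne _ _ (by decide)
    generalize s1.setVar v_step i = s'' at h1' h2' hok hrest
    rw [t2.L] at hi
    rw [← h2', ← hok, ← hrest] at h2
    have hdl' : ∀ c < s''.var v_N, s''.arr a_div c < s''.var v_N := by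
      rw [h1'.N, h1'.div]; exact hdl
    simp only [markStep, exec]
    split_ifs with hc
    · exact ⟨h1'.trans (SameTest.setVar (by decide)), .inl (by simp)⟩
    · refine ⟨h1'.trans (SameTest.exec _ (by decide) (by decide)), ?_⟩
      rw [lt_numReps_iff hdl', not_lt, h1'.K, reps_eq _ h1'] at hc
      rcases h2 with h2 | ⟨hY, hcard, hr⟩
      · exact .inl (by rw [exec_var (by decide)]; exact h2)
      · obtain ⟨a, ha, b, hb, d, hd, d', hd', ra, rb, hne, hin, hwd⟩ :=
          hword (s.var v_L - (i + 1)) s''.marked hc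
        rw [show s.var v_L - (i + 1) + 1 = s.var v_L - i by omega] at hwd
        rw [← reps_eq _ h1'] at ha hb ra rb
        have hle : word (s.var v_L - i) s''.marked ≤ s.var v_W := by
          refine (hlt _ _).le.trans ?_
          rw [hW]
          exact Nat.pow_le_pow_right (Nat.mul_pos hK hK) (by omega)
        obtain ⟨e1, e2⟩ := exec_mark hdl' ha hb ra rb (by rw [h1'.K]; exact hd)
          (by rw [h1'.K]; exact hd') (by rw [h1'.N, h1'.eq_mat, h1'.div]; exact hne)
          (by rw [hr, hwd, h1'.K]) (by rw [hr, h1'.W]; exact hle)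
        rw [h1'.N, h1'.eq_mat, h1'.div] at e2
        have hnot := (firstSep_spec hne).2.1
        refine .inr ⟨?_, ?_, ?_⟩
        · rw [e2]; exact Finset.insert_subset hin hY
        · rw [e2, Finset.card_insert_of_notMem hnot, hcard]
        · rw [e1, e2]
  obtain ⟨t3, h3⟩ := key
  have hex : testBranch.exec s' = checkReps.exec ((loop v_step v_L markStep).exec s2) := rfl
  rw [hex]
  generalize (loop v_step v_L markStep).exec s2 = s3 at t3 h3
  simp only [checkReps, exec]
  split_ifs with hc
  · simp
  · rcases h3 with h3 | ⟨h3, h4, -⟩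
    · exact h3
    · refine absurd ?_ hc
      rw [lt_numReps_iff (by rw [t3.N, t3.div]; exact hdl), reps_eq _ t3, t3.K]
      -- `L` marked labels inside a witness with at most `L` labels: the marks are the whole
      -- witness.
      rw [Finset.eq_of_subset_of_card_le h3 (by rw [h4, t2.L]; exact hYL)]
      exact hYK

theorem exec_testPoor {s : State} (hdl : ∀ c < s.var v_N, s.arr a_div c < s.var v_N)
    (hW : s.var v_W = (s.var v_K * s.var v_K) ^ s.var v_L) :
    (testPoor.exec s).var v_ok ≠ 0 ↔ IsPoorAt s := by
  set s1 := s.setVar v_ok 0 with hs1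
  have t1 : SameTest s s1 := SameTest.setVar (by decide)
  have ht : ∀ i s', SameTest s s' → SameTest s (s'.setVar v_word i) :=
    fun i s' h => h.trans (SameTest.setVar (by decide))
  change ((loop v_word v_W testBranch).exec s1).var v_ok ≠ 0 ↔ _
  constructor
  · refine (exec_loop_induction (P := fun i s' => SameTest s s' ∧ (s'.var v_ok ≠ 0 → IsPoorAt s))
      ⟨t1, fun h => absurd (setVar_var_self _ _ _) h⟩ ?_).2
    rintro i _ s' ⟨h1, h2⟩
    have h1' := ht i s' h1
    refine ⟨h1'.trans (SameTest.exec _ (by decide) (by decide)), fun h => ?_⟩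
    rcases testBranch_sound (by rw [h1'.N, h1'.div]; exact hdl) h with h | h
    · rw [setVar_var_ne _ _ (by decide)] at h
      exact h2 h
    · exact h1'.isPoorAt.1 h
  · intro hp
    obtain ⟨w, hw, hcomp⟩ := exists_testBranch_complete hdl hW hp
    refine (exec_loop_induction (P := fun i s' => SameTest s s' ∧ (w < i → s'.var v_ok ≠ 0))
      ⟨t1, fun h => absurd h (by omega)⟩ ?_).2 (by rw [t1.W]; exact hw)
    rintro i _ s' ⟨h1, h2⟩
    have h1' := ht i s' h1
    refine ⟨h1'.trans (SameTest.exec _ (by decide) (by decide)), fun h => ?_⟩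
    rcases Nat.lt_succ_iff_lt_or_eq.1 h with h | h
    · exact testBranch_mono (by rw [setVar_var_ne _ _ (by decide)]; exact h2 h)
    · exact hcomp _ h1' (by rw [setVar_var_self, h])

end Cmd
end TwinWidth

/-! ### Merging classes and recording the chain of labellings. -/

namespace TwinWidth

theorem mergeLabels_congr {N : ℕ} {f g : ℕ → ℕ} (h : ∀ x < N, f x = g x) {r r' y : ℕ}
    (hr : r < N) (hr' : r' < N) (hy : y < N) : mergeLabels f r r' y = mergeLabels g r r' y := by
  rw [mergeLabels, mergeLabels, h r hr, h r' hr', h y hy]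

theorem Good.congr {N : ℕ} {M : ℕ → ℕ → ℕ} {F E : ℕ} {dl ρ ρ' τ τ' : ℕ → ℕ}
    (hg : Good N M F E dl ρ τ) (hρ : ∀ x < N, ρ x = ρ' x) (hτ : ∀ x < N, τ x = τ' x) :
    Good N M F E dl ρ' τ' where
  mono := hg.mono
  coarse x hx y hy e := hg.coarse x hx y hy (by rw [hτ x hx, hτ y hy, e])
  refine x hx y hy e := by
    rw [← hτ x hx, ← hτ y hy]
    exact hg.refine x hx y hy (by rw [hρ x hx, hρ y hy, e])
  count a := (card_image_le_card_image _ _ ρ fun x hx y hy e => by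
    rw [← hρ x (mem_part.1 hx).1, ← hρ y (mem_part.1 hy).1, e]).trans (hg.count a)
  err r hr := by
    have : errLabels N M dl τ' r ⊆ errLabels N M dl τ r := by
      refine Finset.image_subset_image fun c hc => ?_
      simp only [Finset.mem_filter, Finset.mem_range] at hc ⊢
      obtain ⟨hc, r', hr', c', hc', e1, e2, hne⟩ := hc
      exact ⟨hc, r', hr', c', hc', by rw [hτ _ hr', hτ _ hr, e1], by rw [hτ _ hc', hτ _ hc, e2], hne⟩
    exact (Finset.card_le_card this).trans (hg.err r hr)

/-- The array in memory is known to be the last labelling only below `N`, hence the hypothesis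
`hcur` in place of an equality of functions. -/
theorem IsChain.extend {N h : ℕ} {M : ℕ → ℕ → ℕ} {F E T : ℕ} {Q : ℕ → ℕ → ℕ}
    (hQ : IsChain N h M F E T Q) {cur dl : ℕ → ℕ} {r r' : ℕ} (hcur : ∀ x < N, cur x = Q T x)
    (hr : r < N) (hr' : r' < N) (hne : cur r ≠ cur r')
    (hg : Good N M F E dl cur (mergeLabels cur r r')) (hd : IsDiv N h dl) :
    IsChain N h M F E (T + 1) fun t => if t ≤ T then Q t else mergeLabels cur r r' where
  start := by simpa using hQ.start
  step t ht := by
    by_cases htT : t < T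
    · obtain ⟨a, ha, b, hb, h1, h2, h3⟩ := hQ.step t htT
      refine ⟨a, ha, b, hb, ?_⟩
      simp only [if_pos htT.le, if_pos (show t + 1 ≤ T by omega)]
      exact ⟨h1, h2, h3⟩
    · obtain rfl : t = T := by omega
      refine ⟨r, hr, r', hr', ?_⟩
      simp only [le_refl, if_true, if_neg (show ¬ t + 1 ≤ t by omega)]
      refine ⟨by rw [← hcur r hr, ← hcur r' hr']; exact hne,
        fun y hy => mergeLabels_congr hcur hr hr' hy, dl, hg.congr hcur fun _ _ => rfl, hd⟩

namespace Cmd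

/-- Merge the classes of `v_r` and `v_s` in the labelling `a`. -/
def merge (a : ℕ) : Cmd :=
  .seq (.assign v_a (.get a (.var v_r))) (.seq (.assign v_b (.get a (.var v_s)))
    (fill a v_y v_N (.ite (.eq (.get a (.var v_y)) (.var v_a)) (.var v_b) (.get a (.var v_y)))))

/-- Merge all classes of the labelling `a` that contain related elements, and execute `post` after
every merge. -/
def unionPass (a : ℕ) (cond : Term) (post : Cmd) : Cmd :=
  .loop v_r v_N (.loop v_s v_N (.ite (Term.and cond
    (Term.not (.eq (.get a (.var v_r)) (.get a (.var v_s))))) (.seq (merge a) post) .skip))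

theorem exec_merge {a : ℕ} {s : State} {y : ℕ} (hy : y < s.var v_N) :
    ((merge a).exec s).arr a y = mergeLabels (s.arr a) (s.var v_r) (s.var v_s) y := by
  have key := exec_fill (a := a) (y := v_y) (v := v_N)
    (s := (s.setVar v_a (s.arr a (s.var v_r))).setVar v_b (s.arr a (s.var v_s)))
    (t := .ite (.eq (.get a (.var v_y)) (.var v_a)) (.var v_b) (.get a (.var v_y)))
    (g := mergeLabels (s.arr a) (s.var v_r) (s.var v_s)) (fun i hi s' h1 h2 h3 => by
      simp only [Term.eval, h1, mergeLabels, setVar_var]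
      simp [h3 i le_rfl]) y
  rw [if_pos (by simpa [setVar_var] using hy)] at key
  exact key

/-- If `J` is an invariant of the merges of classes of related elements, then it holds at the end,
and related elements are in the same class. -/
theorem exec_unionPass {a : ℕ} {cond : Term} {post : Cmd} {N : ℕ} {J : State → Prop}
    {C : ℕ → ℕ → Prop} (ha : post.keepsArr a = true) (hr : post.keepsVar v_r = true)
    (hJN : ∀ s, J s → s.var v_N = N)
    (hJr : ∀ s v, J s → J (s.setVar v_r v)) (hJs : ∀ s v, J s → J (s.setVar v_s v))
    (hC : ∀ s, J s → s.var v_r < N → s.var v_s < N →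
      (cond.eval s ≠ 0 ↔ C (s.var v_r) (s.var v_s)))
    (hstep : ∀ s, J s → s.var v_r < N → s.var v_s < N → C (s.var v_r) (s.var v_s) →
      s.arr a (s.var v_r) ≠ s.arr a (s.var v_s) → J (post.exec ((merge a).exec s)))
    {s : State} (h : J s) : J ((unionPass a cond post).exec s) ∧
      ∀ x < N, ∀ y < N, C x y → ((unionPass a cond post).exec s).arr a x =
        ((unionPass a cond post).exec s).arr a y := by
  set body : Cmd := .ite (Term.and cond
    (Term.not (.eq (.get a (.var v_r)) (.get a (.var v_s))))) (.seq (merge a) post) .skip with hb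
  -- A merge never separates elements, so pairs treated earlier stay together, and a single pass
  -- over all pairs is enough.
  have step : ∀ s', J s' → s'.var v_r < N → s'.var v_s < N → J (body.exec s') ∧
      (∀ x < N, ∀ y < N, s'.arr a x = s'.arr a y →
        (body.exec s').arr a x = (body.exec s').arr a y) ∧
      (C (s'.var v_r) (s'.var v_s) → (body.exec s').arr a (s'.var v_r) =
        (body.exec s').arr a (s'.var v_s)) ∧ (body.exec s').var v_r = s'.var v_r := by
    intro s' hJ h1 h2
    simp only [hb, exec]
    split_ifs with hc
    · rw [Term.and_iff, Term.not_iff, Term.eq_iff, hC s' hJ h1 h2] at hc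
      have hm : ∀ y < N, (post.exec ((merge a).exec s')).arr a y =
          mergeLabels (s'.arr a) (s'.var v_r) (s'.var v_s) y := fun y hy => by
        rw [exec_arr ha]
        exact exec_merge (by rw [hJN s' hJ]; exact hy)
      refine ⟨hstep s' hJ h1 h2 hc.1 hc.2, fun x hx y hy e => ?_, fun _ => ?_, ?_⟩
      · rw [hm x hx, hm y hy, mergeLabels_eq_iff]
        exact .inl e
      · rw [hm _ h1, hm _ h2, mergeLabels_eq_iff]
        exact .inr ⟨.inl rfl, .inr rfl⟩
      · rw [exec_var hr]
        exact exec_var (by simp [merge, fill, keepsVar]) _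
    · rw [Term.and_iff, Term.not_iff, Term.eq_iff, hC s' hJ h1 h2] at hc
      refine ⟨hJ, fun _ _ _ _ e => e, fun h => ?_, rfl⟩
      by_contra hne
      exact hc ⟨h, hne⟩
  have inner : ∀ i < N, ∀ s', J s' → s'.var v_r = i → J ((loop v_s v_N body).exec s') ∧
      (∀ x < N, ∀ y < N, s'.arr a x = s'.arr a y →
        ((loop v_s v_N body).exec s').arr a x = ((loop v_s v_N body).exec s').arr a y) ∧
      (∀ y < N, C i y → ((loop v_s v_N body).exec s').arr a i =
        ((loop v_s v_N body).exec s').arr a y) := by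
    intro i hi s' hJ hri
    have := exec_loop_induction (x := v_s) (v := v_N) (c := body) (s := s')
      (P := fun j s'' => J s'' ∧ s''.var v_r = i ∧
        (∀ x < N, ∀ y < N, s'.arr a x = s'.arr a y → s''.arr a x = s''.arr a y) ∧
        (∀ y < N, y < j → C i y → s''.arr a i = s''.arr a y))
      ⟨hJ, hri, fun _ _ _ _ e => e, fun _ _ h => absurd h (by omega)⟩ ?_
    · rw [hJN s' hJ] at this
      exact ⟨this.1, this.2.2.1, fun y hy => this.2.2.2 y hy hy⟩
    · rintro j hj s'' ⟨h1, h2, h3, h4⟩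
      rw [hJN s' hJ] at hj
      have hr' : (s''.setVar v_s j).var v_r = i := by rw [setVar_var_ne _ _ (by decide), h2]
      have hs' : (s''.setVar v_s j).var v_s = j := setVar_var_self _ _ _
      obtain ⟨g1, g2, g3, g4⟩ := step _ (hJs s'' j h1) (by omega) (by omega)
      refine ⟨g1, by omega, fun x hx y hy e => g2 x hx y hy (h3 x hx y hy e), fun y hy hyj hC => ?_⟩
      rcases Nat.lt_succ_iff_lt_or_eq.1 hyj with hyj | rfl
      · exact g2 i hi y hy (h4 y hy hyj hC)
      · rw [hr', hs'] at g3
        exact g3 hC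
  have := exec_loop_induction (x := v_r) (v := v_N) (c := .loop v_s v_N body) (s := s)
    (P := fun i s' => J s' ∧ ∀ x < N, x < i → ∀ y < N, C x y → s'.arr a x = s'.arr a y)
    ⟨h, fun _ _ h => absurd h (by omega)⟩ ?_
  · rw [hJN s h] at this
    exact ⟨this.1, fun x hx => this.2 x hx hx⟩
  · rintro i hi s' ⟨h1, h2⟩
    rw [hJN s h] at hi
    obtain ⟨g1, g2, g3⟩ := inner i hi (s'.setVar v_r i) (hJr s' i h1) (setVar_var_self _ _ _)
    refine ⟨g1, fun x hx hxi y hy hC => ?_⟩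
    rcases Nat.lt_succ_iff_lt_or_eq.1 hxi with hxi | rfl
    · exact g2 x hx y hy (h2 x hx hxi y hy hC)
    · exact g3 y hy hC

/-- Append the current labelling to the output. -/
def snapshot : Cmd :=
  .seq (.loop v_y v_N (.store a_out (.add (.var v_pos) (.var v_y)) (.get a_cur (.var v_y))))
    (.assign v_pos (.add (.var v_pos) (.var v_N)))

theorem exec_snapshot (s : State) :
    (snapshot.exec s).var v_pos = s.var v_pos + s.var v_N ∧
    (∀ i < s.var v_pos, (snapshot.exec s).arr a_out i = s.arr a_out i) ∧
    (∀ y < s.var v_N, (snapshot.exec s).arr a_out (s.var v_pos + y) = s.arr a_cur y) := by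
  set s1 := (loop v_y v_N (.store a_out (.add (.var v_pos) (.var v_y)) (.get a_cur (.var v_y)))).exec s
    with hs1
  have key : s1.var v_pos = s.var v_pos ∧ s1.var v_N = s.var v_N ∧ s1.arr a_cur = s.arr a_cur ∧
      (∀ i < s.var v_pos, s1.arr a_out i = s.arr a_out i) ∧
      (∀ y < s.var v_N, s1.arr a_out (s.var v_pos + y) = s.arr a_cur y) := by
    refine ⟨exec_var (by decide) s, exec_var (by decide) s, exec_arr (by decide) s, ?_⟩
    refine (exec_loop_induction (P := fun j s' => s'.var v_pos = s.var v_pos ∧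
      s'.arr a_cur = s.arr a_cur ∧ (∀ i < s.var v_pos, s'.arr a_out i = s.arr a_out i) ∧
      (∀ y < j, s'.arr a_out (s.var v_pos + y) = s.arr a_cur y))
      ⟨rfl, rfl, fun _ _ => rfl, fun _ h => absurd h (by omega)⟩ ?_).2.2
    rintro j hj s' ⟨h1, h2, h3, h4⟩
    have hp : (s'.setVar v_y j).var v_pos = s.var v_pos := by
      rw [setVar_var_ne _ _ (by decide), h1]
    refine ⟨hp, ?_, fun i hi => ?_, fun y hy => ?_⟩
    · funext i
      simp [exec, setArr_arr, h2]
    · simp only [exec, setArr_arr, Term.eval, hp, setVar_var_self, true_and, setVar_arr]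
      rw [if_neg (by omega)]
      exact h3 i hi
    · simp only [exec, setArr_arr, Term.eval, hp, setVar_var_self, true_and, setVar_arr]
      split_ifs with e
      · rw [h2, show y = j by omega]
      · exact h4 y (by omega)
  have hex : snapshot.exec s = s1.setVar v_pos (s1.var v_pos + s1.var v_N) := rfl
  obtain ⟨k1, k2, k3, k4, k5⟩ := key
  rw [hex]
  exact ⟨by rw [setVar_var_self, k1, k2], k4, k5⟩

/-- The output is a chain of labellings that ends with the current one. -/
def ChainState (N h : ℕ) (M : ℕ → ℕ → ℕ) (F E : ℕ) (s : State) : Prop :=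
  ∃ T Q, IsChain N h M F E T Q ∧ (∀ x < N, s.arr a_cur x = Q T x) ∧ s.var v_pos = (T + 1) * N ∧
    ∀ t ≤ T, ∀ x < N, s.arr a_out (t * N + x) = Q t x

theorem ChainState.congr {N h : ℕ} {M : ℕ → ℕ → ℕ} {F E : ℕ} {s s' : State}
    (hs : ChainState N h M F E s) (h1 : ∀ x < N, s'.arr a_cur x = s.arr a_cur x)
    (h2 : s'.var v_pos = s.var v_pos) (h3 : s'.arr a_out = s.arr a_out) :
    ChainState N h M F E s' := by
  obtain ⟨T, Q, k1, k2, k3, k4⟩ := hs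
  exact ⟨T, Q, k1, fun x hx => (h1 x hx).trans (k2 x hx), h2.trans k3, by rw [h3]; exact k4⟩

theorem ChainState.merge {N h : ℕ} {M : ℕ → ℕ → ℕ} {F E : ℕ} {s : State}
    (hs : ChainState N h M F E s) (hN : s.var v_N = N) (h1 : s.var v_r < N) (h2 : s.var v_s < N)
    (hne : s.arr a_cur (s.var v_r) ≠ s.arr a_cur (s.var v_s)) {dl : ℕ → ℕ} (hd : IsDiv N h dl)
    (hg : Good N M F E dl (s.arr a_cur) (mergeLabels (s.arr a_cur) (s.var v_r) (s.var v_s))) :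
    ChainState N h M F E (snapshot.exec ((merge a_cur).exec s)) := by
  obtain ⟨T, Q, k1, k2, k3, k4⟩ := hs
  set s1 := (Cmd.merge a_cur).exec s with hs1
  have hm : ∀ y < N, s1.arr a_cur y = mergeLabels (s.arr a_cur) (s.var v_r) (s.var v_s) y :=
    fun y hy => exec_merge (by rw [hN]; exact hy)
  have hp1 : s1.var v_pos = (T + 1) * N := by rw [hs1, exec_var (by decide), k3]
  have hN1 : s1.var v_N = N := by rw [hs1, exec_var (by decide), hN]
  have ho1 : s1.arr a_out = s.arr a_out := exec_arr (by decide) _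
  obtain ⟨g1, g2, g3⟩ := exec_snapshot s1
  refine ⟨T + 1, _, k1.extend k2 h1 h2 hne hg hd, fun x hx => ?_, ?_, fun t ht x hx => ?_⟩
  · rw [if_neg (by omega), exec_arr (by decide), hm x hx]
  · rw [g1, hp1, hN1]; ring
  · by_cases htT : t ≤ T
    · rw [if_pos htT, g2, ho1, k4 t htT x hx]
      rw [hp1]
      calc t * N + x < t * N + N := by omega
        _ = (t + 1) * N := by ring
        _ ≤ (T + 1) * N := Nat.mul_le_mul_right N (by omega)
    · obtain rfl : t = T + 1 := by omega
      rw [if_neg htT, ← hp1, g3 x (by rw [hN1]; exact hx), hm x hx]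

/-- Coarsens the current labelling by single merges until it is the equivalence relation `C`. Every
intermediate labelling refines `C`, so `hE` bounds its errors, and the number of classes in an
interval never exceeds the initial one. -/
theorem exec_curPass {N h : ℕ} {M : ℕ → ℕ → ℕ} {F E : ℕ} {dl : ℕ → ℕ} {C : ℕ → ℕ → Prop}
    (hd : IsDiv N h dl) (hCl : ∀ x < N, ∀ y < N, C x y → dl x = dl y)
    (hCs : ∀ x y, C x y → C y x) (hCt : ∀ x y z, C x y → C y z → C x z)
    (hE : ∀ τ : ℕ → ℕ, (∀ x < N, ∀ y < N, τ x = τ y → C x y) →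
      ∀ r < N, (errLabels N M dl τ r).card ≤ E)
    {cond : Term} {I : State → Prop} (hIN : ∀ s, I s → s.var v_N = N)
    (hIr : ∀ s v, I s → I (s.setVar v_r v)) (hIs : ∀ s v, I s → I (s.setVar v_s v))
    (hI : ∀ s, I s → I (snapshot.exec ((merge a_cur).exec s)))
    (hC : ∀ s, I s → s.var v_r < N → s.var v_s < N →
      (cond.eval s ≠ 0 ↔ C (s.var v_r) (s.var v_s)))
    {s : State} (hs : I s) (hchain : ChainState N h M F E s)
    (hcount : ∀ a, ((part N dl a).image (s.arr a_cur)).card ≤ F)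
    (hcur : ∀ x < N, ∀ y < N, s.arr a_cur x = s.arr a_cur y → C x y) :
    I ((unionPass a_cur cond snapshot).exec s) ∧
    ChainState N h M F E ((unionPass a_cur cond snapshot).exec s) ∧
    ∀ x < N, ∀ y < N, ((unionPass a_cur cond snapshot).exec s).arr a_cur x =
      ((unionPass a_cur cond snapshot).exec s).arr a_cur y ↔ C x y := by
  have main := exec_unionPass (a := a_cur) (cond := cond) (post := snapshot) (N := N) (C := C)
    (J := fun s => I s ∧ ChainState N h M F E s ∧
      (∀ a, ((part N dl a).image (s.arr a_cur)).card ≤ F) ∧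
      (∀ x < N, ∀ y < N, s.arr a_cur x = s.arr a_cur y → C x y))
    (by decide) (by decide) (fun s h => hIN s h.1)
    (fun s v h => ⟨hIr s v h.1, h.2.1.congr (fun _ _ => rfl) (setVar_var_ne _ _ (by decide)) rfl,
      h.2.2⟩)
    (fun s v h => ⟨hIs s v h.1, h.2.1.congr (fun _ _ => rfl) (setVar_var_ne _ _ (by decide)) rfl,
      h.2.2⟩)
    (fun s h => hC s h.1) ?_ ⟨hs, hchain, hcount, hcur⟩
  · exact ⟨main.1.1, main.1.2.1, fun x hx y hy => ⟨main.1.2.2.2 x hx y hy, main.2 x hx y hy⟩⟩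
  · rintro s ⟨h1, h2, h3, h4⟩ hr hs hc hne
    have hN := hIN s h1
    have hm : ∀ y < N, (snapshot.exec ((merge a_cur).exec s)).arr a_cur y =
        mergeLabels (s.arr a_cur) (s.var v_r) (s.var v_s) y := fun y hy => by
      rw [exec_arr (by decide)]
      exact exec_merge (by rw [hN]; exact hy)
    have hmC : ∀ x < N, ∀ y < N, mergeLabels (s.arr a_cur) (s.var v_r) (s.var v_s) x =
        mergeLabels (s.arr a_cur) (s.var v_r) (s.var v_s) y → C x y := by
      intro x hx y hy e
      rw [mergeLabels_eq_iff] at e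
      rcases e with e | ⟨e1, e2⟩
      · exact h4 x hx y hy e
      -- The merged elements are related, so everything in the two merged classes is related to
      -- `v_r`.
      · have f1 : C x (s.var v_r) := by
          rcases e1 with e1 | e1
          · exact h4 x hx _ hr e1
          · exact hCt _ _ _ (h4 x hx _ hs e1) (hCs _ _ hc)
        have f2 : C y (s.var v_r) := by
          rcases e2 with e2 | e2
          · exact h4 y hy _ hr e2
          · exact hCt _ _ _ (h4 y hy _ hs e2) (hCs _ _ hc)
        exact hCt _ _ _ f1 (hCs _ _ f2)
    refine ⟨hI s h1, h2.merge hN hr hs hne hd ?_, fun a => ?_, fun x hx y hy e => ?_⟩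
    · exact ⟨hd.mono, fun x hx y hy e => hCl x hx y hy (hmC x hx y hy e),
        fun x _ y _ e => mergeLabels_eq_iff.2 (.inl e), h3, hE _ hmC⟩
    · refine (card_image_le_card_image _ _ (s.arr a_cur) fun x hx y hy e => ?_).trans (h3 a)
      rw [hm x (mem_part.1 hx).1, hm y (mem_part.1 hy).1, mergeLabels_eq_iff]
      exact .inl e
    · rw [hm x hx, hm y hy] at e
      exact hmC x hx y hy e

end Cmd
end TwinWidth

/-! ### One round of the main loop. -/

namespace TwinWidth

namespace Cmd

/-- The parameters of the main algorithm, for the matrix in the array `g`. -/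
structure Params (N h K L : ℕ) (g : ℕ → ℕ) (s : State) : Prop where
  W : s.var v_W = (K * K) ^ L
  N : s.var v_N = N
  h : s.var v_h = h
  K : s.var v_K = K
  L : s.var v_L = L
  mat : s.arr a_mat = g

theorem Params.eq_mat {N h K L : ℕ} {g : ℕ → ℕ} {s : State} (hs : Params N h K L g s) :
    s.mat = matOf N g := by
  rw [State.mat, hs.N, hs.mat]

theorem Params.setVar {N h K L : ℕ} {g : ℕ → ℕ} {s : State} (hs : Params N h K L g s) {x v : ℕ}
    (hx : x ∉ [v_N, v_h, v_K, v_L, v_W]) : Params N h K L g (s.setVar x v) := by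
  simp only [List.mem_cons, List.not_mem_nil, or_false, not_or] at hx
  obtain ⟨h1, h2, h3, h4, h5⟩ := hx
  exact ⟨by rw [setVar_var_ne _ _ (Ne.symm h5), hs.W],
    by rw [setVar_var_ne _ _ (Ne.symm h1), hs.N], by rw [setVar_var_ne _ _ (Ne.symm h2), hs.h],
    by rw [setVar_var_ne _ _ (Ne.symm h3), hs.K], by rw [setVar_var_ne _ _ (Ne.symm h4), hs.L],
    hs.mat⟩

theorem Params.exec {N h K L : ℕ} {g : ℕ → ℕ} {s : State} (hs : Params N h K L g s) (c : Cmd)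
    (hv : ([v_N, v_h, v_K, v_L, v_W].all fun x => c.keepsVar x) = true)
    (ha : c.keepsArr a_mat = true) : Params N h K L g (c.exec s) := by
  simp only [List.all_cons, List.all_nil, Bool.and_true, Bool.and_eq_true] at hv
  exact ⟨by rw [exec_var hv.2.2.2.2, hs.W], by rw [exec_var hv.1, hs.N], by rw [exec_var hv.2.1, hs.h],
    by rw [exec_var hv.2.2.1, hs.K], by rw [exec_var hv.2.2.2.1, hs.L],
    by rw [exec_arr ha, hs.mat]⟩

end Cmd

namespace Term

variable {N h K L : ℕ} {g : ℕ → ℕ} {s : State}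

theorem eval_entry_eq (hs : Cmd.Params N h K L g s) {a b : ℕ} (ha : a ≠ 40) :
    (entry a b).eval s = matOf N g (s.var a) (s.var b) := by
  rw [eval_entry ha, hs.eq_mat]

/-- The rows `v_r` and `v_s` are close. -/
def close : Term :=
  and (.eq (.get a_div (.var v_r)) (.get a_div (.var v_s)))
    (not (.lt (.var v_L) (count 41 v_N (ex 42 v_N (and (.eq (.get a_div (.var 42)) (.var 41))
      (not (.eq (entry v_r 42) (entry v_s 42))))))))

/-- Labels of a division are elements below `N`, so counting the labels below `N` misses none. -/
theorem close_iff (hs : Cmd.Params N h K L g s) (hdl : ∀ c < N, s.arr a_div c < N)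
    (hr : s.var v_r < N) (hr' : s.var v_s < N) :
    close.eval s ≠ 0 ↔ Close N (matOf N g) L (s.arr a_div) (s.var v_r) (s.var v_s) := by
  have hcount : (count 41 v_N (ex 42 v_N (and (.eq (.get a_div (.var 42)) (.var 41))
      (not (.eq (entry v_r 42) (entry v_s 42)))))).eval s =
      (diffLabels N (matOf N g) (s.arr a_div) (s.var v_r) (s.var v_s)).card := by
    rw [eval_count]
    congr 1
    ext l
    have key : ∀ c, (and (.eq (.get a_div (.var 42)) (.var 41))
        (not (.eq (entry v_r 42) (entry v_s 42)))).eval ((s.setVar 41 l).setVar 42 c) ≠ 0 ↔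
        s.arr a_div c = l ∧ matOf N g (s.var v_r) c ≠ matOf N g (s.var v_s) c := by
      intro c
      have hs' : Cmd.Params N h K L g ((s.setVar 41 l).setVar 42 c) :=
        (hs.setVar (by decide)).setVar (by decide)
      rw [and_iff, eq_iff, not_iff, eq_iff, eval_entry_eq hs' (by decide),
        eval_entry_eq hs' (by decide)]
      simp [setVar_var]
    simp only [Finset.mem_filter, Finset.mem_range, ex_iff, key, diffLabels, Finset.mem_image, hs.N,
      setVar_var_ne _ _ (show v_N ≠ 41 by decide)]
    constructor
    · rintro ⟨_, c, hc, e, hne⟩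
      exact ⟨c, ⟨hc, hne⟩, e⟩
    · rintro ⟨c, ⟨hc, hne⟩, e⟩
      exact ⟨e ▸ hdl c hc, c, hc, e, hne⟩
  rw [close, and_iff, eq_iff, not_iff, lt_iff, hcount, Close, eval_var, hs.L, not_lt]
  simp [hr, hr']

/-- The rows in the component of `a` are not equal on the component of `b`. -/
def nonVertical (a b : ℕ) : Term :=
  ex 41 v_N (ex 42 v_N (ex 43 v_N (and (.eq (.get a_comp (.var 41)) (.get a_comp (.var a)))
    (and (.eq (.get a_comp (.var 42)) (.get a_comp (.var a)))
      (and (.eq (.get a_comp (.var 43)) (.get a_comp (.var b)))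
        (not (.eq (entry 41 43) (entry 42 43))))))))

theorem nonVertical_iff (hs : Cmd.Params N h K L g s) {a b : ℕ} (ha : a ∉ [41, 42, 43])
    (hb : b ∉ [41, 42, 43]) : (nonVertical a b).eval s ≠ 0 ↔
      NonVertical N (matOf N g) (s.arr a_comp) (s.var a) (s.var b) := by
  simp only [List.mem_cons, List.not_mem_nil, or_false, not_or] at ha hb
  rw [nonVertical, ex_iff, NonVertical, hs.N]
  refine exists_congr fun r₁ => and_congr_right fun _ => ?_
  rw [ex_iff, setVar_var_ne _ _ (by decide), hs.N]
  refine exists_congr fun r₂ => and_congr_right fun _ => ?_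
  rw [ex_iff, setVar_var_ne _ _ (by decide), setVar_var_ne _ _ (by decide), hs.N]
  refine exists_congr fun c₁ => and_congr_right fun _ => ?_
  have hs' : Cmd.Params N h K L g (((s.setVar 41 r₁).setVar 42 r₂).setVar 43 c₁) :=
    ((hs.setVar (by decide)).setVar (by decide)).setVar (by decide)
  rw [and_iff, and_iff, and_iff, eq_iff, eq_iff, eq_iff, not_iff, eq_iff,
    eval_entry_eq hs' (by decide), eval_entry_eq hs' (by decide)]
  simp [setVar_var, ha, hb]

/-- The rows `v_r` and `v_s` are twins. -/
def twins : Term :=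
  and (.eq (.get a_comp (.var v_r)) (.get a_comp (.var v_s)))
    (all 44 v_N (or (and (nonVertical v_r 44) (nonVertical 44 v_r))
      (.eq (entry v_r 44) (entry v_s 44))))

theorem twins_iff (hs : Cmd.Params N h K L g s) : twins.eval s ≠ 0 ↔
    Twins N (matOf N g) (s.arr a_comp) (s.var v_r) (s.var v_s) := by
  rw [twins, and_iff, eq_iff, all_iff, Twins, hs.N]
  refine and_congr Iff.rfl (forall₂_congr fun c _ => ?_)
  have hs' : Cmd.Params N h K L g (s.setVar 44 c) := hs.setVar (by decide)
  rw [or_iff, and_iff, eq_iff, nonVertical_iff hs' (by decide) (by decide),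
    nonVertical_iff hs' (by decide) (by decide), eval_entry_eq hs' (by decide),
    eval_entry_eq hs' (by decide), Mixed]
  simp only [setVar_var_self, setVar_arr, setVar_var_ne _ _ (show v_r ≠ 44 by decide),
    setVar_var_ne _ _ (show v_s ≠ 44 by decide)]
  tauto

/-- The intervals that meet at the variable `a` can be merged. -/
def eligible (a : ℕ) : Term :=
  and (.eq (.get a_div (.var a)) (.var a))
    (and (not (.eq (.var a) (.lit 0))) (not (.eq (.var a) (.var v_h))))

theorem eligible_iff (hs : Cmd.Params N h K L g s) {a : ℕ} (ha : s.var a < N) :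
    (eligible a).eval s ≠ 0 ↔ Eligible N h (s.arr a_div) (s.var a) := by
  rw [eligible, and_iff, and_iff, eq_iff, not_iff, not_iff, eq_iff, eq_iff, Eligible]
  simp [ha, hs.h]

end Term

theorem IsDiv.congr {N h : ℕ} {dl dl' : ℕ → ℕ} (hd : IsDiv N h dl) (e : ∀ x < N, dl' x = dl x) :
    IsDiv N h dl' where
  mono x y hxy hy := by rw [e x (by omega), e y hy]; exact hd.mono x y hxy hy
  le x hx := by rw [e x hx]; exact hd.le x hx
  idem x hx := by
    have := hd.le x hx
    rw [e x hx, e _ (by omega)]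
    exact hd.idem x hx
  side x hx := by rw [e x hx]; exact hd.side x hx

theorem IsDiv.lt {N h : ℕ} {dl : ℕ → ℕ} (hd : IsDiv N h dl) : ∀ x < N, dl x < N :=
  fun x hx => (hd.le x hx).trans_lt hx

theorem eqvGen_congr {q : ℕ → ℕ} {N : ℕ} {M : ℕ → ℕ → ℕ} {L : ℕ} {dl : ℕ → ℕ}
    (hq : ∀ r < N, ∀ r' < N, Close N M L dl r r' → q r = q r') {r r' : ℕ}
    (h : Relation.EqvGen (Close N M L dl) r r') : q r = q r' := by
  induction h with
  | rel x y h => exact hq x h.1 y h.2.1 h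
  | refl _ => rfl
  | symm _ _ _ ih => exact ih.symm
  | trans _ _ _ _ _ ih ih' => exact ih.trans ih'

/-- Bounds on the number of classes of twins in an interval, and on the errors. -/
structure Bounded (N h : ℕ) (M : ℕ → ℕ → ℕ) (K L f E : ℕ) : Prop where
  count : ∀ dl q cur : ℕ → ℕ, IsComponents N M L dl q → (∀ a, Poor N M K L dl (part N dl a)) →
    (∀ x < N, ∀ y < N, Twins N M q x y → cur x = cur y) → ∀ a, ((part N dl a).image cur).card ≤ f
  err : ∀ dl q τ : ℕ → ℕ, IsComponents N M L dl q → (∀ a, Poor N M K L dl (part N dl a)) →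
    (∀ x < N, ∀ y < N, τ x = τ y → Twins N M q x y) → ∀ r < N, (errLabels N M dl τ r).card ≤ E
  final : ∀ dl τ : ℕ → ℕ, IsDiv N h dl → (∀ x, ¬ Eligible N h dl x) →
    ∀ r < N, (errLabels N M dl τ r).card ≤ E

/-- No two consecutive intervals can be merged. -/
def Stuck (N h : ℕ) (M : ℕ → ℕ → ℕ) (K L : ℕ) (dl : ℕ → ℕ) : Prop :=
  ∀ x, Eligible N h dl x → ¬ Poor N M K L dl (mergedPart N dl x)

open Classical in
/-- The number of intervals. -/
noncomputable def numParts (N : ℕ) (dl : ℕ → ℕ) : ℕ :=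
  ((Finset.range N).filter fun y => dl y = y).card

/-- The position `x` ceases to be the start of an interval and no new start arises. This decrease
bounds the number of rounds. -/
theorem numParts_mergeAt {N h : ℕ} {dl dl' : ℕ → ℕ} {x : ℕ} (hd : IsDiv N h dl)
    (hx : Eligible N h dl x) (e : ∀ y < N, dl' y = mergeAt dl x y) :
    numParts N dl' + 1 ≤ numParts N dl := by
  classical
  obtain ⟨h1, h2, h3, h4⟩ := hx
  have hl := hd.le (x - 1) (by omega)
  refine Finset.card_lt_card ((Finset.ssubset_iff_of_subset fun y hy => ?_).2 ⟨x, ?_, ?_⟩)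
  · simp only [Finset.mem_filter, Finset.mem_range] at hy ⊢
    refine ⟨hy.1, ?_⟩
    have h5 := e y hy.1
    have h6 := hd.le y hy.1
    rw [hy.2, mergeAt] at h5
    split_ifs at h5 <;> omega
  · simp [h1, h2]
  · simp only [Finset.mem_filter, Finset.mem_range, not_and]
    intro _
    rw [e x h1, mergeAt, if_pos h2]
    omega

theorem numParts_le (N : ℕ) (dl : ℕ → ℕ) : numParts N dl ≤ N :=
  (Finset.card_filter_le _ _).trans (Finset.card_range N).le

theorem numParts_pos {N h : ℕ} {dl : ℕ → ℕ} (hd : IsDiv N h dl) (hN : 0 < N) :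
    0 < numParts N dl := by
  classical
  have := hd.le 0 hN
  exact Finset.card_pos.2 ⟨0, by simp [hN]; omega⟩

/-- An interval after the merge is the union of at most two intervals before it: the origin of the
factor two in the width. -/
theorem card_image_part_mergeAt_le {N f : ℕ} {dl dl' cur : ℕ → ℕ} {x : ℕ}
    (e : ∀ y < N, dl' y = mergeAt dl x y) (hf : ∀ a, ((part N dl a).image cur).card ≤ f) (a : ℕ) :
    ((part N dl' a).image cur).card ≤ 2 * f := by
  have hsub : part N dl' a ⊆ part N dl a ∪ part N dl x := by
    intro y hy
    rw [mem_part] at hy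
    rw [Finset.mem_union, mem_part, mem_part]
    have h2 := e y hy.1
    rw [hy.2, mergeAt] at h2
    split_ifs at h2 with h
    · exact .inr ⟨hy.1, h⟩
    · exact .inl ⟨hy.1, h2.symm⟩
  refine (Finset.card_le_card (Finset.image_subset_image hsub)).trans ?_
  rw [Finset.image_union]
  refine (Finset.card_union_le _ _).trans ?_
  have := hf a
  have := hf x
  omega

namespace Cmd

/-- The invariant of the main loop. -/
structure CoreInv (N h K L : ℕ) (g : ℕ → ℕ) (F E : ℕ) (s : State) : Prop where
  params : Params N h K L g s
  div : IsDiv N h (s.arr a_div)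
  poor : ∀ a, Poor N (matOf N g) K L (s.arr a_div) (part N (s.arr a_div) a)
  comp : IsComponents N (matOf N g) L (s.arr a_div) (s.arr a_comp)
  cur : ∀ x < N, ∀ y < N, s.arr a_cur x = s.arr a_cur y ↔
    Twins N (matOf N g) (s.arr a_comp) x y
  chain : ChainState N h (matOf N g) F E s

/-- Labels are identified only along close pairs, and in the end close elements have equal labels,
so the classes are the components. The pass may start from the old components, since these lie
inside the new ones. -/
theorem exec_compPass {N h K L : ℕ} {g : ℕ → ℕ} {s : State} (hs : Params N h K L g s)
    (hdl : ∀ c < N, s.arr a_div c < N)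
    (hq : ∀ r < N, ∀ r' < N, s.arr a_comp r = s.arr a_comp r' →
      Relation.EqvGen (Close N (matOf N g) L (s.arr a_div)) r r') :
    IsComponents N (matOf N g) L (s.arr a_div)
      (((unionPass a_comp Term.close .skip).exec s).arr a_comp) := by
  have main := exec_unionPass (a := a_comp) (cond := Term.close) (post := .skip) (N := N)
    (C := Close N (matOf N g) L (s.arr a_div))
    (J := fun s' => Params N h K L g s' ∧ s'.arr a_div = s.arr a_div ∧
      ∀ r < N, ∀ r' < N, s'.arr a_comp r = s'.arr a_comp r' →
        Relation.EqvGen (Close N (matOf N g) L (s.arr a_div)) r r')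
    (by decide) (by decide) (fun s h => h.1.N)
    (fun s v h => ⟨h.1.setVar (by decide), h.2⟩) (fun s v h => ⟨h.1.setVar (by decide), h.2⟩)
    (fun s' h hr hs => by
      rw [Term.close_iff h.1 (by rw [h.2.1]; exact hdl) hr hs, h.2.1]) ?_ ⟨hs, rfl, hq⟩
  · intro r hr r' hr'
    exact ⟨main.1.2.2 r hr r' hr', fun h => eqvGen_congr main.2 h⟩
  · rintro s' ⟨h1, h2, h3⟩ hr hs hC hne
    refine ⟨h1.exec _ (by decide) (by decide), by rw [exec, exec_arr (by decide), h2], ?_⟩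
    intro x hx y hy e
    rw [exec, exec_merge (by rw [h1.N]; exact hx), exec_merge (by rw [h1.N]; exact hy),
      mergeLabels_eq_iff] at e
    rcases e with e | ⟨e1, e2⟩
    · exact h3 x hx y hy e
    · have f : ∀ x < N, s'.arr a_comp x = s'.arr a_comp (s'.var v_r) ∨
          s'.arr a_comp x = s'.arr a_comp (s'.var v_s) →
          Relation.EqvGen (Close N (matOf N g) L (s.arr a_div)) x (s'.var v_r) := by
        rintro x hx (e | e)
        · exact h3 x hx _ hr e
        · exact .trans _ _ _ (h3 x hx _ hs e) (.symm _ _ (.rel _ _ hC))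
      exact .trans _ _ _ (f x hx e1) (.symm _ _ (f y hy e2))

/-- Search for intervals that can be merged; `v_found` is the place, or `0`. -/
def search : Cmd :=
  .seq (.assign v_found (.lit 0)) (.loop v_x v_N (.ite (Term.eligible v_x)
    (.seq testPoor (.ite (.var v_ok) (.assign v_found (.var v_x)) .skip)) .skip))

/-- The value `0` can stand for failure because `0` is never a mergeable position. Later hits
overwrite earlier ones. -/
theorem exec_search {N h K L : ℕ} {g : ℕ → ℕ} {s : State} (hs : Params N h K L g s)
    (hdl : ∀ c < N, s.arr a_div c < N) :
    ((search.exec s).var v_found = 0 ∧ Stuck N h (matOf N g) K L (s.arr a_div)) ∨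
    ((search.exec s).var v_found ≠ 0 ∧ Eligible N h (s.arr a_div) ((search.exec s).var v_found) ∧
      Poor N (matOf N g) K L (s.arr a_div)
        (mergedPart N (s.arr a_div) ((search.exec s).var v_found))) := by
  set body : Cmd := .ite (Term.eligible v_x)
    (.seq testPoor (.ite (.var v_ok) (.assign v_found (.var v_x)) .skip)) .skip with hb
  set s1 := s.setVar v_found 0 with hs1
  have main := exec_loop_induction (x := v_x) (v := v_N) (c := body) (s := s1)
    (P := fun i s' => Params N h K L g s' ∧ s'.arr a_div = s.arr a_div ∧
      ((s'.var v_found = 0 ∧ ∀ x < i, Eligible N h (s.arr a_div) x →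
        ¬ Poor N (matOf N g) K L (s.arr a_div) (mergedPart N (s.arr a_div) x)) ∨
      (s'.var v_found ≠ 0 ∧ Eligible N h (s.arr a_div) (s'.var v_found) ∧
        Poor N (matOf N g) K L (s.arr a_div) (mergedPart N (s.arr a_div) (s'.var v_found)))))
    ⟨hs.setVar (by decide), rfl, .inl ⟨setVar_var_self _ _ _, fun _ h => absurd h (by omega)⟩⟩ ?_
  · obtain ⟨-, -, h3⟩ := main
    have hex : search.exec s = (loop v_x v_N body).exec s1 := rfl
    rw [hex]
    rcases h3 with ⟨h3, h4⟩ | h3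
    · refine .inl ⟨h3, fun x hx => h4 x ?_ hx⟩
      rw [hs1, setVar_var_ne _ _ (by decide), hs.N]
      exact hx.1
    · exact .inr h3
  · rintro i hi s' ⟨h1, h2, h3⟩
    have hiN : i < N := by
      rw [hs1, setVar_var_ne _ _ (by decide), hs.N] at hi
      exact hi
    have p1 : Params N h K L g (s'.setVar v_x i) := h1.setVar (by decide)
    have d1 : (s'.setVar v_x i).arr a_div = s.arr a_div := h2
    have x1 : (s'.setVar v_x i).var v_x = i := setVar_var_self _ _ _
    have f1 : (s'.setVar v_x i).var v_found = s'.var v_found := setVar_var_ne _ _ (by decide)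
    rw [← f1] at h3
    generalize s'.setVar v_x i = s2 at p1 d1 x1 f1 h3
    refine ⟨p1.exec _ (by decide) (by decide), by rw [exec_arr (by decide), d1], ?_⟩
    have keep : (body.exec s2).var v_found = s2.var v_found →
        (Eligible N h (s.arr a_div) i →
          ¬ Poor N (matOf N g) K L (s.arr a_div) (mergedPart N (s.arr a_div) i)) →
        (((body.exec s2).var v_found = 0 ∧ ∀ x < i + 1, Eligible N h (s.arr a_div) x →
          ¬ Poor N (matOf N g) K L (s.arr a_div) (mergedPart N (s.arr a_div) x)) ∨
        ((body.exec s2).var v_found ≠ 0 ∧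
          Eligible N h (s.arr a_div) ((body.exec s2).var v_found) ∧
          Poor N (matOf N g) K L (s.arr a_div)
            (mergedPart N (s.arr a_div) ((body.exec s2).var v_found)))) := fun e hnot => by
      rw [e]
      refine h3.imp_left fun h3 => ⟨h3.1, fun x hx hel => ?_⟩
      rcases Nat.lt_succ_iff_lt_or_eq.1 hx with hx | rfl
      · exact h3.2 x hx hel
      · exact hnot hel
    by_cases hel : (Term.eligible v_x).eval s2 ≠ 0
    · have hel' : Eligible N h (s.arr a_div) i := by
        rw [Term.eligible_iff p1 (by rw [x1]; exact hiN), d1, x1] at hel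
        exact hel
      have hpoor : (testPoor.exec s2).var v_ok ≠ 0 ↔
          Poor N (matOf N g) K L (s.arr a_div) (mergedPart N (s.arr a_div) i) := by
        rw [exec_testPoor (by rw [p1.N, d1]; exact hdl) (by rw [p1.W, p1.K, p1.L]), IsPoorAt,
          p1.N, p1.K, p1.L, p1.eq_mat, d1, x1]
      by_cases hok : (Term.var v_ok).eval (testPoor.exec s2) ≠ 0
      · have e : (body.exec s2).var v_found = i := by
          simp only [hb, exec, if_pos hel, if_pos hok, setVar_var_self]
          rw [Term.eval_var, exec_var (by decide), x1]
        right
        rw [e]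
        exact ⟨hel'.2.2.1, hel', hpoor.1 hok⟩
      · refine keep ?_ fun _ h => hok (hpoor.2 h)
        simp only [hb, exec, if_pos hel, if_neg hok]
        exact exec_var (by decide) _
    · refine keep ?_ fun hel' => absurd ?_ hel
      · simp only [hb, exec, if_neg hel]
      · rw [Term.eligible_iff p1 (by rw [x1]; exact hiN), d1, x1]
        exact hel'

/-- Merge the intervals that meet at `v_found`. -/
def mergeDiv : Cmd :=
  .seq (.assign v_a (.get a_div (.sub (.var v_found) (.lit 1))))
    (fill a_div v_y v_N (.ite (.eq (.get a_div (.var v_y)) (.var v_found)) (.var v_a)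
      (.get a_div (.var v_y))))

theorem exec_mergeDiv {s : State} {y : ℕ} (hy : y < s.var v_N) :
    (mergeDiv.exec s).arr a_div y = mergeAt (s.arr a_div) (s.var v_found) y := by
  have key := exec_fill (a := a_div) (y := v_y) (v := v_N)
    (s := s.setVar v_a (s.arr a_div (s.var v_found - 1)))
    (t := .ite (.eq (.get a_div (.var v_y)) (.var v_found)) (.var v_a) (.get a_div (.var v_y)))
    (g := mergeAt (s.arr a_div) (s.var v_found)) (fun i hi s' h1 h2 h3 => by
      simp only [Term.eval, h1, mergeAt, setVar_var]
      simp [h3 i le_rfl]) y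
  rw [if_pos (by simpa [setVar_var] using hy)] at key
  exact key

/-- Merge two intervals, if possible, and update the labellings. -/
def round : Cmd :=
  .seq search (.ite (.var v_found) (.seq mergeDiv (.seq (unionPass a_comp Term.close .skip)
    (unionPass a_cur Term.twins snapshot))) .skip)

/-- After the division is coarsened, the components and then the twin classes are updated. Only the
update of the twin classes is recorded: it starts with at most `2 * f` classes in an interval, all
of them inside new twin classes, and merges them one by one. -/
theorem exec_round {N h K L : ℕ} {g : ℕ → ℕ} {f E : ℕ}
    (hB : Bounded N h (matOf N g) K L f E) {s : State} (hs : CoreInv N h K L g (2 * f) E s) :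
    CoreInv N h K L g (2 * f) E (round.exec s) ∧
    ((Stuck N h (matOf N g) K L (s.arr a_div) ∧ (round.exec s).arr a_div = s.arr a_div) ∨
      (¬ Stuck N h (matOf N g) K L (s.arr a_div) ∧
        numParts N ((round.exec s).arr a_div) + 1 ≤ numParts N (s.arr a_div))) := by
  set s1 := search.exec s with hs1
  have hsearch := exec_search hs.params hs.div.lt
  rw [← hs1] at hsearch
  have p1 : Params N h K L g s1 := hs.params.exec _ (by decide) (by decide)
  have d1 : s1.arr a_div = s.arr a_div := exec_arr (by decide) _
  have q1 : s1.arr a_comp = s.arr a_comp := exec_arr (by decide) _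
  have c1 : s1.arr a_cur = s.arr a_cur := exec_arr (by decide) _
  have h1 : ChainState N h (matOf N g) (2 * f) E s1 :=
    hs.chain.congr (fun x _ => by rw [c1]) (exec_var (by decide) _) (exec_arr (by decide) _)
  rcases hsearch with ⟨h0, hstuck⟩ | ⟨h0, hel, hpoor⟩
  · have hex : round.exec s = s1 := by
      simp only [round, exec, ← hs1, Term.eval_var, h0, ne_eq, not_true_eq_false, if_false]
    rw [hex]
    refine ⟨⟨p1, ?_, ?_, ?_, ?_, h1⟩, .inl ⟨hstuck, d1⟩⟩
    · rw [d1]; exact hs.div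
    · rw [d1]; exact hs.poor
    · rw [d1, q1]; exact hs.comp
    · rw [c1, q1]; exact hs.cur
  · set x := s1.var v_found with hx
    set s2 := mergeDiv.exec s1 with hs2
    have p2 : Params N h K L g s2 := p1.exec _ (by decide) (by decide)
    have d2 : ∀ y < N, s2.arr a_div y = mergeAt (s.arr a_div) x y := fun y hy => by
      rw [hs2, exec_mergeDiv (by rw [p1.N]; exact hy), d1]
    have q2 : s2.arr a_comp = s.arr a_comp := by rw [hs2, exec_arr (by decide), q1]
    have c2 : s2.arr a_cur = s.arr a_cur := by rw [hs2, exec_arr (by decide), c1]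
    have h2 : ChainState N h (matOf N g) (2 * f) E s2 :=
      h1.congr (fun x _ => by rw [c2, c1]) (exec_var (by decide) _) (exec_arr (by decide) _)
    have hd2 : IsDiv N h (s2.arr a_div) := (hs.div.mergeAt hel).congr d2
    have hp2 : ∀ a, Poor N (matOf N g) K L (s2.arr a_div) (part N (s2.arr a_div) a) := fun a =>
      (Poor.mergeAt hs.poor hpoor a).mono id d2 fun y hy => by
        rw [mem_part] at hy ⊢
        rw [← d2 y hy.1]
        exact hy
    have hclose : ∀ r r', Close N (matOf N g) L (s.arr a_div) r r' →
        Close N (matOf N g) L (s2.arr a_div) r r' := fun r r' h =>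
      h.mono (fun v => if v = x then s.arr a_div (x - 1) else v) d2
    have heqv : ∀ r r', Relation.EqvGen (Close N (matOf N g) L (s.arr a_div)) r r' →
        Relation.EqvGen (Close N (matOf N g) L (s2.arr a_div)) r r' := fun r r' h =>
      Relation.EqvGen.mono hclose r r' h
    set s3 := (unionPass a_comp Term.close .skip).exec s2 with hs3
    have p3 : Params N h K L g s3 := p2.exec _ (by decide) (by decide)
    have d3 : s3.arr a_div = s2.arr a_div := exec_arr (by decide) _
    have c3 : s3.arr a_cur = s.arr a_cur := by rw [hs3, exec_arr (by decide), c2]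
    have hq3 : IsComponents N (matOf N g) L (s2.arr a_div) (s3.arr a_comp) := by
      refine exec_compPass p2 hd2.lt fun r hr r' hr' e => heqv r r' ?_
      rw [q2] at e
      exact (hs.comp r hr r' hr').1 e
    have h3 : ChainState N h (matOf N g) (2 * f) E s3 :=
      h2.congr (fun x _ => by rw [c3, c2]) (exec_var (by decide) _) (exec_arr (by decide) _)
    -- By `Twins.mono` this makes the old twin classes refine the new ones, as the recorded pass
    -- requires.
    have hqq : ∀ r < N, ∀ r' < N, s.arr a_comp r = s.arr a_comp r' →
        s3.arr a_comp r = s3.arr a_comp r' := fun r hr r' hr' e =>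
      (hq3 r hr r' hr').2 (heqv r r' ((hs.comp r hr r' hr').1 e))
    obtain ⟨i4, h4, c4⟩ := exec_curPass (N := N) (h := h) (M := matOf N g) (F := 2 * f) (E := E)
      (dl := s2.arr a_div) (C := Twins N (matOf N g) (s3.arr a_comp)) hd2
      (fun x hx y hy h => hq3.label hx hy h.1) (fun _ _ h => h.symm) (fun _ _ _ h h' => h.trans h')
      (fun τ hτ => hB.err _ _ τ hq3 hp2 hτ) (cond := Term.twins)
      (I := fun s' => Params N h K L g s' ∧ s'.arr a_comp = s3.arr a_comp)
      (fun s h => h.1.N) (fun s v h => ⟨h.1.setVar (by decide), h.2⟩)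
      (fun s v h => ⟨h.1.setVar (by decide), h.2⟩)
      (fun s' h => ⟨(h.1.exec (merge a_cur) (by decide) (by decide)).exec snapshot (by decide)
        (by decide), by rw [exec_arr (by decide), exec_arr (by decide), h.2]⟩)
      (fun s' h hr hs => by rw [Term.twins_iff h.1, h.2]) (s := s3) ⟨p3, rfl⟩ h3
      (fun a => by
        rw [c3]
        exact card_image_part_mergeAt_le d2 (hB.count _ _ _ hs.comp hs.poor
          fun x hx y hy h => (hs.cur x hx y hy).2 h) a)
      (fun x hx y hy e => by
        rw [c3] at e
        exact ((hs.cur x hx y hy).1 e).mono hqq hx hy)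
    set s4 := (unionPass a_cur Term.twins snapshot).exec s3 with hs4
    have hex : round.exec s = s4 := by
      simp only [round, exec, ← hs1, Term.eval_var, ← hx, h0, ne_eq, not_false_eq_true, if_true,
        hs4, hs3, hs2]
    have d4 : s4.arr a_div = s2.arr a_div := by rw [hs4, exec_arr (by decide), d3]
    rw [hex]
    refine ⟨⟨i4.1, by rw [d4]; exact hd2, by rw [d4]; exact hp2, by rw [d4, i4.2]; exact hq3, ?_, h4⟩,
      .inr ⟨fun h => h _ hel hpoor, ?_⟩⟩
    · rw [i4.2]; exact c4
    · rw [d4]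
      exact numParts_mergeAt hs.div hel d2

end Cmd
end TwinWidth

/-! ### The main algorithm: initialization, rounds and output. -/

namespace TwinWidth

namespace Term

variable {N h K L : ℕ} {g : ℕ → ℕ} {s : State}

/-- Half of a term whose value is at most `v_N`. -/
def half (t : Term) : Term := count 42 v_N (not (.lt t (.add (.add (.var 42) (.var 42)) (.lit 2))))

theorem eval_half {t : Term} {w : ℕ} (ht : ∀ i, t.eval (s.setVar 42 i) = w) (hw : w ≤ s.var v_N) :
    (half t).eval s = w / 2 := by
  rw [half, eval_count]
  have : ((Finset.range (s.var v_N)).filter fun i =>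
      (not (.lt t (.add (.add (.var 42) (.var 42)) (.lit 2)))).eval (s.setVar 42 i) ≠ 0) =
      Finset.range (w / 2) := by
    ext i
    rw [Finset.mem_filter, Finset.mem_range, Finset.mem_range, not_iff, lt_iff, ht]
    simp only [eval_add, eval_var, eval_lit, setVar_var_self]
    omega
  rw [this, Finset.card_range]

/-- The variable `41` is the first element of an interval on the same side as `v_y`. -/
def isLeader : Term :=
  and (.eq (.get a_div (.var 41)) (.var 41))
    (.eq (.lt (.var 41) (.var v_h)) (.lt (.var v_y) (.var v_h)))

/-- The minimum of two terms. -/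
def min (t₁ t₂ : Term) : Term := .ite (.lt t₁ t₂) t₁ t₂

theorem eval_min {t₁ t₂ : Term} : (min t₁ t₂).eval s = Min.min (t₁.eval s) (t₂.eval s) := by
  simp only [min, eval]
  split_ifs <;> grind

/-- The label of `v_y` in the division that joins intervals in pairs. -/
def pair : Term :=
  min (half (.sub (count 41 v_N (and isLeader (not (.lt (.var v_y) (.var 41))))) (.lit 1)))
    (.sub (half (count 41 v_N isLeader)) (.lit 1))

theorem isLeader_iff (hs : Cmd.Params N h K L g s) :
    isLeader.eval s ≠ 0 ↔
      s.arr a_div (s.var 41) = s.var 41 ∧ (s.var 41 < h ↔ s.var v_y < h) := by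
  rw [isLeader, and_iff, eq_iff, eq_iff]
  simp only [eval, hs.h]
  split_ifs <;> grind

theorem eval_pair (hs : Cmd.Params N h K L g s) :
    pair.eval s = pairLabel N h (s.arr a_div) (s.var v_y) := by
  have h1 : ∀ i, (count 41 v_N isLeader).eval (s.setVar 42 i) =
      (leaders N h (s.arr a_div) (s.var v_y)).card := by
    intro i
    have hs' : Cmd.Params N h K L g (s.setVar 42 i) := hs.setVar (by decide)
    rw [eval_count, hs'.N, leaders]
    congr 1
    refine Finset.filter_congr fun l _ => ?_
    rw [isLeader_iff (hs'.setVar (by decide))]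
    simp [setVar_var]
  have h2 : ∀ i, (Term.sub (count 41 v_N (and isLeader (not (.lt (.var v_y) (.var 41)))))
      (.lit 1)).eval (s.setVar 42 i) = rank N h (s.arr a_div) (s.var v_y) := by
    intro i
    have hs' : Cmd.Params N h K L g (s.setVar 42 i) := hs.setVar (by decide)
    rw [eval_sub, eval_lit, eval_count, hs'.N, rank]
    congr 2
    refine Finset.filter_congr fun l _ => ?_
    rw [and_iff, isLeader_iff (hs'.setVar (by decide)), not_iff, lt_iff]
    simp [setVar_var]
  have le1 : (leaders N h (s.arr a_div) (s.var v_y)).card ≤ N :=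
    (Finset.card_filter_le _ _).trans (by simp)
  have le2 : rank N h (s.arr a_div) (s.var v_y) ≤ N := by
    refine (Nat.sub_le _ _).trans ((Finset.card_filter_le _ _).trans ?_)
    simp
  have e1 := eval_half (s := s) h1 (by rw [hs.N]; exact le1)
  have e2 := eval_half (s := s) h2 (by rw [hs.N]; exact le2)
  rw [pair, eval_min, eval_sub, e1, e2, pairLabel, eval_lit]

end Term

namespace Cmd

/-- All labellings are injective at the start. -/
def setup : Cmd :=
  .seq (fill a_div v_y v_N (.var v_y)) (.seq (fill a_comp v_y v_N (.var v_y))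
    (.seq (fill a_cur v_y v_N (.var v_y)) (.seq (.assign v_pos (.lit 0)) snapshot)))

/-- Output a rich division, or contract the intervals and finish the sequence. -/
def finish : Cmd :=
  .ite (Term.ex 45 v_N (Term.eligible 45))
    (.seq (.assign v_flag (.lit 0)) (fill a_out v_y v_N Term.pair))
    (.seq (unionPass a_cur (.eq (.get a_div (.var v_r)) (.get a_div (.var v_s))) snapshot)
      (.assign v_flag (.lit 1)))

/-- The main algorithm. -/
def core : Cmd := .seq setup (.seq (.loop v_round v_N round) finish)

theorem fill_id (a : ℕ) (s : State) {y : ℕ} (hy : y < s.var v_N) :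
    ((fill a v_y v_N (.var v_y)).exec s).arr a y = y := by
  rw [exec_fill (g := fun i => i) (fun i _ s' h _ _ => by rw [Term.eval_var, h, setVar_var_self]),
    if_pos hy]

/-- A single row is fewer than `K` rows, so singletons are poor; this needs `2 ≤ K`. Close rows
share an interval, so components and twin classes are singletons too. -/
theorem exec_setup {N h K L : ℕ} {g : ℕ → ℕ} {F E : ℕ} (hK : 2 ≤ K) {s : State}
    (hs : Params N h K L g s) : CoreInv N h K L g F E (setup.exec s) := by
  set s1 := (fill a_div v_y v_N (.var v_y)).exec s with hs1
  set s2 := (fill a_comp v_y v_N (.var v_y)).exec s1 with hs2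
  set s3 := (fill a_cur v_y v_N (.var v_y)).exec s2 with hs3
  set s4 := s3.setVar v_pos 0 with hs4
  have p1 : Params N h K L g s1 := hs.exec _ (by decide) (by decide)
  have p2 : Params N h K L g s2 := p1.exec _ (by decide) (by decide)
  have p3 : Params N h K L g s3 := p2.exec _ (by decide) (by decide)
  have p4 : Params N h K L g s4 := p3.setVar (by decide)
  have hex : setup.exec s = snapshot.exec s4 := rfl
  have d1 : ∀ x < N, s1.arr a_div x = x := fun x hx => fill_id _ _ (by rw [hs.N]; exact hx)
  have q2 : ∀ x < N, s2.arr a_comp x = x := fun x hx => fill_id _ _ (by rw [p1.N]; exact hx)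
  have c3 : ∀ x < N, s3.arr a_cur x = x := fun x hx => fill_id _ _ (by rw [p2.N]; exact hx)
  have d : (snapshot.exec s4).arr a_div = s1.arr a_div := by
    rw [exec_arr (by decide), hs4, setVar_arr, hs3, exec_arr (by decide), hs2, exec_arr (by decide)]
  have q : (snapshot.exec s4).arr a_comp = s2.arr a_comp := by
    rw [exec_arr (by decide), hs4, setVar_arr, hs3, exec_arr (by decide)]
  have c : (snapshot.exec s4).arr a_cur = s3.arr a_cur := by
    rw [exec_arr (by decide), hs4, setVar_arr]
  obtain ⟨g1, -, g3⟩ := exec_snapshot s4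
  rw [hex]
  refine ⟨p4.exec _ (by decide) (by decide), ?_, ?_, ?_, ?_, ?_⟩
  · rw [d]
    exact IsDiv.congr (dl := id) ⟨fun _ _ h _ => h, fun _ _ => le_rfl, fun _ _ => rfl,
      fun _ _ h => h⟩ d1
  · intro a
    refine ⟨∅, by simp, lt_of_le_of_lt ((Finset.card_le_card reps_subset).trans ?_) hK⟩
    rw [Finset.card_le_one, d]
    intro x hx y hy
    rw [mem_part] at hx hy
    rw [d1 x hx.1] at hx
    rw [d1 y hy.1] at hy
    rw [hx.2, hy.2]
  · intro r hr r' hr'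
    rw [d, q, q2 r hr, q2 r' hr']
    constructor
    · rintro rfl
      exact .refl _
    · intro h
      have := eqvGen_close_label h
      rwa [d1 r hr, d1 r' hr'] at this
  · intro x hx y hy
    rw [c, q, c3 x hx, c3 y hy]
    constructor
    · rintro rfl
      exact Twins.refl _
    · intro h
      have := h.1
      rwa [q2 x hx, q2 y hy] at this
  · refine ⟨0, fun _ x => x, ⟨fun _ _ _ _ h => h, fun t ht => absurd ht (by omega)⟩, ?_, ?_, ?_⟩
    · rw [c]; exact c3
    · rw [g1, hs4, setVar_var_self, setVar_var_ne _ _ (by decide), p3.N, zero_add, zero_add, one_mul]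
    · intro t ht x hx
      have := g3 x (by rw [p4.N]; exact hx)
      rw [hs4, setVar_var_self] at this
      rw [show t = 0 by omega, zero_mul]
      rw [hs4, this]
      exact c3 x hx

/-- The possible results of the main algorithm. -/
def CoreResult (N h K L : ℕ) (g : ℕ → ℕ) (F E : ℕ) (s : State) : Prop :=
  (s.var v_flag = 0 ∧ ∃ dl, IsDiv N h dl ∧ Stuck N h (matOf N g) K L dl ∧
    (∃ x, Eligible N h dl x) ∧ ∀ y < N, s.arr a_out y = pairLabel N h dl y) ∨
  (s.var v_flag = 1 ∧ ∃ T Q, IsChain N h (matOf N g) F E T Q ∧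
    (∀ x < N, ∀ y < N, (x < h ↔ y < h) → Q T x = Q T y) ∧
    ∀ t ≤ T, ∀ x < N, s.arr a_out (t * N + x) = Q t x)

/-- A mergeable position in a stuck division leads to the paired division. Without such a position
each side is one interval, and a last recorded pass joins the classes of each side; its errors are
bounded by `Bounded.final`. -/
theorem exec_finish {N h K L : ℕ} {g : ℕ → ℕ} {f E : ℕ}
    (hB : Bounded N h (matOf N g) K L f E) {s : State} (hs : CoreInv N h K L g (2 * f) E s)
    (hstuck : Stuck N h (matOf N g) K L (s.arr a_div)) :
    CoreResult N h K L g (2 * f) E (finish.exec s) := by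
  have hiff : (Term.ex 45 v_N (Term.eligible 45)).eval s ≠ 0 ↔
      ∃ x, Eligible N h (s.arr a_div) x := by
    rw [Term.ex_iff, hs.params.N]
    constructor
    · rintro ⟨i, hi, h⟩
      rw [Term.eligible_iff (hs.params.setVar (by decide)) (by rw [setVar_var_self]; exact hi),
        setVar_var_self] at h
      exact ⟨i, h⟩
    · rintro ⟨x, hx⟩
      refine ⟨x, hx.1, ?_⟩
      rw [Term.eligible_iff (hs.params.setVar (by decide)) (by rw [setVar_var_self]; exact hx.1),
        setVar_var_self]
      exact hx
  by_cases hel : (Term.ex 45 v_N (Term.eligible 45)).eval s ≠ 0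
  · left
    have hex : finish.exec s = (fill a_out v_y v_N Term.pair).exec (s.setVar v_flag 0) := by
      simp only [finish, exec, if_pos hel, Term.eval_lit]
    have p1 : Params N h K L g (s.setVar v_flag 0) := hs.params.setVar (by decide)
    rw [hex]
    refine ⟨by rw [exec_var (by decide), setVar_var_self], s.arr a_div, hs.div, hstuck, hiff.1 hel,
      fun y hy => ?_⟩
    rw [exec_fill (g := pairLabel N h (s.arr a_div)), if_pos (by rw [p1.N]; exact hy)]
    intro i _ s' h1 h2 _
    have p' : Params N h K L g s' := by
      have p2 := p1.setVar (x := v_y) (v := i) (by decide)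
      exact ⟨by rw [h1, p2.W], by rw [h1, p2.N], by rw [h1, p2.h], by rw [h1, p2.K],
        by rw [h1, p2.L], by rw [h2 _ (by decide), setVar_arr, hs.params.mat]⟩
    rw [Term.eval_pair p', h2 _ (by decide), h1, setVar_var_self, setVar_arr]
  · right
    have hno : ∀ x, ¬ Eligible N h (s.arr a_div) x := fun x hx => hel (hiff.2 ⟨x, hx⟩)
    obtain ⟨-, h4, c4⟩ := exec_curPass (N := N) (h := h) (M := matOf N g) (F := 2 * f) (E := E)
      (dl := s.arr a_div) (C := fun x y => s.arr a_div x = s.arr a_div y) hs.div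
      (fun _ _ _ _ h => h) (fun _ _ h => h.symm) (fun _ _ _ h h' => h.trans h')
      (fun τ _ => hB.final _ τ hs.div hno)
      (cond := .eq (.get a_div (.var v_r)) (.get a_div (.var v_s)))
      (I := fun s' => Params N h K L g s' ∧ s'.arr a_div = s.arr a_div)
      (fun s h => h.1.N) (fun s v h => ⟨h.1.setVar (by decide), h.2⟩)
      (fun s v h => ⟨h.1.setVar (by decide), h.2⟩)
      (fun s' h => ⟨(h.1.exec (merge a_cur) (by decide) (by decide)).exec snapshot (by decide)
        (by decide), by rw [exec_arr (by decide), exec_arr (by decide), h.2]⟩)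
      (fun s' h _ _ => by rw [Term.eq_iff, Term.eval_get, Term.eval_get, h.2]; rfl) (s := s)
      ⟨hs.params, rfl⟩ hs.chain
      (fun a => (hB.count _ _ _ hs.comp hs.poor
          (fun x hx y hy h => (hs.cur x hx y hy).2 h) a).trans (by omega))
      (fun x hx y hy e => hs.comp.label hx hy ((hs.cur x hx y hy).1 e).1)
    set s1 := (unionPass a_cur (.eq (.get a_div (.var v_r)) (.get a_div (.var v_s)))
      snapshot).exec s with hs1
    have hex : finish.exec s = s1.setVar v_flag 1 := by
      simp only [finish, exec, if_neg hel, Term.eval_lit]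
      rfl
    rw [hex]
    obtain ⟨T, Q, k1, k2, k3, k4⟩ := h4
    refine ⟨setVar_var_self _ _ _, T, Q, k1, fun x hx y hy hxy => ?_, k4⟩
    rw [← k2 x hx, ← k2 y hy, c4 x hx y hy]
    exact hs.div.complete hno hx hy hxy

/-- As long as the division is not stuck, a round removes an interval. There is always at least one
interval, so `N` rounds suffice, and a stuck division no longer changes. -/
theorem exec_core {N h K L : ℕ} {g : ℕ → ℕ} {f E : ℕ} (hN : 1 ≤ N) (hK : 2 ≤ K)
    (hB : Bounded N h (matOf N g) K L f E) {s : State} (hs : Params N h K L g s) :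
    CoreResult N h K L g (2 * f) E (core.exec s) := by
  have h1 : CoreInv N h K L g (2 * f) E (setup.exec s) := exec_setup hK hs
  have h2 := exec_loop_induction (x := v_round) (v := v_N) (c := round) (s := setup.exec s)
    (P := fun i s' => CoreInv N h K L g (2 * f) E s' ∧
      (Stuck N h (matOf N g) K L (s'.arr a_div) ∨ numParts N (s'.arr a_div) + i ≤ N))
    ⟨h1, .inr (numParts_le _ _)⟩ ?_
  · refine exec_finish hB h2.1 (h2.2.resolve_right ?_)
    rw [h1.params.N]
    have := numParts_pos h2.1.div hN
    omega
  · rintro i _ s' ⟨k1, k2⟩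
    have k1' : CoreInv N h K L g (2 * f) E (s'.setVar v_round i) :=
      ⟨k1.params.setVar (by decide), k1.div, k1.poor, k1.comp, k1.cur,
        k1.chain.congr (fun _ _ => rfl) (setVar_var_ne _ _ (by decide)) rfl⟩
    obtain ⟨k3, k4⟩ := exec_round hB k1'
    refine ⟨k3, ?_⟩
    rw [setVar_arr] at k4
    rcases k4 with ⟨k4, k5⟩ | k4
    · rw [k5]
      exact .inl k4
    · exact .inr (by have := k2.resolve_left k4.1; omega)

end Cmd
end TwinWidth

/-! ### Numerical bounds for the width and the running time. -/

namespace TwinWidth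

/-- At the end there are at most the two labels `0` and `h`, so `2 ≤ L` takes care of the last pass.
-/
theorem bounded_of_transposeInvariant {N h : ℕ} {M : ℕ → ℕ → ℕ} (hM : TransposeInvariant N M)
    {K L : ℕ} (hL : 2 ≤ L) {A : Finset ℕ} (hA : ∀ x < N, ∀ y < N, M x y ∈ A) :
    Bounded N h M K L (K * K * A.card ^ (K * L)) (L + K * K * L) where
  count _ _ _ hq hp hcur a := card_twins_le hM hq hp hA hcur a
  err _ _ _ hq hp hτ _ hr := card_errLabels_le hM hq hp hτ hr
  final dl τ hd hno r _ := by
    have : errLabels N M dl τ r ⊆ {0, h} := by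
      intro b hb
      simp only [errLabels, Finset.mem_image, Finset.mem_filter, Finset.mem_range] at hb
      obtain ⟨c, ⟨hc, -⟩, rfl⟩ := hb
      have h1 := hno (dl c)
      simp only [Eligible, not_and, not_not] at h1
      have h2 := h1 (hd.lt c hc) (hd.idem c hc)
      rw [Finset.mem_insert, Finset.mem_singleton]
      tauto
    have h2 := (Finset.card_le_card this).trans Finset.card_le_two
    exact h2.trans (hL.trans (Nat.le_add_right _ _))

/-- The general bounds are useless when the permitted width is `1`, that is, for a one-letter
alphabet and for twin-width zero. In both cases the matrix is constant. -/
theorem bounded_of_constant {N h : ℕ} {M : ℕ → ℕ → ℕ} {v : ℕ} (hM : ∀ x < N, ∀ y < N, M x y = v)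
    (K L : ℕ) : Bounded N h M K L 1 0 where
  count dl q cur hq _ hcur a := by
    rw [Finset.card_le_one]
    intro u hu w hw
    obtain ⟨x, hx, rfl⟩ := Finset.mem_image.1 hu
    obtain ⟨y, hy, rfl⟩ := Finset.mem_image.1 hw
    rw [mem_part] at hx hy
    refine hcur x hx.1 y hy.1 ⟨(hq x hx.1 y hy.1).2 (.rel _ _ ⟨hx.1, hy.1, hx.2.trans hy.2.symm, ?_⟩),
      fun c hc _ => by rw [hM x hx.1 c hc, hM y hy.1 c hc]⟩
    have : diffLabels N M dl x y = ∅ := by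
      rw [diffLabels, Finset.image_eq_empty, Finset.filter_eq_empty_iff]
      intro c hc
      rw [Finset.mem_range] at hc
      rw [hM x hx.1 c hc, hM y hy.1 c hc, not_not]
    simp [this]
  err dl _ τ _ _ _ r hr := (errLabels_eq_empty dl τ r hr).le
  final dl τ _ _ r hr := (errLabels_eq_empty dl τ r hr).le
where
  errLabels_eq_empty (dl τ : ℕ → ℕ) (r : ℕ) (hr : r < N) : (errLabels N M dl τ r).card = 0 := by
    rw [Finset.card_eq_zero, errLabels, Finset.image_eq_empty, Finset.filter_eq_empty_iff]
    rintro c hc ⟨r', hr', c', hc', -, -, hne⟩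
    rw [Finset.mem_range] at hc
    exact hne (by rw [hM r hr c hc, hM r' hr' c' hc'])

/-- The richness of the divisions. -/
def richness (k : ℕ) : ℕ := 2 * k * (k + 1)

/-- The number of branches of the poorness test. -/
def branches (k : ℕ) : ℕ := (richness k * richness k) ^ (3 * richness k)

theorem four_le_richness {k : ℕ} (hk : 1 ≤ k) : 4 ≤ richness k := by
  rw [richness]; nlinarith

theorem richness_le {k : ℕ} (hk : 1 ≤ k) : richness k ≤ 4 * k ^ 2 := by
  rw [richness]; nlinarith

theorem richness_mono {k k' : ℕ} (h : k ≤ k') : richness k ≤ richness k' := by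
  rw [richness, richness]; gcongr

theorem branches_mono {k k' : ℕ} (hk : 1 ≤ k) (h : k ≤ k') : branches k ≤ branches k' := by
  have h1 := richness_mono h
  have h2 := four_le_richness hk
  rw [branches, branches]
  refine (Nat.pow_le_pow_left (Nat.mul_le_mul h1 h1) _).trans (Nat.pow_le_pow_right ?_ (by omega))
  have : 0 < richness k' := by omega
  positivity

theorem sq_richness_le_branches {k : ℕ} (hk : 1 ≤ k) :
    richness k * richness k ≤ branches k := by
  have h2 := four_le_richness hk
  exact Nat.le_self_pow (by omega) _

/-- The summand `96` covers `k = 1`, where the logarithm vanishes but the test has `16 ^ 12`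
branches. For `k ≥ 2` the logarithm is at least one and absorbs the additive constants. -/
theorem branches_le {k : ℕ} (hk : 1 ≤ k) :
    branches k ≤ 2 ^ (96 + 288 * (k ^ 2 * Nat.log 2 k)) := by
  have hlog : k < 2 ^ (Nat.log 2 k + 1) := Nat.lt_pow_succ_log_self (by norm_num) k
  set l := Nat.log 2 k with hl
  have h1 : richness k ≤ 2 ^ (2 * l + 4) := by
    refine (richness_le hk).trans ?_
    calc 4 * k ^ 2 ≤ 4 * (2 ^ (l + 1)) ^ 2 := by gcongr
      _ = 2 ^ (2 * l + 4) := by ring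
  have h2 : richness k * richness k ≤ 2 ^ (4 * l + 8) := by
    calc richness k * richness k ≤ 2 ^ (2 * l + 4) * 2 ^ (2 * l + 4) := Nat.mul_le_mul h1 h1
      _ = 2 ^ (4 * l + 8) := by ring
  rcases Nat.lt_or_ge k 2 with h | h
  · obtain rfl : k = 1 := by omega
    have : l = 0 := by simp [hl]
    rw [branches, richness]
    simp only [this]
    norm_num
  · have hl1 : 1 ≤ l := Nat.log_pos (by norm_num) h
    calc branches k ≤ (2 ^ (4 * l + 8)) ^ (3 * richness k) := Nat.pow_le_pow_left h2 _
      _ ≤ (2 ^ (12 * l)) ^ (3 * (4 * k ^ 2)) := by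
          refine (Nat.pow_le_pow_left (Nat.pow_le_pow_right (by norm_num) (by omega)) _).trans
            (Nat.pow_le_pow_right (by positivity) ?_)
          have := richness_le hk
          omega
      _ = 2 ^ (144 * (k ^ 2 * l)) := by rw [← pow_mul]; ring_nf
      _ ≤ _ := Nat.pow_le_pow_right (by norm_num) (by omega)

/-- The time bound of the theorem absorbs polynomials in the size of the instance and the number of
branches. -/
theorem time_le {κ N k x : ℕ} (hN : 2 ≤ N) (hk : 1 ≤ k) (hx : k ^ 2 * Nat.log 2 k ≤ x) :
    κ * (N + branches k + 1) ^ κ ≤ 2 ^ 2 ^ (300 * κ * x) * N ^ (300 * κ) := by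
  have hb := branches_le hk
  have hW : N + branches k + 1 ≤ 2 ^ (288 * x) * N ^ 99 := by
    have h1 : branches k ≤ 2 ^ (288 * x) * 2 ^ 96 := by
      rw [← pow_add]
      exact hb.trans (Nat.pow_le_pow_right (by norm_num) (by omega))
    have h2 : 1 ≤ 2 ^ (288 * x) := Nat.one_le_two_pow
    -- The claimed bound has no constant factor, so the constant is hidden in a power of `N ≥ 2`.
    have h3 : 2 ^ 96 ≤ N ^ 96 := Nat.pow_le_pow_left hN _
    have h4 : 1 ≤ N ^ 96 := Nat.one_le_pow _ _ (by omega)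
    have h6 : N ≤ N ^ 96 := Nat.le_self_pow (by norm_num) _
    have h5 : N ^ 99 = N ^ 96 * N ^ 3 := by rw [← pow_add]
    have h7 : 2 ^ 3 ≤ N ^ 3 := Nat.pow_le_pow_left hN _
    calc N + branches k + 1
        ≤ 2 ^ (288 * x) * N ^ 96 + 2 ^ (288 * x) * N ^ 96 + 2 ^ (288 * x) * N ^ 96 := by
          have g1 : N ^ 96 ≤ 2 ^ (288 * x) * N ^ 96 := Nat.le_mul_of_pos_left _ (by omega)
          have g2 : 2 ^ (288 * x) * 2 ^ 96 ≤ 2 ^ (288 * x) * N ^ 96 := Nat.mul_le_mul_left _ h3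
          omega
      _ = 2 ^ (288 * x) * (N ^ 96 * 3) := by ring
      _ ≤ 2 ^ (288 * x) * N ^ 99 := by
          rw [h5]
          exact Nat.mul_le_mul_left _ (Nat.mul_le_mul_left _ (by omega))
  calc κ * (N + branches k + 1) ^ κ ≤ N ^ κ * (2 ^ (288 * x) * N ^ 99) ^ κ := by
        refine Nat.mul_le_mul ?_ (Nat.pow_le_pow_left hW _)
        exact Nat.lt_two_pow_self.le.trans (Nat.pow_le_pow_left hN _)
    _ = 2 ^ (288 * κ * x) * N ^ (100 * κ) := by
        rw [mul_pow, ← pow_mul, ← pow_mul, mul_left_comm, ← pow_add]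
        ring_nf
    -- Up to this point the estimate is only singly exponential in `x`; the second exponential is
    -- not exploited.
    _ ≤ 2 ^ 2 ^ (300 * κ * x) * N ^ (300 * κ) := by
        refine Nat.mul_le_mul (Nat.pow_le_pow_right (by norm_num) ?_)
          (Nat.pow_le_pow_right (by omega) (by omega))
        refine Nat.lt_two_pow_self.le.trans (Nat.pow_le_pow_right (by norm_num) ?_)
        exact Nat.mul_le_mul_right _ (Nat.mul_le_mul_right _ (by norm_num))

/-- The width of the sequences found by the algorithm. -/
theorem width_le {a k : ℕ} (ha : 2 ≤ a) (hk : 1 ≤ k) :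
    2 * (richness k * richness k * a ^ (richness k * (3 * richness k))) +
      (3 * richness k + richness k * richness k * (3 * richness k)) *
        (2 * (richness k * richness k * a ^ (richness k * (3 * richness k)))) ≤
      a ^ (100 * k ^ 4) := by
  have hr := richness_le hk
  have hk4 : k ≤ k ^ 4 := Nat.le_self_pow (by norm_num) _
  have h1 : richness k ≤ a ^ (4 * k ^ 4) := by
    have h2 : k ^ 2 ≤ 2 ^ (2 * k) := by
      rw [mul_comm 2 k, pow_mul]
      exact Nat.pow_le_pow_left Nat.lt_two_pow_self.le 2
    calc richness k ≤ 4 * k ^ 2 := hr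
      _ ≤ 2 ^ 2 * 2 ^ (2 * k) := Nat.mul_le_mul_left 4 h2
      _ = 2 ^ (2 + 2 * k) := by rw [pow_add]
      _ ≤ 2 ^ (4 * k ^ 4) := Nat.pow_le_pow_right (by norm_num) (by omega)
      _ ≤ a ^ (4 * k ^ 4) := Nat.pow_le_pow_left ha _
  have h2 : a ^ (richness k * (3 * richness k)) ≤ a ^ (48 * k ^ 4) := by
    refine Nat.pow_le_pow_right (by omega) ?_
    calc richness k * (3 * richness k) ≤ 4 * k ^ 2 * (3 * (4 * k ^ 2)) := by gcongr
      _ = 48 * k ^ 4 := by ring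
  have h3 : 16 ≤ a ^ (4 * k ^ 4) := by
    calc 16 = 2 ^ 4 := by norm_num
      _ ≤ 2 ^ (4 * k ^ 4) := Nat.pow_le_pow_right (by norm_num) (by omega)
      _ ≤ a ^ (4 * k ^ 4) := Nat.pow_le_pow_left ha _
  have h4 : 1 ≤ richness k := by have := four_le_richness hk; omega
  set K := richness k
  set X := a ^ (4 * k ^ 4) with hX
  set Z := a ^ (K * (3 * K))
  have h5 : 1 + (3 * K + K * K * (3 * K)) ≤ 7 * K ^ 3 := by
    have : K ≤ K ^ 3 := Nat.le_self_pow (by norm_num) _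
    have e : K * K * (3 * K) = 3 * K ^ 3 := by ring
    omega
  calc 2 * (K * K * Z) + (3 * K + K * K * (3 * K)) * (2 * (K * K * Z))
      = 2 * (1 + (3 * K + K * K * (3 * K))) * (K * K * Z) := by ring
    _ ≤ 2 * (7 * K ^ 3) * (K * K * Z) := by gcongr
    _ = 14 * K ^ 5 * Z := by ring
    -- Here `14 ≤ 16 ≤ X` and `K ≤ X`; the exponents add up to `4 * 6 + 48 = 72`.
    _ ≤ X * X ^ 5 * a ^ (48 * k ^ 4) := by gcongr; omega
    _ = a ^ (72 * k ^ 4) := by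
        rw [hX, ← pow_mul, ← pow_add, ← pow_add]; ring_nf
    _ ≤ a ^ (100 * k ^ 4) := Nat.pow_le_pow_right (by omega) (by omega)

end TwinWidth

/-! ### The main algorithm as a program. -/

namespace TwinWidth

namespace Cmd

/-- Running a compiled command. -/
theorem runs_of_static {V : List ℕ} {c : Cmd} {d B κ : ℕ} (hc : c.varsBelow d = true)
    (hV : c.static V = true) (hd : (V.all fun v => decide (v < d)) = true)
    (hκ : ∀ B, c.time B ≤ κ * (B + 1) ^ κ) {s σ : State} (h : AgreeBelow d s σ)
    (hB : ∀ v ∈ V, σ.var v ≤ B) :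
    ∃ s' t, (c.compile d).Runs s s' t ∧ t ≤ κ * (B + 1) ^ κ ∧ AgreeBelow d s' (c.exec σ) := by
  obtain ⟨s', t, h1, h2, h3⟩ := compile_runs c d s σ hc hV
    (fun v hv => ⟨by simpa using List.all_eq_true.1 hd v hv, hB v hv⟩) h
  exact ⟨s', t, h1, h2.trans (hκ B), h3⟩

/-- Compute `v_K` and `v_L` from `v_k`. -/
def setK : Cmd :=
  .seq (.assign v_K (.add (Term.mulVar v_k (.add (.var v_k) (.lit 1)))
    (Term.mulVar v_k (.add (.var v_k) (.lit 1)))))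
    (.assign v_L (.add (.var v_K) (.add (.var v_K) (.var v_K))))

/-- Compute the square of `v_K`. -/
def setSq : Cmd := .assign v_w (Term.mulVar v_K (.var v_K))

/-- Compute `v_W`. -/
def setW : Cmd :=
  .seq (.assign v_W (.lit 1)) (.loop v_step v_L (.assign v_W (Term.mulVar v_w (.var v_W))))

theorem exec_setK (s : State) : (setK.exec s).var v_K = richness (s.var v_k) ∧
    (setK.exec s).var v_L = 3 * richness (s.var v_k) := by
  have h : (Term.mulVar v_k (.add (.var v_k) (.lit 1))).eval s = s.var v_k * (s.var v_k + 1) :=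
    Term.eval_mulVar fun i => by simp [setVar_var]
  have h' : (setK.exec s).var v_K = richness (s.var v_k) := by
    simp only [setK, exec, Term.eval_add, h, setVar_var, richness]
    simp
    ring
  refine ⟨h', ?_⟩
  rw [← h']
  simp only [setK, exec, Term.eval_add, Term.eval_var, setVar_var_self,
    setVar_var_ne _ _ (show v_K ≠ v_L by decide)]
  ring

theorem exec_setSq (s : State) : (setSq.exec s).var v_w = s.var v_K * s.var v_K := by
  rw [setSq, exec, setVar_var_self]
  exact Term.eval_mulVar fun i => by simp [setVar_var]

theorem exec_setW (s : State) : (setW.exec s).var v_W = s.var v_w ^ s.var v_L := by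
  have h := exec_loop_induction (x := v_step) (v := v_L)
    (c := .assign v_W (Term.mulVar v_w (.var v_W))) (s := s.setVar v_W 1)
    (P := fun i s' => s'.var v_w = s.var v_w ∧ s'.var v_W = s.var v_w ^ i)
    ⟨setVar_var_ne _ _ (by decide), by rw [setVar_var_self, pow_zero]⟩ ?_
  · rw [setVar_var_ne _ _ (by decide)] at h
    exact h.2
  · rintro i _ s' ⟨h1, h2⟩
    refine ⟨?_, ?_⟩
    · rw [exec, setVar_var_ne _ _ (by decide), setVar_var_ne _ _ (by decide), h1]
    · rw [exec, setVar_var_self, Term.eval_mulVar (w := s'.var v_W) fun i => by simp [setVar_var],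
        setVar_var_ne _ _ (by decide), h1, h2, pow_succ, mul_comm]

/-- The number of variables that are not auxiliary. -/
notation "v_max" => 64

/-- The program for the main algorithm, with the computation of its parameters from `v_k`. -/
def solve : Program :=
  .seq (setK.compile v_max) (.seq (setSq.compile v_max)
    (.seq (setW.compile v_max) (core.compile v_max)))

theorem CoreResult.congr {N h K L : ℕ} {g : ℕ → ℕ} {F E : ℕ} {s s' : State}
    (hs : CoreResult N h K L g F E s) (ha : AgreeBelow v_max s' s) :
    CoreResult N h K L g F E s' := by
  unfold CoreResult
  rw [ha.1 v_flag (by decide), ha.2]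
  exact hs

/-- The parameters are computed in separate commands because a command must not change the bounds of
its own loops. Nothing is assumed about the rest of the memory and the instance is preserved, so the
program can be run again for another `k`. -/
theorem solve_runs : ∃ κ, ∀ {N h k f E : ℕ} {g : ℕ → ℕ} {s : State}, 1 ≤ N → 1 ≤ k →
    Bounded N h (matOf N g) (richness k) (3 * richness k) f E →
    s.var v_N = N → s.var v_h = h → s.var v_k = k → s.arr a_mat = g →
    ∃ s' t, solve.Runs s s' t ∧ t ≤ κ * (N + branches k + 1) ^ κ ∧
      CoreResult N h (richness k) (3 * richness k) g (2 * f) E s' ∧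
      s'.var v_N = N ∧ s'.var v_h = h ∧ s'.var v_k = k ∧ s'.arr a_mat = g := by
  obtain ⟨κ₁, h₁⟩ := exists_time_le setK
  obtain ⟨κ₂, h₂⟩ := exists_time_le setSq
  obtain ⟨κ₃, h₃⟩ := exists_time_le setW
  obtain ⟨κ₄, h₄⟩ := exists_time_le core
  refine ⟨κ₁ + κ₂ + κ₃ + κ₄, fun {N h k f E g s} hN hk hB hsN hsh hsk hsm => ?_⟩
  set B := N + branches k with hBdef
  have hr4 := four_le_richness hk
  have hrsq := sq_richness_le_branches hk
  have hr1 : 3 * richness k ≤ branches k := by nlinarith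
  have hkK : k ≤ richness k := by rw [richness]; nlinarith
  obtain ⟨s1, t1, r1, l1, a1⟩ := runs_of_static (V := [v_k]) (c := setK) (d := v_max) (B := B)
    (by decide) (by decide) (by decide) h₁ (AgreeBelow.refl _ s) (by
      intro v hv
      rw [List.mem_singleton] at hv
      rw [hv, hsk]; omega)
  obtain ⟨k1, k2⟩ := exec_setK s
  rw [hsk] at k1 k2
  set σ1 := setK.exec s with hσ1
  obtain ⟨s2, t2, r2, l2, a2⟩ := runs_of_static (V := [v_K]) (c := setSq) (d := v_max) (B := B)
    (by decide) (by decide) (by decide) h₂ a1 (by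
      intro v hv
      rw [List.mem_singleton] at hv
      rw [hv, k1]; omega)
  have k3 := exec_setSq σ1
  rw [k1] at k3
  set σ2 := setSq.exec σ1 with hσ2
  have k4 : σ2.var v_L = 3 * richness k := by rw [hσ2, exec_var (by decide), k2]
  obtain ⟨s3, t3, r3, l3, a3⟩ := runs_of_static (V := [v_L, v_w]) (c := setW) (d := v_max) (B := B)
    (by decide) (by decide) (by decide) h₃ a2 (by
      intro v hv
      rw [List.mem_cons, List.mem_singleton] at hv
      rcases hv with rfl | rfl
      · rw [k4]; omega
      · rw [k3]; omega)
  have k5 := exec_setW σ2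
  rw [k3, k4] at k5
  set σ3 := setW.exec σ2 with hσ3
  have p3 : Params N h (richness k) (3 * richness k) g σ3 := by
    refine ⟨k5, ?_, ?_, ?_, ?_, ?_⟩
    · rw [hσ3, exec_var (by decide), hσ2, exec_var (by decide), hσ1, exec_var (by decide), hsN]
    · rw [hσ3, exec_var (by decide), hσ2, exec_var (by decide), hσ1, exec_var (by decide), hsh]
    · rw [hσ3, exec_var (by decide), hσ2, exec_var (by decide), k1]
    · rw [hσ3, exec_var (by decide), k4]
    · rw [hσ3, exec_arr (by decide), hσ2, exec_arr (by decide), hσ1, exec_arr (by decide), hsm]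
  have kk : σ3.var v_k = k := by
    rw [hσ3, exec_var (by decide), hσ2, exec_var (by decide), hσ1, exec_var (by decide), hsk]
  obtain ⟨s4, t4, r4, l4, a4⟩ := runs_of_static (V := [v_N, v_K, v_L, v_W]) (c := core)
    (d := v_max) (B := B) (by decide) (by decide) (by decide) h₄ a3 (by
      intro v hv
      simp only [List.mem_cons, List.not_mem_nil, or_false] at hv
      rcases hv with rfl | rfl | rfl | rfl
      · rw [p3.N]; omega
      · rw [p3.K]; omega
      · rw [p3.L]; omega
      · rw [p3.W]
        exact Nat.le_add_left _ _)
  have p4 : Params N h (richness k) (3 * richness k) g (core.exec σ3) :=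
    p3.exec _ (by decide) (by decide)
  refine ⟨s4, _, .seq r1 (.seq r2 (.seq r3 r4)), ?_,
    (exec_core hN (by omega) hB p3).congr a4, ?_, ?_, ?_, ?_⟩
  · have hpow : ∀ κ, κ ≤ κ₁ + κ₂ + κ₃ + κ₄ →
        κ * (B + 1) ^ κ ≤ κ * (B + 1) ^ (κ₁ + κ₂ + κ₃ + κ₄) := fun κ h =>
      Nat.mul_le_mul_left _ (Nat.pow_le_pow_right (Nat.succ_pos _) h)
    have e1 := hpow κ₁ (by omega)
    have e2 := hpow κ₂ (by omega)
    have e3 := hpow κ₃ (by omega)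
    have e4 := hpow κ₄ (by omega)
    rw [add_mul, add_mul, add_mul]
    omega
  · rw [a4.1 _ (by decide), p4.N]
  · rw [a4.1 _ (by decide), p4.h]
  · rw [a4.1 _ (by decide), exec_var (by decide), kk]
  · rw [a4.2, p4.mat]

/-- The command `for v_r < v: for v_s < v_N: a[v_N * v_r + v_s] := t`. -/
def fillRows (a v : ℕ) (t : Term) : Cmd :=
  .loop v_r v (.loop v_s v_N
    (.store a (.add (Term.mulVar v_N (.var v_r)) (.var v_s)) t))

/-- The index `N * i + j` with `j < N` determines `i` and `j`, so no entry is overwritten. The term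
may read every array except the one being filled. -/
theorem exec_fillRows {a v : ℕ} {t : Term} {s : State} {g : ℕ → ℕ → ℕ}
    (ht : ∀ i < s.var v, ∀ j < s.var v_N, ∀ s' : State,
      s'.var = ((s.setVar v_r i).setVar v_s j).var → (∀ b ≠ a, s'.arr b = s.arr b) →
      t.eval s' = g i j) {i j : ℕ} (hi : i < s.var v) (hj : j < s.var v_N) :
    ((fillRows a v t).exec s).arr a (s.var v_N * i + j) = g i j := by
  set N := s.var v_N with hN
  have hinj : ∀ {i j i' j'}, j < N → j' < N → N * i + j = N * i' + j' → i = i' ∧ j = j' := by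
    intro i j i' j' hj hj' e
    have h1 : (N * i + j) / N = i := by
      rw [Nat.mul_add_div (by omega), Nat.div_eq_of_lt hj, add_zero]
    have h2 : (N * i' + j') / N = i' := by
      rw [Nat.mul_add_div (by omega), Nat.div_eq_of_lt hj', add_zero]
    rw [e, h2] at h1
    subst h1
    exact ⟨rfl, by omega⟩
  set body : Cmd := .store a (.add (Term.mulVar v_N (.var v_r)) (.var v_s)) t with hbody
  have inner : ∀ i < s.var v, ∀ s', (∀ z, z ≠ v_r → z ≠ v_s → s'.var z = s.var z) →
      s'.var v_r = i → (∀ b ≠ a, s'.arr b = s.arr b) →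
      (∀ z, z ≠ v_r → z ≠ v_s → ((loop v_s v_N body).exec s').var z = s.var z) ∧
      (∀ b ≠ a, ((loop v_s v_N body).exec s').arr b = s.arr b) ∧
      (∀ i' j', j' < N → ((loop v_s v_N body).exec s').arr a (N * i' + j') =
        if i' = i then g i j' else s'.arr a (N * i' + j')) := by
    intro i hi s' hv hr hb
    have hN' : s'.var v_N = N := hv _ (by decide) (by decide)
    have key := exec_loop_induction (x := v_s) (v := v_N) (c := body) (s := s')
      (P := fun k s'' => (∀ z, z ≠ v_s → s''.var z = s'.var z) ∧
        (∀ b ≠ a, s''.arr b = s.arr b) ∧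
        (∀ i' j', j' < N → s''.arr a (N * i' + j') =
          if i' = i ∧ j' < k then g i j' else s'.arr a (N * i' + j')))
      ⟨fun _ _ => rfl, hb, fun _ _ _ => by simp⟩ ?_
    · obtain ⟨k1, k2, k3⟩ := key
      refine ⟨fun z h1 h2 => (k1 z h2).trans (hv z h1 h2), k2, fun i' j' hj' => ?_⟩
      rw [k3 i' j' hj', hN']
      simp [hj']
    · rintro k hk s'' ⟨k1, k2, k3⟩
      rw [hN'] at hk
      have hvar : (s''.setVar v_s k).var = ((s.setVar v_r i).setVar v_s k).var := by
        funext z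
        rw [setVar_var, setVar_var, setVar_var]
        split_ifs with e1 e2
        · rfl
        · rw [k1 z e1, e2, hr]
        · rw [k1 z e1, hv z e2 e1]
      have hval : t.eval (s''.setVar v_s k) = g i k := ht i hi k hk _ hvar k2
      have hidx : (Term.add (Term.mulVar v_N (.var v_r)) (.var v_s)).eval (s''.setVar v_s k) =
          N * i + k := by
        rw [Term.eval_add, Term.eval_mulVar (w := i) fun l => ?_, Term.eval_var, setVar_var_self,
          setVar_var_ne _ _ (by decide), k1 _ (by decide), hN']
        rw [Term.eval_var, setVar_var_ne _ _ (by decide), setVar_var_ne _ _ (by decide),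
          k1 _ (by decide), hr]
      simp only [hbody, exec, hval, hidx]
      refine ⟨fun z hz => ?_, fun b hb => ?_, fun i' j' hj' => ?_⟩
      · rw [setArr_var, setVar_var_ne _ _ hz, k1 z hz]
      · funext l
        rw [setArr_arr, if_neg (fun h => hb h.1), setVar_arr, k2 b hb]
      · rw [setArr_arr, setVar_arr, k3 i' j' hj']
        by_cases he : N * i' + j' = N * i + k
        · obtain ⟨rfl, rfl⟩ := hinj hj' hk he
          simp
        · rw [if_neg (fun h => he h.2)]
          by_cases hi' : i' = i
          · subst hi'
            have : j' ≠ k := fun h => he (by rw [h])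
            by_cases hlt : j' < k
            · rw [if_pos ⟨rfl, hlt⟩, if_pos ⟨rfl, by omega⟩]
            · rw [if_neg (fun h => hlt h.2), if_neg (fun h => by omega)]
          · rw [if_neg (fun h => hi' h.1), if_neg (fun h => hi' h.1)]
  have outer := exec_loop_induction (x := v_r) (v := v) (c := .loop v_s v_N body) (s := s)
    (P := fun k s' => (∀ z, z ≠ v_r → z ≠ v_s → s'.var z = s.var z) ∧
      (∀ b ≠ a, s'.arr b = s.arr b) ∧
      (∀ i' < k, ∀ j' < N, s'.arr a (N * i' + j') = g i' j'))
    ⟨fun _ _ _ => rfl, fun _ _ => rfl, fun _ h => absurd h (by omega)⟩ ?_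
  · exact outer.2.2 i hi j hj
  · rintro k hk s' ⟨k1, k2, k3⟩
    obtain ⟨g1, g2, g3⟩ := inner k hk (s'.setVar v_r k)
      (fun z h1 h2 => by rw [setVar_var_ne _ _ h1, k1 z h1 h2]) (setVar_var_self _ _ _) k2
    refine ⟨g1, g2, fun i' hi' j' hj' => ?_⟩
    rw [g3 i' j' hj']
    split_ifs with e
    · rw [e]
    · exact k3 i' (by omega) j' hj'

end Cmd
end TwinWidth

/-! ### The algorithm for matrices. -/

namespace TwinWidth

theorem IsSequence.mono {R C α : Type*} [Fintype R] [LinearOrder R] [Fintype C] [LinearOrder C]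
    [DecidableEq α] {M : R → C → α} {d e d' e' : ℕ} {P : ℕ → MatPartition R C}
    (h : IsSequence M d e P) (hd : d ≤ d') (he : e ≤ e') : IsSequence M d' e' P where
  contraction := h.contraction
  rows_overlap t ht S hS := (h.rows_overlap t ht S hS).trans hd
  cols_overlap t ht S hS := (h.cols_overlap t ht S hS).trans hd
  error t ht := ⟨fun X hX => ((h.error t ht).1 X hX).trans he,
    fun Y hY => ((h.error t ht).2 Y hY).trans he⟩

theorem IsSequence.tww_le {R C α : Type*} [Fintype R] [LinearOrder R] [Fintype C] [LinearOrder C]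
    [DecidableEq α] {M : R → C → α} {d e : ℕ} {P : ℕ → MatPartition R C}
    (h : IsSequence M d e P) : tww M ≤ d + e :=
  Nat.sInf_le ⟨d, e, rfl, P, h⟩

theorem part_shiftLabel_eq_iff {n o : ℕ} {f : ℕ → ℕ} {i i' : Fin n} :
    (shiftLabel n o f).part i = (shiftLabel n o f).part i' ↔ f (o + i) = f (o + i') := by
  rw [shiftLabel, part_ofLabel, part_ofLabel, labelClass_eq_iff]

/-- The symmetric matrix with a given matrix, stored in an array, as its upper right block. -/
def blockMatrix (n m : ℕ) (a : ℕ → ℕ) (r s : ℕ) : ℕ :=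
  if r < n ∧ ¬ s < n then a (m * r + (s - n))
  else if ¬ r < n ∧ s < n then a (m * s + (r - n)) else 0

theorem blockMatrix_symm (n m : ℕ) (a : ℕ → ℕ) (r s : ℕ) :
    blockMatrix n m a r s = blockMatrix n m a s r := by
  unfold blockMatrix
  by_cases h : r < n <;> by_cases h' : s < n <;> simp [h, h']

section

variable {A : Type} [Fintype A] {name : A ≃ Fin (Fintype.card A)} {n m : ℕ}
  {M : Fin n → Fin m → A} {a : ℕ → ℕ} {M' : ℕ → ℕ → ℕ}

/-- Outside the columns of the upper right block its rows run through the zero diagonal block. -/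
theorem embeds_block (ha : ∀ i j, a (m * (i : Fin n) + (j : Fin m)) = name (M i j))
    (hM' : ∀ x < n + m, ∀ y < n + m, M' x y = blockMatrix n m a x y) :
    Embeds (n + m) M' M 0 n where
  rows_le := by omega
  cols_le := le_rfl
  eq_iff i j i' j' := by
    have hval : ∀ (i : Fin n) (j : Fin m), M' (0 + i) (n + j) = name (M i j) := fun i j => by
      rw [zero_add, hM' _ (by omega) _ (by omega), blockMatrix, if_pos ⟨by omega, by omega⟩,
        ← ha i j, Nat.add_sub_cancel_left]
    rw [hval, hval, Fin.val_inj, name.injective.eq_iff]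
  outside i i' c hc h := by
    rw [hM' _ (by omega) _ hc, hM' _ (by omega) _ hc, blockMatrix, blockMatrix]
    rw [if_neg (by omega), if_neg (by omega), if_neg (by omega), if_neg (by omega)]

theorem embeds_block_transpose (ha : ∀ i j, a (m * (i : Fin n) + (j : Fin m)) = name (M i j))
    (hM' : ∀ x < n + m, ∀ y < n + m, M' x y = blockMatrix n m a x y) :
    Embeds (n + m) M' (fun j i => M i j) n 0 where
  rows_le := le_rfl
  cols_le := by omega
  eq_iff j i j' i' := by
    have hval : ∀ (i : Fin n) (j : Fin m), M' (n + j) (0 + i) = name (M i j) := fun i j => by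
      rw [zero_add, hM' _ (by omega) _ (by omega), blockMatrix, if_neg (by omega),
        if_pos ⟨by omega, by omega⟩, ← ha i j, Nat.add_sub_cancel_left]
    rw [hval, hval, Fin.val_inj, name.injective.eq_iff]
  outside i i' c hc h := by
    rw [hM' _ (by omega) _ hc, hM' _ (by omega) _ hc, blockMatrix, blockMatrix]
    rw [if_neg (by omega), if_neg (by omega), if_neg (by omega), if_neg (by omega)]

theorem transposeInvariant_block
    (hM' : ∀ x < n + m, ∀ y < n + m, M' x y = blockMatrix n m a x y) :
    TransposeInvariant (n + m) M' := by
  intro x hx y hy x' hx' y' hy' h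
  rw [hM' y hy x hx, hM' y' hy' x' hx', blockMatrix_symm, blockMatrix_symm n m a y' x',
    ← hM' x hx y hy, ← hM' x' hx' y' hy', h]

theorem block_mem_range [Nonempty A]
    (ha : ∀ i j, a (m * (i : Fin n) + (j : Fin m)) = name (M i j))
    (hM' : ∀ x < n + m, ∀ y < n + m, M' x y = blockMatrix n m a x y) :
    ∀ x < n + m, ∀ y < n + m, M' x y ∈ Finset.range (Fintype.card A) := by
  intro x hx y hy
  rw [hM' x hx y hy, Finset.mem_range, blockMatrix]
  split_ifs with h1 h2
  · have := ha ⟨x, h1.1⟩ ⟨y - n, by omega⟩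
    simp only at this
    rw [this]
    exact Fin.isLt _
  · have := ha ⟨y, h2.2⟩ ⟨x - n, by omega⟩
    simp only at this
    rw [this]
    exact Fin.isLt _
  · exact Fintype.card_pos

theorem matrixInput_arr (M : Fin n → Fin m → A) (k : ℕ) (i : Fin n) (j : Fin m) :
    (matrixInput name M k).arr 0 (m * i + j) = name (M i j) := by
  have h : m * (i : ℕ) + j < n * m := by
    calc m * (i : ℕ) + j < m * i + m := by omega
      _ = m * (i + 1) := by ring
      _ ≤ m * n := Nat.mul_le_mul_left m i.2
      _ = n * m := mul_comm m n
  have e : finProdFinEquiv.symm ⟨m * (i : ℕ) + j, h⟩ = (i, j) := by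
    rw [Equiv.symm_apply_eq]
    ext
    simp [add_comm]
  simp only [matrixInput, toArray, dif_pos h, e]

end

/-- The conclusions from the result of the main algorithm on a block matrix. -/
theorem isRich_of_block {α : Type*} [DecidableEq α] {n m k : ℕ} (hn : 1 ≤ n) (hm : 1 ≤ m)
    (hk : 1 ≤ k) {M : Fin n → Fin m → α} {M' : ℕ → ℕ → ℕ} {a : ℕ → ℕ}
    (hA : Embeds (n + m) M' M 0 n) (hA' : Embeds (n + m) M' (fun j i => M i j) n 0)
    (hM' : ∀ x < n + m, ∀ y < n + m, M' x y = blockMatrix n m a x y) {dl : ℕ → ℕ}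
    (hd : IsDiv (n + m) n dl) (hs : Stuck (n + m) n M' (richness k) (3 * richness k) dl)
    (he : ∃ x, Eligible (n + m) n dl x) :
    IsRich M (2 * k * (k + 1)) ⟨shiftLabel n 0 (pairLabel (n + m) n dl),
      shiftLabel m n (pairLabel (n + m) n dl)⟩ := by
  have hr := four_le_richness hk
  obtain ⟨x, hx⟩ := he
  obtain ⟨y, hy, hxy⟩ := hd.exists_eligible_opposite (K := richness k) (L := 3 * richness k)
    (M := M') (by omega) (by omega) (fun r hr r' hr' c hc h1 h2 => by
      rw [hM' r hr c hc, hM' r' hr' c hc, blockMatrix, blockMatrix, if_neg (by tauto),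
        if_neg (by tauto), if_neg (by tauto), if_neg (by tauto)]) hs hx
  -- Each side contains one of the mergeable positions `x` and `y`, hence at least two intervals.
  have two : ∀ o, (o < n ↔ x < n) ∨ (o < n ↔ y < n) → 2 ≤ (leaders (n + m) n dl o).card := by
    rintro o (h | h)
    · rw [leaders_congr h]; exact hd.two_le_card_leaders hx
    · rw [leaders_congr h]; exact hd.two_le_card_leaders hy
  exact isRich_pairLabel hA hA' hd ⟨hn, by omega, fun y hy => by omega⟩
    ⟨hm, le_rfl, fun y hy => by omega⟩ hs (two 0 (by omega)) (two n (by omega))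

namespace Cmd

/-- Read the size of the matrix and the parameter. -/
def readSize : Cmd :=
  .seq (.assign v_N (.add (.var 0) (.var 1))) (.seq (.assign v_h (.var 0)) (.assign v_k (.var 2)))

/-- The entries of the block matrix. -/
def blockTerm : Term :=
  .ite (Term.and (.lt (.var v_r) (.var v_h)) (Term.not (.lt (.var v_s) (.var v_h))))
    (.get 0 (.add (Term.mulVar 1 (.var v_r)) (.sub (.var v_s) (.var v_h))))
    (.ite (Term.and (Term.not (.lt (.var v_r) (.var v_h))) (.lt (.var v_s) (.var v_h)))
      (.get 0 (.add (Term.mulVar 1 (.var v_s)) (.sub (.var v_r) (.var v_h)))) (.lit 0))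

theorem eval_blockTerm (s : State) :
    blockTerm.eval s = blockMatrix (s.var v_h) (s.var 1) (s.arr 0) (s.var v_r) (s.var v_s) := by
  have e1 : (Term.mulVar 1 (.var v_r)).eval s = s.var 1 * s.var v_r :=
    Term.eval_mulVar fun i => by simp [setVar_var]
  have e2 : (Term.mulVar 1 (.var v_s)).eval s = s.var 1 * s.var v_s :=
    Term.eval_mulVar fun i => by simp [setVar_var]
  rw [blockTerm, blockMatrix, Term.eval]
  refine if_congr ?_ ?_ ?_
  · rw [Term.and_iff, Term.not_iff, Term.lt_iff, Term.lt_iff]; rfl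
  · rw [Term.eval_get, Term.eval_add, e1]; rfl
  · rw [Term.eval]
    refine if_congr ?_ ?_ rfl
    · rw [Term.and_iff, Term.not_iff, Term.lt_iff, Term.lt_iff]; rfl
    · rw [Term.eval_get, Term.eval_add, e2]; rfl

/-- Build the block matrix. -/
def loadMatrix : Cmd := fillRows a_mat v_N blockTerm

/-- Copy the result to the output. -/
def writeMatrix : Cmd :=
  .seq (fillRows 2 v_N (.get a_out (.add (Term.mulVar v_N (.var v_r)) (.var v_s))))
    (.assign 0 (.var v_flag))

theorem exec_writeMatrix (s : State) : (writeMatrix.exec s).var 0 = s.var v_flag ∧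
    ∀ i < s.var v_N, ∀ j < s.var v_N, (writeMatrix.exec s).arr 2 (s.var v_N * i + j) =
      s.arr a_out (s.var v_N * i + j) := by
  constructor
  · have : ∀ c : Cmd, c.keepsVar v_flag = true →
        ((Cmd.seq c (.assign 0 (.var v_flag))).exec s).var 0 = s.var v_flag := fun c hc => by
      rw [exec, exec, setVar_var_self, Term.eval_var, exec_var hc]
    exact this _ (by decide)
  · intro i hi j hj
    simp only [writeMatrix]
    rw [exec, exec, setVar_arr]
    refine exec_fillRows (g := fun i j => s.arr a_out (s.var v_N * i + j)) ?_ hi hj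
    intro i _ j _ s' h1 h2
    rw [Term.eval_get, Term.eval_add, Term.eval_mulVar (w := i) fun l => ?_, h2 _ (by decide),
      Term.eval_var, h1]
    · simp [setVar_var]
    · rw [Term.eval_var, setVar_var_ne _ _ (by decide), h1]
      simp [setVar_var]

/-- The algorithm for matrices. -/
def solveMatrix : Program :=
  .seq (readSize.compile v_max) (.seq (loadMatrix.compile v_max)
    (.seq solve (writeMatrix.compile v_max)))

/-- The matrix built in memory is known only at indices below `n + m`, so the bounds are required
for every matrix that agrees with the block matrix there. Only the first `n + m` labellings are
copied to the output; a complete sequence has fewer. -/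
theorem solveMatrix_runs : ∃ κ, ∀ {n m k f E : ℕ} {a : ℕ → ℕ} {s : State}, 1 ≤ n → 1 ≤ m → 1 ≤ k →
    s.var 0 = n → s.var 1 = m → s.var 2 = k → s.arr 0 = a →
    (∀ M' : ℕ → ℕ → ℕ, (∀ x < n + m, ∀ y < n + m, M' x y = blockMatrix n m a x y) →
      Bounded (n + m) n M' (richness k) (3 * richness k) f E) →
    ∃ s' t g, solveMatrix.Runs s s' t ∧ t ≤ κ * (n + m + branches k + 1) ^ κ ∧
      (∀ x < n + m, ∀ y < n + m, matOf (n + m) g x y = blockMatrix n m a x y) ∧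
      ((s'.var 0 = 0 ∧ ∃ dl, IsDiv (n + m) n dl ∧
          Stuck (n + m) n (matOf (n + m) g) (richness k) (3 * richness k) dl ∧
          (∃ x, Eligible (n + m) n dl x) ∧
          ∀ y < n + m, s'.arr 2 y = pairLabel (n + m) n dl y) ∨
        (s'.var 0 = 1 ∧ ∃ T Q, IsChain (n + m) n (matOf (n + m) g) (2 * f) E T Q ∧
          (∀ x < n + m, ∀ y < n + m, (x < n ↔ y < n) → Q T x = Q T y) ∧
          ∀ t ≤ T, t < n + m → ∀ x < n + m, s'.arr 2 (t * (n + m) + x) = Q t x)) := by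
  obtain ⟨κ₁, h₁⟩ := exists_time_le readSize
  obtain ⟨κ₂, h₂⟩ := exists_time_le loadMatrix
  obtain ⟨κ₃, h₃⟩ := solve_runs
  obtain ⟨κ₄, h₄⟩ := exists_time_le writeMatrix
  refine ⟨κ₁ + κ₂ + κ₃ + κ₄, fun {n m k f E a s} hn hm hk e0 e1 e2 ea hB => ?_⟩
  set B := n + m + branches k with hBdef
  obtain ⟨s1, t1, r1, l1, a1⟩ := runs_of_static (V := []) (c := readSize) (d := v_max) (B := B)
    (by decide) (by decide) (by decide) h₁ (AgreeBelow.refl _ s) (by simp)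
  set σ1 := readSize.exec s with hσ1
  have N1 : σ1.var v_N = n + m := by
    simp [hσ1, readSize, exec, setVar_var, e0, e1]
  have H1 : σ1.var v_h = n := by
    simp [hσ1, readSize, exec, setVar_var, e0]
  have K1 : σ1.var v_k = k := by
    simp [hσ1, readSize, exec, setVar_var, e2]
  have M1 : σ1.var 1 = m := by rw [hσ1, exec_var (by decide), e1]
  have A1 : σ1.arr 0 = a := by rw [hσ1, exec_arr (by decide), ea]
  obtain ⟨s2, t2, r2, l2, a2⟩ := runs_of_static (V := [1, v_N]) (c := loadMatrix) (d := v_max)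
    (B := B) (by decide) (by decide) (by decide) h₂ a1 (by
      intro v hv
      rw [List.mem_cons, List.mem_singleton] at hv
      rcases hv with rfl | rfl
      · rw [M1]; omega
      · rw [N1]; omega)
  set σ2 := loadMatrix.exec σ1 with hσ2
  have hmat : ∀ x < n + m, ∀ y < n + m,
      matOf (n + m) (σ2.arr a_mat) x y = blockMatrix n m a x y := by
    intro x hx y hy
    rw [matOf, ← N1, hσ2, loadMatrix]
    refine exec_fillRows (g := blockMatrix n m a) ?_ (by rw [N1]; exact hx) (by rw [N1]; exact hy)
    intro i _ j _ s' g1 g2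
    rw [eval_blockTerm, g1, g2 _ (by decide), A1]
    simp [setVar_var, H1, M1]
  obtain ⟨s3, t3, r3, l3, c3, N3, -, -, -⟩ := h₃ (s := s2) (N := n + m) (h := n) (by omega) hk
    (hB _ hmat)
    (by rw [a2.1 _ (by decide), hσ2, exec_var (by decide), N1])
    (by rw [a2.1 _ (by decide), hσ2, exec_var (by decide), H1])
    (by rw [a2.1 _ (by decide), hσ2, exec_var (by decide), K1]) (by rw [a2.2])
  obtain ⟨s4, t4, r4, l4, a4⟩ := runs_of_static (V := [v_N]) (c := writeMatrix) (d := v_max)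
    (B := B) (by decide) (by decide) (by decide) h₄ (AgreeBelow.refl _ s3) (by
      intro v hv
      rw [List.mem_singleton] at hv
      rw [hv, N3]; omega)
  obtain ⟨w1, w2⟩ := exec_writeMatrix s3
  rw [← a4.1 _ (by decide)] at w1
  rw [← a4.2, N3] at w2
  rw [← hBdef] at l3
  refine ⟨s4, _, σ2.arr a_mat, .seq r1 (.seq r2 (.seq r3 r4)), ?_, hmat, ?_⟩
  · have hpow : ∀ κ, κ ≤ κ₁ + κ₂ + κ₃ + κ₄ →
        κ * (B + 1) ^ κ ≤ κ * (B + 1) ^ (κ₁ + κ₂ + κ₃ + κ₄) := fun κ h =>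
      Nat.mul_le_mul_left _ (Nat.pow_le_pow_right (Nat.succ_pos _) h)
    have e1 := hpow κ₁ (by omega)
    have e2 := hpow κ₂ (by omega)
    have e3 := hpow κ₃ (by omega)
    have e4 := hpow κ₄ (by omega)
    rw [add_mul, add_mul, add_mul]
    omega
  · rw [w1]
    refine c3.imp (fun ⟨c1, dl, c2, c3, c4, c5⟩ => ⟨c1, dl, c2, c3, c4, fun y hy => ?_⟩)
      (fun ⟨c1, T, Q, c2, c3, c4⟩ => ⟨c1, T, Q, c2, c3, fun t ht ht' x hx => ?_⟩)
    · have := w2 0 (by omega) y hy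
      rw [mul_zero, zero_add] at this
      rw [this, c5 y hy]
    · rw [← c4 t ht x hx, mul_comm t]
      exact w2 t ht' x hx

end Cmd

theorem exists_matrix_algorithm : ∃ (prog : Program) (c : ℕ),
    ∀ (A : Type) [Fintype A] [DecidableEq A] (name : A ≃ Fin (Fintype.card A))
      (n m k : ℕ) (M : Fin n → Fin m → A), 1 ≤ n → 1 ≤ m → 1 ≤ k →
    ∃ (s : State) (t : ℕ), prog.Runs (matrixInput name M k) s t ∧
      t ≤ 2 ^ 2 ^ (c * (k ^ 2 * Nat.log 2 k)) * (n + m) ^ c ∧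
      ((s.var 0 = 0 ∧ ∃ D : MatPartition (Fin n) (Fin m), s.OutputsPartition D ∧
          IsRich M (2 * k * (k + 1)) D ∧ k < tww M) ∨
       (s.var 0 = 1 ∧ ∃ P : ℕ → MatPartition (Fin n) (Fin m), s.OutputsSequence P ∧
          IsSequence M (Fintype.card A ^ (c * k ^ 4)) (Fintype.card A ^ (c * k ^ 4)) P ∧
          tww M ≤ Fintype.card A ^ (c * k ^ 4))) := by
  obtain ⟨κ, hκ⟩ := Cmd.solveMatrix_runs
  -- `300 * κ` comes from `time_le` and `100` from `width_le`.
  refine ⟨Cmd.solveMatrix, 300 * κ + 100, fun A _ _ name n m k M hn hm hk => ?_⟩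
  have : Nonempty A := ⟨M ⟨0, hn⟩ ⟨0, hm⟩⟩
  have : Nonempty (Fin n) := ⟨⟨0, hn⟩⟩
  have : Nonempty (Fin m) := ⟨⟨0, hm⟩⟩
  set a := (matrixInput name M k).arr 0 with ha
  have ha' : ∀ (i : Fin n) (j : Fin m), a (m * i + j) = name (M i j) := matrixInput_arr M k
  obtain ⟨f, E, hf, hB, hw⟩ : ∃ f E, 1 ≤ f ∧
      (∀ M' : ℕ → ℕ → ℕ, (∀ x < n + m, ∀ y < n + m, M' x y = blockMatrix n m a x y) →
        Bounded (n + m) n M' (richness k) (3 * richness k) f E) ∧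
      (2 * f - 1) + E * (2 * f) ≤ Fintype.card A ^ ((300 * κ + 100) * k ^ 4) := by
    -- A power of one allows only width `1`, which forces `f = 1` and `E = 0`. With at least two
    -- letters the general bounds fit.
    rcases Nat.lt_or_ge (Fintype.card A) 2 with h | h
    · have hc : Fintype.card A = 1 := by have := Fintype.card_pos (α := A); omega
      refine ⟨1, 0, le_rfl, fun M' hM' => bounded_of_constant (v := 0) (fun x hx y hy => ?_) _ _, ?_⟩
      · have := block_mem_range ha' hM' x hx y hy
        rw [hc] at this
        simpa using this
      · rw [hc]; simp
    · have hr := four_le_richness hk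
      refine ⟨_, _, ?_, fun M' hM' => bounded_of_transposeInvariant (transposeInvariant_block hM')
        (by omega) (block_mem_range ha' hM'), ?_⟩
      · rw [Finset.card_range]
        exact Nat.mul_pos (Nat.mul_pos (by omega) (by omega)) (Nat.pow_pos (by omega))
      · rw [Finset.card_range]
        refine (Nat.add_le_add_right (Nat.sub_le _ _) _).trans ((width_le h hk).trans ?_)
        exact Nat.pow_le_pow_right (by omega) (Nat.mul_le_mul_right _ (by omega))
  obtain ⟨s, t, g, hrun, ht, hmat, hres⟩ := hκ (s := matrixInput name M k) hn hm hk rfl rfl rfl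
    ha.symm hB
  have hA := embeds_block ha' hmat
  have hA' := embeds_block_transpose ha' hmat
  refine ⟨s, t, hrun, ht.trans ((time_le (x := k ^ 2 * Nat.log 2 k) (by omega) hk le_rfl).trans ?_),
    hres.imp (fun ⟨h0, dl, hd, hs, he, hout⟩ => ⟨h0, _, ?_,
      isRich_of_block hn hm hk hA hA' hmat hd hs he, ?_⟩)
    (fun ⟨h1, T, Q, hQ, hend, hout⟩ => ?_)⟩
  · refine Nat.mul_le_mul (Nat.pow_le_pow_right (by norm_num) (Nat.pow_le_pow_right (by norm_num)
      (Nat.mul_le_mul_right _ (by omega)))) (Nat.pow_le_pow_right (by omega) (by omega))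
  · constructor
    · intro i i'
      rw [hout _ (by omega), hout _ (by omega), part_shiftLabel_eq_iff]
    · intro j j'
      rw [hout _ (by omega), hout _ (by omega), part_shiftLabel_eq_iff, zero_add]
  · exact lt_tww_of_isRich hk (exists_isSequence hn hm M)
      (isRich_of_block hn hm hk hA hA' hmat hd hs he)
  · obtain ⟨hT, hseq⟩ := hQ.isSequence_disjoint hn hm hA hA' (by omega) hend
    refine ⟨h1, _, ?_, hseq.mono (by omega) (by omega), hseq.tww_le.trans hw⟩
    intro t ht
    have hlast : lastIndex (Fin n) (Fin m) = n + m - 2 := by simp [lastIndex]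
    have htN : t < n + m := by omega
    constructor
    · intro i i'
      rw [hout t (by omega) htN i (by omega), hout t (by omega) htN i' (by omega),
        part_shiftLabel_eq_iff, zero_add, zero_add]
    · intro j j'
      rw [add_assoc, add_assoc, hout t (by omega) htN _ (by omega),
        hout t (by omega) htN _ (by omega), part_shiftLabel_eq_iff]

end TwinWidth

/-! ### Encodings of ordered binary structures, and the search for the parameter. -/

namespace TwinWidth

/-- The entries of a matrix with the bits of `p` relations and their converses as digits. -/
def code (b : ℕ → ℕ → ℕ → ℕ) : ℕ → ℕ → ℕ → ℕ
  | 0, _, _ => 0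
  | p + 1, x, y => 4 * code b p x y + (b p x y + 2 * b p y x)

theorem code_lt {b : ℕ → ℕ → ℕ → ℕ} {p x y : ℕ} (h : ∀ i < p, b i x y ≤ 1 ∧ b i y x ≤ 1) :
    code b p x y < 4 ^ p := by
  induction p with
  | zero => simp [code]
  | succ p ih =>
    have h1 := ih fun i hi => h i (by omega)
    have h2 := h p (by omega)
    rw [code, pow_succ]
    omega

/-- Each relation contributes one digit in base four, which stores its two truth values separately.
-/
theorem code_eq_iff {b : ℕ → ℕ → ℕ → ℕ} {p x y x' y' : ℕ} (h : ∀ i < p, b i x y ≤ 1 ∧ b i y x ≤ 1)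
    (h' : ∀ i < p, b i x' y' ≤ 1 ∧ b i y' x' ≤ 1) :
    code b p x y = code b p x' y' ↔ ∀ i < p, b i x y = b i x' y' ∧ b i y x = b i y' x' := by
  induction p with
  | zero => simp [code]
  | succ p ih =>
    have h1 := ih (fun i hi => h i (by omega)) fun i hi => h' i (by omega)
    have h2 := h p (by omega)
    have h3 := h' p (by omega)
    rw [Nat.forall_lt_succ_right, ← h1, code, code]
    omega

theorem encoding_eq_iff {p q : ℕ} {V : Type*} [LinearOrder V] (G : OrderedBinaryStructure p q V)
    (x y x' y' : V) : G.encoding x y = G.encoding x' y' ↔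
      ∀ i, G.rel i x y = G.rel i x' y' ∧ G.rel i y x = G.rel i y' x' := by
  rw [funext_iff]
  refine forall_congr' fun i => ?_
  simp only [OrderedBinaryStructure.encoding]
  cases G.rel i x y <;> cases G.rel i y x <;> cases G.rel i x' y' <;> cases G.rel i y' x' <;> simp

theorem structureInput_arr {p q n : ℕ} (G : OrderedBinaryStructure p q (Fin n)) (i : Fin p)
    (x y : Fin n) :
    (structureInput G).arr 0 (i * (n * n) + (n * x + y)) = (G.rel i x y).toNat := by
  have h1 : n * (x : ℕ) + y < n * n := by
    calc n * (x : ℕ) + y < n * x + n := by omega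
      _ = n * (x + 1) := by ring
      _ ≤ n * n := Nat.mul_le_mul_left n x.2
  have h2 : (i : ℕ) * (n * n) + (n * x + y) < p * (n * n) := by
    calc (i : ℕ) * (n * n) + (n * x + y) < i * (n * n) + n * n := by omega
      _ = (i + 1) * (n * n) := by ring
      _ ≤ p * (n * n) := Nat.mul_le_mul_right _ i.2
  have e1 : finProdFinEquiv.symm ⟨n * (x : ℕ) + y, h1⟩ = (x, y) := by
    rw [Equiv.symm_apply_eq]
    ext
    simp [add_comm]
  have e2 : finProdFinEquiv.symm ⟨(i : ℕ) * (n * n) + (n * x + y), h2⟩ =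
      (i, ⟨n * (x : ℕ) + y, h1⟩) := by
    rw [Equiv.symm_apply_eq]
    ext
    simp only [finProdFinEquiv_apply_val]
    ring
  simp only [structureInput, toArray, dif_pos h2, e2, e1]

section

variable {p q n : ℕ} {G : OrderedBinaryStructure p q (Fin n)} {b : ℕ → ℕ → ℕ → ℕ} {M' : ℕ → ℕ → ℕ}

theorem bit_le_one (hb : ∀ (i : Fin p) (x y : Fin n), b i x y = (G.rel i x y).toNat) {x y : ℕ}
    (hx : x < n) (hy : y < n) : ∀ i < p, b i x y ≤ 1 ∧ b i y x ≤ 1 := fun i hi =>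
  ⟨(hb ⟨i, hi⟩ ⟨x, hx⟩ ⟨y, hy⟩).trans_le (Bool.toNat_le _),
    (hb ⟨i, hi⟩ ⟨y, hy⟩ ⟨x, hx⟩).trans_le (Bool.toNat_le _)⟩

/-- Exchanging `x` and `y` exchanges the two bits inside each digit, so one entry determines the
other. -/
theorem transposeInvariant_code (hb : ∀ (i : Fin p) (x y : Fin n), b i x y = (G.rel i x y).toNat)
    (hM' : ∀ x < n, ∀ y < n, M' x y = code b p x y) : TransposeInvariant n M' := by
  intro x hx y hy x' hx' y' hy' h
  rw [hM' x hx y hy, hM' x' hx' y' hy', code_eq_iff (bit_le_one hb hx hy) (bit_le_one hb hx' hy')]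
    at h
  rw [hM' y hy x hx, hM' y' hy' x' hx', code_eq_iff (bit_le_one hb hy hx) (bit_le_one hb hy' hx')]
  exact fun i hi => (h i hi).symm

theorem code_eq_iff_encoding (hb : ∀ (i : Fin p) (x y : Fin n), b i x y = (G.rel i x y).toNat)
    (hM' : ∀ x < n, ∀ y < n, M' x y = code b p x y) (x y x' y' : Fin n) :
    G.encoding x y = G.encoding x' y' ↔ M' x y = M' x' y' := by
  have hnat : ∀ u v : Bool, u.toNat = v.toNat ↔ u = v := by decide
  rw [hM' x x.2 y y.2, hM' x' x'.2 y' y'.2, code_eq_iff (bit_le_one hb x.2 y.2)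
    (bit_le_one hb x'.2 y'.2), encoding_eq_iff]
  constructor
  · intro h i hi
    rw [hb ⟨i, hi⟩, hb ⟨i, hi⟩, hb ⟨i, hi⟩, hb ⟨i, hi⟩, (h ⟨i, hi⟩).1, (h ⟨i, hi⟩).2]
    exact ⟨rfl, rfl⟩
  · intro h i
    have := h i i.2
    rw [hb, hb, hb, hb, hnat, hnat] at this
    exact this

theorem embeds_code (hb : ∀ (i : Fin p) (x y : Fin n), b i x y = (G.rel i x y).toNat)
    (hM' : ∀ x < n, ∀ y < n, M' x y = code b p x y) : Embeds n M' G.encoding 0 0 where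
  rows_le := by omega
  cols_le := by omega
  eq_iff x y x' y' := by
    simp only [zero_add]
    exact code_eq_iff_encoding hb hM' x y x' y'
  outside i i' c hc h := by omega

theorem embeds_code_transpose
    (hb : ∀ (i : Fin p) (x y : Fin n), b i x y = (G.rel i x y).toNat)
    (hM' : ∀ x < n, ∀ y < n, M' x y = code b p x y) :
    Embeds n M' (fun y x => G.encoding x y) 0 0 where
  rows_le := by omega
  cols_le := by omega
  eq_iff y x y' x' := by
    simp only [zero_add]
    rw [code_eq_iff_encoding hb hM' x y x' y']
    have hT := transposeInvariant_code hb hM'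
    exact ⟨hT x x.2 y y.2 x' x'.2 y' y'.2, hT y y.2 x x.2 y' y'.2 x' x'.2⟩
  outside i i' c hc h := by omega

end

/-- The last partition has a single row part and a single column part, and error value zero makes
their zone constant. -/
theorem constant_of_tww_eq_zero {α : Type*} [DecidableEq α] {n : ℕ} (hn : 1 ≤ n)
    {M : Fin n → Fin n → α} (h : tww M = 0) (x y x' y' : Fin n) : M x y = M x' y' := by
  obtain ⟨d, e, P, hP⟩ := exists_isSequence hn hn M
  have hmem : tww M ∈ {d | ∃ k e : ℕ, k + e = d ∧ ∃ P : ℕ → MatPartition (Fin n) (Fin n),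
      IsSequence M k e P} := Nat.sInf_mem ⟨d + e, d, e, rfl, P, hP⟩
  rw [h] at hmem
  obtain ⟨d, e, hde, P, hP⟩ := hmem
  obtain rfl : e = 0 := by omega
  have h1 := (hP.error _ le_rfl).1 Finset.univ (by rw [hP.contraction.rows_end]; simp)
  rw [hP.contraction.cols_end, Nat.le_zero, Finset.card_eq_zero, Finset.filter_eq_empty_iff] at h1
  have h2 := h1 (Finset.mem_singleton_self _)
  rw [not_not] at h2
  exact h2 x (by simp) y (by simp) x' (by simp) y' (by simp)

namespace Term

/-- The offset of the `i`-th relation in the input. -/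
def offset : ℕ → Term
  | 0 => .lit 0
  | i + 1 => .add (offset i) (mulVar v_N (.var v_N))

theorem eval_offset (i : ℕ) (s : State) : (offset i).eval s = i * (s.var v_N * s.var v_N) := by
  induction i with
  | zero => simp [offset]
  | succ i ih =>
    rw [offset, eval_add, ih, eval_mulVar (w := s.var v_N) fun j => by simp [setVar_var]]
    ring

/-- The bit of the `i`-th relation. -/
def bit (i x y : ℕ) : Term :=
  .get 0 (.add (offset i) (.add (mulVar v_N (.var x)) (.var y)))

theorem eval_bit {i x y : ℕ} (hx : x ≠ 40) (s : State) : (bit i x y).eval s =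
    s.arr 0 (i * (s.var v_N * s.var v_N) + (s.var v_N * s.var x + s.var y)) := by
  rw [bit, eval_get, eval_add, eval_add, eval_offset,
    eval_mulVar (t := .var x) (w := s.var x) fun j => by rw [eval_var, setVar_var_ne _ _ hx],
    eval_var]

/-- The entry of the matrix in row `v_r` and column `v_s` for `p` relations. -/
def codeTerm : ℕ → Term
  | 0 => .lit 0
  | p + 1 => .add (.add (.add (codeTerm p) (codeTerm p)) (.add (codeTerm p) (codeTerm p)))
      (.add (bit p v_r v_s) (.add (bit p v_s v_r) (bit p v_s v_r)))

theorem eval_codeTerm (p : ℕ) (s : State) : (codeTerm p).eval s =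
    code (fun i x y => s.arr 0 (i * (s.var v_N * s.var v_N) + (s.var v_N * x + y))) p
      (s.var v_r) (s.var v_s) := by
  induction p with
  | zero => simp [codeTerm, code]
  | succ p ih =>
    simp only [codeTerm, code, eval_add, ih, eval_bit (show v_r ≠ 40 by decide),
      eval_bit (show v_s ≠ 40 by decide)]
    ring

theorem offset_admissible (i : ℕ) :
    (offset i).varsBelow v_max = true ∧ (offset i).static [v_N] = true := by
  induction i with
  | zero => exact ⟨rfl, rfl⟩
  | succ i ih =>
    simp only [offset, varsBelow, static, ih, Bool.true_and]
    decide

theorem codeTerm_admissible (p : ℕ) :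
    (codeTerm p).varsBelow v_max = true ∧ (codeTerm p).static [v_N] = true := by
  induction p with
  | zero => exact ⟨rfl, rfl⟩
  | succ p ih =>
    simp only [codeTerm, bit, varsBelow, static, ih, offset_admissible, Bool.true_and]
    decide

/-- A quarter of the variable `v_r`, which is less than four times `v_N`. -/
def quarter : Term :=
  count 41 v_N (not (.lt (.var v_r)
    (.add (.add (.add (.var 41) (.var 41)) (.add (.var 41) (.var 41))) (.lit 4))))

theorem eval_quarter {s : State} (h : s.var v_r < 4 * s.var v_N) :
    quarter.eval s = s.var v_r / 4 := by
  rw [quarter, eval_count]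
  have : ((Finset.range (s.var v_N)).filter fun i => (not (.lt (.var v_r)
      (.add (.add (.add (.var 41) (.var 41)) (.add (.var 41) (.var 41))) (.lit 4)))).eval
        (s.setVar 41 i) ≠ 0) = Finset.range (s.var v_r / 4) := by
    ext i
    rw [Finset.mem_filter, Finset.mem_range, Finset.mem_range, not_iff, lt_iff]
    simp only [eval_add, eval_var, eval_lit, setVar_var_self,
      setVar_var_ne _ _ (show v_r ≠ 41 by decide)]
    omega
  rw [this, Finset.card_range]

/-- The number of the labelling that belongs into row `v_r` of the output. -/
def source : Term :=
  .add quarter (.eq (.sub (.var v_r) (.add (.add quarter quarter) (.add quarter quarter))) (.lit 2))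

/-- In blocks of `N` cells, block `2 * t` of the output holds the row labels of the partition number
`t`, taken from the labelling `(t + 1) / 2`, and block `2 * t + 1` its column labels, taken from `t
/ 2`. In terms of the block number both are a quarter, plus one for remainder two. -/
theorem eval_source {s : State} (h : s.var v_r < 4 * s.var v_N) :
    source.eval s = s.var v_r / 4 + if s.var v_r % 4 = 2 then 1 else 0 := by
  simp only [source, eval, eval_quarter h]
  congr 1
  refine if_congr ?_ rfl rfl
  omega

end Term

namespace Cmd

/-- Read the size of the structure. -/
def readStructureSize : Cmd := .assign v_N (.var 0)

/-- Build the matrix encoding. -/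
def loadStructure (p : ℕ) : Cmd := fillRows a_mat v_N (Term.codeTerm p)

/-- Compute the number of rows of the output. -/
def setRows : Cmd :=
  .assign v_z (.add (.add (.var v_N) (.var v_N)) (.add (.var v_N) (.var v_N)))

/-- Output a sequence of labellings of rows and columns. -/
def writeStructure : Cmd :=
  fillRows 2 v_z (.get a_out (.add (Term.mulVar v_N Term.source) (.var v_s)))

theorem exec_writeStructure {s : State} (hz : s.var v_z = 4 * s.var v_N) {i j : ℕ}
    (hi : i < 4 * s.var v_N) (hj : j < s.var v_N) :
    (writeStructure.exec s).arr 2 (s.var v_N * i + j) =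
      s.arr a_out (s.var v_N * (i / 4 + if i % 4 = 2 then 1 else 0) + j) := by
  refine exec_fillRows
    (g := fun i j => s.arr a_out (s.var v_N * (i / 4 + if i % 4 = 2 then 1 else 0) + j))
    ?_ (by rw [hz]; exact hi) hj
  intro i hi j _ s' h1 h2
  rw [hz] at hi
  have hN : s'.var v_N = s.var v_N := by rw [h1]; simp [setVar_var]
  have hr : s'.var v_r = i := by rw [h1]; simp [setVar_var]
  have hs : s'.var v_s = j := by rw [h1]; simp
  rw [Term.eval_get, Term.eval_add,
    Term.eval_mulVar (w := i / 4 + if i % 4 = 2 then 1 else 0) fun l => ?_, h2 _ (by decide),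
    Term.eval_var, hN, hs]
  have hr' : (s'.setVar 40 l).var v_r = i := by rw [setVar_var_ne _ _ (by decide), hr]
  rw [Term.eval_source, hr']
  rw [hr', setVar_var_ne _ _ (by decide), hN]
  exact hi

/-- Try all values of `v_k` until a sequence is found. -/
def searchSequence : Program :=
  .loop (.eq (.var v_flag) (.lit 0))
    (.seq (.assign v_k (.add (.var v_k) (.lit 1))) solve)

/-- The values `j + 1, j + 2, …` are tried in turn. For `k₀` the first kind of result contradicts
`hfinal`, so the search stops there at the latest. The induction is over the number of values left,
and every attempt is charged at the cost of the last one. -/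
theorem searchSequence_runs {κ : ℕ}
    (hκ : ∀ {N h k f E : ℕ} {g : ℕ → ℕ} {s : State}, 1 ≤ N → 1 ≤ k →
      Bounded N h (matOf N g) (richness k) (3 * richness k) f E →
      s.var v_N = N → s.var v_h = h → s.var v_k = k → s.arr a_mat = g →
      ∃ s' t, solve.Runs s s' t ∧ t ≤ κ * (N + branches k + 1) ^ κ ∧
        CoreResult N h (richness k) (3 * richness k) g (2 * f) E s' ∧
        s'.var v_N = N ∧ s'.var v_h = h ∧ s'.var v_k = k ∧ s'.arr a_mat = g)
    {N h k₀ : ℕ} {f E : ℕ → ℕ} {g : ℕ → ℕ} (hN : 1 ≤ N)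
    (hB : ∀ k, 1 ≤ k → Bounded N h (matOf N g) (richness k) (3 * richness k) (f k) (E k))
    (hfinal : ∀ dl, IsDiv N h dl → Stuck N h (matOf N g) (richness k₀) (3 * richness k₀) dl →
      ∀ x, ¬ Eligible N h dl x) (rem : ℕ) :
    ∀ (j : ℕ) (s : State), j + rem + 1 = k₀ → s.var v_N = N → s.var v_h = h → s.var v_k = j →
      s.arr a_mat = g → s.var v_flag = 0 →
      ∃ s' t k T Q, searchSequence.Runs s s' t ∧
        t ≤ (rem + 1) * (κ * (N + branches k₀ + 1) ^ κ + 20) ∧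
        1 ≤ k ∧ k ≤ k₀ ∧ s'.var v_N = N ∧ IsChain N h (matOf N g) (2 * f k) (E k) T Q ∧
        (∀ x < N, ∀ y < N, (x < h ↔ y < h) → Q T x = Q T y) ∧
        ∀ t ≤ T, ∀ x < N, s'.arr a_out (t * N + x) = Q t x := by
  have step : ∀ (j : ℕ) (s : State), j + 1 ≤ k₀ → s.var v_N = N → s.var v_h = h → s.var v_k = j →
      s.arr a_mat = g → ∃ s' t, Program.Runs (.seq (.assign v_k (.add (.var v_k) (.lit 1))) solve)
        s s' t ∧ t ≤ κ * (N + branches k₀ + 1) ^ κ + 4 ∧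
        CoreResult N h (richness (j + 1)) (3 * richness (j + 1)) g (2 * f (j + 1)) (E (j + 1)) s' ∧
        s'.var v_N = N ∧ s'.var v_h = h ∧ s'.var v_k = j + 1 ∧ s'.arr a_mat = g := by
    intro j s hj e1 e2 e3 e4
    obtain ⟨s', t, r, l, hres⟩ := hκ (s := s.setVar v_k (j + 1)) hN (by omega) (hB (j + 1) (by omega))
      (by rw [setVar_var_ne _ _ (by decide), e1]) (by rw [setVar_var_ne _ _ (by decide), e2])
      (setVar_var_self _ _ _) e4
    have hr : Program.Runs (.assign v_k (.add (.var v_k) (.lit 1))) s (s.setVar v_k (j + 1)) 4 := by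
      have := Program.Runs.assign v_k (.add (.var v_k) (.lit 1)) s
      rwa [Expr.eval, Expr.eval, Expr.eval, e3] at this
    refine ⟨s', _, .seq hr r, ?_, hres⟩
    have : κ * (N + branches (j + 1) + 1) ^ κ ≤ κ * (N + branches k₀ + 1) ^ κ := by
      have := branches_mono (by omega) hj
      gcongr
    omega
  have done : ∀ {s : State}, s.var v_flag = 1 → searchSequence.Runs s s 4 := fun {s} h =>
    .loop_done (by simp [Expr.eval, h])
  induction rem with
  | zero =>
    intro j s hj e1 e2 e3 e4 e5
    obtain ⟨s', t, r, l, hres, n1, n2, n3, n4⟩ := step j s (by omega) e1 e2 e3 e4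
    rcases hres with ⟨h0, dl, d1, d2, ⟨x, hx⟩, -⟩ | ⟨h1, T, Q, hQ, hend, hout⟩
    · obtain rfl : j + 1 = k₀ := by omega
      exact absurd hx (hfinal dl d1 d2 x)
    · refine ⟨s', _, j + 1, T, Q, .loop_step (by simp [Expr.eval, e5]) r (done h1), ?_, by omega,
        by omega, n1, hQ, hend, hout⟩
      simp only [Expr.cost]
      omega
  | succ rem ih =>
    intro j s hj e1 e2 e3 e4 e5
    obtain ⟨s', t, r, l, hres, n1, n2, n3, n4⟩ := step j s (by omega) e1 e2 e3 e4
    rcases hres with ⟨h0, -⟩ | ⟨h1, T, Q, hQ, hend, hout⟩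
    · obtain ⟨s'', t', k, T, Q, r', l', rest⟩ := ih (j + 1) s' (by omega) n1 n2 n3 n4 h0
      refine ⟨s'', _, k, T, Q, .loop_step (by simp [Expr.eval, e5]) r r', ?_, rest⟩
      simp only [Expr.cost]
      rw [add_mul]
      omega
    · refine ⟨s', _, j + 1, T, Q, .loop_step (by simp [Expr.eval, e5]) r (done h1), ?_, by omega,
        by omega, n1, hQ, hend, hout⟩
      simp only [Expr.cost]
      rw [add_mul]
      omega

/-- The algorithm for structures. -/
def solveStructure (p : ℕ) : Program :=
  .seq (readStructureSize.compile v_max) (.seq ((loadStructure p).compile v_max)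
    (.seq searchSequence (.seq (setRows.compile v_max) (writeStructure.compile v_max))))

end Cmd
end TwinWidth

/-! ### The algorithm for structures. -/

namespace TwinWidth
theorem le_branches {k : ℕ} (hk : 1 ≤ k) : k ≤ branches k := by
  have hr := four_le_richness hk
  have hsq := sq_richness_le_branches hk
  have hkr : k ≤ richness k := by rw [richness]; nlinarith
  nlinarith

/-- The number `k` of attempts costs only one more factor, because `k ≤ branches k`. The doubled
bound in `l₅`, needed for the `4 * n` blocks of the output, costs the constant `2 ^ κ₅`. -/
theorem total_time_le {n k κ₁ κ₂ κ₃ κ₄ κ₅ t₁ t₂ t₃ t₄ t₅ : ℕ} (hk : 1 ≤ k)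
    (l₁ : t₁ ≤ κ₁ * (n + n + branches k + 1) ^ κ₁) (l₂ : t₂ ≤ κ₂ * (n + n + branches k + 1) ^ κ₂)
    (l₃ : t₃ ≤ (k - 1 + 1) * (κ₃ * (n + branches k + 1) ^ κ₃ + 20))
    (l₄ : t₄ ≤ κ₄ * (n + n + branches k + 1) ^ κ₄)
    (l₅ : t₅ ≤ κ₅ * (2 * (n + n + branches k) + 1) ^ κ₅) :
    t₁ + (t₂ + (t₃ + (t₄ + t₅))) ≤ (κ₁ + κ₂ + (κ₃ + 21) + κ₄ + κ₅ * 2 ^ κ₅) *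
      (n + n + branches k + 1) ^ (κ₁ + κ₂ + (κ₃ + 21) + κ₄ + κ₅ * 2 ^ κ₅) := by
  have hkB := le_branches hk
  have hnB : n + branches k ≤ n + n + branches k := by omega
  generalize n + n + branches k = B at *
  have hκ₅ : κ₅ ≤ κ₅ * 2 ^ κ₅ := Nat.le_mul_of_pos_right _ (Nat.two_pow_pos _)
  have b5 : t₅ ≤ κ₅ * 2 ^ κ₅ * (B + 1) ^ κ₅ := by
    refine l₅.trans ?_
    rw [mul_assoc, ← mul_pow]
    exact Nat.mul_le_mul_left _ (Nat.pow_le_pow_left (by omega) _)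
  have b3 : t₃ ≤ (κ₃ + 21) * (B + 1) ^ (κ₃ + 1) := by
    have hone : 1 ≤ (B + 1) ^ κ₃ := Nat.one_le_pow _ _ (Nat.succ_pos _)
    have hmono : κ₃ * (n + branches k + 1) ^ κ₃ ≤ κ₃ * (B + 1) ^ κ₃ :=
      Nat.mul_le_mul_left _ (Nat.pow_le_pow_left (by omega) _)
    calc t₃ ≤ (B + 1) * ((κ₃ + 21) * (B + 1) ^ κ₃) :=
          l₃.trans (Nat.mul_le_mul (by omega) (by rw [add_mul]; omega))
      _ = _ := by ring
  generalize κ₅ * 2 ^ κ₅ = y at *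
  have hpow : ∀ x z, z ≤ κ₁ + κ₂ + (κ₃ + 21) + κ₄ + y →
      x * (B + 1) ^ z ≤ x * (B + 1) ^ (κ₁ + κ₂ + (κ₃ + 21) + κ₄ + y) := fun x z h =>
    Nat.mul_le_mul_left _ (Nat.pow_le_pow_right (Nat.succ_pos _) h)
  have c1 := hpow κ₁ κ₁ (by omega)
  have c2 := hpow κ₂ κ₂ (by omega)
  have c3 := hpow (κ₃ + 21) (κ₃ + 1) (by omega)
  have c4 := hpow κ₄ κ₄ (by omega)
  have c5 := hpow y κ₅ (by omega)
  generalize (B + 1) ^ (κ₁ + κ₂ + (κ₃ + 21) + κ₄ + y) = X at *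
  calc t₁ + (t₂ + (t₃ + (t₄ + t₅))) ≤ κ₁ * X + (κ₂ * X + ((κ₃ + 21) * X + (κ₄ * X + y * X))) :=
        add_le_add (l₁.trans c1) (add_le_add (l₂.trans c2) (add_le_add (b3.trans c3)
          (add_le_add (l₄.trans c4) (b5.trans c5))))
    _ = _ := by ring

namespace Cmd

theorem loadStructure_admissible (p : ℕ) :
    (loadStructure p).varsBelow v_max = true ∧ (loadStructure p).static [v_N] = true := by
  simp only [loadStructure, fillRows, varsBelow, static, Term.codeTerm_admissible, Bool.and_true]
  decide

/-- The bounds `f k` and `E k` depend on the value `k ≤ k₀` at which the search stops. The output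
has `4 * n` blocks, two for each partition, which is more than enough; the values are specified only
as long as the chain lasts. -/
theorem solveStructure_runs (p : ℕ) : ∃ κ, ∀ {n k₀ : ℕ} {f E : ℕ → ℕ} {a : ℕ → ℕ} {s : State},
    1 ≤ n → 1 ≤ k₀ → s.var 0 = n → s.var v_h = 0 → s.var v_k = 0 → s.var v_flag = 0 →
    s.arr 0 = a →
    (∀ M' : ℕ → ℕ → ℕ, (∀ x < n, ∀ y < n,
        M' x y = code (fun i x y => a (i * (n * n) + (n * x + y))) p x y) →
      (∀ k, 1 ≤ k → Bounded n 0 M' (richness k) (3 * richness k) (f k) (E k)) ∧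
      ∀ dl, IsDiv n 0 dl → Stuck n 0 M' (richness k₀) (3 * richness k₀) dl →
        ∀ x, ¬ Eligible n 0 dl x) →
    ∃ s' t g k T Q, (solveStructure p).Runs s s' t ∧ t ≤ κ * (n + n + branches k₀ + 1) ^ κ ∧
      (∀ x < n, ∀ y < n,
        matOf n g x y = code (fun i x y => a (i * (n * n) + (n * x + y))) p x y) ∧
      1 ≤ k ∧ k ≤ k₀ ∧ IsChain n 0 (matOf n g) (2 * f k) (E k) T Q ∧
      (∀ x < n, ∀ y < n, Q T x = Q T y) ∧
      ∀ i < 4 * n, ∀ j < n, i / 4 + (if i % 4 = 2 then 1 else 0) ≤ T →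
        s'.arr 2 (n * i + j) = Q (i / 4 + if i % 4 = 2 then 1 else 0) j := by
  obtain ⟨κ₁, h₁⟩ := exists_time_le readStructureSize
  obtain ⟨κ₂, h₂⟩ := exists_time_le (loadStructure p)
  obtain ⟨κ₃, h₃⟩ := solve_runs
  obtain ⟨κ₄, h₄⟩ := exists_time_le setRows
  obtain ⟨κ₅, h₅⟩ := exists_time_le writeStructure
  refine ⟨κ₁ + κ₂ + (κ₃ + 21) + κ₄ + κ₅ * 2 ^ κ₅,
    fun {n k₀ f E a s} hn hk e0 eh ek ef ea hyp => ?_⟩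
  set B := n + n + branches k₀ with hBdef
  obtain ⟨s1, t1, r1, l1, a1⟩ := runs_of_static (V := []) (c := readStructureSize) (d := v_max)
    (B := B) (by decide) (by decide) (by decide) h₁ (AgreeBelow.refl _ s) (by simp)
  set σ1 := readStructureSize.exec s with hσ1
  have N1 : σ1.var v_N = n := by
    simp [hσ1, readStructureSize, exec, e0]
  have A1 : σ1.arr 0 = a := by rw [hσ1, exec_arr (by decide), ea]
  obtain ⟨s2, t2, r2, l2, a2⟩ := runs_of_static (V := [v_N]) (c := loadStructure p) (d := v_max)
    (B := B) (loadStructure_admissible p).1 (loadStructure_admissible p).2 (by decide) h₂ a1 (by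
      intro v hv
      rw [List.mem_singleton] at hv
      rw [hv, N1]; omega)
  set σ2 := (loadStructure p).exec σ1 with hσ2
  have keep : ∀ v, v < v_max → (loadStructure p).keepsVar v = true →
      readStructureSize.keepsVar v = true → s2.var v = s.var v := fun v hv h h' => by
    rw [a2.1 v hv, hσ2, exec_var h, hσ1, exec_var h']
  have N2 : s2.var v_N = n := by rw [a2.1 _ (by decide), hσ2, exec_var rfl, N1]
  have hmat : ∀ x < n, ∀ y < n, matOf n (s2.arr a_mat) x y =
      code (fun i x y => a (i * (n * n) + (n * x + y))) p x y := by
    intro x hx y hy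
    rw [a2.2, matOf, ← N1, hσ2, loadStructure]
    refine exec_fillRows ?_ (by rw [N1]; exact hx) (by rw [N1]; exact hy)
    intro i _ j _ s' g1 g2
    rw [Term.eval_codeTerm, g1, g2 _ (by decide), A1]
    simp [setVar_var]
  obtain ⟨hB, hfinal⟩ := hyp _ hmat
  obtain ⟨s3, t3, k, T, Q, r3, l3, k1, k2, N3, hQ, hend, hout⟩ := searchSequence_runs h₃ hn hB hfinal
    (k₀ - 1) 0 s2 (by omega) N2 (by rw [keep _ (by decide) rfl rfl, eh])
    (by rw [keep _ (by decide) rfl rfl, ek]) rfl (by rw [keep _ (by decide) rfl rfl, ef])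
  obtain ⟨s4, t4, r4, l4, a4⟩ := runs_of_static (V := []) (c := setRows) (d := v_max) (B := B)
    (by decide) (by decide) (by decide) h₄ (AgreeBelow.refl _ s3) (by simp)
  have N4 : s4.var v_N = n := by rw [a4.1 _ (by decide), exec_var (by decide), N3]
  have Z4 : s4.var v_z = 4 * s4.var v_N := by
    rw [N4, a4.1 _ (by decide), setRows, exec, setVar_var_self]
    simp only [Term.eval_add, Term.eval_var, N3]
    omega
  obtain ⟨s5, t5, r5, l5, a5⟩ := runs_of_static (V := [v_N, v_z]) (c := writeStructure)
    (d := v_max) (B := 2 * B) (by decide) (by decide) (by decide) h₅ (AgreeBelow.refl _ s4) (by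
      intro v hv
      rw [List.mem_cons, List.mem_singleton] at hv
      rcases hv with rfl | rfl
      · rw [N4]; omega
      · rw [Z4, N4]; omega)
  refine ⟨s5, _, s2.arr a_mat, k, T, Q, .seq r1 (.seq r2 (.seq r3 (.seq r4 r5))), ?_, hmat, k1, k2,
    hQ, fun x hx y hy => hend x hx y hy (by simp), fun i hi j hj hT => ?_⟩
  · exact total_time_le hk l1 l2 l3 l4 l5
  · have hw := exec_writeStructure Z4 (i := i) (j := j) (by rw [N4]; exact hi) (by rw [N4]; exact hj)
    rw [N4] at hw
    rw [a5.2, hw, a4.2, exec_arr (by decide), mul_comm n]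
    exact hout _ hT j hj

end Cmd

theorem exists_structure_algorithm (p q : ℕ) : ∃ (prog : Program) (c : ℕ),
    ∀ (n : ℕ) (G : OrderedBinaryStructure p q (Fin n)), 1 ≤ n →
    ∃ (s : State) (t : ℕ), prog.Runs (structureInput G) s t ∧
      t ≤ 2 ^ 2 ^ (c * (G.tww ^ 2 * Nat.log 2 G.tww)) * (n + n) ^ c ∧
      ∃ (P : ℕ → MatPartition (Fin n) (Fin n)) (d e : ℕ), s.OutputsSequence P ∧
        IsSequence G.encoding d e P ∧ IsSymmetricSequence P ∧
        d + e ≤ 2 ^ (c * G.tww ^ 4) := by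
  obtain ⟨κ, hκ⟩ := Cmd.solveStructure_runs p
  refine ⟨Cmd.solveStructure p, 300 * κ + 200 * (p + 1), fun n G hn => ?_⟩
  have : Nonempty (Fin n) := ⟨⟨0, hn⟩⟩
  set a := (structureInput G).arr 0 with ha
  set b : ℕ → ℕ → ℕ → ℕ := fun i x y => a (i * (n * n) + (n * x + y)) with hbdef
  have hb : ∀ (i : Fin p) (x y : Fin n), b i x y = (G.rel i x y).toNat := structureInput_arr G
  set w := G.tww with hwdef
  -- The additional digit gives `width_le` an alphabet with at least two letters even if `p = 0`.
  have h4 : 2 ≤ 4 ^ (p + 1) := by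
    rw [pow_succ]
    have := Nat.pow_pos (n := p) (show 0 < 4 by norm_num)
    omega
  obtain ⟨f, E, hB, hw⟩ : ∃ f E : ℕ → ℕ,
      (∀ M' : ℕ → ℕ → ℕ, (∀ x < n, ∀ y < n, M' x y = code b p x y) →
        ∀ k, 1 ≤ k → Bounded n 0 M' (richness k) (3 * richness k) (f k) (E k)) ∧
      ∀ k, 1 ≤ k → k ≤ max 1 w → 1 ≤ f k ∧
        (2 * f k - 1) + E k * (2 * f k) ≤ 2 ^ ((300 * κ + 200 * (p + 1)) * w ^ 4) := by
    -- For twin-width zero the permitted width is `2 ^ 0 = 1`; the matrix is then constant, and `f =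
    -- 1`, `E = 0` suffice.
    rcases Nat.eq_zero_or_pos w with h0 | hpos
    · refine ⟨fun _ => 1, fun _ => 0, fun M' hM' k _ => ?_, fun k _ _ => ⟨le_rfl, ?_⟩⟩
      · refine bounded_of_constant (v := M' 0 0) (fun x hx y hy => ?_) _ _
        exact (code_eq_iff_encoding hb hM' ⟨x, hx⟩ ⟨y, hy⟩ ⟨0, hn⟩ ⟨0, hn⟩).1
          (constant_of_tww_eq_zero hn h0 _ _ _ _)
      · simp [h0]
    · refine ⟨fun k => richness k * richness k * (Finset.range (4 ^ (p + 1))).card ^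
          (richness k * (3 * richness k)),
        fun k => 3 * richness k + richness k * richness k * (3 * richness k),
        fun M' hM' k hk => ?_, fun k hk hkw => ⟨?_, ?_⟩⟩
      · have := four_le_richness hk
        exact bounded_of_transposeInvariant (A := Finset.range (4 ^ (p + 1)))
          (transposeInvariant_code hb hM') (by omega) fun x hx y hy => by
            rw [hM' x hx y hy, Finset.mem_range]
            exact (code_lt (bit_le_one hb hx hy)).trans_le
              (Nat.pow_le_pow_right (by norm_num) (by omega))
      · have hr := four_le_richness hk
        simp only [Finset.card_range]
        exact Nat.mul_pos (Nat.mul_pos (by omega) (by omega)) (Nat.pow_pos (by omega))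
      · simp only [Finset.card_range]
        refine (Nat.add_le_add_right (Nat.sub_le _ _) _).trans ((width_le h4 hk).trans ?_)
        have h2 : 4 ^ (p + 1) = 2 ^ (2 * (p + 1)) := pow_mul 2 2 (p + 1) |>.symm
        rw [h2, ← pow_mul]
        refine Nat.pow_le_pow_right (by norm_num) ?_
        have : k ^ 4 ≤ w ^ 4 := Nat.pow_le_pow_left (by omega) 4
        calc 2 * (p + 1) * (100 * k ^ 4) = 200 * (p + 1) * k ^ 4 := by ring
          _ ≤ (300 * κ + 200 * (p + 1)) * w ^ 4 := Nat.mul_le_mul (by omega) this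
  obtain ⟨s, t, g, k, T, Q, hrun, ht, hmat, hk, hkw, hQ, hend, hout⟩ := hκ (s := structureInput G)
    hn (le_max_left 1 w) rfl rfl rfl rfl ha.symm fun M' hM' => ⟨hB M' hM', fun dl hd hs x hx => by
      -- A mergeable position would yield a rich division for `max 1 w`, and then the twin-width `w`
      -- would exceed `max 1 w`. There is only one side, so the same intervals serve as rows and as
      -- columns.
      have two : 2 ≤ (leaders n 0 dl 0).card := by
        rw [leaders_congr (x := 0) (y := x) (by simp)]
        exact hd.two_le_card_leaders hx
      have side : IsSide n 0 0 n := ⟨hn, by omega, fun y hy => by omega⟩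
      have := lt_tww_of_isRich (le_max_left 1 w) (exists_isSequence hn hn G.encoding)
        (isRich_pairLabel (embeds_code hb hM') (embeds_code_transpose hb hM') hd side side hs two two)
      exact absurd (le_max_right 1 w) (not_le.2 this)⟩
  obtain ⟨hf, hwk⟩ := hw k hk hkw
  obtain ⟨hT, hseq, hsym⟩ := hQ.isSequence_symmetric hn (embeds_code hb hmat)
    (embeds_code_transpose hb hmat) (by omega) hend
  refine ⟨s, t, hrun, ht.trans ((time_le (x := w ^ 2 * Nat.log 2 w) (by omega)
    (le_max_left 1 w) ?_).trans ?_), _, _, _, ?_, hseq, hsym, hwk⟩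
  -- The search runs up to `max 1 w`, while the exponent is stated for `w`. For `w = 0` both
  -- products vanish.
  · rcases Nat.eq_zero_or_pos w with h0 | hpos
    · simp [h0]
    · rw [max_eq_right hpos]
  · refine Nat.mul_le_mul (Nat.pow_le_pow_right (by norm_num) (Nat.pow_le_pow_right (by norm_num)
      (Nat.mul_le_mul_right _ (by omega)))) (Nat.pow_le_pow_right (by omega) (by omega))
  · intro t ht
    have hlast : lastIndex (Fin n) (Fin n) = n + n - 2 := by simp [lastIndex]
    have hrow : ∀ i : Fin n, s.arr 2 (t * (n + n) + i) = Q ((t + 1) / 2) i := fun i => by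
      have e : 2 * t / 4 + (if 2 * t % 4 = 2 then 1 else 0) = (t + 1) / 2 := by
        split_ifs <;> omega
      have := hout (2 * t) (by omega) i i.2 (by rw [e]; omega)
      rw [e] at this
      rw [← this]
      congr 1
      ring
    have hcol : ∀ i : Fin n, s.arr 2 (t * (n + n) + n + i) = Q (t / 2) i := fun i => by
      have e : (2 * t + 1) / 4 + (if (2 * t + 1) % 4 = 2 then 1 else 0) = t / 2 := by
        split_ifs <;> omega
      have := hout (2 * t + 1) (by omega) i i.2 (by rw [e]; omega)
      rw [e] at this
      rw [← this]
      congr 1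
      ring
    constructor
    · intro i i'
      rw [hrow, hrow, part_shiftLabel_eq_iff, zero_add, zero_add]
    · intro i i'
      rw [hcol, hcol, part_shiftLabel_eq_iff, zero_add, zero_add]

end TwinWidth

open TwinWidth in
theorem theorem2 :
    (∃ (prog : Program) (c : ℕ),
      ∀ (A : Type) [Fintype A] [DecidableEq A] (name : A ≃ Fin (Fintype.card A))
        (n m k : ℕ) (M : Fin n → Fin m → A), 1 ≤ n → 1 ≤ m → 1 ≤ k →
      ∃ (s : State) (t : ℕ), prog.Runs (matrixInput name M k) s t ∧
        t ≤ 2 ^ 2 ^ (c * (k ^ 2 * Nat.log 2 k)) * (n + m) ^ c ∧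
        ((s.var 0 = 0 ∧ ∃ D : MatPartition (Fin n) (Fin m), s.OutputsPartition D ∧
            IsRich M (2 * k * (k + 1)) D ∧ k < tww M) ∨
         (s.var 0 = 1 ∧ ∃ P : ℕ → MatPartition (Fin n) (Fin m), s.OutputsSequence P ∧
            IsSequence M (Fintype.card A ^ (c * k ^ 4)) (Fintype.card A ^ (c * k ^ 4)) P ∧
            tww M ≤ Fintype.card A ^ (c * k ^ 4)))) ∧
    (∀ p q : ℕ, ∃ (prog : Program) (c : ℕ),
      ∀ (n : ℕ) (G : OrderedBinaryStructure p q (Fin n)), 1 ≤ n →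
      ∃ (s : State) (t : ℕ), prog.Runs (structureInput G) s t ∧
        t ≤ 2 ^ 2 ^ (c * (G.tww ^ 2 * Nat.log 2 G.tww)) * (n + n) ^ c ∧
        ∃ (P : ℕ → MatPartition (Fin n) (Fin n)) (d e : ℕ), s.OutputsSequence P ∧
          IsSequence G.encoding d e P ∧ IsSymmetricSequence P ∧
          d + e ≤ 2 ^ (c * G.tww ^ 4)) :=
  ⟨exists_matrix_algorithm, fun p q => exists_structure_algorithm p q⟩
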